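/- Let $0\le\alpha<1$, $s\in\mathbb R$. On $L^2((0,\infty),dr)$ let $h_{0,\alpha}^*$ be the maximal operator of $-\partial_r^2+(\alpha^2-\frac14)r^{-2}$ (domain: $\psi,\psi'$ locally absolutely continuous on $(0,\infty)$, $\psi$ and $-\psi''+(\alpha^2-\frac14)r^{-2}\psi$ in $L^2$). Let $F_\alpha(r)=r^{1/2+\alpha}$, and $G_\alpha(r)=\frac1{2\alpha}(r^{1/2-\alpha}-r^{1/2+\alpha})$ for $\alpha>0$, $G_0(r)=-\sqrt r\ln r$. With $W(u,v)=uv'-vu'$, the Hamiltonian $h_{0,\alpha}(s)$ of the $\delta$-potential is the restriction of $h_{0,\alpha}^*$ to the $\psi$ with $\lim_{r\downarrow0}W(G_\alpha+sF_\alpha,\psi)(r)=0$; the free Hamiltonian $h_{0,\alpha}(\infty)$ is the restriction to the $\psi$ with $\lim_{r\downarrow0}W(F_\alpha,\psi)(r)=0$. For $k,r>0$ put $$\phi_0(r;k,\alpha)=\sqrt{\tfrac{\pi kr}{2}}\,J_\alpha(kr),\qquad \chi_0^+(r;k,\alpha)=\sqrt{\tfrac{\pi kr}{2}}\,H^{(1)}_\alpha(kr),$$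 $$A(k,\alpha;s)=\frac\pi2\Big[\Big(\frac k2\Big)^{-2\alpha}\frac{2s\alpha-1}{\sin\pi\alpha}\frac{\Gamma(1+\alpha)}{\Gamma(1-\alpha)}+\cot\pi\alpha-i\Big]^{-1}\quad(\alpha>0),\qquad A(k,0;s)=\frac{\pi^2}4\Big[\ln\frac k{2i}+\gamma+s\Big]^{-1},$$ where $\gamma$ is Euler's constant. Definitions. The outgoing state of $h_{0,\alpha}(s)$ at energy $k^2$ is the solution $\phi$ of $-\phi''+(\alpha^2-\frac14)r^{-2}\phi=k^2\phi$ on $(0,\infty)$ with $\lim_{r\downarrow0}W(G_\alpha+sF_\alpha,\phi)(r)=0$ and $\phi(r)=\phi_0(r;k,\alpha)+c\,e^{ikr}+o(1)$ as $r\to\infty$ for some $c\in\mathbb C$. Let $\Omega^\pm$ be the wave operators $e^{ith_{0,\alpha}(s)}e^{-ith_{0,\alpha}(\infty)}$, $t\to\pm\infty$, and $S=(\Omega^+)^*\Omega^-$. A phase shift is a continuous $\delta=\delta(\cdot,\alpha;s):(0,\infty)\to\mathbb R$ such that $S\int_0^\infty g(k)\phi_0(\cdot;k,\alpha)\,dk=\int_0^\infty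 e^{2i\delta(k)}g(k)\phi_0(\cdot;k,\alpha)\,dk$ for all $g\in C_c^\infty((0,\infty))$; the partial wave amplitude is $f(k,\alpha;s)=(e^{2i\delta(k,\alpha;s)}-1)/\sqrt{\pi ik}$ (principal root). Theorem. (1) For each $k>0$ the outgoing state exists, is unique and equals $$\phi^+(r;k,\alpha)=\phi_0(r;k,\alpha)+\frac{2i}\pi A(k,\alpha;s)\,\chi_0^+(r;k,\alpha);$$ moreover $\Omega^-\int_0^\infty g(k)\phi_0(\cdot;k,\alpha)\,dk=\int_0^\infty g(k)\phi^+(\cdot;k,\alpha)\,dk$ for all $g\in C_c^\infty((0,\infty))$. (2) A continuous $\delta:(0,\infty)\to\mathbb R$ is a phase shift if and only if $e^{2i\delta(k)}=1+\frac{4i}\pi A(k,\alpha;s)$ for all $k>0$. For every phase shift and every $k>0$, $$f(k,\alpha;s)=\frac{4i}\pi\frac{A(k,\alpha;s)}{\sqrt{\pi ik}},\qquad \phi^+(r;k,\alpha)=\phi_0(r;k,\alpha)+\tfrac12\sqrt{\pi k}\,f(k,\alpha;s)\,e^{i(kr-\frac\pi2\alpha)}+o(1)\quad(r\to\infty).$$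 (3) There is a phase shift with values in $(0,\pi)$. (4) Suppose $2\alpha s\neq1$, and let $n$ be the number of bound states of $h_{0,\alpha}(s)$, that is, the dimension of the span of its $L^2$ eigenfunctions. Then $n=\frac12(1-\operatorname{sgn}(2\alpha s-1))\in\{0,1\}$. Every phase shift with values in $(0,\pi)$ satisfies $\delta(0^+)=\pi n$ and $\delta(\infty)=\pi\alpha$; and for every phase shift the limits $\delta(0^+)$, $\delta(\infty)$ exist and $$\delta(0^+,\alpha;s)-\delta(\infty,\alpha;s)=\pi(n-\alpha).$$ -/

import Mathlib

open Real Set Filter Topology MeasureTheory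
open scoped ContDiff

noncomputable section

namespace AnyonDelta

/-! ### Bessel and Hankel functions of a positive real argument -/

/-- The Bessel function `J_ν(x)` of real order, for `x > 0`. -/
def besselJ (ν x : ℝ) : ℝ :=
  ∑' m : ℕ, (-1 : ℝ) ^ m / ((m.factorial : ℝ) * Real.Gamma (m + ν + 1))
    * (x / 2) ^ (2 * (m : ℝ) + ν)

/-- The Bessel function of the second kind of order zero, `Y_0(x)`, for `x > 0`. -/
def besselYZero (x : ℝ) : ℝ :=
  2 / π * ((Real.log (x / 2) + Real.eulerMascheroniConstant) * besselJ 0 x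
    + ∑' m : ℕ, (-1 : ℝ) ^ (m + 1) * (harmonic m : ℝ) / (m.factorial : ℝ) ^ 2
        * (x / 2) ^ (2 * m))

/-- The first Hankel function `H^{(1)}_ν(x)` for `x > 0` and `0 ≤ ν < 1`
(for non-integral `ν` it is `(J_{-ν} - e^{-iπν} J_ν) / (i sin πν)`, for `ν = 0` it is
`J_0 + i Y_0`, the limit of that expression). -/
def hankelOne (ν x : ℝ) : ℂ :=
  if ν = 0 then (besselJ 0 x : ℂ) + Complex.I * (besselYZero x : ℂ)
  else ((besselJ (-ν) x : ℂ) - Complex.exp (-(Complex.I * (π * ν))) * (besselJ ν x : ℂ))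
    / (Complex.I * (Real.sin (π * ν) : ℂ))

/-- The regular free solution `φ_0(r; k, α) = √(πkr/2) J_α(kr)`. -/
def phiFree (α k r : ℝ) : ℂ :=
  ((Real.sqrt (π * k * r / 2) * besselJ α (k * r) : ℝ) : ℂ)

/-- The irregular outgoing free solution `χ_0^+(r; k, α) = √(πkr/2) H^{(1)}_α(kr)`. -/
def chiFree (α k r : ℝ) : ℂ :=
  (Real.sqrt (π * k * r / 2) : ℂ) * hankelOne α (k * r)

/-! ### The Hamiltonians on `L²((0,∞), dr)` -/

/-- Lebesgue measure on the open half line. -/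
abbrev halfLine : Measure ℝ := volume.restrict (Ioi (0 : ℝ))

/-- The Hilbert space `L²((0,∞), dr)`. -/
abbrev HalfLineL2 : Type := Lp ℂ 2 halfLine

/-- The differential expression `-ψ'' + (α² - 1/4) r⁻² ψ`. -/
def radialExpr (α : ℝ) (ψ : ℝ → ℂ) (r : ℝ) : ℂ :=
  -(deriv (deriv ψ) r) + (((α ^ 2 - 1 / 4) / r ^ 2 : ℝ) : ℂ) * ψ r

/-- The Wronskian `W(u, v) = u v' - v u'`. -/
def wronskian (u v : ℝ → ℂ) (r : ℝ) : ℂ := u r * deriv v r - v r * deriv u r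

/-- The domain of `h_{0,α}^*`, the maximal domain: `ψ` and `ψ'` are locally absolutely continuous
on `(0,∞)`, and `ψ` and `-ψ'' + (α² - 1/4) r⁻² ψ` are square integrable. -/
structure InMaximalDomain (α : ℝ) (ψ : ℝ → ℂ) : Prop where
  differentiable : ∀ r, 0 < r → DifferentiableAt ℝ ψ r
  deriv_ac : ∀ a b, 0 < a → a < b → AbsolutelyContinuousOnInterval (deriv ψ) a b
  memLp : MemLp ψ 2 halfLine
  memLp_radialExpr : MemLp (radialExpr α ψ) 2 halfLine

/-- The boundary condition `W(u, ψ)(r) → 0` as `r ↓ 0`. -/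
def BoundaryCondition (u ψ : ℝ → ℂ) : Prop :=
  Tendsto (wronskian u ψ) (𝓝[>] 0) (𝓝 0)

/-- The graph, as a set of pairs `(Ψ, hΨ)`, of the restriction `h` of `h_{0,α}^*` to the functions
that satisfy the boundary condition given by `u`. -/
def operatorGraph (α : ℝ) (u : ℝ → ℂ) : Set (HalfLineL2 × HalfLineL2) :=
  {p | ∃ ψ : ℝ → ℂ, InMaximalDomain α ψ ∧ BoundaryCondition u ψ ∧
    (p.1 : ℝ → ℂ) =ᵐ[halfLine] ψ ∧ (p.2 : ℝ → ℂ) =ᵐ[halfLine] radialExpr α ψ}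

/-- The regular zero-energy solution `F_α(r) = r^{1/2+α}`. -/
def zeroRegular (α r : ℝ) : ℝ := r ^ (1 / 2 + α)

/-- The irregular zero-energy solution `G_α(r) = F_α(r) ∫_r^1 F_α(t)⁻² dt`, in closed form. -/
def zeroIrregular (α r : ℝ) : ℝ :=
  if α = 0 then -(Real.sqrt r * Real.log r)
  else 1 / (2 * α) * (r ^ (1 / 2 - α) - r ^ (1 / 2 + α))

/-- The function `ψ_{α,s} = G_α + s F_α` that defines the boundary condition. -/
def boundaryFn (α s r : ℝ) : ℂ := ((zeroIrregular α r + s * zeroRegular α r : ℝ) : ℂ)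

/-- The Hamiltonian `h_{0,α}(s)` of the δ-potential (its graph). -/
def deltaHamiltonian (α s : ℝ) : Set (HalfLineL2 × HalfLineL2) :=
  operatorGraph α (boundaryFn α s)

/-- The free Hamiltonian `h_{0,α}(∞)` (its graph): the Friedrichs extension. -/
def freeHamiltonian (α : ℝ) : Set (HalfLineL2 × HalfLineL2) :=
  operatorGraph α (fun r => (zeroRegular α r : ℂ))

/-- The number of bound states of `h` with multiplicity: the dimension of the linear span of all its
square integrable eigenfunctions. -/
def boundStateCount (h : Set (HalfLineL2 × HalfLineL2)) : Cardinal :=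
  Module.rank ℂ (Submodule.span ℂ {Ψ : HalfLineL2 | ∃ E : ℝ, (Ψ, (E : ℂ) • Ψ) ∈ h})

/-! ### Scattering theory -/

/-- The coefficient `A(k, α; s)` of the resolvent; for `α = 0` it is given by the limit `α → 0`. -/
def resolventCoeff (k α s : ℝ) : ℂ :=
  if α = 0 then
    (π : ℂ) ^ 2 / 4 *
      (Complex.log (k / (2 * Complex.I)) + (Real.eulerMascheroniConstant : ℂ) + s)⁻¹
  else
    (π : ℂ) / 2 *
      ((((k / 2) ^ (-(2 * α)) * (2 * s * α - 1) * (1 / Real.sin (π * α))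
          * (Real.Gamma (1 + α) / Real.Gamma (1 - α)) + Real.cot (π * α) : ℝ) : ℂ)
        - Complex.I)⁻¹

/-- `φ` is the outgoing state of `h_{0,α}(s)` at energy `k²`: it is a generalized eigenfunction,
that is, it solves the eigenvalue equation on `(0,∞)` and satisfies the boundary condition of
`h_{0,α}(s)` at `0`, and it is the sum of the free state `φ_0` and of a scattered part which is
asymptotically a purely outgoing wave. -/
structure IsOutgoingState (α s k : ℝ) (φ : ℝ → ℂ) : Prop where
  differentiable : ∀ r, 0 < r → DifferentiableAt ℝ φ r
  differentiable_deriv : ∀ r, 0 < r → DifferentiableAt ℝ (deriv φ) r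
  eigen : ∀ r, 0 < r → radialExpr α φ r = (k : ℂ) ^ 2 * φ r
  boundary : BoundaryCondition (boundaryFn α s) φ
  outgoing : ∃ c : ℂ, Tendsto
    (fun r : ℝ => φ r - phiFree α k r - c * Complex.exp (Complex.I * (k * r))) atTop (𝓝 0)

/-- The function `φ_0 + (2i/π) A(k, α; s) χ_0^+`. -/
def outgoingFn (α s k r : ℝ) : ℂ :=
  phiFree α k r + 2 * Complex.I / π * resolventCoeff k α s * chiFree α k r

/-- `Ψ` is a solution of the Schrödinger equation `i ∂_t Ψ = h Ψ`; for self-adjoint `h` this is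
`Ψ(t) = e^{-ith} Ψ(0)` with `Ψ(0)` in the domain of `h`. -/
def IsSchrodingerSolution (h : Set (HalfLineL2 × HalfLineL2)) (Ψ : ℝ → HalfLineL2) : Prop :=
  ∀ t : ℝ, ∃ Ψ' : HalfLineL2, HasDerivAt Ψ Ψ' t ∧ (Ψ t, Complex.I • Ψ') ∈ h

/-- `X = Ω Φ`, where `Ω = s-lim e^{ith} e^{-ith₀}` along `l` is the wave operator of the pair
`(h, h₀)`, for `Φ`, `X` in the domains: the motion under `h` which is at `X` at time zero is
asymptotic along `l` to the motion under `h₀` which is at `Φ` at time zero. -/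
def IsWaveOperatorImage (h h₀ : Set (HalfLineL2 × HalfLineL2)) (l : Filter ℝ)
    (Φ X : HalfLineL2) : Prop :=
  ∃ Ψ Ψ₀ : ℝ → HalfLineL2, IsSchrodingerSolution h Ψ ∧ IsSchrodingerSolution h₀ Ψ₀ ∧
    Ψ 0 = X ∧ Ψ₀ 0 = Φ ∧ Tendsto (fun t => ‖Ψ t - Ψ₀ t‖) l (𝓝 0)

/-- `Φout = S Φin` for the scattering operator `S = (Ω⁺)^* Ω⁻` of the pair `(h, h₀)`, where
`Ω^±` is the wave operator for `t → ±∞`: one state has the two free asymptotes. -/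
def ScattersTo (h h₀ : Set (HalfLineL2 × HalfLineL2)) (Φin Φout : HalfLineL2) : Prop :=
  ∃ X, IsWaveOperatorImage h h₀ atBot Φin X ∧ IsWaveOperatorImage h h₀ atTop Φout X

/-- Smooth functions of the momentum with compact support in `(0,∞)`. -/
def IsMomentumTest (g : ℝ → ℂ) : Prop :=
  ContDiff ℝ ∞ g ∧ HasCompactSupport g ∧ tsupport g ⊆ Ioi 0

/-- The element `Φ` of the Hilbert space is the wave packet `r ↦ ∫_0^∞ g(k) u(k, r) dk`. -/
def IsWavePacket (u : ℝ → ℝ → ℂ) (g : ℝ → ℂ) (Φ : HalfLineL2) : Prop :=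
  (Φ : ℝ → ℂ) =ᵐ[halfLine] fun r => ∫ k in Ioi (0 : ℝ), g k * u k r

/-- `δ` is the scattering phase shift, a continuous function of the momentum: in the spectral
representation of the free Hamiltonian, given by the `φ_0(·; k, α)`, the scattering operator is
multiplication by `e^{2iδ(k)}`. -/
def IsPhaseShift (α s : ℝ) (δ : ℝ → ℝ) : Prop :=
  ContinuousOn δ (Ioi 0) ∧
    ∀ g : ℝ → ℂ, IsMomentumTest g → ∃ Φin Φout : HalfLineL2,
      IsWavePacket (phiFree α) g Φin ∧
      IsWavePacket (phiFree α) (fun k => Complex.exp (2 * Complex.I * δ k) * g k) Φout ∧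
      ScattersTo (deltaHamiltonian α s) (freeHamiltonian α) Φin Φout

/-- `√(πik)`, the principal square root. -/
def sqrtPiIK (k : ℝ) : ℂ := (π * Complex.I * k : ℂ) ^ (1 / 2 : ℂ)

/-- The partial wave amplitude `f(k) = (e^{2iδ(k)} - 1) / √(πik)`. -/
def partialWaveAmplitude (δ : ℝ → ℝ) (k : ℝ) : ℂ :=
  (Complex.exp (2 * Complex.I * δ k) - 1) / sqrtPiIK k

end AnyonDelta

end

open AnyonDelta

/-! The radial equation is solved explicitly. Its solutions are a power of `r`, with a logarithm
when the order is zero, times entire functions of `E r²/4`, so that one family serves the energies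
`k²`, `0` and `-κ²`. Near the origin the energy is a perturbation of relative size `r²`, so the
limits of Wronskians do not depend on it. Hence the boundary condition, though posed with a zero
energy function, selects at every energy the multiples of one real solution `bcSol`, and `regSol` is
a companion with Wronskian one (`wronskian_bc_reg`).

At infinity every solution at energy one is a superposition of `e^{ix}` and `e^{-ix}` with error
`O(1/x)`. The amplitudes of the Hankel function come from Poisson's integral by a contour shift,
which needs order above `1/2`; the three term recurrence lowers the order, and order zero is reached
as a limit with uniform error constants (`chi_asymptotics`).

Stationary theory: write `T` for `cotPhase`. The real combination `T J - Y`, times `√(πx/2)`,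
satisfies the boundary condition (`cotPhase_mul_pJ_sub_qY`). Divided by `T - i` it equals `φ_0 +
(2i/π) A χ_0^+`, and the prescribed incoming amplitude excludes every other multiple. The scattering
matrix is then `(T + i)/(T - i)`, of modulus one.

Time dependent theory: packets of these states evolve by factors `e^{-ik²t}`. The outgoing packet
minus the free one is a packet of `χ`, and the outgoing packet minus the free one with amplitude
multiplied by the scattering matrix is a packet of the conjugate of `χ`. For `t → -∞` and `t → +∞`
respectively the phase has no stationary point, and one integration by parts makes these differences
tend to zero in `L²` (`norm_packet_chi_le`). So both wave operator images are exhibited. That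
nothing else qualifies as a phase shift follows from two facts: the Hamiltonians are symmetric,
hence motions keep their distance and the outgoing asymptote is unique (`ScattersTo.unique`), and
the expansion in the `φ_0` is injective on the amplitudes in question (`eq_of_isWavePacket`).

Levinson's relation: `π/2 - arctan T` is a phase shift in `(0, π)`, and any other one differs from
it by a constant multiple of `π`. As `k → ∞` it tends to `πα`; as `k ↓ 0` its limit depends on the
sign of `2αs - 1`. The same sign governs bound states: at energy `-κ²` the quotient `bcSol / regSol`
has a limit at infinity, which vanishes for exactly one `κ` if `2αs < 1` and for none if `2αs > 1`;
a nonzero limit means growth, a zero limit means decay. Non-negative energies are excluded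
separately. -/

noncomputable section

namespace AnyonDelta

/-! ### Rapidly convergent power series -/

/-- Coefficient sequences of power series of exponential growth. -/
def Rapid (c : ℕ → ℝ) : Prop :=
  ∃ C K : ℝ, 0 ≤ C ∧ 0 ≤ K ∧ ∀ m, |c m| ≤ C * K ^ m / m.factorial

/-- The sum of a power series. -/
def pser (c : ℕ → ℝ) (z : ℝ) : ℝ := ∑' m, c m * z ^ m

/-- The coefficients of the derived power series. -/
def dshift (c : ℕ → ℝ) (m : ℕ) : ℝ := (m + 1) * c (m + 1)

theorem Rapid.derived {c : ℕ → ℝ} (hc : Rapid c) : Rapid (dshift c) := by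
  obtain ⟨C, K, hC, hK, h⟩ := hc
  refine ⟨C * K, K, by positivity, hK, fun m => ?_⟩
  have h1 := h (m + 1)
  have h2 : (0 : ℝ) < m + 1 := by positivity
  rw [dshift, abs_mul, abs_of_pos h2]
  calc (m + 1 : ℝ) * |c (m + 1)| ≤ (m + 1) * (C * K ^ (m + 1) / (m + 1).factorial) := by gcongr
    _ = C * K * K ^ m / m.factorial := by
      rw [Nat.factorial_succ]; push_cast; field_simp; ring

theorem Rapid.nat_mul {c : ℕ → ℝ} (hc : Rapid c) : Rapid (fun m => m * c m) := by
  obtain ⟨C, K, hC, hK, h⟩ := hc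
  refine ⟨C, 2 * K, by positivity, by positivity, fun m => ?_⟩
  rw [abs_mul, abs_of_nonneg (by positivity : (0 : ℝ) ≤ m)]
  have h2 : (m : ℝ) ≤ 2 ^ m := by exact_mod_cast (Nat.lt_two_pow_self (n := m)).le
  calc (m : ℝ) * |c m| ≤ 2 ^ m * (C * K ^ m / m.factorial) := by gcongr; exact h m
    _ = _ := by rw [mul_pow]; ring

theorem Rapid.summable_abs {c : ℕ → ℝ} (hc : Rapid c) (z : ℝ) :
    Summable fun m => |c m| * |z| ^ m := by
  obtain ⟨C, K, hC, hK, h⟩ := hc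
  have hs := (Real.summable_pow_div_factorial (K * |z|)).mul_left C
  refine Summable.of_nonneg_of_le (fun m => by positivity) (fun m => ?_) hs
  calc |c m| * |z| ^ m ≤ (C * K ^ m / m.factorial) * |z| ^ m := by gcongr; exact h m
    _ = _ := by rw [mul_pow]; ring

theorem Rapid.summable {c : ℕ → ℝ} (hc : Rapid c) (z : ℝ) : Summable fun m => c m * z ^ m := by
  refine Summable.of_norm ?_
  simpa [abs_mul, abs_pow] using hc.summable_abs z

theorem Rapid.hasSum {c : ℕ → ℝ} (hc : Rapid c) (z : ℝ) :
    HasSum (fun m => c m * z ^ m) (pser c z) := (hc.summable z).hasSum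

theorem hasSum_of_eq {f g : ℕ → ℝ} {a : ℝ} (h : HasSum f a) (e : ∀ m, g m = f m) :
    HasSum g a := by rwa [funext e]

theorem pser_zero (c : ℕ → ℝ) : pser c 0 = c 0 := by
  rw [pser, tsum_eq_single 0]
  · simp
  · intro m hm; simp [hm]

/-- The Euler operator `z d/dz` multiplies the coefficient of index `m` by `m`. Through it,
differential equations and recurrences become identities between coefficients. -/
theorem mul_pser_dshift {c : ℕ → ℝ} (hc : Rapid c) (z : ℝ) :
    z * pser (dshift c) z = pser (fun m => m * c m) z := by
  have h1 := (hc.derived.hasSum z).mul_left z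
  have h2 := hc.nat_mul.hasSum z
  have h3 : HasSum (fun m : ℕ => ((m + 1 : ℕ) : ℝ) * c (m + 1) * z ^ (m + 1))
      (z * pser (dshift c) z) := by
    refine hasSum_of_eq h1 fun m => ?_
    simp only [dshift]; push_cast; ring
  have h4 := (hasSum_nat_add_iff (f := fun m : ℕ => (m : ℝ) * c m * z ^ m) 1).1 h3
  simpa using h4.unique h2

theorem Rapid.hasDerivAt {c : ℕ → ℝ} (hc : Rapid c) (z : ℝ) :
    HasDerivAt (pser c) (pser (dshift c) z) z := by
  -- Any radius above `|z|` would do: termwise differentiation needs a summable bound uniform on a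
  -- neighbourhood of `z`.
  set R : ℝ := |z| + 1
  have hR : 0 ≤ R := by positivity
  have hd : ∀ (m : ℕ) (y : ℝ), y ∈ Ioo (-R) R →
      HasDerivAt (fun y => c m * y ^ m) (c m * (m * y ^ (m - 1))) y := fun m y _ =>
    (hasDerivAt_pow m y).const_mul _
  have hu : Summable fun m : ℕ => |c m| * (m * R ^ (m - 1)) := by
    rw [← summable_nat_add_iff 1]
    have := hc.derived.summable_abs R
    rw [abs_of_nonneg hR] at this
    refine this.congr fun m => ?_
    simp only [dshift, abs_mul, Nat.add_sub_cancel]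
    rw [abs_of_pos (by positivity : (0 : ℝ) < m + 1)]; push_cast; ring
  have hb : ∀ (m : ℕ) (y : ℝ), y ∈ Ioo (-R) R →
      ‖c m * (m * y ^ (m - 1))‖ ≤ |c m| * (m * R ^ (m - 1)) := by
    intro m y hy
    rw [norm_mul, norm_mul, norm_pow, Real.norm_eq_abs, Real.norm_eq_abs, Real.norm_eq_abs,
      abs_of_nonneg (by positivity : (0 : ℝ) ≤ m)]
    have : |y| ≤ R := (abs_lt.2 hy).le
    gcongr
  have hzm : z ∈ Ioo (-R) R := by
    exact abs_lt.1 (by simp [R])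
  have key := hasDerivAt_tsum_of_isPreconnected hu isOpen_Ioo isPreconnected_Ioo hd hb hzm
    (hc.summable z) hzm
  have e : ∑' m, c m * (m * z ^ (m - 1)) = pser (dshift c) z := by
    have hs : Summable fun m : ℕ => c m * (m * z ^ (m - 1)) :=
      Summable.of_norm_bounded hu fun m => hb m z hzm
    rw [hs.tsum_eq_zero_add, pser]
    simp only [Nat.cast_zero, zero_mul, mul_zero, zero_add, Nat.add_sub_cancel, dshift]
    refine tsum_congr fun m => ?_
    push_cast; ring
  rw [e] at key
  exact key

theorem Rapid.continuous {c : ℕ → ℝ} (hc : Rapid c) : Continuous (pser c) :=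
  continuous_iff_continuousAt.2 fun z => (hc.hasDerivAt z).continuousAt

/-! ### The power series of the Bessel functions -/

/-- Coefficients of `J_ν(x) = (x/2)^ν ∑ (-1)^m / (m! Γ(m+ν+1)) (x²/4)^m`. -/
def bjCoeff (ν : ℝ) (m : ℕ) : ℝ := (-1 : ℝ) ^ m / ((m.factorial : ℝ) * Real.Gamma (m + ν + 1))

/-- The entire factor of the Bessel function, as a function of `x²/4`. -/
def bj (ν z : ℝ) : ℝ := pser (bjCoeff ν) z

/-- From `ν + 2 > 1` on, each unit shift multiplies `Γ` by a factor at least one. Between `ν + 1`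
and `ν + 2` it may decrease, so `m = 0` has its own term in the bound. -/
theorem inv_Gamma_le {ν : ℝ} (hν : -1 < ν) (m : ℕ) :
    (Real.Gamma (m + ν + 1))⁻¹ ≤ (Real.Gamma (ν + 1))⁻¹ + (Real.Gamma (ν + 2))⁻¹ := by
  have g1 : 0 < Real.Gamma (ν + 1) := Real.Gamma_pos_of_pos (by linarith)
  have g2 : 0 < Real.Gamma (ν + 2) := Real.Gamma_pos_of_pos (by linarith)
  rcases m with _ | m
  · simp; positivity
  · have : Real.Gamma (ν + 2) ≤ Real.Gamma ((m + 1 : ℕ) + ν + 1) := by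
      induction m with
      | zero => apply le_of_eq; congr 1; push_cast; ring
      | succ m ih =>
        have e : ((m + 1 + 1 : ℕ) : ℝ) + ν + 1 = (((m + 1 : ℕ) : ℝ) + ν + 1) + 1 := by
          push_cast; ring
        have hp : (0 : ℝ) ≤ m := by positivity
        have h1 : 1 ≤ ((m + 1 : ℕ) : ℝ) + ν + 1 := by push_cast; linarith
        rw [e, Real.Gamma_add_one (by linarith)]
        nlinarith
    have := inv_anti₀ g2 this
    have : 0 < (Real.Gamma (ν + 1))⁻¹ := by positivity
    linarith

theorem rapid_bjCoeff {ν : ℝ} (hν : -1 < ν) : Rapid (bjCoeff ν) := by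
  have g1 : 0 < Real.Gamma (ν + 1) := Real.Gamma_pos_of_pos (by linarith)
  have g2 : 0 < Real.Gamma (ν + 2) := Real.Gamma_pos_of_pos (by linarith)
  refine ⟨(Real.Gamma (ν + 1))⁻¹ + (Real.Gamma (ν + 2))⁻¹, 1, by positivity, zero_le_one,
    fun m => ?_⟩
  have g3 : 0 < Real.Gamma (m + ν + 1) := Real.Gamma_pos_of_pos (by
    have : (0 : ℝ) ≤ m := by positivity
    linarith)
  have := inv_Gamma_le hν m
  rw [bjCoeff, abs_div, abs_pow, abs_neg, abs_one, one_pow, mul_one,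
    abs_of_pos (by positivity), one_div, mul_inv, mul_comm, ← div_eq_mul_inv]
  gcongr

theorem dshift_bjCoeff {ν : ℝ} (m : ℕ) : dshift (bjCoeff ν) m = -bjCoeff (ν + 1) m := by
  simp only [dshift, bjCoeff, Nat.factorial_succ, pow_succ]
  push_cast
  have : (m : ℝ) + 1 + ν + 1 = m + (ν + 1) + 1 := by ring
  rw [this]
  have : (m : ℝ) + 1 ≠ 0 := by positivity
  field_simp

theorem pser_neg (c : ℕ → ℝ) (z : ℝ) : pser (fun m => -c m) z = -pser c z := by
  simp only [pser, neg_mul, tsum_neg]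

theorem hasDerivAt_bj {ν : ℝ} (hν : -1 < ν) (z : ℝ) : HasDerivAt (bj ν) (-bj (ν + 1) z) z := by
  have := (rapid_bjCoeff hν).hasDerivAt z
  rwa [show dshift (bjCoeff ν) = fun m => -bjCoeff (ν + 1) m from funext dshift_bjCoeff,
    pser_neg] at this

theorem continuous_bj {ν : ℝ} (hν : -1 < ν) : Continuous (bj ν) := (rapid_bjCoeff hν).continuous

theorem bj_zero (ν : ℝ) : bj ν 0 = (Real.Gamma (ν + 1))⁻¹ := by
  rw [bj, pser_zero]; simp [bjCoeff]

/-- The three term recurrence `J_{ν} + J_{ν+2} = 2(ν+1)/x J_{ν+1}`. -/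
theorem bj_recurrence {ν : ℝ} (hν : -1 < ν) (z : ℝ) :
    bj ν z + z * bj (ν + 2) z = (ν + 1) * bj (ν + 1) z := by
  have hν1 : -1 < ν + 1 := by linarith
  have h1 := mul_pser_dshift (rapid_bjCoeff hν1) z
  rw [show dshift (bjCoeff (ν + 1)) = fun m => -bjCoeff (ν + 1 + 1) m from funext dshift_bjCoeff,
    pser_neg] at h1
  have s1 := (rapid_bjCoeff hν1).hasSum z
  have s2 := (rapid_bjCoeff hν1).nat_mul.hasSum z
  have s0 := (rapid_bjCoeff hν).hasSum z
  have : HasSum (fun m => bjCoeff ν m * z ^ m)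
      ((ν + 1) * pser (bjCoeff (ν + 1)) z + pser (fun m => m * bjCoeff (ν + 1) m) z) := by
    refine hasSum_of_eq ((s1.mul_left (ν + 1)).add s2) fun m => ?_
    have hp : (0 : ℝ) ≤ m := by positivity
    have hm : (m : ℝ) + ν + 1 ≠ 0 := by linarith
    simp only [bjCoeff]
    rw [show (m : ℝ) + (ν + 1) + 1 = (m + ν + 1) + 1 by ring, Real.Gamma_add_one hm]
    have : Real.Gamma (m + ν + 1) ≠ 0 := (Real.Gamma_pos_of_pos (by linarith)).ne'
    field_simp
    ring
  have e := s0.unique this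
  rw [show ν + 2 = ν + 1 + 1 by ring]
  simp only [bj]
  rw [e, ← h1]; ring

theorem besselJ_eq {ν x : ℝ} (hx : 0 < x) : besselJ ν x = (x / 2) ^ ν * bj ν (x ^ 2 / 4) := by
  rw [besselJ, bj, pser, ← tsum_mul_left]
  refine tsum_congr fun m => ?_
  rw [rpow_add (by positivity), mul_comm (2 : ℝ) (m : ℝ), rpow_mul (by positivity), rpow_natCast,
    rpow_ofNat, bjCoeff, ← pow_mul, mul_comm m 2, pow_mul,
    show (x / 2) ^ 2 = x ^ 2 / 4 by ring]
  ring

/-- Coefficients of the power series that accompanies the logarithm in `Y_0`. -/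
def bhCoeff (m : ℕ) : ℝ := (-1 : ℝ) ^ (m + 1) * (harmonic m : ℝ) / (m.factorial : ℝ) ^ 2

/-- The power series that accompanies the logarithm in `Y_0`, as a function of `x²/4`. -/
def bh (z : ℝ) : ℝ := pser bhCoeff z

theorem harmonic_nonneg_le (m : ℕ) : (0 : ℝ) ≤ (harmonic m : ℝ) ∧ (harmonic m : ℝ) ≤ m := by
  induction m with
  | zero => simp
  | succ m ih =>
    rw [harmonic_succ]
    push_cast
    have h1 : ((m : ℝ) + 1)⁻¹ ≤ 1 := inv_le_one_of_one_le₀ (by linarith [(by positivity : (0:ℝ) ≤ m)])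
    have h2 : 0 ≤ ((m : ℝ) + 1)⁻¹ := by positivity
    constructor <;> linarith [ih.1, ih.2]

theorem rapid_bhCoeff : Rapid bhCoeff := by
  refine ⟨1, 1, zero_le_one, zero_le_one, fun m => ?_⟩
  obtain ⟨h0, h1⟩ := harmonic_nonneg_le m
  rw [bhCoeff, abs_div, abs_mul, abs_pow, abs_neg, abs_one, one_pow, abs_of_nonneg h0,
    abs_of_nonneg (by positivity), one_pow, div_le_div_iff₀ (by positivity) (by positivity)]
  have : (m : ℝ) ≤ m.factorial := by exact_mod_cast Nat.self_le_factorial m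
  have : (harmonic m : ℝ) ≤ m.factorial := h1.trans this
  have : (0 : ℝ) < m.factorial := by positivity
  nlinarith

/-- Frobenius' method: in `log r * bj 0 + bh`, with `log r` equal to half of `log z` up to a
constant, differentiating the logarithm leaves the derivative of `bj 0`, that is `-bj 1`, and `bh`
has to compensate it. The harmonic numbers are the solution of the resulting recursion for the
coefficients. -/
theorem bh_ode (z : ℝ) :
    z * pser (dshift (dshift bhCoeff)) z + pser (dshift bhCoeff) z + bh z = bj 1 z := by
  have hr := rapid_bhCoeff
  rw [mul_pser_dshift hr.derived]
  have h := ((hr.derived.nat_mul.hasSum z).add (hr.derived.hasSum z)).add (hr.hasSum z)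
  refine h.unique ?_
  rw [bj]
  refine hasSum_of_eq ((rapid_bjCoeff (by norm_num : (-1 : ℝ) < 1)).hasSum z) fun m => ?_
  simp only [dshift, bhCoeff, bjCoeff, harmonic_succ, Nat.factorial_succ, pow_succ]
  rw [show (m : ℝ) + 1 + 1 = ((m + 1 : ℕ) : ℝ) + 1 by push_cast; ring, Real.Gamma_nat_eq_factorial,
    Nat.factorial_succ]
  push_cast
  have : (m : ℝ) + 1 ≠ 0 := by positivity
  field_simp
  ring

theorem hasDerivAt_bh (z : ℝ) : HasDerivAt bh (pser (dshift bhCoeff) z) z :=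
  rapid_bhCoeff.hasDerivAt z

theorem bh_zero : bh 0 = 0 := by rw [bh, pser_zero]; simp [bhCoeff]

theorem besselYZero_eq (x : ℝ) : besselYZero x =
    2 / π * ((Real.log (x / 2) + Real.eulerMascheroniConstant) * besselJ 0 x + bh (x ^ 2 / 4)) := by
  rw [besselYZero, bh, pser]
  congr 3
  ext m
  rw [bhCoeff, pow_mul, show (x / 2) ^ 2 = x ^ 2 / 4 by ring]

/-! ### The radial equation -/

/-- `u` solves `-u'' + c r⁻² u = E u` on `(0,∞)`, and `v` is its derivative. -/
structure IsSol {V : Type*} [NormedAddCommGroup V] [NormedSpace ℝ V] (c E : ℝ) (u v : ℝ → V) :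
    Prop where
  left : ∀ r, 0 < r → HasDerivAt u (v r) r
  right : ∀ r, 0 < r → HasDerivAt v ((c / r ^ 2 - E) • u r) r

namespace IsSol

variable {V W : Type*} [NormedAddCommGroup V] [NormedSpace ℝ V] [NormedAddCommGroup W]
  [NormedSpace ℝ W] {c E : ℝ} {u v u₁ v₁ : ℝ → V}

theorem add (h : IsSol c E u v) (h₁ : IsSol c E u₁ v₁) :
    IsSol c E (fun r => u r + u₁ r) (fun r => v r + v₁ r) :=
  ⟨fun r hr => (h.left r hr).add (h₁.left r hr), fun r hr => by
    rw [smul_add]; exact (h.right r hr).add (h₁.right r hr)⟩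

theorem clm (h : IsSol c E u v) (L : V →L[ℝ] W) :
    IsSol c E (fun r => L (u r)) (fun r => L (v r)) :=
  ⟨fun r hr => L.hasFDerivAt.comp_hasDerivAt r (h.left r hr), fun r hr => by
    rw [← map_smul]; exact L.hasFDerivAt.comp_hasDerivAt r (h.right r hr)⟩

theorem sub (h : IsSol c E u v) (h₁ : IsSol c E u₁ v₁) :
    IsSol c E (fun r => u r - u₁ r) (fun r => v r - v₁ r) :=
  ⟨fun r hr => (h.left r hr).sub (h₁.left r hr), fun r hr => by
    rw [smul_sub]; exact (h.right r hr).sub (h₁.right r hr)⟩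

theorem const_mul {𝕜 : Type*} [NormedRing 𝕜] [NormedAlgebra ℝ 𝕜] {u v : ℝ → 𝕜}
    (h : IsSol c E u v) (a : 𝕜) : IsSol c E (fun r => a * u r) (fun r => a * v r) :=
  ⟨fun r hr => (h.left r hr).const_mul a, fun r hr => by
    rw [← mul_smul_comm]; exact (h.right r hr).const_mul a⟩

theorem ofReal {u v : ℝ → ℝ} (h : IsSol c E u v) :
    IsSol c E (fun r => (u r : ℂ)) (fun r => (v r : ℂ)) := h.clm Complex.ofRealCLM

theorem conj {u v : ℝ → ℂ} (h : IsSol c E u v) :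
    IsSol c E (fun r => (starRingEnd ℂ) (u r)) (fun r => (starRingEnd ℂ) (v r)) :=
  h.clm (Complex.conjCLE : ℂ →L[ℝ] ℂ)

theorem scale (h : IsSol c 1 u v) {k : ℝ} (hk : 0 < k) :
    IsSol c (k ^ 2) (fun r => u (k * r)) (fun r => k • v (k * r)) := by
  have hm : ∀ r, HasDerivAt (fun r => k * r) k r := fun r => by
    simpa using (hasDerivAt_id r).const_mul k
  refine ⟨fun r hr => ?_, fun r hr => ?_⟩
  · exact HasDerivAt.scomp r (h.left (k * r) (by positivity)) (hm r)
  · have h1 := (HasDerivAt.scomp r (h.right (k * r) (by positivity)) (hm r)).const_smul k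
    refine h1.congr_deriv ?_
    rw [smul_smul, smul_smul]
    congr 1
    field_simp

/-- The Wronskian of two solutions is constant. -/
theorem wronskian_const {𝕜 : Type*} [NormedCommRing 𝕜] [NormedAlgebra ℝ 𝕜] {u v u₁ v₁ : ℝ → 𝕜}
    (h : IsSol c E u v) (h₁ : IsSol c E u₁ v₁) {r r' : ℝ} (hr : 0 < r) (hr' : 0 < r') :
    u r * v₁ r - u₁ r * v r = u r' * v₁ r' - u₁ r' * v r' := by
  have hd : ∀ x ∈ Ioi (0 : ℝ), HasDerivAt (fun r => u r * v₁ r - u₁ r * v r) 0 x := by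
    intro x hx
    refine (((h.left x hx).mul (h₁.right x hx)).sub
      ((h₁.left x hx).mul (h.right x hx))).congr_deriv ?_
    simp only [mul_smul_comm]
    rw [mul_comm (u₁ x) (u x), mul_comm (v₁ x) (v x)]
    abel
  have := (convex_Ioi (0 : ℝ)).norm_image_sub_le_of_norm_hasDerivWithin_le (C := 0)
    (fun x hx => (hd x hx).hasDerivWithinAt) (by simp) hr' hr
  simpa [sub_eq_zero] using this

end IsSol

theorem hasDerivAt_sq_scale (E r : ℝ) : HasDerivAt (fun r : ℝ => E * r ^ 2 / 4) (E * r / 2) r := by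
  have := ((hasDerivAt_pow 2 r).const_mul E).div_const 4
  refine this.congr_deriv ?_
  norm_num; ring

/-- The solution `r^{1/2+ν} ∑ (-1)^m / (m! Γ(m+ν+1)) (E r²/4)^m` of the radial equation. -/
def powSol (ν E r : ℝ) : ℝ := r ^ (1 / 2 + ν) * bj ν (E * r ^ 2 / 4)

/-- The derivative of `powSol`. -/
def powSolDeriv (ν E r : ℝ) : ℝ :=
  r ^ (ν - 1 / 2) * ((1 / 2 + ν) * bj ν (E * r ^ 2 / 4)
    - 2 * (E * r ^ 2 / 4) * bj (ν + 1) (E * r ^ 2 / 4))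

theorem isSol_powSol {ν : ℝ} (hν : -1 < ν) (E : ℝ) :
    IsSol (ν ^ 2 - 1 / 4) E (powSol ν E) (powSolDeriv ν E) := by
  have hν1 : -1 < ν + 1 := by linarith
  have d0 : ∀ r, HasDerivAt (fun r => bj ν (E * r ^ 2 / 4))
      (-bj (ν + 1) (E * r ^ 2 / 4) * (E * r / 2)) r := fun r =>
    (hasDerivAt_bj hν _).comp r (hasDerivAt_sq_scale E r)
  have d1 : ∀ r, HasDerivAt (fun r => bj (ν + 1) (E * r ^ 2 / 4))
      (-bj (ν + 1 + 1) (E * r ^ 2 / 4) * (E * r / 2)) r := fun r =>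
    (hasDerivAt_bj hν1 _).comp r (hasDerivAt_sq_scale E r)
  refine ⟨fun r hr => ?_, fun r hr => ?_⟩
  · have h := (Real.hasDerivAt_rpow_const (p := 1 / 2 + ν) (Or.inl hr.ne')).mul (d0 r)
    refine h.congr_deriv ?_
    rw [powSolDeriv, show 1 / 2 + ν = ν - 1 / 2 + 1 by ring, rpow_add hr, rpow_one,
      show ν - 1 / 2 + 1 - 1 = ν - 1 / 2 by ring]
    ring
  · have h := (Real.hasDerivAt_rpow_const (p := ν - 1 / 2) (Or.inl hr.ne')).mul
      (((d0 r).const_mul (1 / 2 + ν)).sub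
        (((hasDerivAt_sq_scale E r).const_mul 2).mul (d1 r)))
    refine h.congr_deriv ?_
    have hrec := bj_recurrence hν (E * r ^ 2 / 4)
    rw [show ν + 2 = ν + 1 + 1 by ring] at hrec
    rw [smul_eq_mul, powSol, show ν - 1 / 2 = ν - 1 / 2 - 1 + 1 by ring, rpow_add hr, rpow_one,
      show 1 / 2 + ν = ν - 1 / 2 - 1 + 1 + 1 by ring, rpow_add hr, rpow_add hr, rpow_one,
      show ν - 1 / 2 - 1 + 1 - 1 = ν - 1 / 2 - 1 by ring]
    -- The recurrence eliminates `bj ν`; what remains is an identity linear in the two higher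
    -- orders.
    have e : bj ν (E * r ^ 2 / 4) = (ν + 1) * bj (ν + 1) (E * r ^ 2 / 4)
      - E * r ^ 2 / 4 * bj (ν + 1 + 1) (E * r ^ 2 / 4) := by linarith
    simp only [Pi.sub_apply, Pi.mul_apply, e]
    field_simp
    ring

/-- The logarithmic solution of the radial equation for `ν = 0`. -/
def logSol (E r : ℝ) : ℝ :=
  r ^ (1 / 2 : ℝ) * (Real.log r * bj 0 (E * r ^ 2 / 4) + bh (E * r ^ 2 / 4))

/-- The derivative of `logSol`. -/
def logSolDeriv (E r : ℝ) : ℝ :=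
  r ^ (-(1 / 2) : ℝ) * (1 / 2 * (Real.log r * bj 0 (E * r ^ 2 / 4) + bh (E * r ^ 2 / 4))
    + bj 0 (E * r ^ 2 / 4) + 2 * (E * r ^ 2 / 4) *
      (pser (dshift bhCoeff) (E * r ^ 2 / 4) - Real.log r * bj 1 (E * r ^ 2 / 4)))

theorem isSol_logSol (E : ℝ) :
    IsSol (0 ^ 2 - 1 / 4) E (logSol E) (logSolDeriv E) := by
  have d0 : ∀ r, HasDerivAt (fun r => bj 0 (E * r ^ 2 / 4))
      (-bj 1 (E * r ^ 2 / 4) * (E * r / 2)) r := fun r => by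
    have := (hasDerivAt_bj (by norm_num : (-1 : ℝ) < 0) _).comp r (hasDerivAt_sq_scale E r)
    rwa [zero_add] at this
  have d1 : ∀ r, HasDerivAt (fun r => bj 1 (E * r ^ 2 / 4))
      (-bj 2 (E * r ^ 2 / 4) * (E * r / 2)) r := fun r => by
    have := (hasDerivAt_bj (by norm_num : (-1 : ℝ) < 1) _).comp r (hasDerivAt_sq_scale E r)
    rwa [one_add_one_eq_two] at this
  have h0 : ∀ r, HasDerivAt (fun r => bh (E * r ^ 2 / 4))
      (pser (dshift bhCoeff) (E * r ^ 2 / 4) * (E * r / 2)) r := fun r =>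
    (hasDerivAt_bh _).comp r (hasDerivAt_sq_scale E r)
  have h1 : ∀ r, HasDerivAt (fun r => pser (dshift bhCoeff) (E * r ^ 2 / 4))
      (pser (dshift (dshift bhCoeff)) (E * r ^ 2 / 4) * (E * r / 2)) r := fun r =>
    (rapid_bhCoeff.derived.hasDerivAt _).comp r (hasDerivAt_sq_scale E r)
  refine ⟨fun r hr => ?_, fun r hr => ?_⟩
  · have h := (Real.hasDerivAt_rpow_const (p := 1 / 2) (Or.inl hr.ne')).mul
      (((Real.hasDerivAt_log hr.ne').mul (d0 r)).add (h0 r))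
    refine h.congr_deriv ?_
    rw [logSolDeriv, show (1 / 2 : ℝ) = -(1 / 2) + 1 by ring, rpow_add hr, rpow_one,
      show -(1 / 2 : ℝ) + 1 - 1 = -(1 / 2) by ring]
    simp only [Pi.add_apply, Pi.mul_apply]
    field_simp
    ring_nf
  · have h := (Real.hasDerivAt_rpow_const (p := -(1 / 2)) (Or.inl hr.ne')).mul
      ((((((Real.hasDerivAt_log hr.ne').mul (d0 r)).add (h0 r)).const_mul (1 / 2)).add (d0 r)).add
        (((hasDerivAt_sq_scale E r).const_mul 2).mul
          ((h1 r).sub ((Real.hasDerivAt_log hr.ne').mul (d1 r)))))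
    refine h.congr_deriv ?_
    have hrec := bj_recurrence (by norm_num : (-1 : ℝ) < 0) (E * r ^ 2 / 4)
    have hbh := bh_ode (E * r ^ 2 / 4)
    norm_num at hrec
    have q1 : (1 / 2 : ℝ) = -(1 / 2) - 1 + 1 + 1 := by ring
    have q2 : r ^ (1 / 2 : ℝ) = r ^ (-(1 / 2) - 1 : ℝ) * r * r := by
      conv_lhs => rw [q1]
      rw [rpow_add hr, rpow_add hr, rpow_one]
    have q3 : r ^ (-(1 / 2) : ℝ) = r ^ (-(1 / 2) - 1 : ℝ) * r := by
      conv_lhs => rw [show -(1 / 2 : ℝ) = -(1 / 2) - 1 + 1 by ring]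
      rw [rpow_add hr, rpow_one]
    rw [smul_eq_mul, logSol, q2, q3]
    have e : bj 0 (E * r ^ 2 / 4) = bj 1 (E * r ^ 2 / 4)
      - E * r ^ 2 / 4 * bj 2 (E * r ^ 2 / 4) := by linarith
    have e' : bh (E * r ^ 2 / 4) = bj 1 (E * r ^ 2 / 4) - pser (dshift bhCoeff) (E * r ^ 2 / 4)
      - E * r ^ 2 / 4 * pser (dshift (dshift bhCoeff)) (E * r ^ 2 / 4) := by linarith
    simp only [Pi.add_apply, Pi.mul_apply, Pi.sub_apply, e, e']
    field_simp
    ring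

end AnyonDelta

end
noncomputable section

namespace AnyonDelta

/-! ### Solutions of the radial equation at large radius -/

/-- The increment over `[x, y]` is dominated by `K/x - K/y`, the increment of a primitive of the
bound. So `f` is Cauchy at infinity, and `y → ∞` in the same inequality gives the rate. -/
theorem exists_limit_of_deriv_le {f f' : ℝ → ℂ} {K : ℝ}
    (hf : ∀ x, 1 ≤ x → HasDerivAt f (f' x) x) (hb : ∀ x, 1 ≤ x → ‖f' x‖ ≤ K / x ^ 2) :
    ∃ L, ∀ x, 1 ≤ x → ‖f x - L‖ ≤ K / x := by
  have hK : 0 ≤ K := by simpa using (norm_nonneg _).trans (hb 1 le_rfl)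
  have key : ∀ x y, 1 ≤ x → x ≤ y → ‖f y - f x‖ ≤ K / x - K / y := by
    intro x y hx hxy
    refine image_norm_le_of_norm_deriv_right_le_deriv_boundary' (a := x) (b := y)
      (f := fun y => f y - f x) (f' := f') (B := fun y => K / x - K / y)
      (B' := fun y => K / y ^ 2) ?_ ?_ (by simp) ?_ ?_ ?_ ⟨hxy, le_rfl⟩
    · exact fun t ht => ((hf t (hx.trans ht.1)).sub_const _).continuousAt.continuousWithinAt
    · exact fun t ht => ((hf t (hx.trans ht.1)).sub_const _).hasDerivWithinAt
    · intro t ht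
      have : t ≠ 0 := by linarith [ht.1]
      exact (continuousAt_const.sub (continuousAt_const.div continuousAt_id this)).continuousWithinAt
    · intro t ht
      have : t ≠ 0 := by linarith [ht.1]
      have := ((hasDerivAt_inv this).const_mul K).const_sub (K / x)
      refine (this.congr_deriv (by field_simp)).hasDerivWithinAt
    · exact fun t ht => hb t (hx.trans ht.1)
  -- Clamping the argument at `1` makes the family defined, and controlled, for all real arguments.
  have hcs : CauchySeq (fun x : ℝ => f (max 1 x)) := by
    refine cauchySeq_of_le_tendsto_0 (fun N => 2 * K / max 1 N) (fun n m N hn hm => ?_) ?_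
    · have h1 := key (max 1 N) (max 1 n) (le_max_left _ _) (max_le_max le_rfl hn)
      have h2 := key (max 1 N) (max 1 m) (le_max_left _ _) (max_le_max le_rfl hm)
      have p1 : 0 ≤ K / max 1 n := by positivity
      have p2 : 0 ≤ K / max 1 m := by positivity
      rw [dist_eq_norm]
      calc ‖f (max 1 n) - f (max 1 m)‖
          = ‖(f (max 1 n) - f (max 1 N)) - (f (max 1 m) - f (max 1 N))‖ := by congr 1; ring
        _ ≤ K / max 1 N + K / max 1 N := (norm_sub_le _ _).trans (by linarith)
        _ = _ := by ring
    · refine Tendsto.div_atTop tendsto_const_nhds ?_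
      exact tendsto_atTop_mono (fun x => le_max_right 1 x) tendsto_id
  obtain ⟨L, hL⟩ := cauchySeq_tendsto_of_complete hcs
  refine ⟨L, fun x hx => ?_⟩
  have h1 : Tendsto (fun y : ℝ => ‖f (max 1 y) - f x‖) atTop (𝓝 ‖L - f x‖) :=
    (hL.sub_const _).norm
  rw [norm_sub_rev]
  refine le_of_tendsto h1 ?_
  filter_upwards [eventually_ge_atTop x] with y hy
  rw [max_eq_right (hx.trans hy)]
  have := key x y hx hy
  have p : 0 ≤ K / y := div_nonneg hK (by linarith)
  linarith

namespace IsSol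

variable {c : ℝ} {u v : ℝ → ℂ}

theorem hasDerivAt_energy (h : IsSol c 1 u v) {r : ℝ} (hr : 0 < r) :
    HasDerivAt (fun r => ‖u r‖ ^ 2 + ‖v r‖ ^ 2) (2 * (c / r ^ 2) * inner ℝ (u r) (v r)) r := by
  refine ((h.left r hr).norm_sq.add (h.right r hr).norm_sq).congr_deriv ?_
  rw [real_inner_smul_right, real_inner_comm (u r) (v r)]
  ring

theorem abs_deriv_energy_le (u v : ℝ → ℂ) (c r : ℝ) :
    |2 * (c / r ^ 2) * inner ℝ (u r) (v r)| ≤ |c| / r ^ 2 * (‖u r‖ ^ 2 + ‖v r‖ ^ 2) := by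
  have h1 := abs_real_inner_le_norm (u r) (v r)
  have h2 : 2 * (‖u r‖ * ‖v r‖) ≤ ‖u r‖ ^ 2 + ‖v r‖ ^ 2 := by
    nlinarith [sq_nonneg (‖u r‖ - ‖v r‖)]
  rw [abs_mul, abs_mul, abs_div, abs_two, abs_of_nonneg (sq_nonneg r)]
  have : 0 ≤ |c| / r ^ 2 := by positivity
  nlinarith

/-- The logarithmic derivative of `‖u‖² + ‖v‖²` is at most `|c|/r²` in modulus, which the factors
`exp(±|c|/r)` offset exactly. The upper bound yields boundedness of solutions; the lower one later
excludes bound states at positive energies. -/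
theorem energy_le (h : IsSol c 1 u v) {x y : ℝ} (hx : 0 < x) (hxy : x ≤ y) :
    (‖u y‖ ^ 2 + ‖v y‖ ^ 2) * rexp (|c| / y) ≤ (‖u x‖ ^ 2 + ‖v x‖ ^ 2) * rexp (|c| / x) ∧
    (‖u x‖ ^ 2 + ‖v x‖ ^ 2) * rexp (-|c| / x) ≤ (‖u y‖ ^ 2 + ‖v y‖ ^ 2) * rexp (-|c| / y) := by
  have he : ∀ (a r : ℝ), 0 < r → HasDerivAt (fun r => rexp (a / r))
      (rexp (a / r) * (-a / r ^ 2)) r := fun a r hr => by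
    refine (((hasDerivAt_inv hr.ne').const_mul a).exp.congr_deriv ?_)
    simp only [div_eq_mul_inv]; ring
  have hd : ∀ (a r : ℝ), 0 < r → HasDerivAt
      (fun r => (‖u r‖ ^ 2 + ‖v r‖ ^ 2) * rexp (a / r))
      (rexp (a / r) * (2 * (c / r ^ 2) * inner ℝ (u r) (v r)
        - a / r ^ 2 * (‖u r‖ ^ 2 + ‖v r‖ ^ 2))) r := fun a r hr =>
    ((h.hasDerivAt_energy hr).mul (he a r hr)).congr_deriv (by ring)
  constructor
  · refine antitoneOn_of_deriv_nonpos (convex_Ioi (0 : ℝ))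
      (f := fun r => (‖u r‖ ^ 2 + ‖v r‖ ^ 2) * rexp (|c| / r))
      (fun r hr => (hd _ r hr).continuousAt.continuousWithinAt) ?_ ?_ hx (hx.trans_le hxy) hxy
    · rw [interior_Ioi]
      exact fun r hr => (hd _ r hr).differentiableAt.differentiableWithinAt
    · rw [interior_Ioi]
      intro r hr
      rw [(hd _ r hr).deriv]
      have := (abs_le.1 (abs_deriv_energy_le u v c r)).2
      exact mul_nonpos_of_nonneg_of_nonpos (by positivity) (by linarith)
  · refine monotoneOn_of_deriv_nonneg (convex_Ioi (0 : ℝ))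
      (f := fun r => (‖u r‖ ^ 2 + ‖v r‖ ^ 2) * rexp (-|c| / r))
      (fun r hr => (hd _ r hr).continuousAt.continuousWithinAt) ?_ ?_ hx (hx.trans_le hxy) hxy
    · rw [interior_Ioi]
      exact fun r hr => (hd _ r hr).differentiableAt.differentiableWithinAt
    · rw [interior_Ioi]
      intro r hr
      rw [(hd _ r hr).deriv]
      have := (abs_le.1 (abs_deriv_energy_le u v c r)).1
      refine mul_nonneg (by positivity) ?_
      rw [neg_div]; linarith

theorem norm_le (h : IsSol c 1 u v) {x : ℝ} (hx : 1 ≤ x) :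
    ‖u x‖ ≤ √((‖u 1‖ ^ 2 + ‖v 1‖ ^ 2) * rexp |c|) := by
  have h1 := (h.energy_le one_pos hx).1
  have h2 : 1 ≤ rexp (|c| / x) := Real.one_le_exp (by positivity)
  refine Real.le_sqrt_of_sq_le ?_
  rw [div_one] at h1
  nlinarith [sq_nonneg ‖u x‖, sq_nonneg ‖v x‖]

theorem le_energy (h : IsSol c 1 u v) {x : ℝ} (hx : 1 ≤ x) :
    (‖u 1‖ ^ 2 + ‖v 1‖ ^ 2) * rexp (-|c|) ≤ ‖u x‖ ^ 2 + ‖v x‖ ^ 2 := by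
  have h1 := (h.energy_le one_pos hx).2
  have h2 : rexp (-|c| / x) ≤ 1 := by
    rw [Real.exp_le_one_iff, neg_div, neg_nonpos]; positivity
  rw [div_one] at h1
  nlinarith [sq_nonneg ‖u x‖, sq_nonneg ‖v x‖]

/-- The constant in the error estimate for the asymptotics of a solution. -/
def errorConst (c : ℝ) (u v : ℝ → ℂ) : ℝ := |c| * √((‖u 1‖ ^ 2 + ‖v 1‖ ^ 2) * rexp |c|)

/-- For `c = 0` and `ε = ±i` the expression is constant. The potential leaves the derivative
`e^{-εx} (c/x²) u`, which is `O(1/x²)` because `u` is bounded. -/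
theorem exists_amplitude (h : IsSol c 1 u v) (ε : ℂ) (hε : ε ^ 2 = -1) (hε' : ε.re = 0) :
    ∃ L : ℂ, ∀ x : ℝ, 1 ≤ x →
      ‖Complex.exp (-ε * x) * (v x + ε * u x) - L‖ ≤ errorConst c u v / x := by
  refine exists_limit_of_deriv_le
    (f' := fun x => Complex.exp (-ε * x) * ((c / x ^ 2 : ℝ) * u x)) ?_ ?_
  · intro x hx
    have hx0 : 0 < x := by linarith
    have he : HasDerivAt (fun x : ℝ => Complex.exp (-ε * x)) (Complex.exp (-ε * x) * (-ε)) x := by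
      have h0 : HasDerivAt (fun z : ℂ => Complex.exp (-ε * z))
          (Complex.exp (-ε * x) * (-ε * 1)) (x : ℂ) :=
        ((hasDerivAt_id (x : ℂ)).const_mul (-ε)).cexp
      simpa using h0.comp_ofReal
    refine (he.mul ((h.right x hx0).add ((h.left x hx0).const_mul ε))).congr_deriv ?_
    simp only [Pi.add_apply, Complex.real_smul]
    push_cast
    linear_combination (-Complex.exp (-ε * x) * u x) * hε
  · intro x hx
    have hx0 : 0 < x := by linarith
    rw [norm_mul, norm_mul, Complex.norm_exp, errorConst, Complex.norm_real, Real.norm_eq_abs,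
      abs_div, abs_of_nonneg (sq_nonneg x)]
    have : (-ε * x).re = 0 := by simp [hε']
    rw [this, Real.exp_zero, one_mul, mul_div_right_comm]
    have := h.norm_le hx
    gcongr

/-- Every solution at energy one is asymptotically a superposition of plane waves. -/
theorem asymptotics (h : IsSol c 1 u v) : ∃ a b : ℂ, ∀ x : ℝ, 1 ≤ x →
    ‖u x - (a * Complex.exp (Complex.I * x) + b * Complex.exp (-(Complex.I * x)))‖
      ≤ errorConst c u v / x ∧
    ‖v x - Complex.I * (a * Complex.exp (Complex.I * x) - b * Complex.exp (-(Complex.I * x)))‖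
      ≤ errorConst c u v / x := by
  obtain ⟨A, hA⟩ := h.exists_amplitude Complex.I (by simp) (by simp)
  obtain ⟨B, hB⟩ := h.exists_amplitude (-Complex.I) (by simp) (by simp)
  refine ⟨A / (2 * Complex.I), -B / (2 * Complex.I), fun x hx => ?_⟩
  have h1 := hA x hx
  have h2 := hB x hx
  rw [neg_neg] at h2
  rw [neg_mul] at h1
  set K := errorConst c u v / x
  set p := Complex.exp (Complex.I * x) with hp
  set q := Complex.exp (-(Complex.I * x)) with hq
  have hpq : p * q = 1 := by rw [hp, hq, ← Complex.exp_add]; simp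
  have np : ‖p‖ = 1 := by rw [hp, Complex.norm_exp]; simp
  have nq : ‖q‖ = 1 := by rw [hq, Complex.norm_exp]; simp
  have n1 : ‖p * (q * (v x + Complex.I * u x) - A)‖ ≤ K := by rw [norm_mul, np, one_mul]; exact h1
  have n2 : ‖q * (p * (v x + -Complex.I * u x) - B)‖ ≤ K := by
    rw [norm_mul, nq, one_mul]; exact h2
  have hI : Complex.I ≠ 0 := Complex.I_ne_zero
  constructor
  · have e : u x - (A / (2 * Complex.I) * p + -B / (2 * Complex.I) * q)
        = (p * (q * (v x + Complex.I * u x) - A) - q * (p * (v x + -Complex.I * u x) - B))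
          / (2 * Complex.I) := by
      field_simp
      linear_combination (-2 * Complex.I * u x) * hpq
    rw [e, norm_div]
    have : ‖2 * Complex.I‖ = 2 := by simp
    rw [this, div_le_iff₀ two_pos]
    exact (norm_sub_le _ _).trans (by linarith)
  · have e : v x - Complex.I * (A / (2 * Complex.I) * p - -B / (2 * Complex.I) * q)
        = (p * (q * (v x + Complex.I * u x) - A) + q * (p * (v x + -Complex.I * u x) - B)) / 2 := by
      field_simp
      linear_combination (-2 * v x) * hpq
    rw [e, norm_div, Complex.norm_two, div_le_iff₀ two_pos]
    exact (norm_add_le _ _).trans (by linarith)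

end IsSol

/-- Along multiples of `2π` the sum is `a + b`; along the same points shifted by `π/2` it is `i(a -
b)`. -/
theorem planeWaves_eq_zero {a b : ℂ} (h : Tendsto (fun x : ℝ =>
    a * Complex.exp (Complex.I * x) + b * Complex.exp (-(Complex.I * x))) atTop (𝓝 0)) :
    a = 0 ∧ b = 0 := by
  have ht : Tendsto (fun n : ℕ => (n : ℝ) * (2 * π)) atTop atTop :=
    tendsto_natCast_atTop_atTop.atTop_mul_const (by positivity)
  have e1 : ∀ n : ℕ, Complex.exp (Complex.I * ((n : ℝ) * (2 * π) : ℝ)) = 1 := fun n => by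
    have := Complex.exp_nat_mul_two_pi_mul_I n
    rw [← this]; congr 1; push_cast; ring
  have h1 := h.comp ht
  have h2 := h.comp (tendsto_atTop_add_const_right _ (π / 2) ht)
  have e2 : Complex.exp (Complex.I * (π / 2 : ℝ)) = Complex.I := by
    rw [mul_comm]; push_cast; exact Complex.exp_pi_div_two_mul_I
  have k1 : a + b = 0 := by
    refine tendsto_nhds_unique (tendsto_const_nhds.congr fun n => ?_) h1
    simp only [Function.comp_apply, Complex.exp_neg, e1]; simp
  have k2 : a * Complex.I - b * Complex.I = 0 := by
    refine tendsto_nhds_unique (tendsto_const_nhds.congr fun n => ?_) h2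
    simp only [Function.comp_apply, Complex.ofReal_add, mul_add, Complex.exp_neg,
      Complex.exp_add, e1, e2]
    simp [sub_eq_add_neg]
  have k3 : a - b = 0 := by
    have : (a - b) * Complex.I = 0 := by linear_combination k2
    exact (mul_eq_zero.1 this).resolve_right Complex.I_ne_zero
  constructor
  · linear_combination (k1 + k3) / 2
  · linear_combination (k1 - k3) / 2

end AnyonDelta

end
noncomputable section

namespace AnyonDelta

/-! ### Poisson's integral and the asymptotics of the Bessel functions -/

theorem continuous_one_sub_sq_rpow {μ : ℝ} (hμ : 0 < μ) :
    Continuous fun t : ℝ => (1 - t ^ 2) ^ μ :=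
  (continuous_const.sub (continuous_pow 2)).rpow_const fun _ => Or.inr hμ.le

/-- The substitution `t = 2s - 1` gives the Beta integral with both parameters `μ + 1`, and the
duplication formula removes `Γ(2μ + 2)`. -/
theorem integral_one_sub_sq_rpow {μ : ℝ} (hμ : 0 < μ) :
    ∫ t in (-1 : ℝ)..1, (1 - t ^ 2) ^ μ
      = √π * Real.Gamma (μ + 1) / Real.Gamma (μ + 3 / 2) := by
  have h1 : ∫ s in (0 : ℝ)..1, (s ^ μ * (1 - s) ^ μ)
      = Real.Gamma (μ + 1) * Real.Gamma (μ + 1) / Real.Gamma (μ + 1 + (μ + 1)) := by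
    have hb := Complex.betaIntegral_eq_Gamma_mul_div ((μ + 1 : ℝ) : ℂ) ((μ + 1 : ℝ) : ℂ)
      (by rw [Complex.ofReal_re]; linarith) (by rw [Complex.ofReal_re]; linarith)
    rw [← Complex.ofReal_add, Complex.Gamma_ofReal, Complex.Gamma_ofReal, Complex.betaIntegral] at hb
    have : ∫ x in (0 : ℝ)..1, (x : ℂ) ^ (((μ + 1 : ℝ) : ℂ) - 1) * (1 - (x : ℂ)) ^
        (((μ + 1 : ℝ) : ℂ) - 1) = ∫ x in (0 : ℝ)..1, ((x ^ μ * (1 - x) ^ μ : ℝ) : ℂ) := by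
      refine intervalIntegral.integral_congr fun x hx => ?_
      rw [uIcc_of_le zero_le_one] at hx
      rw [Complex.ofReal_mul, Complex.ofReal_cpow hx.1, Complex.ofReal_cpow (by linarith [hx.2])]
      push_cast
      simp
    rw [this, intervalIntegral.integral_ofReal] at hb
    exact_mod_cast hb
  have h2 : ∫ s in (0 : ℝ)..1, (1 - (2 * s - 1) ^ 2) ^ μ = 4 ^ μ *
      ∫ s in (0 : ℝ)..1, (s ^ μ * (1 - s) ^ μ) := by
    rw [← intervalIntegral.integral_const_mul]
    refine intervalIntegral.integral_congr fun s hs => ?_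
    rw [uIcc_of_le zero_le_one] at hs
    rw [← Real.mul_rpow hs.1 (by linarith [hs.2]), ← Real.mul_rpow (by norm_num)
      (mul_nonneg hs.1 (by linarith [hs.2]))]
    congr 1; ring
  have h3 := intervalIntegral.integral_comp_mul_sub (a := 0) (b := 1)
    (fun t : ℝ => (1 - t ^ 2) ^ μ) (two_ne_zero) 1
  norm_num at h3
  have h4 := Real.Gamma_mul_Gamma_add_half (μ + 1)
  have g1 : 0 < Real.Gamma (μ + 1) := Real.Gamma_pos_of_pos (by linarith)
  have g2 : 0 < Real.Gamma (μ + 3 / 2) := Real.Gamma_pos_of_pos (by linarith)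
  have g3 : 0 < Real.Gamma (2 * (μ + 1)) := Real.Gamma_pos_of_pos (by linarith)
  rw [show μ + 1 + 1 / 2 = μ + 3 / 2 by ring] at h4
  rw [h2, h1, show μ + 1 + (μ + 1) = 2 * (μ + 1) by ring] at h3
  have h5 : ∫ t in (-1 : ℝ)..1, (1 - t ^ 2) ^ μ = 2 * (4 ^ μ *
    (Real.Gamma (μ + 1) * Real.Gamma (μ + 1) / Real.Gamma (2 * (μ + 1)))) := by linarith
  have h6 : (4 : ℝ) ^ μ * 2 * 2 ^ (1 - 2 * (μ + 1)) = 1 := by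
    rw [show (4 : ℝ) = 2 ^ (2 : ℝ) by norm_num, ← Real.rpow_mul (by norm_num),
      ← Real.rpow_add_one (by norm_num), ← Real.rpow_add (by norm_num)]
    ring_nf; norm_num
  rw [h5]
  generalize Real.Gamma (μ + 3 / 2) = G2 at *
  field_simp
  linear_combination (2 * 4 ^ μ) * h4 + Real.Gamma (2 * (μ + 1)) * √π * h6

/-- The function `t^{2m+1} (1 - t²)^{μ+1}` vanishes at both ends; integrating its derivative links
consecutive even moments. -/
theorem integral_pow_mul_one_sub_sq_rpow {μ : ℝ} (hμ : 0 < μ) (m : ℕ) :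
    ∫ t in (-1 : ℝ)..1, t ^ (2 * m) * (1 - t ^ 2) ^ μ
      = √π * Real.Gamma (μ + 1) * (2 * m).factorial
        / (4 ^ m * m.factorial * Real.Gamma (m + μ + 3 / 2)) := by
  have hc := continuous_one_sub_sq_rpow hμ
  induction m with
  | zero => simpa using integral_one_sub_sq_rpow hμ
  | succ m ih =>
    have hi : ∀ n : ℕ, IntervalIntegrable (fun t : ℝ => t ^ n * (1 - t ^ 2) ^ μ) volume (-1) 1 :=
      fun n => ((continuous_pow n).mul hc).intervalIntegrable _ _
    have hd : ∀ t : ℝ, HasDerivAt (fun t : ℝ => t ^ (2 * m + 1) * (1 - t ^ 2) ^ (μ + 1))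
        (((2 * m + 1 : ℕ) : ℝ) * t ^ (2 * m) * (1 - t ^ 2) ^ (μ + 1)
          - 2 * (μ + 1) * (t ^ (2 * (m + 1)) * (1 - t ^ 2) ^ μ)) t := fun t => by
      have h1 : HasDerivAt (fun t : ℝ => 1 - t ^ 2) (-(2 * t)) t := by
        simpa using (hasDerivAt_pow 2 t).const_sub 1
      have h2 := h1.rpow_const (p := μ + 1) (Or.inr (by linarith))
      refine ((hasDerivAt_pow (2 * m + 1) t).mul h2).congr_deriv ?_
      rw [Nat.add_sub_cancel, add_sub_cancel_right]
      ring
    have hF := intervalIntegral.integral_eq_sub_of_hasDerivAt (a := -1) (b := 1)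
      (fun t _ => hd t) (by
        refine Continuous.intervalIntegrable ?_ _ _
        exact ((continuous_const.mul (continuous_pow _)).mul
          (continuous_one_sub_sq_rpow (by linarith))).sub
          (continuous_const.mul ((continuous_pow _).mul hc)))
    have hz : ∀ t : ℝ, t ^ 2 = 1 → (1 - t ^ 2) ^ (μ + 1) = 0 := fun t ht => by
      rw [ht, sub_self, Real.zero_rpow (by linarith)]
    rw [hz 1 (by norm_num), hz (-1) (by norm_num), mul_zero, mul_zero, sub_zero] at hF
    have he : ∫ t in (-1 : ℝ)..1, (((2 * m + 1 : ℕ) : ℝ) * t ^ (2 * m) * (1 - t ^ 2) ^ (μ + 1)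
          - 2 * (μ + 1) * (t ^ (2 * (m + 1)) * (1 - t ^ 2) ^ μ))
        = ∫ t in (-1 : ℝ)..1, ((2 * m + 1) * (t ^ (2 * m) * (1 - t ^ 2) ^ μ)
          - (2 * m + 2 * μ + 3) * (t ^ (2 * (m + 1)) * (1 - t ^ 2) ^ μ)) := by
      refine intervalIntegral.integral_congr fun t ht => ?_
      rw [uIcc_of_le (by norm_num)] at ht
      have : 0 ≤ 1 - t ^ 2 := by nlinarith [ht.1, ht.2]
      rw [Real.rpow_add_one' this (by linarith)]
      push_cast
      ring
    rw [he, intervalIntegral.integral_sub ((hi _).const_mul _) ((hi _).const_mul _),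
      intervalIntegral.integral_const_mul, intervalIntegral.integral_const_mul, ih] at hF
    have hp : (0 : ℝ) ≤ m := by positivity
    have g2 : 0 < Real.Gamma (m + μ + 3 / 2) := Real.Gamma_pos_of_pos (by linarith)
    have hne : 2 * (m : ℝ) + 2 * μ + 3 ≠ 0 := by positivity
    have hne' : (m : ℝ) + μ + 3 / 2 ≠ 0 := by positivity
    rw [show 2 * (m + 1) = 2 * m + 1 + 1 by ring] at hF ⊢
    rw [Nat.factorial_succ, Nat.factorial_succ, Nat.factorial_succ m,
      show ((m + 1 : ℕ) : ℝ) + μ + 3 / 2 = (m + μ + 3 / 2) + 1 by push_cast; ring,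
      Real.Gamma_add_one hne']
    have hF' : ∫ t in (-1 : ℝ)..1, t ^ (2 * m + 1 + 1) * (1 - t ^ 2) ^ μ = (2 * m + 1) *
        (√π * Real.Gamma (μ + 1) * (2 * m).factorial
          / (4 ^ m * m.factorial * Real.Gamma (m + μ + 3 / 2))) / (2 * m + 2 * μ + 3) := by
      field_simp at hF ⊢
      linarith
    rw [hF']
    push_cast
    field_simp
    ring

/-- The cosine is expanded and integrated term by term; the factor `(2m)!` of the moment cancels
that of the cosine series. The restriction `ν > 1/2` makes the weight continuous and bounded by one.
-/
theorem poisson_integral {ν : ℝ} (hν : 1 / 2 < ν) (x : ℝ) :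
    ∫ t in (-1 : ℝ)..1, Real.cos (x * t) * (1 - t ^ 2) ^ (ν - 1 / 2)
      = √π * Real.Gamma (ν + 1 / 2) * bj ν (x ^ 2 / 4) := by
  have hμ : 0 < ν - 1 / 2 := by linarith
  have hc := continuous_one_sub_sq_rpow hμ
  have hs : HasSum (fun m : ℕ => ∫ t in (-1 : ℝ)..1,
      ((-1) ^ m * (x * t) ^ (2 * m) / (2 * m).factorial) * (1 - t ^ 2) ^ (ν - 1 / 2))
      (∫ t in (-1 : ℝ)..1, Real.cos (x * t) * (1 - t ^ 2) ^ (ν - 1 / 2)) := by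
    have hsum : Summable fun m : ℕ => |x| ^ (2 * m) / (2 * m).factorial :=
      (Real.summable_pow_div_factorial |x|).comp_injective
        (i := fun m : ℕ => 2 * m) (mul_right_injective₀ two_ne_zero)
    refine intervalIntegral.hasSum_integral_of_dominated_convergence
      (fun m _ => |x| ^ (2 * m) / (2 * m).factorial) (fun m => ?_) (fun m => ?_) ?_ ?_ ?_
    · refine Continuous.aestronglyMeasurable ?_
      fun_prop
    · refine Eventually.of_forall fun t ht => ?_
      rw [uIoc_of_le (by norm_num)] at ht
      have h1 : 0 ≤ 1 - t ^ 2 := by nlinarith [ht.1, ht.2]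
      have h2 : (1 - t ^ 2) ^ (ν - 1 / 2) ≤ 1 :=
        Real.rpow_le_one h1 (by nlinarith [sq_nonneg t]) hμ.le
      have h3 : |t| ≤ 1 := abs_le.2 ⟨ht.1.le, ht.2⟩
      rw [norm_mul, Real.norm_eq_abs, Real.norm_eq_abs, abs_of_nonneg (Real.rpow_nonneg h1 _),
        abs_div, abs_mul, abs_pow, abs_neg, abs_one, one_pow, one_mul, abs_pow, abs_mul, mul_pow,
        abs_of_nonneg (by positivity : (0 : ℝ) ≤ ((2 * m).factorial : ℝ))]
      have h4 : |t| ^ (2 * m) ≤ 1 := pow_le_one₀ (abs_nonneg t) h3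
      have h5 : |x| ^ (2 * m) * |t| ^ (2 * m) ≤ |x| ^ (2 * m) :=
        mul_le_of_le_one_right (by positivity) h4
      calc _ ≤ |x| ^ (2 * m) * |t| ^ (2 * m) / ((2 * m).factorial : ℝ) :=
            mul_le_of_le_one_right (by positivity) h2
        _ ≤ _ := by gcongr
    · exact Eventually.of_forall fun t _ => hsum
    · exact intervalIntegrable_const
    · exact Eventually.of_forall fun t _ => (Real.hasSum_cos (x * t)).mul_right _
  refine hs.unique ?_
  refine hasSum_of_eq (((rapid_bjCoeff (by linarith : -1 < ν)).hasSum (x ^ 2 / 4)).mul_left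
    (√π * Real.Gamma (ν + 1 / 2))) fun m => ?_
  have e : ∀ t : ℝ, ((-1) ^ m * (x * t) ^ (2 * m) / (2 * m).factorial) * (1 - t ^ 2) ^ (ν - 1 / 2)
      = ((-1) ^ m * x ^ (2 * m) / (2 * m).factorial) * (t ^ (2 * m) * (1 - t ^ 2) ^ (ν - 1 / 2)) :=
    fun t => by rw [mul_pow]; ring
  simp only [e]
  rw [intervalIntegral.integral_const_mul, integral_pow_mul_one_sub_sq_rpow hμ, bjCoeff,
    show ν - 1 / 2 + 1 = ν + 1 / 2 by ring, show (m : ℝ) + (ν - 1 / 2) + 3 / 2 = m + ν + 1 by ring,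
    div_pow, ← pow_mul]
  have g2 : Real.Gamma (m + ν + 1) ≠ 0 := (Real.Gamma_pos_of_pos (by
    have : (0 : ℝ) ≤ m := by positivity
    linarith)).ne'
  have : ((2 * m).factorial : ℝ) ≠ 0 := by positivity
  field_simp

theorem cpow_pos_mul {c : ℝ} (hc : 0 < c) {w : ℂ} (hw : w ≠ 0) (μ : ℝ) :
    ((c : ℂ) * w) ^ (μ : ℂ) = ((c ^ μ : ℝ) : ℂ) * w ^ (μ : ℂ) := by
  have hc' : (c : ℂ) ≠ 0 := by exact_mod_cast hc.ne'
  rw [Complex.cpow_def_of_ne_zero (mul_ne_zero hc' hw), Complex.log_ofReal_mul hc hw,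
    Complex.cpow_def_of_ne_zero hw, Real.rpow_def_of_pos hc, Complex.ofReal_exp, ← Complex.exp_add]
  congr 1; push_cast; ring

/-- Watson's lemma at the branch point `y = 0`: after `y = u/x` the integrand is `e^{-u} u^μ (u/x +
w)^μ`, which tends to `e^{-u} u^μ w^μ`, and the Gamma integral results. Since `w` is not real, `u/x
+ w` stays off the cut. -/
theorem tendsto_laplace_side {μ : ℝ} (hμ : 0 < μ) {w : ℂ} (hw : w.im ≠ 0) :
    Tendsto (fun x : ℝ => ((x ^ (μ + 1) : ℝ) : ℂ) *
      ∫ y in (0 : ℝ)..1, (rexp (-(x * y)) : ℂ) * ((y : ℂ) * (y + w)) ^ (μ : ℂ))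
      atTop (𝓝 (w ^ (μ : ℂ) * (Real.Gamma (μ + 1) : ℂ))) := by
  have hsp : ∀ a : ℝ, (a : ℂ) + w ∈ Complex.slitPlane := fun a => by
    rw [Complex.mem_slitPlane_iff]; right; simpa using hw
  set F : ℝ → ℝ → ℂ := fun x => indicator (Ioc 0 x) fun u =>
    ((rexp (-u) * u ^ μ : ℝ) : ℂ) * (((u / x : ℝ) : ℂ) + w) ^ (μ : ℂ) with hF
  have h1 : ∀ x : ℝ, 0 < x → ((x ^ (μ + 1) : ℝ) : ℂ) *
      ∫ y in (0 : ℝ)..1, (rexp (-(x * y)) : ℂ) * ((y : ℂ) * (y + w)) ^ (μ : ℂ)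
      = ∫ u in Ioi (0 : ℝ), F x u := by
    intro x hx
    rw [hF, setIntegral_indicator measurableSet_Ioc, show Ioi (0 : ℝ) ∩ Ioc 0 x = Ioc 0 x from
      inter_eq_right.2 fun y hy => hy.1, ← intervalIntegral.integral_of_le hx.le]
    have hsub := intervalIntegral.smul_integral_comp_mul_left (a := 0) (b := 1)
      (fun u : ℝ => ((rexp (-u) * u ^ μ : ℝ) : ℂ) * (((u / x : ℝ) : ℂ) + w) ^ (μ : ℂ)) x
    rw [mul_zero, mul_one] at hsub
    rw [← hsub, Complex.real_smul, ← intervalIntegral.integral_const_mul,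
      ← intervalIntegral.integral_const_mul]
    refine intervalIntegral.integral_congr_ae (Eventually.of_forall fun y hy => ?_)
    rw [uIoc_of_le zero_le_one] at hy
    rw [cpow_pos_mul hy.1 (Complex.slitPlane_ne_zero (hsp y)), mul_div_cancel_left₀ _ hx.ne',
      Real.mul_rpow hx.le hy.1.le, Real.rpow_add_one hx.ne']
    push_cast
    ring
  have h2 : Tendsto (fun x => ∫ u in Ioi (0 : ℝ), F x u) atTop
      (𝓝 (∫ u in Ioi (0 : ℝ), ((rexp (-u) * u ^ μ : ℝ) : ℂ) * w ^ (μ : ℂ))) := by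
    refine tendsto_integral_filter_of_dominated_convergence
      (fun u => rexp (-u) * u ^ μ * (2 * ‖w‖) ^ μ  + rexp (-u) * u ^ (μ + μ) * (2 : ℝ) ^ μ)
      ?_ ?_ ?_ ?_
    · filter_upwards [eventually_gt_atTop 0] with x hx
      refine AEStronglyMeasurable.indicator ?_ measurableSet_Ioc
      refine ContinuousOn.aestronglyMeasurable (fun u hu => ?_) measurableSet_Ioi
      refine ContinuousAt.continuousWithinAt ?_
      refine ContinuousAt.mul ?_ ?_
      · refine Complex.continuous_ofReal.continuousAt.comp ?_
        exact (Real.continuous_exp.comp continuous_neg).continuousAt.mul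
          (Real.continuousAt_rpow_const _ _ (Or.inr hμ.le))
      · exact ContinuousAt.comp (f := fun u : ℝ => ((u / x : ℝ) : ℂ) + w)
          (continuousAt_cpow_const (hsp _)) (by fun_prop)
    · filter_upwards [eventually_ge_atTop 1] with x hx
      refine (ae_restrict_iff' measurableSet_Ioi).2 (Eventually.of_forall fun u hu => ?_)
      have hu0 : 0 < u := hu
      have hb0 : 0 ≤ rexp (-u) * u ^ μ * (2 * ‖w‖) ^ μ + rexp (-u) * u ^ (μ + μ) * (2 : ℝ) ^ μ := by
        positivity
      refine (norm_indicator_le_norm_self _ _).trans ?_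
      rw [norm_mul, Complex.norm_real, Real.norm_eq_abs, abs_of_nonneg (by positivity),
        Complex.norm_cpow_of_ne_zero (Complex.slitPlane_ne_zero (hsp _)), Complex.ofReal_re,
        Complex.ofReal_im, mul_zero, Real.exp_zero, div_one]
      have n1 : ‖((u / x : ℝ) : ℂ) + w‖ ≤ u + ‖w‖ := by
        refine (norm_add_le _ _).trans ?_
        rw [Complex.norm_real, Real.norm_eq_abs, abs_of_nonneg (by positivity)]
        have : u / x ≤ u := div_le_self hu0.le hx
        linarith
      -- Comparing `u` with `‖w‖` bounds `(u + ‖w‖)^μ` by the sum of two terms, each integrable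
      -- against `e^{-u} u^μ` and independent of `x`.
      have n2 : ‖((u / x : ℝ) : ℂ) + w‖ ^ μ ≤ (2 * ‖w‖) ^ μ + u ^ μ * 2 ^ μ := by
        have k1 : (0 : ℝ) ≤ (2 * ‖w‖) ^ μ := by positivity
        have k2 : 0 ≤ u ^ μ * 2 ^ μ := by positivity
        rcases le_total u ‖w‖ with h | h
        · have : ‖((u / x : ℝ) : ℂ) + w‖ ^ μ ≤ (2 * ‖w‖) ^ μ := by gcongr; linarith
          linarith
        · have : ‖((u / x : ℝ) : ℂ) + w‖ ^ μ ≤ (u * 2) ^ μ := by gcongr; linarith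
          rw [Real.mul_rpow hu0.le (by norm_num)] at this
          linarith
      calc _ ≤ rexp (-u) * u ^ μ * ((2 * ‖w‖) ^ μ + u ^ μ * 2 ^ μ) := by gcongr
        _ = _ := by rw [Real.rpow_add hu0]; ring
    · have i1 := (Real.GammaIntegral_convergent (s := μ + 1) (by linarith)).mul_const
        ((2 * ‖w‖) ^ μ)
      have i2 := (Real.GammaIntegral_convergent (s := μ + μ + 1) (by linarith)).mul_const
        ((2 : ℝ) ^ μ)
      simp only [add_sub_cancel_right] at i1 i2
      exact i1.add i2
    · refine (ae_restrict_iff' measurableSet_Ioi).2 (Eventually.of_forall fun u hu => ?_)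
      have hu0 : 0 < u := hu
      have h0 : Tendsto (fun x : ℝ => ((rexp (-u) * u ^ μ : ℝ) : ℂ) *
          (((u / x : ℝ) : ℂ) + w) ^ (μ : ℂ)) atTop
          (𝓝 (((rexp (-u) * u ^ μ : ℝ) : ℂ) * w ^ (μ : ℂ))) := by
        refine Tendsto.const_mul _ ?_
        have t1 : Tendsto (fun x : ℝ => ((u / x : ℝ) : ℂ) + w) atTop (𝓝 w) := by
          have := (Complex.continuous_ofReal.tendsto 0).comp
            (tendsto_const_nhds.div_atTop tendsto_id : Tendsto (fun x : ℝ => u / x) atTop (𝓝 0))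
          simpa using this.add_const w
        have t2 : w ∈ Complex.slitPlane := by simpa using hsp 0
        exact (continuousAt_cpow_const t2).tendsto.comp t1
      refine h0.congr' ?_
      filter_upwards [eventually_ge_atTop u] with x hx
      rw [hF]
      simp only
      rw [indicator_of_mem (show u ∈ Ioc 0 x from ⟨hu0, hx⟩)]
  have h3 : ∫ u in Ioi (0 : ℝ), ((rexp (-u) * u ^ μ : ℝ) : ℂ) * w ^ (μ : ℂ)
      = w ^ (μ : ℂ) * (Real.Gamma (μ + 1) : ℂ) := by
    rw [integral_mul_const, integral_complex_ofReal, Real.Gamma_eq_integral (by linarith),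
      add_sub_cancel_right, mul_comm]
  rw [h3] at h2
  refine h2.congr' ?_
  filter_upwards [eventually_gt_atTop 0] with x hx using (h1 x hx).symm

end AnyonDelta

end
-- Contour shift in Poisson's integral
noncomputable section

namespace AnyonDelta

/-- Cauchy's theorem on the rectangle over `[-1, 1]` of height one. There `Re (1 - z²) = 1 - (Re z)²
+ (Im z)²` is nonnegative, and positive inside, so the principal power is holomorphic inside and
continuous up to the corners `±1`. On the vertical sides `1 - z² = y (y ∓ 2i)` and the exponential
is `e^{±ix} e^{-xy}`, so the sides are Laplace integrals carrying plane waves. -/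
theorem contour_shift {μ : ℝ} (hμ : 0 < μ) (x : ℝ) :
    ∫ t in (-1 : ℝ)..1, Complex.exp (Complex.I * x * t) * (1 - (t : ℂ) ^ 2) ^ (μ : ℂ)
      = (∫ t in (-1 : ℝ)..1, Complex.exp (Complex.I * x * (t + Complex.I)) *
          (1 - (t + Complex.I) ^ 2) ^ (μ : ℂ))
        - Complex.I * (Complex.exp (Complex.I * x) * ∫ y in (0 : ℝ)..1, (rexp (-(x * y)) : ℂ) *
          ((y : ℂ) * (y + -(2 * Complex.I))) ^ (μ : ℂ))
        + Complex.I * (Complex.exp (-(Complex.I * x)) * ∫ y in (0 : ℝ)..1, (rexp (-(x * y)) : ℂ) *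
          ((y : ℂ) * (y + 2 * Complex.I)) ^ (μ : ℂ)) := by
  have hre : ∀ z : ℂ, (1 - z ^ 2).re = 1 - z.re ^ 2 + z.im ^ 2 := fun z => by
    simp [pow_two]; ring
  have key := Complex.integral_boundary_rect_eq_zero_of_continuousOn_of_differentiableOn
    (fun z : ℂ => Complex.exp (Complex.I * x * z) * (1 - z ^ 2) ^ (μ : ℂ)) (-1) (1 + Complex.I)
    (by
      intro z hz
      have h1 := hz.1
      simp only [mem_preimage, Complex.neg_re, Complex.one_re, Complex.add_re, Complex.I_re,
        add_zero] at h1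
      rw [uIcc_of_le (by norm_num)] at h1
      refine ContinuousAt.continuousWithinAt (ContinuousAt.mul (by fun_prop) ?_)
      refine ContinuousAt.comp (f := fun z : ℂ => 1 - z ^ 2)
        (Complex.continuousAt_cpow_const_of_re_pos (Or.inl ?_) (by simpa using hμ)) (by fun_prop)
      rw [hre]
      nlinarith [h1.1, h1.2, sq_nonneg z.im])
    (by
      intro z hz
      have h1 := hz.1
      simp only [mem_preimage, Complex.neg_re, Complex.one_re, Complex.add_re, Complex.I_re,
        add_zero] at h1
      rw [min_eq_left (by norm_num), max_eq_right (by norm_num)] at h1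
      have hsp : 1 - z ^ 2 ∈ Complex.slitPlane := by
        left
        rw [hre]
        nlinarith [h1.1, h1.2, sq_nonneg z.im]
      refine DifferentiableAt.differentiableWithinAt (DifferentiableAt.mul (by fun_prop) ?_)
      exact DifferentiableAt.cpow_const (by fun_prop) hsp)
  simp only [Complex.neg_re, Complex.one_re, Complex.add_re, Complex.I_re, Complex.neg_im,
    Complex.one_im, Complex.add_im, Complex.I_im, add_zero, zero_add, neg_zero, Complex.ofReal_zero,
    zero_mul, Complex.ofReal_one, one_mul, smul_eq_mul] at key
  have r1 : ∫ y in (0 : ℝ)..1, Complex.exp (Complex.I * x * (1 + y * Complex.I)) *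
      (1 - (1 + y * Complex.I) ^ 2) ^ (μ : ℂ) = Complex.exp (Complex.I * x) *
      ∫ y in (0 : ℝ)..1, (rexp (-(x * y)) : ℂ) *
          ((y : ℂ) * (y + -(2 * Complex.I))) ^ (μ : ℂ) := by
    rw [← intervalIntegral.integral_const_mul]
    refine intervalIntegral.integral_congr fun y _ => ?_
    rw [← mul_assoc, Complex.ofReal_exp, ← Complex.exp_add]
    congr 2
    · push_cast
      linear_combination (x * y) * Complex.I_sq
    · linear_combination (-(y : ℂ) ^ 2) * Complex.I_sq
  have r2 : ∫ y in (0 : ℝ)..1, Complex.exp (Complex.I * x * (((-1 : ℝ) : ℂ) + y * Complex.I)) *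
      (1 - (((-1 : ℝ) : ℂ) + y * Complex.I) ^ 2) ^ (μ : ℂ) = Complex.exp (-(Complex.I * x)) *
      ∫ y in (0 : ℝ)..1, (rexp (-(x * y)) : ℂ) *
          ((y : ℂ) * (y + 2 * Complex.I)) ^ (μ : ℂ) := by
    rw [← intervalIntegral.integral_const_mul]
    refine intervalIntegral.integral_congr fun y _ => ?_
    rw [← mul_assoc, Complex.ofReal_exp, ← Complex.exp_add]
    congr 2
    · push_cast
      linear_combination (x * y) * Complex.I_sq
    · push_cast
      linear_combination (-(y : ℂ) ^ 2) * Complex.I_sq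
  rw [r1, r2] at key
  linear_combination key

/-- On the line `Im z = 1` the exponential has modulus `e^{-x}`, which beats the power. -/
theorem tendsto_rpow_mul_top {μ : ℝ} :
    Tendsto (fun x : ℝ => ((x ^ (μ + 1) : ℝ) : ℂ) *
      ∫ t in (-1 : ℝ)..1, Complex.exp (Complex.I * x * (t + Complex.I)) *
          (1 - (t + Complex.I) ^ 2) ^ (μ : ℂ)) atTop (𝓝 0) := by
  have hre : ∀ t : ℝ, (1 - (t + Complex.I) ^ 2 : ℂ).re = 2 - t ^ 2 := fun t => by
    simp [pow_two]; ring
  have hcont : ContinuousOn (fun t : ℝ => (1 - (t + Complex.I) ^ 2 : ℂ) ^ (μ : ℂ)) (Icc (-1) 1) := by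
    intro t ht
    refine ContinuousAt.continuousWithinAt (ContinuousAt.comp
      (f := fun t : ℝ => (1 - (t + Complex.I) ^ 2 : ℂ)) (continuousAt_cpow_const ?_) (by fun_prop))
    left
    rw [hre]
    nlinarith [ht.1, ht.2]
  obtain ⟨C, hC⟩ := isCompact_Icc.exists_bound_of_continuousOn hcont
  rw [tendsto_zero_iff_norm_tendsto_zero]
  have h0 : Tendsto (fun x : ℝ => C * 2 * (x ^ (μ + 1) * rexp (-1 * x))) atTop (𝓝 0) := by
    simpa using (tendsto_rpow_mul_exp_neg_mul_atTop_nhds_zero (μ + 1) 1 one_pos).const_mul (C * 2)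
  refine squeeze_zero' (Eventually.of_forall fun x => norm_nonneg _) ?_ h0
  filter_upwards [eventually_gt_atTop 0] with x hx
  have h1 : ‖∫ t in (-1 : ℝ)..1, Complex.exp (Complex.I * x * (t + Complex.I)) *
          (1 - (t + Complex.I) ^ 2) ^ (μ : ℂ)‖ ≤ rexp (-1 * x) * C * |1 - (-1)| := by
    refine intervalIntegral.norm_integral_le_of_norm_le_const fun t ht => ?_
    rw [uIoc_of_le (by norm_num)] at ht
    rw [norm_mul, Complex.norm_exp]
    have e : (Complex.I * x * (t + Complex.I)).re = -1 * x := by simp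
    rw [e]
    have := hC t ⟨ht.1.le, ht.2⟩
    gcongr
  rw [norm_mul, Complex.norm_real, Real.norm_eq_abs, abs_of_nonneg (by positivity)]
  have h2 : |(1 : ℝ) - (-1)| = 2 := by norm_num
  rw [h2] at h1
  calc _ ≤ x ^ (μ + 1) * (rexp (-1 * x) * C * 2) := by gcongr
    _ = _ := by ring

/-- The function `√(πx/2) J_ν(x)`. -/
def pJ (ν x : ℝ) : ℝ := √(π / 2) * 2 ^ (-ν) * powSol ν 1 x

/-- The derivative of `pJ`. -/
def pJDeriv (ν x : ℝ) : ℝ := √(π / 2) * 2 ^ (-ν) * powSolDeriv ν 1 x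

theorem isSol_pJ {ν : ℝ} (hν : -1 < ν) : IsSol (ν ^ 2 - 1 / 4) 1 (pJ ν) (pJDeriv ν) :=
  (isSol_powSol hν 1).const_mul _

theorem pJ_eq {ν x : ℝ} (hx : 0 < x) : pJ ν x = √(π * x / 2) * besselJ ν x := by
  rw [besselJ_eq hx, pJ, powSol, Real.div_rpow hx.le two_pos.le, Real.rpow_add hx,
    show π * x / 2 = π / 2 * x by ring, Real.sqrt_mul (by positivity), Real.sqrt_eq_rpow x,
    Real.rpow_neg two_pos.le, one_mul]
  ring

theorem pJ_eq_integral {ν x : ℝ} (hν : 1 / 2 < ν) (hx : 0 < x) :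
    pJ ν x = 2 ^ (-ν - 1 / 2) / Real.Gamma (ν + 1 / 2) * (((x ^ (ν - 1 / 2 + 1) : ℝ) : ℂ) *
      ∫ t in (-1 : ℝ)..1, Complex.exp (Complex.I * x * t) *
        (1 - (t : ℂ) ^ 2) ^ ((ν - 1 / 2 : ℝ) : ℂ)).re := by
  have hc := continuous_one_sub_sq_rpow (by linarith : 0 < ν - 1 / 2)
  have e : ∫ t in (-1 : ℝ)..1, Complex.exp (Complex.I * x * t) *
        (1 - (t : ℂ) ^ 2) ^ ((ν - 1 / 2 : ℝ) : ℂ) = ∫ t in (-1 : ℝ)..1,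
        Complex.exp (Complex.I * x * t) * (((1 - t ^ 2) ^ (ν - 1 / 2) : ℝ) : ℂ) := by
    refine intervalIntegral.integral_congr fun t ht => ?_
    rw [uIcc_of_le (by norm_num)] at ht
    rw [Complex.ofReal_cpow (by nlinarith [ht.1, ht.2])]
    push_cast
    rfl
  have e2 : (∫ t in (-1 : ℝ)..1,
        Complex.exp (Complex.I * x * t) * (((1 - t ^ 2) ^ (ν - 1 / 2) : ℝ) : ℂ)).re =
      ∫ t in (-1 : ℝ)..1, Real.cos (x * t) * (1 - t ^ 2) ^ (ν - 1 / 2) := by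
    have hi : IntervalIntegrable (fun t : ℝ =>
        Complex.exp (Complex.I * x * t) * (((1 - t ^ 2) ^ (ν - 1 / 2) : ℝ) : ℂ)) volume (-1) 1 := by
      refine Continuous.intervalIntegrable ?_ _ _
      exact (by fun_prop : Continuous fun t : ℝ => Complex.exp (Complex.I * x * t)).mul
        (Complex.continuous_ofReal.comp hc)
    have := Complex.reCLM.intervalIntegral_comp_comm hi
    rw [← Complex.reCLM_apply, ← this]
    refine intervalIntegral.integral_congr fun t _ => ?_
    rw [Complex.reCLM_apply, Complex.re_mul_ofReal,
      show Complex.I * x * t = ((x * t : ℝ) : ℂ) * Complex.I by push_cast; ring,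
      Complex.exp_ofReal_mul_I_re]
  rw [Complex.re_ofReal_mul, e, e2, poisson_integral hν, pJ, powSol, one_mul,
    show ν - 1 / 2 + 1 = 1 / 2 + ν by ring, Real.sqrt_div pi_pos.le,
    show -ν - 1 / 2 = -ν + -(1 / 2) by ring, Real.rpow_add two_pos, Real.rpow_neg two_pos.le (1 / 2),
    ← Real.sqrt_eq_rpow]
  have : Real.Gamma (ν + 1 / 2) ≠ 0 := (Real.Gamma_pos_of_pos (by linarith)).ne'
  field_simp

theorem two_I_cpow (μ : ℝ) :
    (2 * Complex.I) ^ (μ : ℂ) = ((2 ^ μ : ℝ) : ℂ) * Complex.exp (Complex.I * (π / 2 * μ : ℝ)) ∧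
    (-(2 * Complex.I)) ^ (μ : ℂ)
      = ((2 ^ μ : ℝ) : ℂ) * Complex.exp (-(Complex.I * (π / 2 * μ : ℝ))) := by
  constructor
  · have := cpow_pos_mul two_pos Complex.I_ne_zero μ
    rw [Complex.ofReal_ofNat] at this
    rw [this, Complex.cpow_def_of_ne_zero Complex.I_ne_zero, Complex.log_I]
    congr 2; push_cast; ring
  · have := cpow_pos_mul two_pos (neg_ne_zero.2 Complex.I_ne_zero) μ
    rw [Complex.ofReal_ofNat, mul_neg] at this
    rw [this, Complex.cpow_def_of_ne_zero (neg_ne_zero.2 Complex.I_ne_zero), Complex.log_neg_I]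
    congr 2; push_cast; ring

/-- Only the two vertical sides survive. The factors `(±2i)^μ` supply opposite phases `±πμ/2`, and
the plane waves combine to `sin(x - πμ/2)`, the required cosine because `μ = ν - 1/2`. -/
theorem tendsto_pJ_of_half_lt {ν : ℝ} (hν : 1 / 2 < ν) :
    Tendsto (fun x => pJ ν x - Real.cos (x - ν * π / 2 - π / 4)) atTop (𝓝 0) := by
  set μ := ν - 1 / 2 with hμd
  have hμ : 0 < μ := by linarith
  set G : ℝ := Real.Gamma (μ + 1)
  have hG : G ≠ 0 := (Real.Gamma_pos_of_pos (by linarith)).ne'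
  have t1 := tendsto_rpow_mul_top (μ := μ)
  have t2 := tendsto_laplace_side hμ (w := 2 * Complex.I) (by simp)
  have t3 := tendsto_laplace_side hμ (w := -(2 * Complex.I)) (by simp)
  rw [(two_I_cpow μ).1] at t2
  rw [(two_I_cpow μ).2] at t3
  rw [← tendsto_sub_nhds_zero_iff] at t2 t3
  have bdd : ∀ ε : ℝ, IsBoundedUnder (· ≤ ·) atTop
      (fun x : ℝ => ‖Complex.I * Complex.exp (ε * (Complex.I * x))‖) := fun ε => by
    refine ⟨1, Filter.eventually_map.2 (Eventually.of_forall fun x => ?_)⟩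
    rw [norm_mul, Complex.norm_I, Complex.norm_exp]; simp
  have s2 := (t2.zero_mul_isBoundedUnder_le (bdd (-1)))
  have s3 := (t3.zero_mul_isBoundedUnder_le (bdd 1))
  have s := (t1.sub s3).add s2
  have s' := ((Complex.continuous_re.tendsto 0).comp (by simpa only [sub_zero, add_zero] using s)).const_mul
    (2 ^ (-ν - 1 / 2) / G)
  rw [Complex.zero_re, mul_zero] at s'
  refine s'.congr' ?_
  filter_upwards [eventually_gt_atTop 0] with x hx
  rw [pJ_eq_integral hν hx, show ν + 1 / 2 = μ + 1 by rw [hμd]; ring, ← hμd, contour_shift hμ x]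
  have hcos : Real.cos (x - ν * π / 2 - π / 4) = 2 ^ (-ν - 1 / 2) / G *
      (Complex.I * (Complex.exp (-(Complex.I * x)) * (((2 ^ μ : ℝ) : ℂ) *
        Complex.exp (Complex.I * (π / 2 * μ : ℝ)) * G)) -
       Complex.I * (Complex.exp (Complex.I * x) * (((2 ^ μ : ℝ) : ℂ) *
        Complex.exp (-(Complex.I * (π / 2 * μ : ℝ))) * G))).re := by
    have e1 : Complex.I * (Complex.exp (-(Complex.I * x)) * (((2 ^ μ : ℝ) : ℂ) *
        Complex.exp (Complex.I * (π / 2 * μ : ℝ)) * G)) -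
       Complex.I * (Complex.exp (Complex.I * x) * (((2 ^ μ : ℝ) : ℂ) *
        Complex.exp (-(Complex.I * (π / 2 * μ : ℝ))) * G)) =
        ((2 ^ μ * G * (2 * Real.sin (x - π / 2 * μ)) : ℝ) : ℂ) := by
      have a1 : Complex.exp (-(Complex.I * x)) * Complex.exp (Complex.I * (π / 2 * μ : ℝ))
          = Complex.exp (((-(x - π / 2 * μ) : ℝ) : ℂ) * Complex.I) := by
        rw [← Complex.exp_add]; congr 1; push_cast; ring
      have a2 : Complex.exp (Complex.I * x) * Complex.exp (-(Complex.I * (π / 2 * μ : ℝ)))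
          = Complex.exp (((x - π / 2 * μ : ℝ) : ℂ) * Complex.I) := by
        rw [← Complex.exp_add]; congr 1; push_cast; ring
      rw [Complex.exp_mul_I, ← Complex.ofReal_cos, ← Complex.ofReal_sin] at a1 a2
      rw [Real.cos_neg, Real.sin_neg] at a1
      generalize (2 : ℝ) ^ μ = p
      push_cast at a1 a2 ⊢
      linear_combination Complex.I * (p * G) * (a1 - a2)
        - 2 * p * G * Complex.sin (x - π / 2 * μ) * Complex.I_sq
    rw [e1, Complex.ofReal_re]
    have a3 : Real.sin (x - π / 2 * μ) = Real.cos (x - ν * π / 2 - π / 4) := by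
      rw [← Real.cos_pi_div_two_sub, ← Real.cos_neg]
      congr 1; rw [hμd]; ring
    have a4 : (2 : ℝ) ^ (-ν - 1 / 2) * (2 ^ μ * 2) = 1 := by
      rw [← Real.rpow_add_one two_ne_zero, ← Real.rpow_add two_pos, hμd]
      ring_nf; simp
    rw [a3]
    generalize Real.cos (x - ν * π / 2 - π / 4) = q
    generalize (2 : ℝ) ^ (-ν - 1 / 2) = p at *
    field_simp
    linear_combination -q * a4
  rw [hcos, ← mul_sub, ← Complex.sub_re]
  refine congrArg (fun z : ℂ => 2 ^ (-ν - 1 / 2) / G * z.re) ?_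
  beta_reduce
  rw [Complex.ofReal_neg, Complex.ofReal_one, neg_one_mul, one_mul]
  ring

end AnyonDelta

end
noncomputable section

namespace AnyonDelta

/-! ### Identification of plane wave amplitudes -/

theorem tendsto_zero_of_norm_le_div {f : ℝ → ℂ} {K : ℝ} (h : ∀ x : ℝ, 1 ≤ x → ‖f x‖ ≤ K / x) :
    Tendsto f atTop (𝓝 0) := by
  rw [tendsto_zero_iff_norm_tendsto_zero]
  refine squeeze_zero' (Eventually.of_forall fun x => norm_nonneg _) ?_
    (tendsto_const_nhds.div_atTop tendsto_id : Tendsto (fun x : ℝ => K / x) atTop (𝓝 0))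
  filter_upwards [eventually_ge_atTop 1] with x hx using h x hx

/-- Plane wave amplitudes are unique, so an `o(1)` expansion of `u` alone improves to the rate `1/x`
and extends to the derivative. -/
theorem IsSol.asymptotics_of_tendsto {c : ℝ} {u v : ℝ → ℂ} (h : IsSol c 1 u v) {a b : ℂ}
    (ht : Tendsto (fun x : ℝ => u x -
      (a * Complex.exp (Complex.I * x) + b * Complex.exp (-(Complex.I * x)))) atTop (𝓝 0)) :
    ∀ x : ℝ, 1 ≤ x →
    ‖u x - (a * Complex.exp (Complex.I * x) + b * Complex.exp (-(Complex.I * x)))‖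
      ≤ errorConst c u v / x ∧
    ‖v x - Complex.I * (a * Complex.exp (Complex.I * x) - b * Complex.exp (-(Complex.I * x)))‖
      ≤ errorConst c u v / x := by
  obtain ⟨a', b', h'⟩ := h.asymptotics
  have h1 := tendsto_zero_of_norm_le_div fun x hx => (h' x hx).1
  have h2 := planeWaves_eq_zero (a := a - a') (b := b - b')
    (by simpa using (h1.sub ht).congr fun x => by ring)
  obtain rfl : a = a' := sub_eq_zero.1 h2.1
  obtain rfl : b = b' := sub_eq_zero.1 h2.2
  exact h'

theorem tendsto_ofReal_zero {ι : Type*} {l : Filter ι} {f : ι → ℝ} (h : Tendsto f l (𝓝 0)) :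
    Tendsto (fun x => (f x : ℂ)) l (𝓝 0) := by
  have := (Complex.continuous_ofReal.tendsto 0).comp h
  rwa [Complex.ofReal_zero] at this

theorem cos_sub_eq_planeWaves (x θ : ℝ) : (Real.cos (x - θ) : ℂ)
    = Complex.exp (-(Complex.I * θ)) / 2 * Complex.exp (Complex.I * x)
      + Complex.exp (Complex.I * θ) / 2 * Complex.exp (-(Complex.I * x)) := by
  rw [Complex.ofReal_cos, Complex.cos]
  have e1 : Complex.exp (((x - θ : ℝ) : ℂ) * Complex.I)
      = Complex.exp (-(Complex.I * θ)) * Complex.exp (Complex.I * x) := by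
    rw [← Complex.exp_add]; congr 1; push_cast; ring
  have e2 : Complex.exp (-((x - θ : ℝ) : ℂ) * Complex.I)
      = Complex.exp (Complex.I * θ) * Complex.exp (-(Complex.I * x)) := by
    rw [← Complex.exp_add]; congr 1; push_cast; ring
  rw [e1, e2]; ring

theorem pJDeriv_eq {ν x : ℝ} (hx : 0 < x) :
    pJDeriv ν x = (ν + 1 / 2) / x * pJ ν x - pJ (ν + 1) x := by
  simp only [pJDeriv, pJ, powSolDeriv, powSol]
  rw [show 1 / 2 + (ν + 1) = ν - 1 / 2 + 1 + 1 by ring, show 1 / 2 + ν = ν - 1 / 2 + 1 by ring,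
    show -(ν + 1) = -ν - 1 by ring, Real.rpow_sub_one two_ne_zero,
    Real.rpow_add_one hx.ne' (ν - 1 / 2 + 1), Real.rpow_add_one hx.ne' (ν - 1 / 2)]
  field_simp
  ring

/-- The asymptotics `√(πx/2) J_ν(x) = cos(x - νπ/2 - π/4) + o(1)`. -/
def BesselAsymp (ν : ℝ) : Prop :=
  Tendsto (fun x => pJ ν x - Real.cos (x - (ν * π / 2 + π / 4))) atTop (𝓝 0)

/-- Up to `O(1/x)` the derivative of `pJ ν` is `-pJ (ν + 1)`. The amplitudes of a solution and of
its derivative differ by the factors `±i`, so the amplitudes at order `ν + 1` determine those at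
order `ν`. -/
theorem BesselAsymp.of_succ {ν : ℝ} (hν : -1 < ν) (h : BesselAsymp (ν + 1)) : BesselAsymp ν := by
  obtain ⟨a, b, hab⟩ := (isSol_pJ hν).ofReal.asymptotics
  have h1 := tendsto_zero_of_norm_le_div fun x hx => (hab x hx).1
  have h2 := tendsto_zero_of_norm_le_div fun x hx => (hab x hx).2
  have h3 : Tendsto (fun x : ℝ => (((ν + 1 / 2) / x * pJ ν x : ℝ) : ℂ)) atTop (𝓝 0) := by
    have hb : IsBoundedUnder (· ≤ ·) atTop (fun x : ℝ => ‖(pJ ν x : ℂ)‖) :=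
      ⟨_, Filter.eventually_map.2 ((eventually_ge_atTop 1).mono fun x hx =>
        (isSol_pJ hν).ofReal.norm_le hx)⟩
    have hz : Tendsto (fun x : ℝ => (((ν + 1 / 2) / x : ℝ) : ℂ)) atTop (𝓝 0) := by
      exact tendsto_ofReal_zero (tendsto_const_nhds.div_atTop tendsto_id)
    refine (hz.zero_mul_isBoundedUnder_le hb).congr fun x => ?_
    push_cast; ring
  have h4 : Tendsto (fun x : ℝ => ((pJ (ν + 1) x - Real.cos (x - ((ν + 1) * π / 2 + π / 4)) : ℝ) : ℂ))
      atTop (𝓝 0) := tendsto_ofReal_zero h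
  set θ := (ν + 1) * π / 2 + π / 4 with hθ
  have h5 := planeWaves_eq_zero (a := Complex.I * a + Complex.exp (-(Complex.I * θ)) / 2)
    (b := -(Complex.I * b) + Complex.exp (Complex.I * θ) / 2) (by
      have := (h3.sub h2).sub h4
      simp only [sub_zero] at this
      refine this.congr' ?_
      filter_upwards [eventually_gt_atTop 0] with x hx
      rw [pJDeriv_eq hx, Complex.ofReal_sub, Complex.ofReal_sub, cos_sub_eq_planeWaves]
      ring)
  have eI : Complex.exp (Complex.I * (π / 2 : ℝ)) = Complex.I := by
    rw [mul_comm]; push_cast; exact Complex.exp_pi_div_two_mul_I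
  have eI' : Complex.exp (-(Complex.I * (π / 2 : ℝ))) = -Complex.I := by
    rw [Complex.exp_neg, eI, Complex.inv_I]
  have q1 : Complex.exp (-(Complex.I * θ)) = Complex.exp (-(Complex.I * (ν * π / 2 + π / 4 : ℝ)))
      * -Complex.I := by
    rw [← eI', ← Complex.exp_add]; congr 1; rw [hθ]; push_cast; ring
  have q2 : Complex.exp (Complex.I * θ) = Complex.exp (Complex.I * (ν * π / 2 + π / 4 : ℝ))
      * Complex.I := by
    have : Complex.exp (Complex.I * θ) = Complex.exp (Complex.I * (ν * π / 2 + π / 4 : ℝ))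
        * Complex.exp (Complex.I * (π / 2 : ℝ)) := by
      rw [← Complex.exp_add]; congr 1; rw [hθ]; push_cast; ring
    rw [this, eI]
  rw [q1, q2] at h5
  have ea : a = Complex.exp (-(Complex.I * (ν * π / 2 + π / 4 : ℝ))) / 2 := by
    linear_combination (-Complex.I) * h5.1 + (a - Complex.exp (-(Complex.I * (ν * π / 2 + π / 4 : ℝ))) / 2) * Complex.I_sq
  have eb : b = Complex.exp (Complex.I * (ν * π / 2 + π / 4 : ℝ)) / 2 := by
    linear_combination (Complex.I) * h5.2 + (b - Complex.exp (Complex.I * (ν * π / 2 + π / 4 : ℝ)) / 2) * Complex.I_sq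
  have h6 := (Complex.continuous_re.tendsto 0).comp h1
  rw [Complex.zero_re] at h6
  refine h6.congr fun x => ?_
  rw [Function.comp_apply, ea, eb, ← cos_sub_eq_planeWaves, ← Complex.ofReal_sub, Complex.ofReal_re]

/-- Two downward steps suffice, because `ν + 2` exceeds `1/2`. Orders down to `-1` are needed for
`J_{-α}`. -/
theorem besselAsymp {ν : ℝ} (hν : -1 < ν) : BesselAsymp ν := by
  have h2 : BesselAsymp (ν + 1 + 1) := by
    refine (tendsto_pJ_of_half_lt (by linarith : 1 / 2 < ν + 1 + 1)).congr fun x => ?_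
    rw [sub_sub x]
  exact (h2.of_succ (by linarith)).of_succ hν

/-! ### The irregular solution `√(πx/2) Y_α(x)` -/

/-- The function `√(πx/2) Y_α(x)` for `0 ≤ α < 1`. -/
def qY (α x : ℝ) : ℝ :=
  if α = 0 then √(π / 2) * (2 / π) *
    (logSol 1 x + (Real.eulerMascheroniConstant - Real.log 2) * powSol 0 1 x)
  else (Real.cos (π * α) * pJ α x - pJ (-α) x) / Real.sin (π * α)

/-- The derivative of `qY`. -/
def qYDeriv (α x : ℝ) : ℝ :=
  if α = 0 then √(π / 2) * (2 / π) *
    (logSolDeriv 1 x + (Real.eulerMascheroniConstant - Real.log 2) * powSolDeriv 0 1 x)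
  else (Real.cos (π * α) * pJDeriv α x - pJDeriv (-α) x) / Real.sin (π * α)

theorem isSol_qY {α : ℝ} (hα0 : 0 ≤ α) (hα1 : α < 1) :
    IsSol (α ^ 2 - 1 / 4) 1 (qY α) (qYDeriv α) := by
  by_cases h : α = 0
  · subst h
    unfold qY qYDeriv
    simp only [if_true]
    have := ((isSol_logSol 1).add ((isSol_powSol (by norm_num : (-1 : ℝ) < 0) 1).const_mul
      (Real.eulerMascheroniConstant - Real.log 2))).const_mul (√(π / 2) * (2 / π))
    exact this
  · unfold qY qYDeriv
    simp only [if_neg h]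
    have h2 := isSol_pJ (ν := -α) (by linarith)
    rw [neg_sq] at h2
    have := (((isSol_pJ (ν := α) (by linarith)).const_mul (Real.cos (π * α))).sub h2).const_mul
      (Real.sin (π * α))⁻¹
    simpa only [div_eq_inv_mul] using this

theorem sin_pi_mul_pos {α : ℝ} (hα0 : 0 < α) (hα1 : α < 1) : 0 < Real.sin (π * α) :=
  Real.sin_pos_of_pos_of_lt_pi (by positivity) (by nlinarith [pi_pos])

/-- The outgoing solution `√(πx/2) H^{(1)}_α(x)`. -/
def chi (α x : ℝ) : ℂ := pJ α x + Complex.I * qY α x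

/-- The derivative of `chi`. -/
def chiDeriv (α x : ℝ) : ℂ := pJDeriv α x + Complex.I * qYDeriv α x

theorem isSol_chi {α : ℝ} (hα0 : 0 ≤ α) (hα1 : α < 1) :
    IsSol (α ^ 2 - 1 / 4) 1 (chi α) (chiDeriv α) :=
  (isSol_pJ (by linarith)).ofReal.add ((isSol_qY hα0 hα1).ofReal.const_mul Complex.I)

/-- The constant phase of the outgoing wave. -/
def phase (α : ℝ) : ℂ := Complex.exp (-(Complex.I * (α * π / 2 + π / 4 : ℝ)))

/-- The cosines for the orders `α` and `-α` combine to a sine in `qY`, and cosine plus `i` times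
sine leaves no incoming wave. The error constant is kept explicit for the limit of vanishing order.
-/
theorem chi_asymptotics_of_pos {α : ℝ} (hα0 : 0 < α) (hα1 : α < 1) : ∀ x : ℝ, 1 ≤ x →
    ‖chi α x - phase α * Complex.exp (Complex.I * x)‖
      ≤ IsSol.errorConst (α ^ 2 - 1 / 4) (chi α) (chiDeriv α) / x ∧
    ‖chiDeriv α x - Complex.I * (phase α * Complex.exp (Complex.I * x))‖
      ≤ IsSol.errorConst (α ^ 2 - 1 / 4) (chi α) (chiDeriv α) / x := by
  have hs := sin_pi_mul_pos hα0 hα1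
  have h1 : BesselAsymp α := besselAsymp (by linarith)
  have h2 : BesselAsymp (-α) := besselAsymp (by linarith)
  have h3 := ((h1.const_mul (Real.cos (π * α))).sub h2).const_mul (Real.sin (π * α))⁻¹
  have h1' := (Complex.continuous_ofReal.tendsto 0).comp h1
  have h3' := (Complex.continuous_ofReal.tendsto _).comp h3
  simp only [mul_zero, sub_zero, Complex.ofReal_zero] at h1' h3'
  have h4 := h1'.add (h3'.const_mul Complex.I)
  simp only [mul_zero, add_zero] at h4
  have key := (isSol_chi hα0.le hα1).asymptotics_of_tendsto (a := phase α) (b := 0) (by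
    refine h4.congr fun x => ?_
    set y := x - (α * π / 2 + π / 4) with hy
    have e1 : Real.cos (x - (-α * π / 2 + π / 4)) =
        Real.cos (π * α) * Real.cos y - Real.sin (π * α) * Real.sin y := by
      rw [← Real.cos_add]; congr 1; rw [hy]; ring
    have e2 : phase α * Complex.exp (Complex.I * x) = Real.cos y + Real.sin y * Complex.I := by
      rw [phase, ← Complex.exp_add, Complex.ofReal_cos, Complex.ofReal_sin, ← Complex.exp_mul_I]
      congr 1; rw [hy]; push_cast; ring
    have e3 : (Real.sin (π * α))⁻¹ * (Real.cos (π * α) * (pJ α x - Real.cos y) -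
        (pJ (-α) x - Real.cos (x - (-α * π / 2 + π / 4)))) = qY α x - Real.sin y := by
      rw [e1, qY, if_neg hα0.ne']
      field_simp
      ring
    simp only [Function.comp_apply]
    rw [← hy, e3, zero_mul, add_zero, e2, chi]
    push_cast
    ring)
  intro x hx
  simpa using key x hx

/-! ### The derivative of the Bessel functions with respect to the order -/

/-- In the recursion of `1/Γ` each step divides by a number of real part at least `1/2`, hence the
factor `2^m`. Uniformity over a complex neighbourhood of the orders `0` and `1` is what allows
termwise differentiation in the order. -/
theorem norm_inv_Gamma_le : ∃ C : ℝ, 0 ≤ C ∧ ∀ (m : ℕ) (w : ℂ), -(1 / 2) < w.re → ‖w‖ < 2 →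
    ‖(Complex.Gamma (m + 1 + w))⁻¹‖ ≤ C * 2 ^ m := by
  have hd := Complex.differentiable_one_div_Gamma
  have hc : Continuous fun w : ℂ => (Complex.Gamma (1 + w))⁻¹ :=
    hd.continuous.comp (continuous_const.add continuous_id)
  obtain ⟨C, hC⟩ := (isCompact_closedBall (0 : ℂ) 2).exists_bound_of_continuousOn hc.continuousOn
  have hC0 : 0 ≤ C := (norm_nonneg _).trans (hC 0 (by simp))
  refine ⟨C, hC0, fun m w hw hw2 => ?_⟩
  induction m with
  | zero => simpa using hC w (by simpa using hw2.le)
  | succ m ih =>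
    have hre : (1 / 2 : ℝ) ≤ ((m : ℂ) + 1 + w).re := by
      have : (0 : ℝ) ≤ m := by positivity
      simp only [Complex.add_re, Complex.natCast_re, Complex.one_re]; linarith
    have hn : (1 / 2 : ℝ) ≤ ‖(m : ℂ) + 1 + w‖ := hre.trans (Complex.re_le_norm _)
    have hne : (m : ℂ) + 1 + w ≠ 0 := by
      intro h; rw [h] at hn; norm_num at hn
    rw [show ((m + 1 : ℕ) : ℂ) + 1 + w = ((m : ℂ) + 1 + w) + 1 by push_cast; ring,
      Complex.Gamma_add_one _ hne, mul_inv, norm_mul, norm_inv]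
    have : ‖(m : ℂ) + 1 + w‖⁻¹ ≤ 2 := by
      rw [inv_le_comm₀ (by linarith) two_pos]; linarith
    calc _ ≤ 2 * (C * 2 ^ m) := by gcongr
      _ = _ := by ring

/-- The series is extended to complex orders, where locally uniform convergence of holomorphic
functions passes to derivatives. The values of `Γ'` at the positive integers bring in Euler's
constant and the harmonic numbers. Order one is needed because it occurs in `pJDeriv`. -/
theorem hasDerivAt_bj_order (z : ℝ) {n : ℕ} (hn : n ≤ 1) :
    HasDerivAt (fun ν => bj ν z) (∑' m : ℕ, ((-1) ^ m / (m.factorial : ℝ) * z ^ m) *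
      -(((-Real.eulerMascheroniConstant + harmonic (m + n))) / (m + n).factorial)) n := by
  obtain ⟨C, hC0, hC⟩ := norm_inv_Gamma_le
  set U : Set ℂ := {w | -(1 / 2) < w.re} ∩ {w | ‖w‖ < 2}
  have hU : IsOpen U := (isOpen_lt continuous_const Complex.continuous_re).inter
    (isOpen_lt continuous_norm continuous_const)
  set F : ℕ → ℂ → ℂ := fun m w => (((-1) ^ m / (m.factorial : ℝ) * z ^ m : ℝ) : ℂ) *
    (Complex.Gamma (m + 1 + w))⁻¹ with hF
  have hdiff : ∀ m, Differentiable ℂ (F m) := fun m =>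
    (Complex.differentiable_one_div_Gamma.comp
      ((differentiable_const _).add differentiable_id)).const_mul _
  have hu : Summable fun m : ℕ => (2 * |z|) ^ m / m.factorial * C :=
    (Real.summable_pow_div_factorial (2 * |z|)).mul_right C
  have hle : ∀ (m : ℕ) (w : ℂ), w ∈ U → ‖F m w‖ ≤ (2 * |z|) ^ m / m.factorial * C := by
    intro m w hw
    rw [hF]
    simp only
    rw [norm_mul, Complex.norm_real, Real.norm_eq_abs, abs_mul, abs_div, abs_pow, abs_neg, abs_one,
      one_pow, abs_pow, abs_of_nonneg (by positivity : (0 : ℝ) ≤ (m.factorial : ℝ))]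
    calc _ ≤ 1 / (m.factorial : ℝ) * |z| ^ m * (C * 2 ^ m) := by
          gcongr; exact hC m w hw.1 hw.2
      _ = _ := by rw [mul_pow]; ring
  have hnU : ((n : ℝ) : ℂ) ∈ U := by
    have : (n : ℝ) ≤ 1 := by exact_mod_cast hn
    have h0 : (0 : ℝ) ≤ n := by positivity
    constructor
    · simp only [mem_ofPred_eq, Complex.ofReal_re]; linarith
    · simp only [mem_ofPred_eq, Complex.norm_real, Real.norm_eq_abs, abs_of_nonneg h0]; linarith
  have h1 := (Complex.differentiableOn_tsum_of_summable_norm hu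
    (fun i => (hdiff i).differentiableOn) hU hle).differentiableAt (hU.mem_nhds hnU)
  have h2 := Complex.hasSum_deriv_of_summable_norm hu
    (fun i => (hdiff i).differentiableOn) hU hle hnU
  have h3 : ∀ m, deriv (F m) ((n : ℝ) : ℂ) = (((((-1) ^ m / (m.factorial : ℝ) * z ^ m) *
      -(((-Real.eulerMascheroniConstant + harmonic (m + n))) / (m + n).factorial) : ℝ)) : ℂ) := by
    intro m
    have hG := Complex.hasDerivAt_Gamma_nat (m + n)
    have e : ((m : ℂ) + 1 + ((n : ℝ) : ℂ)) = ((m + n : ℕ) : ℂ) + 1 := by push_cast; ring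
    rw [← e] at hG
    have hg : Complex.Gamma ((m : ℂ) + 1 + ((n : ℝ) : ℂ)) = ((m + n).factorial : ℂ) := by
      rw [e, Complex.Gamma_nat_eq_factorial]
    have hfac : ((m + n).factorial : ℂ) ≠ 0 := by exact_mod_cast (m + n).factorial_ne_zero
    have h5 : HasDerivAt (fun w : ℂ => Complex.Gamma (m + 1 + w))
        ((m + n).factorial * (-Real.eulerMascheroniConstant + harmonic (m + n)))
        (((n : ℝ) : ℂ)) := by
      simpa using hG.comp_const_add ((m : ℂ) + 1) ((n : ℝ) : ℂ)
    have h4 := (h5.inv (by rw [hg]; exact hfac)).const_mul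
      (((-1) ^ m / (m.factorial : ℝ) * z ^ m : ℝ) : ℂ)
    rw [hg] at h4
    refine HasDerivAt.deriv (h4.congr_deriv ?_)
    push_cast
    field_simp
  have h4 := h1.hasDerivAt.real_of_complex
  have h5 : deriv (fun w => ∑' i, F i w) ((n : ℝ) : ℂ) =
      ((∑' m : ℕ, ((-1) ^ m / (m.factorial : ℝ) * z ^ m) *
      -(((-Real.eulerMascheroniConstant + harmonic (m + n))) / (m + n).factorial) : ℝ) : ℂ) := by
    rw [← h2.tsum_eq, Complex.ofReal_tsum]
    exact tsum_congr h3
  rw [h5, Complex.ofReal_re] at h4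
  refine h4.congr_of_eventuallyEq (Eventually.of_forall fun ν => ?_)
  simp only [hF]
  have h6 : ∀ m : ℕ, (((-1) ^ m / (m.factorial : ℝ) * z ^ m : ℝ) : ℂ) *
      (Complex.Gamma (m + 1 + (ν : ℂ)))⁻¹ = ((bjCoeff ν m * z ^ m : ℝ) : ℂ) := fun m => by
    rw [show (m : ℂ) + 1 + (ν : ℂ) = ((m + ν + 1 : ℝ) : ℂ) by push_cast; ring,
      Complex.Gamma_ofReal, bjCoeff]
    push_cast
    field_simp
  rw [tsum_congr h6, ← Complex.ofReal_tsum, Complex.ofReal_re]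
  rfl

theorem hasDerivAt_bj_order_zero (z : ℝ) : HasDerivAt (fun ν => bj ν z)
    (Real.eulerMascheroniConstant * bj 0 z + bh z) 0 := by
  have h := hasDerivAt_bj_order z zero_le_one
  rw [Nat.cast_zero] at h
  refine h.congr_deriv (HasSum.tsum_eq ?_)
  refine hasSum_of_eq ((((rapid_bjCoeff (by norm_num : (-1 : ℝ) < 0)).hasSum z).mul_left
    Real.eulerMascheroniConstant).add (rapid_bhCoeff.hasSum z)) fun m => ?_
  rw [bjCoeff, bhCoeff, add_zero, add_zero, Real.Gamma_nat_eq_factorial]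
  have : (m.factorial : ℝ) ≠ 0 := by positivity
  field_simp
  ring

theorem hasDerivAt_bj_order_one (z : ℝ) : HasDerivAt (fun ν => bj ν z)
    (Real.eulerMascheroniConstant * bj 1 z - pser (dshift bhCoeff) z) 1 := by
  have h := hasDerivAt_bj_order z le_rfl
  rw [Nat.cast_one] at h
  refine h.congr_deriv (HasSum.tsum_eq ?_)
  refine hasSum_of_eq ((((rapid_bjCoeff (by norm_num : (-1 : ℝ) < 1)).hasSum z).mul_left
    Real.eulerMascheroniConstant).sub (rapid_bhCoeff.derived.hasSum z)) fun m => ?_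
  rw [bjCoeff, dshift, bhCoeff, show (m : ℝ) + 1 + 1 = ((m + 1 : ℕ) : ℝ) + 1 by push_cast; ring,
    Real.Gamma_nat_eq_factorial, Nat.factorial_succ, pow_succ, pow_succ]
  have : (m.factorial : ℝ) ≠ 0 := by positivity
  have : (m : ℝ) + 1 ≠ 0 := by positivity
  push_cast
  field_simp
  ring

end AnyonDelta

end
noncomputable section

namespace AnyonDelta

/-! ### The limit of vanishing order -/

theorem hasDerivAt_const_rpow_order {a : ℝ} (ha : 0 < a) (p q t : ℝ) :
    HasDerivAt (fun ν : ℝ => a ^ (p + q * ν)) (a ^ (p + q * t) * (q * Real.log a)) t := by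
  have h := ((((hasDerivAt_id t).const_mul q).const_add p).const_mul (Real.log a)).exp
  refine (h.congr_of_eventuallyEq (Eventually.of_forall fun ν => ?_)).congr_deriv ?_
  · simp [Real.rpow_def_of_pos ha]
  · simp only [Real.rpow_def_of_pos ha, id]; ring

/-- The classical relation `∂_ν J_ν = (π/2) Y_0` at `ν = 0`, which identifies the logarithmic
solution as the limit of the irregular solutions of positive order. -/
theorem hasDerivAt_pJ_order {x : ℝ} (hx : 0 < x) :
    HasDerivAt (fun ν => pJ ν x) (π / 2 * qY 0 x) 0 := by
  have h1 := hasDerivAt_const_rpow_order two_pos 0 (-1) 0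
  have h2 := hasDerivAt_const_rpow_order hx (1 / 2) 1 0
  have h3 := hasDerivAt_bj_order_zero (1 * x ^ 2 / 4)
  have h := ((h1.const_mul √(π / 2)).mul (h2.mul h3))
  refine (h.congr_of_eventuallyEq (Eventually.of_forall fun ν => ?_)).congr_deriv ?_
  · simp [pJ, powSol]
  · simp only [qY, if_true, logSol, powSol, mul_zero, add_zero, Real.rpow_zero, Pi.mul_apply]
    field_simp
    ring

theorem hasDerivAt_pJDeriv_order {x : ℝ} (hx : 0 < x) :
    HasDerivAt (fun ν => pJDeriv ν x) (π / 2 * qYDeriv 0 x) 0 := by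
  have h1 := hasDerivAt_const_rpow_order two_pos 0 (-1) 0
  have h2 := hasDerivAt_const_rpow_order hx (-(1 / 2)) 1 0
  have h3 := hasDerivAt_bj_order_zero (1 * x ^ 2 / 4)
  have h4 : HasDerivAt (fun ν => bj (ν + 1) (1 * x ^ 2 / 4)) _ 0 :=
    HasDerivAt.comp_add_const 0 1 (f := fun ν => bj ν (1 * x ^ 2 / 4))
      (by rw [zero_add]; exact hasDerivAt_bj_order_one (1 * x ^ 2 / 4))
  have h5 := ((hasDerivAt_id (0 : ℝ)).const_add (1 / 2)).mul h3
  have h := ((h1.const_mul √(π / 2)).mul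
    (h2.mul (h5.sub (h4.const_mul (2 * (1 * x ^ 2 / 4))))))
  refine (h.congr_of_eventuallyEq (Eventually.of_forall fun ν => ?_)).congr_deriv ?_
  · simp [pJDeriv, powSolDeriv, sub_eq_add_neg, add_comm]
  · simp only [qYDeriv, if_true, logSolDeriv, powSolDeriv, mul_zero, add_zero, zero_add,
      Real.rpow_zero, Pi.mul_apply, Pi.sub_apply, id, zero_sub]
    field_simp
    ring

/-- Numerator and denominator vanish at `ν = 0` with derivatives `π D` and `π`: the difference of `J
ν` and `J (-ν)` doubles `(π/2) D`, while the cosine is stationary. -/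
theorem tendsto_order_quotient {J : ℝ → ℝ} {D : ℝ} (h : HasDerivAt J (π / 2 * D) 0) :
    Tendsto (fun ν => (Real.cos (π * ν) * J ν - J (-ν)) / Real.sin (π * ν)) (𝓝[>] 0) (𝓝 D) := by
  have hm : HasDerivAt (fun ν : ℝ => π * ν) π 0 := by
    simpa using (hasDerivAt_id (0 : ℝ)).const_mul π
  have hn : HasDerivAt (fun ν => J (-ν)) (-(π / 2 * D)) 0 := by
    have := HasDerivAt.comp (0 : ℝ) (h₂ := J) (by rw [neg_zero]; exact h) (hasDerivAt_neg (0 : ℝ))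
    exact this.congr_deriv (by simp)
  have h1 : HasDerivAt (fun ν => Real.cos (π * ν) * J ν - J (-ν)) (π * D) 0 := by
    refine ((hm.cos.mul h).sub hn).congr_deriv ?_
    simp; ring
  have h2 : HasDerivAt (fun ν => Real.sin (π * ν)) π 0 := by
    refine hm.sin.congr_deriv ?_
    simp
  have t1 := (hasDerivAt_iff_tendsto_slope_zero.1 h1).mono_left (nhdsGT_le_nhdsNE 0)
  have t2 := (hasDerivAt_iff_tendsto_slope_zero.1 h2).mono_left (nhdsGT_le_nhdsNE 0)
  have t := t1.div t2 pi_ne_zero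
  rw [mul_div_cancel_left₀ _ pi_ne_zero] at t
  refine t.congr' ?_
  filter_upwards [self_mem_nhdsWithin] with ν hν
  have : ν ≠ 0 := (mem_Ioi.1 hν).ne'
  simp only [Pi.div_apply, zero_add, mul_zero, Real.cos_zero, Real.sin_zero, neg_zero, one_mul,
    sub_self, sub_zero, smul_eq_mul]
  rw [mul_div_mul_left _ _ (inv_ne_zero this)]

theorem tendsto_chi_order {x : ℝ} (hx : 0 < x) :
    Tendsto (fun ν => chi ν x) (𝓝[>] 0) (𝓝 (chi 0 x)) ∧
    Tendsto (fun ν => chiDeriv ν x) (𝓝[>] 0) (𝓝 (chiDeriv 0 x)) := by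
  have aux : ∀ {J Q : ℝ → ℝ}, HasDerivAt J (π / 2 * Q 0) 0 →
      (∀ ν, ν ≠ 0 → Q ν = (Real.cos (π * ν) * J ν - J (-ν)) / Real.sin (π * ν)) →
      Tendsto (fun ν => (J ν : ℂ) + Complex.I * Q ν) (𝓝[>] 0) (𝓝 (J 0 + Complex.I * Q 0)) := by
    intro J Q hJ hQ
    have t1 : Tendsto J (𝓝[>] 0) (𝓝 (J 0)) := hJ.continuousAt.tendsto.mono_left nhdsWithin_le_nhds
    have t2 : Tendsto Q (𝓝[>] 0) (𝓝 (Q 0)) := by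
      refine (tendsto_order_quotient hJ).congr' ?_
      filter_upwards [self_mem_nhdsWithin] with ν hν using (hQ ν (mem_Ioi.1 hν).ne').symm
    exact ((Complex.continuous_ofReal.tendsto _).comp t1).add
      (((Complex.continuous_ofReal.tendsto _).comp t2).const_mul _)
  exact ⟨aux (Q := fun ν => qY ν x) (hasDerivAt_pJ_order hx) fun ν hν => by simp [qY, hν],
    aux (Q := fun ν => qYDeriv ν x) (hasDerivAt_pJDeriv_order hx) fun ν hν => by simp [qYDeriv, hν]⟩

/-- The asymptotics of the Hankel function. -/
theorem chi_asymptotics {α : ℝ} (hα0 : 0 ≤ α) (hα1 : α < 1) : ∃ K : ℝ, ∀ x : ℝ, 1 ≤ x →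
    ‖chi α x - phase α * Complex.exp (Complex.I * x)‖ ≤ K / x ∧
    ‖chiDeriv α x - Complex.I * (phase α * Complex.exp (Complex.I * x))‖ ≤ K / x := by
  refine ⟨IsSol.errorConst (α ^ 2 - 1 / 4) (chi α) (chiDeriv α), ?_⟩
  rcases hα0.eq_or_lt with rfl | hα
  · have t0 : Tendsto (fun ν : ℝ => ν) (𝓝[>] 0) (𝓝 0) := nhdsWithin_le_nhds
    have tp : Tendsto phase (𝓝[>] 0) (𝓝 (phase 0)) := by
      have : Continuous phase := by unfold phase; fun_prop
      exact (this.tendsto 0).mono_left nhdsWithin_le_nhds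
    -- The error constant depends on the order only through `ν² - 1/4` and the values of the
    -- solution at `x = 1`, so the estimate with fixed `x` survives the limit `ν ↓ 0`.
    have tE : Tendsto (fun ν => IsSol.errorConst (ν ^ 2 - 1 / 4) (chi ν) (chiDeriv ν)) (𝓝[>] 0)
        (𝓝 (IsSol.errorConst (0 ^ 2 - 1 / 4) (chi 0) (chiDeriv 0))) := by
      have t1 := tendsto_chi_order one_pos
      have tc : Tendsto (fun ν : ℝ => |ν ^ 2 - 1 / 4|) (𝓝[>] 0) (𝓝 |(0 : ℝ) ^ 2 - 1 / 4|) :=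
        ((t0.pow 2).sub_const _).abs
      exact tc.mul ((((t1.1.norm.pow 2).add (t1.2.norm.pow 2)).mul
        ((Real.continuous_exp.tendsto _).comp tc)).sqrt)
    have hev : ∀ᶠ ν : ℝ in 𝓝[>] 0, 0 < ν ∧ ν < 1 := by
      filter_upwards [Ioo_mem_nhdsGT (zero_lt_one' ℝ)] with ν hν using hν
    intro x hx
    have tx := tendsto_chi_order (by linarith : 0 < x)
    have tpe := tp.mul_const (Complex.exp (Complex.I * x))
    exact ⟨le_of_tendsto_of_tendsto (tx.1.sub tpe).norm (tE.div_const x)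
        (hev.mono fun ν hν => (chi_asymptotics_of_pos hν.1 hν.2 x hx).1),
      le_of_tendsto_of_tendsto (tx.2.sub (tpe.const_mul Complex.I)).norm (tE.div_const x)
        (hev.mono fun ν hν => (chi_asymptotics_of_pos hν.1 hν.2 x hx).2)⟩
  · exact chi_asymptotics_of_pos hα hα1

theorem norm_phase (α : ℝ) : ‖phase α‖ = 1 := by
  rw [phase, Complex.norm_exp]; simp

/-! ### Solutions near the origin -/

theorem Rapid.exists_bound {c : ℕ → ℝ} (hc : Rapid c) (R : ℝ) : ∃ C : ℝ, 0 ≤ C ∧ ∀ z, |z| ≤ R →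
    |pser c z| ≤ C ∧ |pser c z - pser c 0| ≤ C * |z| := by
  obtain ⟨C₁, h₁⟩ := (isCompact_Icc (a := -R) (b := R)).exists_bound_of_continuousOn
    hc.continuous.continuousOn
  obtain ⟨C₂, h₂⟩ := (isCompact_Icc (a := -R) (b := R)).exists_bound_of_continuousOn
    hc.derived.continuous.continuousOn
  refine ⟨max 0 (max C₁ C₂), le_max_left _ _, fun z hz => ?_⟩
  have hzI : z ∈ Icc (-R) R := abs_le.1 hz
  have h0 : (0 : ℝ) ∈ Icc (-R) R := abs_le.1 (by rw [abs_zero]; exact (abs_nonneg z).trans hz)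
  refine ⟨(h₁ z hzI).trans ((le_max_left _ _).trans (le_max_right _ _)), ?_⟩
  have := (convex_Icc (-R) R).norm_image_sub_le_of_norm_hasDerivWithin_le
    (fun x _ => (hc.hasDerivAt x).hasDerivWithinAt) h₂ h0 hzI
  rw [sub_zero, Real.norm_eq_abs, Real.norm_eq_abs] at this
  refine this.trans ?_
  gcongr
  exact (le_max_right _ _).trans (le_max_right _ _)

/-- Families of solutions, indexed by the energy, that are controlled near the origin. -/
def NearBound (β : ℝ) (X Y : ℝ → ℝ → ℝ) : Prop :=
  ∀ R : ℝ, ∃ C : ℝ, 0 ≤ C ∧ ∀ E r : ℝ, |E| ≤ R → 0 < r → r ≤ 1 →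
    |X E r| ≤ C * r ^ (-β) ∧ |Y E r| ≤ C * r ^ (-1 - β) ∧
    |X E r - X 0 r| ≤ C * r ^ (2 - β) ∧ |Y E r - Y 0 r| ≤ C * r ^ (1 - β)

theorem NearBound.add {β : ℝ} {X Y X₁ Y₁ : ℝ → ℝ → ℝ} (h : NearBound β X Y)
    (h₁ : NearBound β X₁ Y₁) :
    NearBound β (fun E r => X E r + X₁ E r) (fun E r => Y E r + Y₁ E r) := by
  intro R
  obtain ⟨C, hC, k⟩ := h R
  obtain ⟨C₁, hC₁, k₁⟩ := h₁ R
  refine ⟨C + C₁, by positivity, fun E r hE hr hr1 => ?_⟩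
  obtain ⟨a1, a2, a3, a4⟩ := k E r hE hr hr1
  obtain ⟨b1, b2, b3, b4⟩ := k₁ E r hE hr hr1
  refine ⟨?_, ?_, ?_, ?_⟩
  · exact (abs_add_le _ _).trans (by linarith)
  · exact (abs_add_le _ _).trans (by linarith)
  · rw [show X E r + X₁ E r - (X 0 r + X₁ 0 r) = (X E r - X 0 r) + (X₁ E r - X₁ 0 r) by ring]
    exact (abs_add_le _ _).trans (by linarith)
  · rw [show Y E r + Y₁ E r - (Y 0 r + Y₁ 0 r) = (Y E r - Y 0 r) + (Y₁ E r - Y₁ 0 r) by ring]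
    exact (abs_add_le _ _).trans (by linarith)

theorem NearBound.const_mul {β : ℝ} {X Y : ℝ → ℝ → ℝ} (h : NearBound β X Y) (a : ℝ) :
    NearBound β (fun E r => a * X E r) (fun E r => a * Y E r) := by
  intro R
  obtain ⟨C, hC, k⟩ := h R
  refine ⟨|a| * C, by positivity, fun E r hE hr hr1 => ?_⟩
  obtain ⟨a1, a2, a3, a4⟩ := k E r hE hr hr1
  rw [← mul_sub, ← mul_sub, abs_mul, abs_mul, abs_mul, abs_mul]
  refine ⟨?_, ?_, ?_, ?_⟩ <;> rw [mul_assoc |a|] <;> gcongr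

theorem abs_energy_le {E R r : ℝ} (hE : |E| ≤ R) (hr : 0 < r) (hr1 : r ≤ 1) :
    |E * r ^ 2 / 4| ≤ R ∧ |E * r ^ 2 / 4| ≤ R * r ^ 2 := by
  have hR : 0 ≤ R := (abs_nonneg E).trans hE
  have h1 : |E * r ^ 2 / 4| ≤ R * r ^ 2 := by
    rw [abs_div, abs_mul, abs_of_nonneg (sq_nonneg r), abs_of_pos (by norm_num : (0 : ℝ) < 4)]
    have : |E| * r ^ 2 ≤ R * r ^ 2 := by gcongr
    have : 0 ≤ |E| * r ^ 2 := by positivity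
    linarith
  refine ⟨h1.trans ?_, h1⟩
  exact mul_le_of_le_one_right hR (pow_le_one₀ hr.le hr1)

/-- The hypothesis on `β` compares `r^{1/2+ν}` with `r^{-β}` on `(0, 1]`. The energy enters only
through `E r²/4`, so differences from zero energy gain `r²`. The constant `D` merely dominates the
four constants that occur. -/
theorem nearBound_powSol {ν β : ℝ} (hν : -1 < ν) (hβ : -β ≤ 1 / 2 + ν) :
    NearBound β (powSol ν) (powSolDeriv ν) := by
  intro R
  obtain ⟨C, hC, h⟩ := (rapid_bjCoeff hν).exists_bound R
  obtain ⟨C₁, hC₁, h₁⟩ := (rapid_bjCoeff (by linarith : -1 < ν + 1)).exists_bound R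
  by_cases hR : R < 0
  · exact ⟨0, le_rfl, fun E r hE => absurd (hE.trans_lt hR) (not_lt.2 (abs_nonneg E))⟩
  push Not at hR
  set D : ℝ := (1 + R) * (|1 / 2 + ν| + 1) * C + 2 * R * C₁ with hD
  have hCD : C * (1 + R) ≤ D := by
    have : 0 ≤ (1 + R) * |1 / 2 + ν| * C := by positivity
    have : 0 ≤ 2 * R * C₁ := by positivity
    rw [hD]; nlinarith
  have hC1 : C ≤ D := by nlinarith
  have hCR : C * R ≤ D := by nlinarith
  have hD1 : |1 / 2 + ν| * C + 2 * R * C₁ ≤ D := by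
    have : 0 ≤ R * (|1 / 2 + ν| + 1) * C + C := by positivity
    rw [hD]; nlinarith
  have hD2 : |1 / 2 + ν| * (C * R) + 2 * R * C₁ ≤ D := by
    have : 0 ≤ (|1 / 2 + ν| + 1) * C + R * C := by positivity
    rw [hD]; nlinarith
  have hD0 : 0 ≤ D := hC.trans hC1
  refine ⟨D, hD0, fun E r hE hr hr1 => ?_⟩
  obtain ⟨z1, z2⟩ := abs_energy_le hE hr hr1
  set z := E * r ^ 2 / 4
  obtain ⟨a1, a2⟩ := h z z1
  obtain ⟨b1, -⟩ := h₁ z z1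
  have hz0 : (0 : ℝ) * r ^ 2 / 4 = 0 := by ring
  have p1 : r ^ (1 / 2 + ν) ≤ r ^ (-β) := Real.rpow_le_rpow_of_exponent_ge hr hr1 hβ
  have p2 : r ^ (ν - 1 / 2) ≤ r ^ (-1 - β) :=
    Real.rpow_le_rpow_of_exponent_ge hr hr1 (by linarith)
  have e1 : r ^ (2 - β) = r ^ (-β) * r ^ 2 := by
    rw [← Real.rpow_natCast, ← Real.rpow_add hr]; congr 1; push_cast; ring
  have e2 : r ^ (1 - β) = r ^ (-1 - β) * r ^ 2 := by
    rw [← Real.rpow_natCast, ← Real.rpow_add hr]; congr 1; push_cast; ring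
  have s1 : 0 ≤ r ^ (1 / 2 + ν) := by positivity
  have s2 : 0 ≤ r ^ (ν - 1 / 2) := by positivity
  have a2' : |pser (bjCoeff ν) z - pser (bjCoeff ν) 0| ≤ C * R * r ^ 2 :=
    a2.trans (by rw [mul_assoc]; gcongr)
  refine ⟨?_, ?_, ?_, ?_⟩
  · rw [powSol, abs_mul, abs_of_nonneg s1, mul_comm]
    exact mul_le_mul (a1.trans hC1) p1 s1 hD0
  · rw [powSolDeriv, abs_mul, abs_of_nonneg s2, mul_comm]
    refine mul_le_mul ?_ p2 s2 hD0
    refine (abs_sub _ _).trans ?_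
    rw [abs_mul, abs_mul, abs_mul, abs_two]
    calc _ ≤ |1 / 2 + ν| * C + 2 * R * C₁ := by gcongr; exacts [a1, b1]
      _ ≤ D := hD1
  · rw [powSol, powSol, hz0, ← mul_sub, abs_mul, abs_of_nonneg s1, e1]
    calc _ ≤ r ^ (-β) * (C * R * r ^ 2) := by gcongr; exact a2'
      _ = C * R * (r ^ (-β) * r ^ 2) := by ring
      _ ≤ _ := by gcongr
  · rw [powSolDeriv, powSolDeriv, hz0, ← mul_sub, abs_mul, abs_of_nonneg s2, e2]
    have : |(1 / 2 + ν) * bj ν z - 2 * z * bj (ν + 1) z -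
        ((1 / 2 + ν) * bj ν 0 - 2 * 0 * bj (ν + 1) 0)| ≤ D * r ^ 2 := by
      rw [show (1 / 2 + ν) * bj ν z - 2 * z * bj (ν + 1) z -
        ((1 / 2 + ν) * bj ν 0 - 2 * 0 * bj (ν + 1) 0) =
        (1 / 2 + ν) * (bj ν z - bj ν 0) - 2 * z * bj (ν + 1) z by ring]
      refine (abs_sub _ _).trans ?_
      rw [abs_mul, abs_mul, abs_mul, abs_two]
      calc _ ≤ |1 / 2 + ν| * (C * R * r ^ 2) + 2 * (R * r ^ 2) * C₁ := by
            gcongr; exacts [a2', b1]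
        _ = (|1 / 2 + ν| * (C * R) + 2 * R * C₁) * r ^ 2 := by ring
        _ ≤ _ := by gcongr
    calc _ ≤ r ^ (-1 - β) * (D * r ^ 2) := by gcongr
      _ = _ := by ring

/-- On `(0, 1]` one has `√r |log r| ≤ 2`, so the logarithm is absorbed and `β = 0` is possible. -/
theorem nearBound_logSol : NearBound 0 logSol logSolDeriv := by
  intro R
  obtain ⟨C, hC, h⟩ := (rapid_bjCoeff (by norm_num : (-1 : ℝ) < 0)).exists_bound R
  obtain ⟨C₁, hC₁, h₁⟩ := (rapid_bjCoeff (by norm_num : (-1 : ℝ) < 1)).exists_bound R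
  obtain ⟨C₂, hC₂, h₂⟩ := rapid_bhCoeff.exists_bound R
  obtain ⟨C₃, hC₃, h₃⟩ := rapid_bhCoeff.derived.exists_bound R
  by_cases hR : R < 0
  · exact ⟨0, le_rfl, fun E r hE => absurd (hE.trans_lt hR) (not_lt.2 (abs_nonneg E))⟩
  push Not at hR
  set M : ℝ := max C (max C₁ (max C₂ C₃)) with hM
  have m0 : C ≤ M := le_max_left _ _
  have m1 : C₁ ≤ M := (le_max_left _ _).trans (le_max_right _ _)
  have m2 : C₂ ≤ M := ((le_max_left _ _).trans (le_max_right _ _)).trans (le_max_right _ _)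
  have m3 : C₃ ≤ M := ((le_max_right _ _).trans (le_max_right _ _)).trans (le_max_right _ _)
  have hM0 : 0 ≤ M := hC.trans m0
  refine ⟨M * (5 + 10 * R), by positivity, fun E r hE hr hr1 => ?_⟩
  obtain ⟨z1, z2⟩ := abs_energy_le hE hr hr1
  set z := E * r ^ 2 / 4
  have hz0 : (0 : ℝ) * r ^ 2 / 4 = 0 := by ring
  have a1 : |bj 0 z| ≤ M := (h z z1).1.trans m0
  have a2 : |bj 0 z - bj 0 0| ≤ M * (R * r ^ 2) := (h z z1).2.trans (by gcongr)
  have b1 : |bj 1 z| ≤ M := (h₁ z z1).1.trans m1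
  have c1 : |bh z| ≤ M := (h₂ z z1).1.trans m2
  have c2 : |bh z - bh 0| ≤ M * (R * r ^ 2) := (h₂ z z1).2.trans (by gcongr)
  have d1 : |pser (dshift bhCoeff) z| ≤ M := (h₃ z z1).1.trans m3
  have hl : |r ^ (1 / 2 : ℝ) * Real.log r| ≤ 2 := by
    have := (Real.abs_log_mul_self_rpow_lt r (1 / 2) hr hr1 (by norm_num)).le
    rw [mul_comm]; norm_num at this ⊢; exact this
  have hs0 : 0 ≤ r ^ (1 / 2 : ℝ) := by positivity
  have hs : r ^ (1 / 2 : ℝ) ≤ 1 := Real.rpow_le_one hr.le hr1 (by norm_num)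
  have hs' : |r ^ (1 / 2 : ℝ)| ≤ 1 := by rwa [abs_of_nonneg hs0]
  have e3 : r ^ (-(1 / 2) : ℝ) = r ^ (-1 : ℝ) * r ^ (1 / 2 : ℝ) := by
    rw [← Real.rpow_add hr]; norm_num
  have e0 : r ^ (-0 : ℝ) = 1 := by simp
  have e1 : r ^ (2 - 0 : ℝ) = r ^ 2 := by simp
  have e2 : r ^ (1 - 0 : ℝ) = r ^ (-1 : ℝ) * r ^ 2 := by
    rw [← Real.rpow_natCast, ← Real.rpow_add hr]; norm_num
  have e4 : r ^ (-1 - 0 : ℝ) = r ^ (-1 : ℝ) := by simp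
  have q0 : 0 ≤ r ^ (-1 : ℝ) := by positivity
  set s := r ^ (1 / 2 : ℝ)
  set l := s * Real.log r with hl'
  have hRr : R * r ^ 2 ≤ R := mul_le_of_le_one_right hR (pow_le_one₀ hr.le hr1)
  have k : ∀ {x y A B : ℝ}, |x| ≤ A → |y| ≤ B → |x * y| ≤ A * B := fun hx hy => by
    rw [abs_mul]; exact mul_le_mul hx hy (abs_nonneg _) ((abs_nonneg _).trans hx)
  have hMR : 0 ≤ M * R := by positivity
  have k1 := abs_le.1 (k hl a1)
  have k2 := abs_le.1 (k hs' c1)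
  have k3 := abs_le.1 (k hl a2)
  have k4 := abs_le.1 (k hs' c2)
  have k5 := abs_le.1 (k hs' a1)
  have k6 := abs_le.1 (k z1 (k hs' d1))
  have k7 := abs_le.1 (k z1 (k hl b1))
  have k6' := abs_le.1 (k z2 (k hs' d1))
  have k7' := abs_le.1 (k z2 (k hl b1))
  have k8 := abs_le.1 (k hs' a2)
  refine ⟨?_, ?_, ?_, ?_⟩
  · rw [logSol, e0, mul_one, show s * (Real.log r * bj 0 z + bh z) = l * bj 0 z + s * bh z by
      rw [hl']; ring]
    exact abs_le.2 ⟨by linarith [k1.1, k2.1], by linarith [k1.2, k2.2]⟩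
  · rw [logSolDeriv, e3, e4, show r ^ (-1 : ℝ) * s * (1 / 2 * (Real.log r * bj 0 z + bh z)
      + bj 0 z + 2 * z * (pser (dshift bhCoeff) z - Real.log r * bj 1 z)) =
      r ^ (-1 : ℝ) * (1 / 2 * (l * bj 0 z) + 1 / 2 * (s * bh z) + s * bj 0 z +
        2 * (z * (s * pser (dshift bhCoeff) z)) - 2 * (z * (l * bj 1 z))) by rw [hl']; ring,
      abs_mul, abs_of_nonneg q0, mul_comm]
    gcongr
    exact abs_le.2 ⟨by linarith [k1.1, k2.1, k5.1, k6.1, k7.2],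
      by linarith [k1.2, k2.2, k5.2, k6.2, k7.1]⟩
  · rw [logSol, logSol, hz0, e1, show s * (Real.log r * bj 0 z + bh z) -
      s * (Real.log r * bj 0 0 + bh 0) = l * (bj 0 z - bj 0 0) + s * (bh z - bh 0) by
      rw [hl']; ring]
    have : 0 ≤ M * R * r ^ 2 := by positivity
    have : 0 ≤ M * r ^ 2 := by positivity
    exact abs_le.2 ⟨by linarith [k3.1, k4.1], by linarith [k3.2, k4.2]⟩
  · rw [logSolDeriv, logSolDeriv, hz0, e3, e2, show r ^ (-1 : ℝ) * s *
      (1 / 2 * (Real.log r * bj 0 z + bh z)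
      + bj 0 z + 2 * z * (pser (dshift bhCoeff) z - Real.log r * bj 1 z)) -
      r ^ (-1 : ℝ) * s * (1 / 2 * (Real.log r * bj 0 0 + bh 0)
      + bj 0 0 + 2 * 0 * (pser (dshift bhCoeff) 0 - Real.log r * bj 1 0)) =
      r ^ (-1 : ℝ) * (1 / 2 * (l * (bj 0 z - bj 0 0)) + 1 / 2 * (s * (bh z - bh 0)) +
        s * (bj 0 z - bj 0 0) +
        2 * (z * (s * pser (dshift bhCoeff) z)) - 2 * (z * (l * bj 1 z))) by rw [hl']; ring,
      abs_mul, abs_of_nonneg q0, show M * (5 + 10 * R) * (r ^ (-1 : ℝ) * r ^ 2) =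
        r ^ (-1 : ℝ) * (M * (5 + 10 * R) * r ^ 2) by ring]
    gcongr
    have : 0 ≤ M * R * r ^ 2 := by positivity
    have : 0 ≤ M * r ^ 2 := by positivity
    exact abs_le.2 ⟨by linarith [k3.1, k4.1, k8.1, k6'.1, k7'.2],
      by linarith [k3.2, k4.2, k8.2, k6'.2, k7'.1]⟩

end AnyonDelta

end
noncomputable section

namespace AnyonDelta

/-! ### The solutions that are normalized at the origin -/

/-- The regular solution at energy `E`. -/
def regSol (α E r : ℝ) : ℝ := Real.Gamma (1 + α) * powSol α E r

/-- The derivative of `regSol`. -/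
def regSolDeriv (α E r : ℝ) : ℝ := Real.Gamma (1 + α) * powSolDeriv α E r

/-- The irregular solution at energy `E`. -/
def irrSol (α E r : ℝ) : ℝ :=
  if α = 0 then -logSol E r
  else 1 / (2 * α) * (Real.Gamma (1 - α) * powSol (-α) E r - Real.Gamma (1 + α) * powSol α E r)

/-- The derivative of `irrSol`. -/
def irrSolDeriv (α E r : ℝ) : ℝ :=
  if α = 0 then -logSolDeriv E r
  else 1 / (2 * α) *
    (Real.Gamma (1 - α) * powSolDeriv (-α) E r - Real.Gamma (1 + α) * powSolDeriv α E r)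

/-- The solution at energy `E` that satisfies the boundary condition of the δ-potential. -/
def bcSol (α s E r : ℝ) : ℝ := irrSol α E r + s * regSol α E r

/-- The derivative of `bcSol`. -/
def bcSolDeriv (α s E r : ℝ) : ℝ := irrSolDeriv α E r + s * regSolDeriv α E r

section
variable {α : ℝ} (hα0 : 0 ≤ α) (hα1 : α < 1) (s E : ℝ)
include hα0

theorem isSol_regSol : IsSol (α ^ 2 - 1 / 4) E (regSol α E) (regSolDeriv α E) :=
  (isSol_powSol (by linarith) E).const_mul _

theorem nearBound_regSol : NearBound (α / 2) (regSol α) (regSolDeriv α) :=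
  (nearBound_powSol (by linarith) (by linarith)).const_mul _

include hα1

theorem isSol_irrSol : IsSol (α ^ 2 - 1 / 4) E (irrSol α E) (irrSolDeriv α E) := by
  by_cases h : α = 0
  · subst h
    have := (isSol_logSol E).const_mul (-1)
    unfold irrSol irrSolDeriv
    simpa only [if_true, neg_one_mul] using this
  · have h2 := isSol_powSol (ν := -α) (by linarith) E
    rw [neg_sq] at h2
    unfold irrSol irrSolDeriv
    simp only [if_neg h]
    exact ((h2.const_mul _).sub ((isSol_powSol (by linarith) E).const_mul _)).const_mul _

theorem isSol_bcSol : IsSol (α ^ 2 - 1 / 4) E (bcSol α s E) (bcSolDeriv α s E) :=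
  (isSol_irrSol hα0 hα1 E).add ((isSol_regSol hα0 E).const_mul s)

/-- The exponent `α/2` is admissible for the irregular part because `1/2 - α ≥ -α/2` for `α ≤ 1`,
and it is below `1/2`, as the comparison of Wronskians and square integrability at the origin
require. -/
theorem nearBound_irrSol : NearBound (α / 2) (irrSol α) (irrSolDeriv α) := by
  by_cases h : α = 0
  · subst h
    have := nearBound_logSol.const_mul (-1)
    unfold irrSol irrSolDeriv
    simpa only [if_true, neg_one_mul, zero_div] using this
  · have h1 := (nearBound_powSol (ν := -α) (β := α / 2) (by linarith) (by linarith)).const_mul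
      (Real.Gamma (1 - α))
    have h2 := (nearBound_powSol (ν := α) (β := α / 2) (by linarith) (by linarith)).const_mul
      (-Real.Gamma (1 + α))
    have := (h1.add h2).const_mul (1 / (2 * α))
    unfold irrSol irrSolDeriv
    simpa only [if_neg h, neg_mul, ← sub_eq_add_neg] using this

theorem nearBound_bcSol : NearBound (α / 2) (bcSol α s) (bcSolDeriv α s) :=
  (nearBound_irrSol hα0 hα1).add ((nearBound_regSol hα0).const_mul s)

end

theorem regSol_zero {α : ℝ} (hα0 : 0 ≤ α) (r : ℝ) : regSol α 0 r = r ^ (1 / 2 + α) := by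
  have : Real.Gamma (1 + α) ≠ 0 := (Real.Gamma_pos_of_pos (by linarith)).ne'
  rw [regSol, powSol, zero_mul, zero_div, bj_zero, add_comm α 1]
  field_simp

theorem regSolDeriv_zero {α : ℝ} (hα0 : 0 ≤ α) (r : ℝ) :
    regSolDeriv α 0 r = (1 / 2 + α) * r ^ (α - 1 / 2) := by
  have : Real.Gamma (1 + α) ≠ 0 := (Real.Gamma_pos_of_pos (by linarith)).ne'
  rw [regSolDeriv, powSolDeriv, zero_mul, zero_div, bj_zero, add_comm α 1]
  field_simp
  ring

theorem irrSol_zero {α : ℝ} (hα0 : 0 ≤ α) (hα1 : α < 1) (r : ℝ) :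
    irrSol α 0 r = zeroIrregular α r := by
  rw [irrSol, zeroIrregular]
  split_ifs with h
  · rw [logSol, zero_mul, zero_div, bj_zero, bh_zero, Real.sqrt_eq_rpow]
    simp
  · have h1 : Real.Gamma (1 + α) ≠ 0 := (Real.Gamma_pos_of_pos (by linarith)).ne'
    have h2 : Real.Gamma (1 - α) ≠ 0 := (Real.Gamma_pos_of_pos (by linarith)).ne'
    rw [powSol, powSol, zero_mul, zero_div, bj_zero, bj_zero, add_comm α 1,
      show -α + 1 = 1 - α by ring, show 1 / 2 + -α = 1 / 2 - α by ring]
    field_simp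

theorem irrSolDeriv_zero {α : ℝ} (hα0 : 0 ≤ α) (hα1 : α < 1) (r : ℝ) :
    irrSolDeriv α 0 r = if α = 0 then -(r ^ (-(1 / 2) : ℝ) * (1 / 2 * Real.log r + 1))
      else 1 / (2 * α) *
        ((1 / 2 - α) * r ^ (-α - 1 / 2) - (1 / 2 + α) * r ^ (α - 1 / 2)) := by
  rw [irrSolDeriv]
  split_ifs with h
  · rw [logSolDeriv, zero_mul, zero_div, bj_zero, bh_zero]
    simp
  · have h1 : Real.Gamma (1 + α) ≠ 0 := (Real.Gamma_pos_of_pos (by linarith)).ne'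
    have h2 : Real.Gamma (1 - α) ≠ 0 := (Real.Gamma_pos_of_pos (by linarith)).ne'
    rw [powSolDeriv, powSolDeriv, zero_mul, zero_div, bj_zero α, bj_zero (-α), add_comm α 1,
      show -α + 1 = 1 - α by ring]
    field_simp
    ring

theorem wronskian_zero_energy {α : ℝ} (hα0 : 0 ≤ α) (hα1 : α < 1) {r : ℝ} (hr : 0 < r) :
    irrSol α 0 r * regSolDeriv α 0 r - regSol α 0 r * irrSolDeriv α 0 r = 1 := by
  rw [irrSol_zero hα0 hα1, irrSolDeriv_zero hα0 hα1, regSol_zero hα0, regSolDeriv_zero hα0,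
    zeroIrregular]
  split_ifs with h
  · subst h
    rw [Real.sqrt_eq_rpow, add_zero, zero_sub, Real.rpow_neg hr.le]
    have : r ^ (1 / 2 : ℝ) ≠ 0 := (Real.rpow_pos_of_pos hr _).ne'
    field_simp
    ring
  · have e1 : r ^ (1 / 2 - α) = r ^ (1 / 2 : ℝ) * (r ^ α)⁻¹ := by
      rw [Real.rpow_sub hr, div_eq_mul_inv]
    have e2 : r ^ (1 / 2 + α) = r ^ (1 / 2 : ℝ) * r ^ α := Real.rpow_add hr _ _
    have e3 : r ^ (α - 1 / 2) = (r ^ (1 / 2 : ℝ))⁻¹ * r ^ α := by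
      rw [Real.rpow_sub hr, div_eq_mul_inv, mul_comm]
    have e4 : r ^ (-α - 1 / 2) = (r ^ (1 / 2 : ℝ))⁻¹ * (r ^ α)⁻¹ := by
      rw [Real.rpow_sub hr, Real.rpow_neg hr.le, div_eq_mul_inv, mul_comm]
    have h1 : r ^ (1 / 2 : ℝ) ≠ 0 := (Real.rpow_pos_of_pos hr _).ne'
    have h2 : r ^ α ≠ 0 := (Real.rpow_pos_of_pos hr _).ne'
    rw [e1, e2, e3, e4]
    field_simp
    ring

theorem boundaryFn_eq {α : ℝ} (hα0 : 0 ≤ α) (hα1 : α < 1) (s : ℝ) :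
    boundaryFn α s = fun r => (bcSol α s 0 r : ℂ) := by
  ext r
  rw [boundaryFn, bcSol, irrSol_zero hα0 hα1, regSol_zero hα0, zeroRegular]

theorem zeroRegular_eq {α : ℝ} (hα0 : 0 ≤ α) :
    (fun r => (zeroRegular α r : ℂ)) = fun r => (regSol α 0 r : ℂ) := by
  ext r
  rw [regSol_zero hα0, zeroRegular]

/-- Wronskians of controlled solutions at different energies differ little near the origin. -/
theorem NearBound.wronskian_sub_le {β : ℝ} {X Y X₁ Y₁ : ℝ → ℝ → ℝ} (h : NearBound β X Y)
    (h₁ : NearBound β X₁ Y₁) (R : ℝ) : ∃ C : ℝ, 0 ≤ C ∧ ∀ E E' r : ℝ, |E| ≤ R → |E'| ≤ R →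
      0 < r → r ≤ 1 →
      |X E r * Y₁ E' r - X₁ E' r * Y E r - (X 0 r * Y₁ 0 r - X₁ 0 r * Y 0 r)|
        ≤ C * r ^ (1 - 2 * β) := by
  obtain ⟨C, hC, k⟩ := h R
  obtain ⟨C₁, hC₁, k₁⟩ := h₁ R
  refine ⟨4 * (C * C₁), by positivity, fun E E' r hE hE' hr hr1 => ?_⟩
  have h0 : |(0 : ℝ)| ≤ R := by rw [abs_zero]; exact (abs_nonneg _).trans hE
  obtain ⟨a1, a2, a3, a4⟩ := k E r hE hr hr1
  obtain ⟨b1, b2, b3, b4⟩ := k₁ E' r hE' hr hr1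
  obtain ⟨a1', a2', -, -⟩ := k 0 r h0 hr hr1
  obtain ⟨b1', b2', -, -⟩ := k₁ 0 r h0 hr hr1
  have key : ∀ {x y A B p q : ℝ}, |x| ≤ A * r ^ p → |y| ≤ B * r ^ q → p + q = 1 - 2 * β →
      |x * y| ≤ A * B * r ^ (1 - 2 * β) := by
    intro x y A B p q hx hy hpq
    rw [abs_mul, ← hpq, Real.rpow_add hr, show A * B * (r ^ p * r ^ q) =
      A * r ^ p * (B * r ^ q) by ring]
    exact mul_le_mul hx hy (abs_nonneg _) ((abs_nonneg _).trans hx)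
  have t1 := abs_le.1 (key a3 b2 (by ring))
  have t2 := abs_le.1 (key a1' b4 (by ring))
  have t3 := abs_le.1 (key b3 a2 (by ring))
  have t4 := abs_le.1 (key b1' a4 (by ring))
  -- Telescoping: each of the four products contains one difference from zero energy, and all the
  -- exponents add up to `1 - 2β`.
  rw [show X E r * Y₁ E' r - X₁ E' r * Y E r - (X 0 r * Y₁ 0 r - X₁ 0 r * Y 0 r) =
    (X E r - X 0 r) * Y₁ E' r + X 0 r * (Y₁ E' r - Y₁ 0 r) - (X₁ E' r - X₁ 0 r) * Y E r
      - X₁ 0 r * (Y E r - Y 0 r) by ring]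
  exact abs_le.2 ⟨by linarith [t1.1, t2.1, t3.2, t4.2], by linarith [t1.2, t2.2, t3.1, t4.1]⟩

theorem tendsto_rpow_nhdsGT {p : ℝ} (hp : 0 < p) : Tendsto (fun r : ℝ => r ^ p) (𝓝[>] 0) (𝓝 0) := by
  have := (Real.continuousAt_rpow_const 0 p (Or.inr hp.le)).tendsto
  rw [Real.zero_rpow hp.ne'] at this
  exact this.mono_left nhdsWithin_le_nhds

/-- For `β < 1/2` the boundary values of solutions do not feel the energy: a zero energy function
tests solutions of any energy. -/
theorem NearBound.tendsto_wronskian {β : ℝ} (hβ : β < 1 / 2) {X Y X₁ Y₁ : ℝ → ℝ → ℝ}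
    (h : NearBound β X Y) (h₁ : NearBound β X₁ Y₁) (E E' : ℝ) {w : ℝ}
    (hw : ∀ r, 0 < r → X 0 r * Y₁ 0 r - X₁ 0 r * Y 0 r = w) :
    Tendsto (fun r => X E r * Y₁ E' r - X₁ E' r * Y E r) (𝓝[>] 0) (𝓝 w) := by
  obtain ⟨C, hC, k⟩ := h.wronskian_sub_le h₁ (max |E| |E'|)
  have t : Tendsto (fun r : ℝ => C * r ^ (1 - 2 * β)) (𝓝[>] 0) (𝓝 0) := by
    simpa using (tendsto_rpow_nhdsGT (by linarith : 0 < 1 - 2 * β)).const_mul C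
  rw [tendsto_iff_norm_sub_tendsto_zero]
  refine squeeze_zero' (Eventually.of_forall fun r => norm_nonneg _) ?_ t
  filter_upwards [Ioc_mem_nhdsGT (zero_lt_one' ℝ)] with r hr
  rw [← hw r hr.1, Real.norm_eq_abs]
  exact k E E' r (le_max_left _ _) (le_max_right _ _) hr.1 hr.2

section
variable {α : ℝ} (hα0 : 0 ≤ α) (hα1 : α < 1) (s E : ℝ)
include hα0 hα1

/-- Constant in `r` by the equation; its limit at the origin is the zero energy value. -/
theorem wronskian_bc_reg {r : ℝ} (hr : 0 < r) :
    bcSol α s E r * regSolDeriv α E r - regSol α E r * bcSolDeriv α s E r = 1 := by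
  have hw : ∀ r, 0 < r →
      bcSol α s 0 r * regSolDeriv α 0 r - regSol α 0 r * bcSolDeriv α s 0 r = 1 := fun r hr => by
    rw [← wronskian_zero_energy hα0 hα1 hr, bcSol, bcSolDeriv]; ring
  have t := (nearBound_bcSol hα0 hα1 s).tendsto_wronskian (by linarith) (nearBound_regSol hα0) E E
    hw
  refine tendsto_nhds_unique (l := 𝓝[>] (0 : ℝ)) (tendsto_const_nhds.congr' ?_) t
  filter_upwards [self_mem_nhdsWithin] with x hx
  exact (isSol_bcSol hα0 hα1 s E).wronskian_const (isSol_regSol hα0 E) hr hx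

/-- A solution is the combination of the two normalized ones given by its Wronskians. -/
theorem IsSol.eq_combination {φ φ' : ℝ → ℂ} (h : IsSol (α ^ 2 - 1 / 4) E φ φ') :
    ∃ a b : ℂ, (∀ r, 0 < r → φ r = a * regSol α E r + b * bcSol α s E r) ∧
      ∀ r, 0 < r → φ' r = a * regSolDeriv α E r + b * bcSolDeriv α s E r := by
  have hF := (isSol_regSol hα0 E).ofReal
  have hB := (isSol_bcSol hα0 hα1 s E).ofReal
  refine ⟨bcSol α s E 1 * φ' 1 - φ 1 * bcSolDeriv α s E 1,
    φ 1 * regSolDeriv α E 1 - regSol α E 1 * φ' 1, fun r hr => ?_, fun r hr => ?_⟩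
  all_goals
    rw [hB.wronskian_const h one_pos hr, h.wronskian_const hF one_pos hr]
    have e := congrArg (fun x : ℝ => (x : ℂ)) (wronskian_bc_reg hα0 hα1 s E hr)
    push_cast at e
  · linear_combination (-φ r) * e
  · linear_combination (-φ' r) * e

end

/-! ### Differential equations and boundary conditions in terms of `deriv` -/

theorem IsSol.deriv_eq {c E : ℝ} {u v : ℝ → ℂ} (h : IsSol c E u v) {r : ℝ} (hr : 0 < r) :
    deriv u r = v r := (h.left r hr).deriv

theorem IsSol.congr {c E : ℝ} {u v u₁ : ℝ → ℂ} (h : IsSol c E u v) (e : ∀ r, 0 < r → u₁ r = u r) :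
    IsSol c E u₁ v := by
  refine ⟨fun r hr => (h.left r hr).congr_of_eventuallyEq ?_, fun r hr => ?_⟩
  · filter_upwards [Ioi_mem_nhds hr] with x hx using e x hx
  · rw [e r hr]; exact h.right r hr

theorem IsSol.deriv_deriv_eq {c E : ℝ} {u v : ℝ → ℂ} (h : IsSol c E u v) {r : ℝ} (hr : 0 < r) :
    HasDerivAt (deriv u) ((c / r ^ 2 - E) • u r) r := by
  refine (h.right r hr).congr_of_eventuallyEq ?_
  filter_upwards [Ioi_mem_nhds hr] with x hx using h.deriv_eq hx

theorem IsSol.radialExpr_eq {α E : ℝ} {u v : ℝ → ℂ} (h : IsSol (α ^ 2 - 1 / 4) E u v) {r : ℝ}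
    (hr : 0 < r) : radialExpr α u r = E * u r := by
  rw [radialExpr, (h.deriv_deriv_eq hr).deriv, Complex.real_smul]
  push_cast; ring

theorem isSol_of_radialExpr {α E : ℝ} {u : ℝ → ℂ} (h1 : ∀ r, 0 < r → DifferentiableAt ℝ u r)
    (h2 : ∀ r, 0 < r → DifferentiableAt ℝ (deriv u) r)
    (h3 : ∀ r, 0 < r → radialExpr α u r = E * u r) : IsSol (α ^ 2 - 1 / 4) E u (deriv u) := by
  refine ⟨fun r hr => (h1 r hr).hasDerivAt, fun r hr => (h2 r hr).hasDerivAt.congr_deriv ?_⟩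
  have := h3 r hr
  rw [radialExpr] at this
  rw [Complex.real_smul]
  push_cast at this ⊢
  linear_combination -this

theorem deriv_congr_Ioi {u v : ℝ → ℂ} (h : ∀ r, 0 < r → u r = v r) {r : ℝ} (hr : 0 < r) :
    deriv u r = deriv v r := by
  refine Filter.EventuallyEq.deriv_eq ?_
  filter_upwards [Ioi_mem_nhds hr] with x hx using h x hx

theorem boundaryCondition_iff {u u' : ℝ → ℝ} {ψ : ℝ → ℂ}
    (hu : ∀ r, 0 < r → HasDerivAt u (u' r) r) :
    BoundaryCondition (fun r => (u r : ℂ)) ψ ↔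
      Tendsto (fun r => u r * deriv ψ r - ψ r * u' r) (𝓝[>] 0) (𝓝 0) := by
  refine tendsto_congr' ?_
  filter_upwards [self_mem_nhdsWithin] with r hr
  rw [wronskian, (hu r hr).ofReal_comp.deriv]

section
variable {α : ℝ} (hα0 : 0 ≤ α) (hα1 : α < 1) (s E : ℝ)
include hα0 hα1

theorem boundaryCondition_boundaryFn_iff {ψ : ℝ → ℂ} : BoundaryCondition (boundaryFn α s) ψ ↔
    Tendsto (fun r => bcSol α s 0 r * deriv ψ r - ψ r * bcSolDeriv α s 0 r) (𝓝[>] 0) (𝓝 0) := by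
  rw [boundaryFn_eq hα0 hα1]
  exact boundaryCondition_iff (isSol_bcSol hα0 hα1 s 0).left

theorem boundaryCondition_bcSol {ψ : ℝ → ℂ} {a : ℂ} (h : ∀ r, 0 < r → ψ r = a * bcSol α s E r) :
    BoundaryCondition (boundaryFn α s) ψ := by
  rw [boundaryCondition_boundaryFn_iff hα0 hα1]
  have hB := nearBound_bcSol hα0 hα1 s
  have t := (tendsto_ofReal_zero (hB.tendsto_wronskian (by linarith) hB 0 E
    (w := 0) fun r hr => by ring)).const_mul a
  rw [mul_zero] at t
  refine t.congr' ?_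
  filter_upwards [self_mem_nhdsWithin] with r hr
  rw [deriv_congr_Ioi h hr, h r hr,
    ((isSol_bcSol hα0 hα1 s E).ofReal.const_mul a).deriv_eq hr]
  push_cast; ring

/-- The solutions of the eigenvalue equation that satisfy the boundary condition. -/
theorem IsSol.eq_mul_bcSol {φ φ' : ℝ → ℂ} (h : IsSol (α ^ 2 - 1 / 4) E φ φ')
    (hbc : BoundaryCondition (boundaryFn α s) φ) :
    ∃ b : ℂ, ∀ r, 0 < r → φ r = b * bcSol α s E r := by
  obtain ⟨a, b, e, e'⟩ := h.eq_combination hα0 hα1 s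
  rw [boundaryCondition_boundaryFn_iff hα0 hα1] at hbc
  have hB := nearBound_bcSol hα0 hα1 s
  have t1 := (tendsto_ofReal_zero (hB.tendsto_wronskian (by linarith) hB 0 E
    (w := 0) fun r hr => by ring)).const_mul b
  have t2 := ((Complex.continuous_ofReal.tendsto 1).comp
    (hB.tendsto_wronskian (by linarith) (nearBound_regSol hα0) 0 E
    fun r hr => wronskian_bc_reg hα0 hα1 s 0 hr)).const_mul a
  have t3 := t2.add t1
  -- The Wronskian with the boundary function tends to `a`: that of `regSol` tends to one and that
  -- of `bcSol` to zero.
  have : a = 0 := by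
    refine tendsto_nhds_unique (l := 𝓝[>] (0 : ℝ)) (?_ : Tendsto _ _ (𝓝 a)) hbc
    rw [Complex.ofReal_one, mul_one, mul_zero, add_zero] at t3
    refine t3.congr' ?_
    filter_upwards [self_mem_nhdsWithin] with r hr
    rw [h.deriv_eq hr, e r hr, e' r hr]
    simp only [Function.comp_apply]
    push_cast; ring
  refine ⟨b, fun r hr => ?_⟩
  rw [e r hr, this, zero_mul, zero_add]

end

end AnyonDelta

end
noncomputable section

namespace AnyonDelta

/-! ### The outgoing state -/

theorem phiFree_eq {α k r : ℝ} (hk : 0 < k) (hr : 0 < r) : phiFree α k r = pJ α (k * r) := by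
  rw [phiFree, pJ_eq (mul_pos hk hr), mul_assoc π k r]

theorem qY_eq {α x : ℝ} (hx : 0 < x) : qY α x = √(π * x / 2) *
    (if α = 0 then besselYZero x
      else (Real.cos (π * α) * besselJ α x - besselJ (-α) x) / Real.sin (π * α)) := by
  rw [qY]
  split_ifs with h
  · rw [besselYZero_eq, besselJ_eq hx, Real.rpow_zero, one_mul, logSol, powSol, one_mul,
      Real.log_div hx.ne' two_ne_zero, add_zero, show π * x / 2 = π / 2 * x by ring,
      Real.sqrt_mul (by positivity), Real.sqrt_eq_rpow x]
    ring
  · rw [pJ_eq hx, pJ_eq hx]; ring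

theorem chiFree_eq {α k r : ℝ} (hα0 : 0 ≤ α) (hα1 : α < 1) (hk : 0 < k) (hr : 0 < r) :
    chiFree α k r = chi α (k * r) := by
  have hx := mul_pos hk hr
  rw [chiFree, chi, qY_eq hx, pJ_eq hx, mul_assoc π k r, hankelOne]
  split_ifs with h
  · subst h; push_cast; ring
  · have hs : ((Real.sin (π * α) : ℝ) : ℂ) ≠ 0 :=
      Complex.ofReal_ne_zero.2 (sin_pi_mul_pos (lt_of_le_of_ne hα0 (Ne.symm h)) hα1).ne'
    have he : Complex.exp (-(Complex.I * (π * α)))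
        = (Real.cos (π * α) : ℂ) - Complex.I * (Real.sin (π * α) : ℂ) := by
      rw [show -(Complex.I * (π * α)) = ((-(π * α) : ℝ) : ℂ) * Complex.I by push_cast; ring,
        Complex.exp_mul_I, ← Complex.ofReal_cos, ← Complex.ofReal_sin, Real.cos_neg, Real.sin_neg]
      push_cast; ring
    rw [he]
    push_cast at hs ⊢
    field_simp
    linear_combination (√(π * k * r / 2) : ℂ) * ((besselJ (-α) (k * r) : ℂ)
      - Complex.cos (π * α) * besselJ α (k * r)) * Complex.I_sq

/-- The cotangent of the phase shift. -/
def cotPhase (α s k : ℝ) : ℝ :=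
  if α = 0 then 2 / π * (Real.log (k / 2) + Real.eulerMascheroniConstant + s)
  else (k / 2) ^ (-(2 * α)) * (2 * s * α - 1) * (1 / Real.sin (π * α))
    * (Real.Gamma (1 + α) / Real.Gamma (1 - α)) + Real.cot (π * α)

theorem ofReal_sub_I_ne_zero (x : ℝ) : (x : ℂ) - Complex.I ≠ 0 := fun h => by
  simpa using congrArg Complex.im h

/-- For `α = 0` the logarithm of `k/(2i)` has imaginary part `-π/2`; once `π/2` is factored out this
becomes the `-i` of the case `α > 0`, and both cases take one form. -/
theorem resolventCoeff_eq {α s k : ℝ} (hk : 0 < k) :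
    resolventCoeff k α s = π / 2 * ((cotPhase α s k : ℂ) - Complex.I)⁻¹ := by
  rw [resolventCoeff, cotPhase]
  split_ifs with h
  · have hl : Complex.log (k / (2 * Complex.I)) = (Real.log (k / 2) : ℂ) - π / 2 * Complex.I := by
      rw [show (k : ℂ) / (2 * Complex.I) = ((k / 2 : ℝ) : ℂ) * (-Complex.I) by
        push_cast; field_simp; rw [Complex.I_sq]; ring,
        Complex.log_ofReal_mul (by positivity) (neg_ne_zero.2 Complex.I_ne_zero), Complex.log_neg_I]
      ring
    have hπ : (π : ℂ) ≠ 0 := Complex.ofReal_ne_zero.2 pi_ne_zero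
    rw [hl, show (Real.log (k / 2) : ℂ) - π / 2 * Complex.I + Real.eulerMascheroniConstant + s
      = π / 2 * (((2 / π * (Real.log (k / 2) + Real.eulerMascheroniConstant + s) : ℝ) : ℂ)
        - Complex.I) by push_cast; field_simp; ring, mul_inv]
    field_simp
    ring
  · rfl

/-- The scattering matrix in terms of the cotangent of the phase shift. -/
theorem one_add_resolventCoeff {α s k : ℝ} (hk : 0 < k) :
    1 + 4 * Complex.I / π * resolventCoeff k α s
      = (cotPhase α s k + Complex.I) / (cotPhase α s k - Complex.I) := by
  have hπ : (π : ℂ) ≠ 0 := Complex.ofReal_ne_zero.2 pi_ne_zero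
  have := ofReal_sub_I_ne_zero (cotPhase α s k)
  rw [resolventCoeff_eq hk]
  field_simp
  ring

/-- The factor between the free state and the regular solution. -/
def freeFactor (α k : ℝ) : ℝ := √(π / 2) * 2 ^ (-α) * k ^ (1 / 2 + α) / Real.Gamma (1 + α)

theorem powSol_scale {ν k r : ℝ} (hk : 0 < k) (hr : 0 < r) :
    powSol ν 1 (k * r) = k ^ (1 / 2 + ν) * powSol ν (k ^ 2) r := by
  rw [powSol, powSol, Real.mul_rpow hk.le hr.le, one_mul, mul_pow, mul_assoc]

theorem pJ_scale {α k r : ℝ} (hα0 : 0 ≤ α) (hk : 0 < k) (hr : 0 < r) :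
    pJ α (k * r) = freeFactor α k * regSol α (k ^ 2) r := by
  have : Real.Gamma (1 + α) ≠ 0 := (Real.Gamma_pos_of_pos (by linarith)).ne'
  rw [pJ, powSol_scale hk hr, freeFactor, regSol]
  field_simp

/-- The factor between the outgoing state and the solution `bcSol`. -/
def bcFactor (α k : ℝ) : ℝ :=
  if α = 0 then √(π / 2) * k ^ (1 / 2 : ℝ) * (2 / π)
  else √(π / 2) * 2 ^ α * k ^ (1 / 2 - α) * (2 * α)
    / (Real.sin (π * α) * Real.Gamma (1 - α))

theorem bcFactor_pos {α k : ℝ} (hα0 : 0 ≤ α) (hα1 : α < 1) (hk : 0 < k) : 0 < bcFactor α k := by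
  rw [bcFactor]
  split_ifs with h
  · positivity
  · have h0 : 0 < α := lt_of_le_of_ne hα0 (Ne.symm h)
    have := Real.Gamma_pos_of_pos (by linarith : 0 < 1 - α)
    have := sin_pi_mul_pos h0 hα1
    positivity

/-- The origin of the coefficient `A`: `cotPhase` is the weight of `J` against `Y` that matches the
ratio of irregular and regular parts prescribed by the boundary condition. -/
theorem cotPhase_mul_pJ_sub_qY {α s k r : ℝ} (hα0 : 0 ≤ α) (hα1 : α < 1) (hk : 0 < k)
    (hr : 0 < r) : cotPhase α s k * pJ α (k * r) - qY α (k * r)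
      = bcFactor α k * bcSol α s (k ^ 2) r := by
  rw [cotPhase, qY, bcFactor, bcSol, irrSol, regSol]
  split_ifs with h
  · subst h
    have hl : logSol 1 (k * r) = k ^ (1 / 2 : ℝ) *
        (logSol (k ^ 2) r + Real.log k * powSol 0 (k ^ 2) r) := by
      rw [logSol, logSol, powSol, Real.mul_rpow hk.le hr.le, one_mul, mul_pow,
        Real.log_mul hk.ne' hr.ne', add_zero]
      ring
    rw [hl, pJ, powSol_scale hk hr, Real.log_div hk.ne' two_ne_zero, add_zero, neg_zero,
      Real.rpow_zero, add_zero, Real.Gamma_one]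
    ring
  · have h0 : 0 < α := lt_of_le_of_ne hα0 (Ne.symm h)
    have h1 := (Real.Gamma_pos_of_pos (by linarith : 0 < 1 + α)).ne'
    have h2 := (Real.Gamma_pos_of_pos (by linarith : 0 < 1 - α)).ne'
    have hs := (sin_pi_mul_pos h0 hα1).ne'
    have k1 : k ^ (1 / 2 + α) = k ^ (1 / 2 - α) * (k ^ α) ^ 2 := by
      rw [← Real.rpow_natCast, ← Real.rpow_mul hk.le, ← Real.rpow_add hk]; congr 1; push_cast; ring
    have k2 : (k / 2) ^ (-(2 * α)) = (2 ^ α) ^ 2 / (k ^ α) ^ 2 := by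
      rw [Real.rpow_neg (by positivity), Real.div_rpow hk.le two_pos.le, mul_comm 2 α,
        Real.rpow_mul hk.le, Real.rpow_mul two_pos.le]
      simp
    have hk' : k ^ α ≠ 0 := (Real.rpow_pos_of_pos hk _).ne'
    have h2' : (2 : ℝ) ^ α ≠ 0 := (Real.rpow_pos_of_pos two_pos _).ne'
    rw [pJ, pJ, powSol_scale hk hr, powSol_scale hk hr, Real.cot_eq_cos_div_sin, neg_neg,
      show 1 / 2 + -α = 1 / 2 - α by ring, k1, k2, Real.rpow_neg two_pos.le]
    field_simp
    ring

theorem outgoingFn_eq_div {α s k r : ℝ} (hα0 : 0 ≤ α) (hα1 : α < 1) (hk : 0 < k) (hr : 0 < r) :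
    outgoingFn α s k r = (cotPhase α s k * pJ α (k * r) - qY α (k * r) : ℝ)
      / ((cotPhase α s k : ℂ) - Complex.I) := by
  have := ofReal_sub_I_ne_zero (cotPhase α s k)
  have hπ : (π : ℂ) ≠ 0 := Complex.ofReal_ne_zero.2 pi_ne_zero
  rw [outgoingFn, resolventCoeff_eq hk, chiFree_eq hα0 hα1 hk hr, phiFree_eq hk hr, chi]
  push_cast
  field_simp
  linear_combination (qY α (k * r) : ℂ) * Complex.I_sq

/-- The factor between the outgoing state and `bcSol`, as a complex number. -/
def outgoingFactor (α s k : ℝ) : ℂ := bcFactor α k / ((cotPhase α s k : ℂ) - Complex.I)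

theorem outgoingFactor_ne_zero {α s k : ℝ} (hα0 : 0 ≤ α) (hα1 : α < 1) (hk : 0 < k) :
    outgoingFactor α s k ≠ 0 :=
  div_ne_zero (Complex.ofReal_ne_zero.2 (bcFactor_pos hα0 hα1 hk).ne') (ofReal_sub_I_ne_zero _)

theorem outgoingFn_eq {α s k r : ℝ} (hα0 : 0 ≤ α) (hα1 : α < 1) (hk : 0 < k) (hr : 0 < r) :
    outgoingFn α s k r = outgoingFactor α s k * bcSol α s (k ^ 2) r := by
  rw [outgoingFn_eq_div hα0 hα1 hk hr, cotPhase_mul_pJ_sub_qY hα0 hα1 hk hr, outgoingFactor]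
  push_cast; ring

theorem phiFree_eq_regSol {α k r : ℝ} (hα0 : 0 ≤ α) (hk : 0 < k) (hr : 0 < r) :
    phiFree α k r = freeFactor α k * regSol α (k ^ 2) r := by
  rw [phiFree_eq hk hr, pJ_scale hα0 hk hr]; push_cast; rfl

theorem pJ_eq_chi (α x : ℝ) : (pJ α x : ℂ) = (chi α x + (starRingEnd ℂ) (chi α x)) / 2 := by
  simp [chi]; ring

theorem tendsto_chi_sub {α : ℝ} (hα0 : 0 ≤ α) (hα1 : α < 1) : Tendsto (fun x : ℝ =>
    chi α x - phase α * Complex.exp (Complex.I * x)) atTop (𝓝 0) := by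
  obtain ⟨K, hK⟩ := chi_asymptotics hα0 hα1
  exact tendsto_zero_of_norm_le_div fun x hx => (hK x hx).1

theorem tendsto_pJ_sub {α : ℝ} (hα0 : 0 ≤ α) (hα1 : α < 1) : Tendsto (fun x : ℝ =>
    (pJ α x : ℂ) - (phase α / 2 * Complex.exp (Complex.I * x)
      + (starRingEnd ℂ) (phase α) / 2 * Complex.exp (-(Complex.I * x)))) atTop (𝓝 0) := by
  have t := tendsto_chi_sub hα0 hα1
  have t' := (Complex.continuous_conj.tendsto 0).comp t
  rw [map_zero] at t'
  have t2 := (t.add t').const_mul (1 / 2 : ℂ)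
  rw [add_zero, mul_zero] at t2
  refine t2.congr fun x => ?_
  have : (starRingEnd ℂ) (Complex.exp (Complex.I * x)) = Complex.exp (-(Complex.I * x)) := by
    rw [← Complex.exp_conj]; simp
  simp only [Function.comp_apply, pJ_eq_chi α x, map_sub, map_mul, this]
  ring

theorem tendsto_outgoingFn_sub {α k : ℝ} (s : ℝ) (hα0 : 0 ≤ α) (hα1 : α < 1) (hk : 0 < k) :
    Tendsto (fun r : ℝ => outgoingFn α s k r - phiFree α k r -
      2 * Complex.I / π * resolventCoeff k α s * phase α * Complex.exp (Complex.I * (k * r)))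
      atTop (𝓝 0) := by
  have hkr : Tendsto (fun r : ℝ => k * r) atTop atTop := tendsto_id.const_mul_atTop hk
  have t := ((tendsto_chi_sub hα0 hα1).comp hkr).const_mul
    (2 * Complex.I / π * resolventCoeff k α s)
  rw [mul_zero] at t
  refine t.congr' ?_
  filter_upwards [eventually_gt_atTop 0] with r hr
  rw [outgoingFn, chiFree_eq hα0 hα1 hk hr]
  simp only [Function.comp_apply]
  push_cast; ring

/-- The equation and the boundary condition leave one complex factor `l` in front of `outgoingFn`.
In `φ - φ_0` the incoming wave then has amplitude `(l - 1)` times half the conjugate of `phase α`,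
so the absence of incoming waves forces `l = 1`. -/
theorem isOutgoingState_iff {α k : ℝ} (s : ℝ) (hα0 : 0 ≤ α) (hα1 : α < 1) (hk : 0 < k)
    (φ : ℝ → ℂ) : IsOutgoingState α s k φ ↔ ∀ r : ℝ, 0 < r → φ r = outgoingFn α s k r := by
  have hk2 : ((k : ℂ)) ^ 2 = ((k ^ 2 : ℝ) : ℂ) := by push_cast; rfl
  constructor
  · intro h
    have hsol := isSol_of_radialExpr (E := k ^ 2) h.differentiable h.differentiable_deriv
      fun r hr => by rw [h.eigen r hr, hk2]
    obtain ⟨b, hb⟩ := hsol.eq_mul_bcSol hα0 hα1 s (k ^ 2) h.boundary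
    have hf := outgoingFactor_ne_zero (s := s) hα0 hα1 hk
    obtain ⟨l, rfl⟩ : ∃ l, b = l * outgoingFactor α s k := ⟨b / outgoingFactor α s k, by field_simp⟩
    have hφ : ∀ r, 0 < r → φ r = l * outgoingFn α s k r := fun r hr => by
      rw [hb r hr, outgoingFn_eq hα0 hα1 hk hr]; ring
    obtain ⟨c, hc⟩ := h.outgoing
    have t1 := (tendsto_outgoingFn_sub s hα0 hα1 hk).const_mul l
    have hxk : Tendsto (fun x : ℝ => x / k) atTop atTop := tendsto_id.atTop_div_const hk
    have t2 := ((hc.sub t1).comp hxk).sub ((tendsto_pJ_sub hα0 hα1).const_mul (l - 1))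
    rw [mul_zero, mul_zero, sub_zero, sub_zero] at t2
    have t3 : Tendsto (fun x : ℝ =>
        ((l - 1) * (phase α / 2) + (l * (2 * Complex.I / π * resolventCoeff k α s * phase α) - c))
          * Complex.exp (Complex.I * x)
        + (l - 1) * ((starRingEnd ℂ) (phase α) / 2) * Complex.exp (-(Complex.I * x)))
        atTop (𝓝 0) := by
      refine t2.congr' ?_
      filter_upwards [eventually_gt_atTop 0] with x hx
      have hxk0 : 0 < x / k := by positivity
      have e : (k : ℂ) * ((x / k : ℝ) : ℂ) = x := by
        have : (k : ℂ) ≠ 0 := Complex.ofReal_ne_zero.2 hk.ne'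
        push_cast; field_simp
      have e' : k * (x / k) = x := by field_simp
      simp only [Function.comp_apply]
      rw [hφ _ hxk0, phiFree_eq hk hxk0, e, e']
      ring
    have hz := (planeWaves_eq_zero t3).2
    have hp : (starRingEnd ℂ) (phase α) / 2 ≠ 0 := by
      have : phase α ≠ 0 := Complex.exp_ne_zero _
      simpa using this
    have : l = 1 := sub_eq_zero.1 ((mul_eq_zero.1 hz).resolve_right hp)
    intro r hr
    rw [hφ r hr, this, one_mul]
  · intro h
    have hφ : ∀ r, 0 < r → φ r = outgoingFactor α s k * bcSol α s (k ^ 2) r := fun r hr => by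
      rw [h r hr, outgoingFn_eq hα0 hα1 hk hr]
    have hsol := (((isSol_bcSol hα0 hα1 s (k ^ 2)).ofReal).const_mul (outgoingFactor α s k)).congr hφ
    refine ⟨fun r hr => (hsol.left r hr).differentiableAt,
      fun r hr => (hsol.deriv_deriv_eq hr).differentiableAt,
      fun r hr => by rw [hsol.radialExpr_eq hr, hk2],
      boundaryCondition_bcSol hα0 hα1 s (k ^ 2) hφ,
      ⟨2 * Complex.I / π * resolventCoeff k α s * phase α,
        (tendsto_outgoingFn_sub s hα0 hα1 hk).congr' ?_⟩⟩
    filter_upwards [eventually_gt_atTop 0] with r hr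
    rw [h r hr]

end AnyonDelta

end
noncomputable section

namespace AnyonDelta

/-! ### Complex valued absolutely continuous functions -/

theorem absolutelyContinuous_of_dist_le {X Y : Type*} [PseudoMetricSpace X] [PseudoMetricSpace Y]
    {f : ℝ → X} {g : ℝ → Y} {a b C : ℝ} (hf : AbsolutelyContinuousOnInterval f a b)
    (h : ∀ x ∈ uIcc a b, ∀ y ∈ uIcc a b, dist (g x) (g y) ≤ C * dist (f x) (f y)) :
    AbsolutelyContinuousOnInterval g a b := by
  have h0 : Tendsto (fun E : ℕ × (ℕ → ℝ × ℝ) =>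
      C * ∑ i ∈ Finset.range E.1, dist (f (E.2 i).1) (f (E.2 i).2))
      (AbsolutelyContinuousOnInterval.totalLengthFilter ⊓
        𝓟 (AbsolutelyContinuousOnInterval.disjWithin a b)) (𝓝 0) := by
    simpa using Tendsto.const_mul C hf
  refine squeeze_zero' (Eventually.of_forall fun E => Finset.sum_nonneg fun i _ => dist_nonneg) ?_ h0
  filter_upwards [mem_inf_of_right (mem_principal_self _)] with E hE
  rw [Finset.mul_sum]
  exact Finset.sum_le_sum fun i hi => h _ (hE.1 i hi).1 _ (hE.1 i hi).2

theorem absolutelyContinuous_clm {V W : Type*} [NormedAddCommGroup V] [NormedSpace ℝ V]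
    [NormedAddCommGroup W] [NormedSpace ℝ W] {f : ℝ → V} {a b : ℝ}
    (hf : AbsolutelyContinuousOnInterval f a b) (L : V →L[ℝ] W) :
    AbsolutelyContinuousOnInterval (fun x => L (f x)) a b :=
  absolutelyContinuous_of_dist_le hf fun x _ y _ => by
    rw [dist_eq_norm, dist_eq_norm, ← map_sub]; exact L.le_opNorm _

theorem absolutelyContinuous_congr {V : Type*} [PseudoMetricSpace V] {f g : ℝ → V} {a b : ℝ}
    (hf : AbsolutelyContinuousOnInterval f a b) (h : ∀ x ∈ uIcc a b, g x = f x) :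
    AbsolutelyContinuousOnInterval g a b :=
  absolutelyContinuous_of_dist_le (C := 1) hf fun x hx y hy => by rw [h x hx, h y hy, one_mul]

theorem absolutelyContinuous_of_hasDerivAt {f f' : ℝ → ℂ} {a b : ℝ}
    (hd : ∀ x ∈ uIcc a b, HasDerivAt f (f' x) x) (hc : ContinuousOn f' (uIcc a b)) :
    AbsolutelyContinuousOnInterval f a b := by
  obtain ⟨C, hC⟩ := isCompact_uIcc.exists_bound_of_continuousOn hc
  refine LipschitzOnWith.absolutelyContinuousOnInterval (K := C.toNNReal) ?_
  refine (convex_uIcc a b).lipschitzOnWith_of_nnnorm_hasDerivWithin_le (f' := f')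
    (fun x hx => (hd x hx).hasDerivWithinAt) fun x hx => ?_
  rw [← NNReal.coe_le_coe, coe_nnnorm, Real.coe_toNNReal']
  exact (hC x hx).trans (le_max_left _ _)

/-- The fundamental theorem of calculus for complex absolutely continuous functions. -/
theorem integral_eq_sub_of_absolutelyContinuous {f f' : ℝ → ℂ} {a b : ℝ}
    (hf : AbsolutelyContinuousOnInterval f a b)
    (hd : ∀ᵐ x, x ∈ uIcc a b → HasDerivAt f (f' x) x) :
    IntervalIntegrable f' volume a b ∧ ∫ x in a..b, f' x = f b - f a := by
  -- The real valued fundamental theorem is applied to the real and the imaginary part.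
  have key : ∀ L : ℂ →L[ℝ] ℝ, IntervalIntegrable (fun x => L (f' x)) volume a b ∧
      ∫ x in a..b, L (f' x) = L (f b) - L (f a) := by
    intro L
    have hL := absolutelyContinuous_clm hf L
    have e : ∀ᵐ x, x ∈ uIoc a b → deriv (fun x => L (f x)) x = L (f' x) := by
      filter_upwards [hd] with x hx hxI
      exact ((L.hasFDerivAt).comp_hasDerivAt x (hx (uIoc_subset_uIcc hxI))).deriv
    refine ⟨hL.intervalIntegrable_deriv.congr_ae ?_, ?_⟩
    · rw [EventuallyEq, ae_restrict_iff' measurableSet_uIoc]; exact e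
    · rw [← hL.integral_deriv_eq_sub]
      exact intervalIntegral.integral_congr_ae (e.mono fun x hx hxI => (hx hxI).symm)
  obtain ⟨ir, er⟩ := key Complex.reCLM
  obtain ⟨ii, ei⟩ := key Complex.imCLM
  simp only [Complex.reCLM_apply, Complex.imCLM_apply] at ir er ii ei
  replace ir : IntervalIntegrable (fun x => ((f' x).re : ℂ)) volume a b :=
    ⟨ir.1.ofReal, ir.2.ofReal⟩
  replace ii : IntervalIntegrable (fun x => ((f' x).im : ℂ)) volume a b :=
    ⟨ii.1.ofReal, ii.2.ofReal⟩
  have hi : IntervalIntegrable (fun x => ((f' x).re : ℂ) + ((f' x).im : ℂ) * Complex.I)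
      volume a b := ir.add (ii.mul_const _)
  simp only [Complex.re_add_im] at hi
  refine ⟨hi, ?_⟩
  calc ∫ x in a..b, f' x = ∫ x in a..b, (((f' x).re : ℂ) + ((f' x).im : ℂ) * Complex.I) := by
        simp only [Complex.re_add_im]
    _ = ((f b).re - (f a).re : ℝ) + ((f b).im - (f a).im : ℝ) * Complex.I := by
        rw [intervalIntegral.integral_add ir (ii.mul_const _),
          intervalIntegral.integral_mul_const, intervalIntegral.integral_ofReal,
          intervalIntegral.integral_ofReal, er, ei]
    _ = f b - f a := by
        apply Complex.ext <;> simp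

/-! ### The maximal domain -/

section
variable {α : ℝ} {ψ ψ₁ : ℝ → ℂ}

theorem uIcc_subset_Ioi {a b : ℝ} (ha : 0 < a) (hb : 0 < b) : uIcc a b ⊆ Ioi 0 := fun _ hx =>
  (lt_min ha hb).trans_le hx.1

theorem InMaximalDomain.ac_deriv (h : InMaximalDomain α ψ) {a b : ℝ} (ha : 0 < a) (hb : 0 < b) :
    AbsolutelyContinuousOnInterval (deriv ψ) a b := by
  -- The domain condition is stated for strictly ordered endpoints, so the interval is enlarged by
  -- one to cover any order and the degenerate case.
  have := h.deriv_ac (min a b) (max a b + 1) (lt_min ha hb) (by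
    have := min_le_max (a := a) (b := b); linarith)
  refine this.mono ?_
  rw [uIcc_of_le (a := min a b) (b := max a b + 1)
    (by have := min_le_max (a := a) (b := b); linarith)]
  exact Icc_subset_Icc le_rfl (by linarith)

theorem InMaximalDomain.continuousOn_deriv (h : InMaximalDomain α ψ) :
    ContinuousOn (deriv ψ) (Ioi 0) := by
  intro x hx
  have hx : 0 < x := hx
  have := (h.ac_deriv (a := x / 2) (b := 2 * x) (by positivity) (by positivity)).continuousOn
  rw [uIcc_of_le (by linarith)] at this
  exact (this.continuousAt (Icc_mem_nhds (by linarith) (by linarith))).continuousWithinAt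

theorem InMaximalDomain.continuousOn (h : InMaximalDomain α ψ) : ContinuousOn ψ (Ioi 0) :=
  fun x hx => (h.differentiable x hx).continuousAt.continuousWithinAt

theorem InMaximalDomain.ac (h : InMaximalDomain α ψ) {a b : ℝ} (ha : 0 < a) (hb : 0 < b) :
    AbsolutelyContinuousOnInterval ψ a b :=
  absolutelyContinuous_of_hasDerivAt
    (fun x hx => (h.differentiable x (uIcc_subset_Ioi ha hb hx)).hasDerivAt)
    (h.continuousOn_deriv.mono (uIcc_subset_Ioi ha hb))

/-- Absolute continuity gives differentiability almost everywhere on each of countably many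
intervals exhausting `(0, ∞)`; where it holds, the value is read off from the differential
expression. -/
theorem InMaximalDomain.ae_hasDerivAt (h : InMaximalDomain α ψ) :
    ∀ᵐ x, x ∈ Ioi (0 : ℝ) → HasDerivAt (deriv ψ)
      ((((α ^ 2 - 1 / 4) / x ^ 2 : ℝ) : ℂ) * ψ x - radialExpr α ψ x) x := by
  have h1 : ∀ n : ℕ, ∀ᵐ x, x ∈ uIcc (1 / ((n : ℝ) + 1)) ((n : ℝ) + 1) →
      DifferentiableAt ℝ (deriv ψ) x := fun n =>
    (h.ac_deriv (by positivity) (by positivity)).boundedVariationOn.ae_differentiableAt_of_mem_uIcc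
  rw [← ae_all_iff] at h1
  filter_upwards [h1] with x hx hx0
  have hx0 : 0 < x := hx0
  obtain ⟨n, hn⟩ := exists_nat_gt (max x (1 / x))
  have hn1 : x < n := (le_max_left _ _).trans_lt hn
  have hn2 : 1 / x < n := (le_max_right _ _).trans_lt hn
  have hd : DifferentiableAt ℝ (deriv ψ) x := by
    refine hx n ⟨(min_le_left _ _).trans ?_, le_trans ?_ (le_max_right _ _)⟩
    · rw [div_le_iff₀ (by positivity)]
      rw [div_lt_iff₀ hx0] at hn2
      nlinarith
    · linarith
  refine hd.hasDerivAt.congr_deriv ?_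
  rw [radialExpr]; ring

theorem InMaximalDomain.sub (h : InMaximalDomain α ψ) (h₁ : InMaximalDomain α ψ₁) :
    InMaximalDomain α (ψ - ψ₁) ∧ (∀ x, 0 < x → deriv (ψ - ψ₁) x = deriv ψ x - deriv ψ₁ x) ∧
      radialExpr α (ψ - ψ₁) =ᵐ[halfLine] radialExpr α ψ - radialExpr α ψ₁ := by
  have e1 : ∀ x, 0 < x → deriv (ψ - ψ₁) x = deriv ψ x - deriv ψ₁ x := fun x hx =>
    ((h.differentiable x hx).hasDerivAt.sub (h₁.differentiable x hx).hasDerivAt).deriv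
  have e2 : radialExpr α (ψ - ψ₁) =ᵐ[halfLine] radialExpr α ψ - radialExpr α ψ₁ := by
    rw [EventuallyEq, ae_restrict_iff' measurableSet_Ioi]
    filter_upwards [h.ae_hasDerivAt, h₁.ae_hasDerivAt] with x hx hx₁ hx0
    have hd : HasDerivAt (deriv (ψ - ψ₁)) _ x := ((hx hx0).sub (hx₁ hx0)).congr_of_eventuallyEq <| by
      filter_upwards [Ioi_mem_nhds hx0] with y hy using e1 y hy
    rw [radialExpr, hd.deriv, Pi.sub_apply, Pi.sub_apply]
    ring
  refine ⟨⟨fun r hr => (h.differentiable r hr).sub (h₁.differentiable r hr), fun a b ha hab => ?_,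
    h.memLp.sub h₁.memLp, (h.memLp_radialExpr.sub h₁.memLp_radialExpr).ae_eq e2.symm⟩, e1, e2⟩
  exact absolutelyContinuous_congr ((h.ac_deriv ha (ha.trans hab)).sub
    (h₁.ac_deriv ha (ha.trans hab))) fun x hx => e1 x (uIcc_subset_Ioi ha (ha.trans hab) hx)

theorem operatorGraph_sub {u : ℝ → ℂ} {p q : HalfLineL2 × HalfLineL2}
    (hp : p ∈ operatorGraph α u) (hq : q ∈ operatorGraph α u) : p - q ∈ operatorGraph α u := by
  obtain ⟨ψ, h, hb, e, e'⟩ := hp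
  obtain ⟨ψ₁, h₁, hb₁, e₁, e₁'⟩ := hq
  obtain ⟨k, kd, ke⟩ := h.sub h₁
  refine ⟨ψ - ψ₁, k, ?_, (Lp.coeFn_sub _ _).trans (e.sub e₁),
    ((Lp.coeFn_sub _ _).trans (e'.sub e₁')).trans ke.symm⟩
  have := Tendsto.sub hb hb₁
  rw [sub_zero] at this
  refine Tendsto.congr' ?_ this
  filter_upwards [self_mem_nhdsWithin] with r hr
  rw [wronskian, wronskian, wronskian, kd r hr, Pi.sub_apply]
  ring

/-- The current `conj ψ ψ'`. -/
def current (ψ : ℝ → ℂ) (r : ℝ) : ℂ := (starRingEnd ℂ) (ψ r) * deriv ψ r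

/-- The almost everywhere derivative of the current. -/
def currentDeriv (α : ℝ) (ψ : ℝ → ℂ) (x : ℝ) : ℂ :=
  (starRingEnd ℂ) (deriv ψ x) * deriv ψ x + (starRingEnd ℂ) (ψ x) *
    ((((α ^ 2 - 1 / 4) / x ^ 2 : ℝ) : ℂ) * ψ x - radialExpr α ψ x)

theorem InMaximalDomain.current_sub (h : InMaximalDomain α ψ) {a b : ℝ} (ha : 0 < a) (hb : 0 < b) :
    IntervalIntegrable (currentDeriv α ψ) volume a b ∧
      ∫ x in a..b, currentDeriv α ψ x = current ψ b - current ψ a := by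
  have hc : AbsolutelyContinuousOnInterval (fun x => (starRingEnd ℂ) (ψ x)) a b :=
    absolutelyContinuous_clm (h.ac ha hb) (Complex.conjCLE : ℂ →L[ℝ] ℂ)
  have hac : AbsolutelyContinuousOnInterval (current ψ) a b :=
    absolutelyContinuous_congr (hc.smul (h.ac_deriv ha hb)) fun x _ => rfl
  refine integral_eq_sub_of_absolutelyContinuous hac ?_
  filter_upwards [h.ae_hasDerivAt] with x hx hxI
  have hx0 := uIcc_subset_Ioi ha hb hxI
  have h1 : HasDerivAt (fun x => (starRingEnd ℂ) (ψ x)) ((starRingEnd ℂ) (deriv ψ x)) x :=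
    (Complex.conjCLE : ℂ →L[ℝ] ℂ).hasFDerivAt.comp_hasDerivAt x
      (h.differentiable x hx0).hasDerivAt
  exact h1.mul (hx hx0)

theorem InMaximalDomain.integrable_mul_radialExpr (h : InMaximalDomain α ψ) :
    IntegrableOn (fun x => (starRingEnd ℂ) (ψ x) * radialExpr α ψ x) (Ioi 0) :=
  h.memLp.star.integrable_mul h.memLp_radialExpr

theorem InMaximalDomain.integrable_normSq (h : InMaximalDomain α ψ) :
    IntegrableOn (fun x => ‖ψ x‖ ^ 2) (Ioi 0) := by
  have := h.memLp.integrable_norm_pow two_ne_zero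
  exact_mod_cast this

end

end AnyonDelta

end
noncomputable section

namespace AnyonDelta

/-! ### Functions of the maximal domain at infinity -/

theorem not_integrableOn_of_one_le {f : ℝ → ℝ} {a b : ℝ} (h : ∀ x, b ≤ x → 1 ≤ f x) :
    ¬IntegrableOn f (Ioi a) := by
  intro hf
  have h1 : IntegrableOn (fun _ => (1 : ℝ)) (Ioi (max a b)) := by
    refine Integrable.mono' (hf.mono_set (Ioi_subset_Ioi (le_max_left a b)))
      aestronglyMeasurable_const ?_
    rw [ae_restrict_iff' measurableSet_Ioi]
    refine Eventually.of_forall fun x hx => ?_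
    rw [norm_one]
    exact h x ((le_max_right a b).trans (le_of_lt hx))
  rw [integrableOn_const_iff] at h1
  simp at h1

section
variable {α : ℝ} {ψ : ℝ → ℂ}

theorem re_currentDeriv (x : ℝ) : (currentDeriv α ψ x).re = ‖deriv ψ x‖ ^ 2
    + (α ^ 2 - 1 / 4) / x ^ 2 * ‖ψ x‖ ^ 2 - ((starRingEnd ℂ) (ψ x) * radialExpr α ψ x).re := by
  rw [currentDeriv, mul_sub, ← mul_assoc, mul_comm _ (((α ^ 2 - 1 / 4) / x ^ 2 : ℝ) : ℂ), mul_assoc,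
    Complex.conj_mul', Complex.conj_mul', ← Complex.ofReal_pow, ← Complex.ofReal_pow,
    ← Complex.ofReal_mul]
  simp only [Complex.add_re, Complex.sub_re, Complex.ofReal_re]
  ring

theorem im_currentDeriv (x : ℝ) : (currentDeriv α ψ x).im =
    -((starRingEnd ℂ) (ψ x) * radialExpr α ψ x).im := by
  rw [currentDeriv, mul_sub, ← mul_assoc, mul_comm _ (((α ^ 2 - 1 / 4) / x ^ 2 : ℝ) : ℂ), mul_assoc,
    Complex.conj_mul', Complex.conj_mul', ← Complex.ofReal_pow, ← Complex.ofReal_pow,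
    ← Complex.ofReal_mul]
  simp only [Complex.add_im, Complex.sub_im, Complex.ofReal_im]
  ring

theorem InMaximalDomain.hasDerivAt_normSq (h : InMaximalDomain α ψ) {x : ℝ} (hx : 0 < x) :
    HasDerivAt (fun x => ‖ψ x‖ ^ 2) (2 * (current ψ x).re) x := by
  have := (h.differentiable x hx).hasDerivAt.norm_sq
  refine this.congr_deriv ?_
  rw [Complex.inner, current, mul_comm (deriv ψ x)]

/-- The real part of the current `conj ψ ψ'` at `b` is, up to a bounded amount, at least `∫_1^b
‖ψ'‖²`. If the latter exceeded a certain bound, the current would stay above one and `‖ψ‖²` would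
grow linearly, contradicting square integrability. -/
theorem InMaximalDomain.integrableOn_normSq_deriv (h : InMaximalDomain α ψ) :
    IntegrableOn (fun x => ‖deriv ψ x‖ ^ 2) (Ioi 1) := by
  set N : ℝ → ℝ := fun x => |α ^ 2 - 1 / 4| * ‖ψ x‖ ^ 2
    + ‖(starRingEnd ℂ) (ψ x) * radialExpr α ψ x‖ with hN
  have hNi : IntegrableOn N (Ioi 1) := by
    refine IntegrableOn.mono_set ?_ (Ioi_subset_Ioi zero_le_one)
    exact (h.integrable_normSq.const_mul _).add h.integrable_mul_radialExpr.norm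
  have hN0 : ∀ x, 0 ≤ N x := fun x => by positivity
  have hloc : ∀ b, 1 ≤ b → IntervalIntegrable (fun x => ‖deriv ψ x‖ ^ 2) volume 1 b := fun b hb =>
    ((h.continuousOn_deriv.mono (uIcc_subset_Ioi one_pos (by linarith))).norm.pow 2
      ).intervalIntegrable
  have hlow : ∀ b, 1 ≤ b → (∫ x in (1 : ℝ)..b, ‖deriv ψ x‖ ^ 2) - (∫ x in Ioi 1, N x)
      ≤ (current ψ b).re - (current ψ 1).re := by
    intro b hb
    obtain ⟨i1, e1⟩ := h.current_sub one_pos (by linarith : 0 < b)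
    have iN : IntervalIntegrable N volume 1 b :=
      (intervalIntegrable_iff_integrableOn_Ioc_of_le hb).2 (hNi.mono_set Ioc_subset_Ioi_self)
    have e2 : ∫ x in (1 : ℝ)..b, (currentDeriv α ψ x).re = (current ψ b).re - (current ψ 1).re := by
      rw [← Complex.sub_re, ← e1]
      exact Complex.reCLM.intervalIntegral_comp_comm i1
    have i3 : IntervalIntegrable (fun x => (currentDeriv α ψ x).re) volume 1 b :=
      ⟨i1.1.re, i1.2.re⟩
    have e3 : ∫ x in (1 : ℝ)..b, N x ≤ ∫ x in Ioi 1, N x := by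
      rw [intervalIntegral.integral_of_le hb]
      exact setIntegral_mono_set hNi (Eventually.of_forall hN0)
        (LE.le.eventuallyLE Ioc_subset_Ioi_self)
    have e4 : ∫ x in (1 : ℝ)..b, (‖deriv ψ x‖ ^ 2 - N x) ≤
        ∫ x in (1 : ℝ)..b, (currentDeriv α ψ x).re := by
      refine intervalIntegral.integral_mono_on hb ((hloc b hb).sub iN) i3 fun x hx => ?_
      rw [re_currentDeriv, hN]
      have h1 : -(|α ^ 2 - 1 / 4| * ‖ψ x‖ ^ 2) ≤ (α ^ 2 - 1 / 4) / x ^ 2 * ‖ψ x‖ ^ 2 := by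
        rw [← neg_mul]
        gcongr
        have hx2 : 1 ≤ x ^ 2 := one_le_pow₀ hx.1
        have : |(α ^ 2 - 1 / 4) / x ^ 2| ≤ |α ^ 2 - 1 / 4| := by
          rw [abs_div, abs_of_pos (by linarith : 0 < x ^ 2)]
          exact div_le_self (abs_nonneg _) hx2
        linarith [neg_abs_le ((α ^ 2 - 1 / 4) / x ^ 2)]
      have h2 := (abs_le.1 (Complex.abs_re_le_norm
        ((starRingEnd ℂ) (ψ x) * radialExpr α ψ x))).2
      linarith
    rw [intervalIntegral.integral_sub (hloc b hb) iN] at e4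
    linarith
  -- The bound is chosen so that exceeding it makes the real part of the current at least one from
  -- there on.
  set M : ℝ := (∫ x in Ioi 1, N x) - (current ψ 1).re + 1 with hM
  have hb : ∀ b, 1 ≤ b → (∫ x in (1 : ℝ)..b, ‖deriv ψ x‖ ^ 2) ≤ M := by
    intro b hb
    by_contra! hlt
    have hre : ∀ x, b ≤ x → 1 ≤ (current ψ x).re := by
      intro x hx
      have := hlow x (hb.trans hx)
      have : (∫ x in (1 : ℝ)..b, ‖deriv ψ x‖ ^ 2) ≤ ∫ x in (1 : ℝ)..x, ‖deriv ψ x‖ ^ 2 :=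
        intervalIntegral.integral_mono_interval le_rfl hb hx
          (Eventually.of_forall fun x => by positivity) (hloc x (hb.trans hx))
      linarith
    refine not_integrableOn_of_one_le (a := 0) (b := b + 1) (fun x hx => ?_) h.integrable_normSq
    have hmono := (convex_Ici b).mul_sub_le_image_sub_of_le_deriv (f := fun x => ‖ψ x‖ ^ 2) (C := 2)
      (fun y hy => (h.hasDerivAt_normSq (by linarith [mem_Ici.1 hy])).continuousAt.continuousWithinAt)
      (fun y hy => (h.hasDerivAt_normSq
        (by linarith [mem_Ici.1 (interior_subset hy)])).differentiableAt.differentiableWithinAt)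
      (fun y hy => by
        rw [(h.hasDerivAt_normSq (by linarith [mem_Ici.1 (interior_subset hy)])).deriv]
        linarith [hre y (interior_subset hy)])
      b self_mem_Ici x (mem_Ici.2 (by linarith)) (by linarith)
    have : 0 ≤ ‖ψ b‖ ^ 2 := by positivity
    linarith
  refine integrableOn_Ioi_of_intervalIntegral_norm_bounded (l := atTop) (b := fun x : ℝ => x) M 1
    (fun b => ?_) tendsto_id ?_
  · rcases le_total 1 b with h1 | h1
    · exact (intervalIntegrable_iff_integrableOn_Ioc_of_le h1).1 (hloc b h1)
    · rw [Ioc_eq_empty (not_lt.2 h1)]; exact integrableOn_empty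
  · filter_upwards [eventually_ge_atTop 1] with b h1
    simpa only [norm_pow, norm_norm] using hb b h1

theorem InMaximalDomain.memLp_deriv (h : InMaximalDomain α ψ) :
    MemLp (deriv ψ) 2 (volume.restrict (Ioi 1)) := by
  rw [memLp_two_iff_integrable_sq_norm]
  · exact h.integrableOn_normSq_deriv
  · exact (h.continuousOn_deriv.mono (Ioi_subset_Ioi zero_le_one)).aestronglyMeasurable
      measurableSet_Ioi

/-- The imaginary part of the current is the flux integral. -/
theorem InMaximalDomain.im_current (h : InMaximalDomain α ψ) {a : ℝ} (ha : 0 < a) :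
    (current ψ a).im = ∫ x in Ioi a, ((starRingEnd ℂ) (ψ x) * radialExpr α ψ x).im := by
  have hJ : IntegrableOn (fun x => ((starRingEnd ℂ) (ψ x) * radialExpr α ψ x).im) (Ioi 0) :=
    h.integrable_mul_radialExpr.im
  have hs : ∀ b, 0 < b → (current ψ b).im = (current ψ a).im -
      ∫ x in a..b, ((starRingEnd ℂ) (ψ x) * radialExpr α ψ x).im := by
    intro b hb
    obtain ⟨i1, e1⟩ := h.current_sub ha hb
    have e2 : ∫ x in a..b, (currentDeriv α ψ x).im = (current ψ b).im - (current ψ a).im := by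
      rw [← Complex.sub_im, ← e1]
      exact Complex.imCLM.intervalIntegral_comp_comm i1
    simp only [im_currentDeriv, intervalIntegral.integral_neg] at e2
    linarith
  have ht : Tendsto (fun b => (current ψ b).im) atTop (𝓝 ((current ψ a).im -
      ∫ x in Ioi a, ((starRingEnd ℂ) (ψ x) * radialExpr α ψ x).im)) := by
    refine (tendsto_const_nhds.sub (intervalIntegral_tendsto_integral_Ioi a
      (hJ.mono_set (Ioi_subset_Ioi ha.le)) tendsto_id)).congr' ?_
    filter_upwards [eventually_gt_atTop 0] with b hb
    rw [hs b hb, id]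
  -- The flux converges at infinity and is integrable there, both `ψ` and `ψ'` being square
  -- integrable; hence its limit is zero.
  have hi : IntegrableOn (fun b => (current ψ b).im) (Ioi 1) :=
    Integrable.im ((h.memLp.mono_measure
      (Measure.restrict_mono (Ioi_subset_Ioi zero_le_one) le_rfl)).star.integrable_mul h.memLp_deriv)
  have hz := IntegrableAtFilter.eq_zero_of_tendsto (μ := volume) (l := atTop)
    ⟨Ioi 1, Ioi_mem_atTop 1, hi⟩ (fun s hs => by
      obtain ⟨b, hb⟩ := mem_atTop_sets.1 hs
      rw [← top_le_iff, ← Real.volume_Ici (a := b)]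
      exact measure_mono hb) ht
  linarith

/-- Boundary functions that define self-adjoint restrictions: real zero energy solutions with a
square integrable companion of Wronskian one. -/
def AdmissibleBoundary (α : ℝ) (w : ℝ → ℂ) : Prop :=
  ∃ u u' v v' : ℝ → ℝ, (w = fun r => (u r : ℂ)) ∧ IsSol (α ^ 2 - 1 / 4) 0 u u' ∧
    IsSol (α ^ 2 - 1 / 4) 0 v v' ∧ (∀ r, 0 < r → u r * v' r - v r * u' r = 1) ∧
    MemLp (fun r => (v r : ℂ)) 2 (volume.restrict (Ioc 0 1))

theorem IsSol.continuousOn {c E : ℝ} {u u' : ℝ → ℂ} (h : IsSol c E u u') :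
    ContinuousOn u (Ioi 0) ∧ ContinuousOn u' (Ioi 0) :=
  ⟨fun r hr => (h.left r hr).continuousAt.continuousWithinAt,
    fun r hr => (h.right r hr).continuousAt.continuousWithinAt⟩

/-- The derivative of the Wronskian with a zero energy solution `v` is `v` times the differential
expression of `ψ`, a product of two functions square integrable near the origin. -/
theorem InMaximalDomain.exists_wronskian_bound (h : InMaximalDomain α ψ) {v v' : ℝ → ℝ}
    (hv : IsSol (α ^ 2 - 1 / 4) 0 v v')
    (hv2 : MemLp (fun r => (v r : ℂ)) 2 (volume.restrict (Ioc 0 1))) :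
    ∃ C, ∀ r ∈ Ioc (0 : ℝ) 1, ‖ψ r * v' r - v r * deriv ψ r‖ ≤ C := by
  have hi : IntegrableOn (fun x => (v x : ℂ) * radialExpr α ψ x) (Ioc 0 1) :=
    hv2.integrable_mul (h.memLp_radialExpr.mono_measure
      (Measure.restrict_mono Ioc_subset_Ioi_self le_rfl))
  refine ⟨‖ψ 1 * v' 1 - v 1 * deriv ψ 1‖ + ∫ x in Ioc 0 1, ‖(v x : ℂ) * radialExpr α ψ x‖,
    fun r hr => ?_⟩
  have hv' := hv.ofReal
  have hsub := uIcc_subset_Ioi hr.1 one_pos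
  have a1 : AbsolutelyContinuousOnInterval (fun x => (v x : ℂ)) r 1 :=
    absolutelyContinuous_of_hasDerivAt (fun x hx => hv'.left x (hsub hx))
      (hv'.continuousOn.2.mono hsub)
  have a2 : AbsolutelyContinuousOnInterval (fun x => (v' x : ℂ)) r 1 := by
    refine absolutelyContinuous_of_hasDerivAt (fun x hx => hv'.right x (hsub hx)) ?_
    have hV : ContinuousOn (fun x : ℝ => (α ^ 2 - 1 / 4) / x ^ 2 - 0) (uIcc r 1) := by
      refine fun x hx => ContinuousAt.continuousWithinAt ?_
      have : x ^ 2 ≠ 0 := pow_ne_zero 2 (hsub hx : 0 < x).ne'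
      fun_prop (disch := assumption)
    exact hV.smul (hv'.continuousOn.1.mono hsub)
  obtain ⟨-, e⟩ := integral_eq_sub_of_absolutelyContinuous
    (f := fun x => ψ x * v' x - v x * deriv ψ x) (f' := fun x => (v x : ℂ) * radialExpr α ψ x)
    (absolutelyContinuous_congr (((h.ac hr.1 one_pos).smul a2).sub
      (a1.smul (h.ac_deriv hr.1 one_pos))) fun x _ => rfl) (by
    filter_upwards [h.ae_hasDerivAt] with x hx hxI
    have hx0 := hsub hxI
    refine ((((h.differentiable x hx0).hasDerivAt).mul (hv'.right x hx0)).sub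
      ((hv'.left x hx0).mul (hx hx0))).congr_deriv ?_
    rw [Complex.real_smul]
    push_cast; ring)
  have e2 : ‖∫ x in r..1, (v x : ℂ) * radialExpr α ψ x‖ ≤
      ∫ x in Ioc 0 1, ‖(v x : ℂ) * radialExpr α ψ x‖ := by
    rw [intervalIntegral.integral_of_le hr.2]
    refine (norm_integral_le_integral_norm _).trans ?_
    exact setIntegral_mono_set hi.norm (Eventually.of_forall fun x => norm_nonneg _)
      (LE.le.eventuallyLE (Ioc_subset_Ioc_left hr.1.le))
  rw [e] at e2
  have := norm_sub_norm_le (ψ r * v' r - v r * deriv ψ r) (ψ 1 * v' 1 - v 1 * deriv ψ 1)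
  rw [norm_sub_rev (ψ r * v' r - v r * deriv ψ r)] at this
  linarith

/-- In the basis `u`, `v` of zero energy solutions with Wronskian one, `ψ = a u + b v` and `ψ' = a
u' + b v'` with variable coefficients, and the flux is `Im (conj a · b)`. Here `a` is bounded, and
`b` tends to zero by the boundary condition. -/
theorem InMaximalDomain.tendsto_im_current (h : InMaximalDomain α ψ) {w : ℝ → ℂ}
    (hw : AdmissibleBoundary α w) (hb : BoundaryCondition w ψ) :
    Tendsto (fun r => (current ψ r).im) (𝓝[>] 0) (𝓝 0) := by
  obtain ⟨u, u', v, v', rfl, hu, hv, hW, hv2⟩ := hw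
  obtain ⟨C, hC⟩ := h.exists_wronskian_bound hv hv2
  rw [boundaryCondition_iff hu.left] at hb
  have hb' := hb.norm.const_mul C
  rw [norm_zero, mul_zero] at hb'
  refine squeeze_zero_norm' ?_ hb'
  filter_upwards [Ioc_mem_nhdsGT (zero_lt_one' ℝ)] with r hr
  have e := congrArg (fun x : ℝ => (x : ℂ)) (hW r hr.1)
  push_cast at e
  set a := ψ r * v' r - v r * deriv ψ r with ha
  set b := (u r : ℂ) * deriv ψ r - ψ r * u' r with hbd
  have e1 : ψ r = a * u r + b * v r := by rw [ha, hbd]; linear_combination (-ψ r) * e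
  have e2 : deriv ψ r = a * u' r + b * v' r := by
    rw [ha, hbd]; linear_combination (-deriv ψ r) * e
  have e3 : (current ψ r).im = ((starRingEnd ℂ) a * b).im := by
    rw [current, e1, e2]
    simp only [map_add, map_mul, Complex.conj_ofReal, Complex.mul_im, Complex.mul_re, Complex.add_im,
      Complex.add_re, Complex.conj_re, Complex.conj_im, Complex.ofReal_re, Complex.ofReal_im]
    linear_combination (a.re * b.im - a.im * b.re) * hW r hr.1
  rw [e3, Real.norm_eq_abs]
  refine (Complex.abs_im_le_norm _).trans ?_
  rw [norm_mul, Complex.norm_conj]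
  gcongr
  exact hC r hr

theorem InMaximalDomain.integral_im_eq_zero (h : InMaximalDomain α ψ) {w : ℝ → ℂ}
    (hw : AdmissibleBoundary α w) (hb : BoundaryCondition w ψ) :
    ∫ x in Ioi (0 : ℝ), ((starRingEnd ℂ) (ψ x) * radialExpr α ψ x).im = 0 := by
  have t := h.tendsto_im_current hw hb
  have hJ : IntegrableOn (fun x => ((starRingEnd ℂ) (ψ x) * radialExpr α ψ x).im) (Ioi 0) :=
    h.integrable_mul_radialExpr.im
  have hcov : AECover (volume.restrict (Ioi (0 : ℝ))) (𝓝[>] (0 : ℝ)) (fun a => Ioi a) :=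
    aecover_Ioi_of_Ioi nhdsWithin_le_nhds
  refine tendsto_nhds_unique (hcov.integral_tendsto_of_countably_generated hJ) (t.congr' ?_)
  filter_upwards [self_mem_nhdsWithin] with a ha
  rw [h.im_current ha, Measure.restrict_restrict measurableSet_Ioi,
    inter_eq_left.2 (Ioi_subset_Ioi (le_of_lt ha))]

end

/-! ### Unitarity of the evolution -/

theorem inner_im_eq_zero {α : ℝ} {w : ℝ → ℂ} (hw : AdmissibleBoundary α w)
    {p : HalfLineL2 × HalfLineL2} (hp : p ∈ operatorGraph α w) : (inner ℂ p.1 p.2).im = 0 := by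
  obtain ⟨ψ, h, hb, e, e'⟩ := hp
  rw [← h.integral_im_eq_zero hw hb, L2.inner_def]
  have : ∫ x, inner ℂ ((p.1 : ℝ → ℂ) x) ((p.2 : ℝ → ℂ) x) ∂halfLine
      = ∫ x in Ioi 0, (starRingEnd ℂ) (ψ x) * radialExpr α ψ x := by
    refine integral_congr_ae ?_
    filter_upwards [e, e'] with x hx hx'
    rw [hx, hx', RCLike.inner_apply, mul_comm]
  rw [this]
  exact (Complex.imCLM.integral_comp_comm h.integrable_mul_radialExpr).symm

/-- The derivative of the squared distance is twice the real part of `⟨χ, χ'⟩` for the difference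
`χ`, and `(χ, iχ')` lies in the graph, on which the form is real. Symmetry suffices for this. -/
theorem norm_sub_const {α : ℝ} {w : ℝ → ℂ} (hw : AdmissibleBoundary α w)
    {Ψ Ψ₁ : ℝ → HalfLineL2} (h : IsSchrodingerSolution (operatorGraph α w) Ψ)
    (h₁ : IsSchrodingerSolution (operatorGraph α w) Ψ₁) (t : ℝ) :
    ‖Ψ t - Ψ₁ t‖ = ‖Ψ 0 - Ψ₁ 0‖ := by
  have hd : ∀ t, HasDerivAt (fun t => inner ℂ (Ψ t - Ψ₁ t) (Ψ t - Ψ₁ t)) 0 t := by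
    intro t
    obtain ⟨D, hD, hg⟩ := h t
    obtain ⟨D₁, hD₁, hg₁⟩ := h₁ t
    have hs := hD.sub hD₁
    refine (HasDerivAt.inner ℂ hs hs).congr_deriv ?_
    have hz := inner_im_eq_zero hw (operatorGraph_sub hg hg₁)
    have e : ((Ψ t, Complex.I • D) - (Ψ₁ t, Complex.I • D₁) : HalfLineL2 × HalfLineL2)
        = (Ψ t - Ψ₁ t, Complex.I • (D - D₁)) := by rw [Prod.mk_sub_mk, smul_sub]
    rw [e] at hz
    simp only [inner_smul_right] at hz
    rw [Pi.sub_apply, ← inner_conj_symm (D - D₁) (Ψ t - Ψ₁ t), Complex.add_conj]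
    simp at hz
    simp [hz]
  have hc := is_const_of_deriv_eq_zero (fun t => (hd t).differentiableAt)
    (fun t => (hd t).deriv) t 0
  have hn := congrArg Complex.re hc
  have key : ∀ x : HalfLineL2, ‖x‖ ^ 2 = (inner ℂ x x).re := fun x => by
    rw [inner_self_eq_norm_sq_to_K]; norm_cast
  have : ‖Ψ t - Ψ₁ t‖ ^ 2 = ‖Ψ 0 - Ψ₁ 0‖ ^ 2 := by rw [key, key]; exact hn
  exact (pow_left_inj₀ (norm_nonneg _) (norm_nonneg _) two_ne_zero).1 this

section
variable {α : ℝ} {w w₀ : ℝ → ℂ} (hw : AdmissibleBoundary α w) (hw₀ : AdmissibleBoundary α w₀)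
include hw hw₀

/-- Wave operators are isometric: both motions preserve distances, and along `l` the two distances
approach each other. Applied at `-∞` and then at `+∞`, this makes the scattered state unique. -/
theorem IsWaveOperatorImage.eq {l : Filter ℝ} [l.NeBot] {Φ Φ₁ X X₁ : HalfLineL2}
    (h : IsWaveOperatorImage (operatorGraph α w) (operatorGraph α w₀) l Φ X)
    (h₁ : IsWaveOperatorImage (operatorGraph α w) (operatorGraph α w₀) l Φ₁ X₁) :
    ‖X - X₁‖ = ‖Φ - Φ₁‖ := by
  obtain ⟨Ψ, Ψ₀, s, s₀, rfl, rfl, t⟩ := h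
  obtain ⟨Ψ', Ψ₀', s', s₀', rfl, rfl, t'⟩ := h₁
  have t2 := t.add t'
  rw [add_zero] at t2
  refine eq_of_abs_sub_nonpos (le_of_tendsto_of_tendsto' tendsto_const_nhds t2 fun τ => ?_)
  rw [← norm_sub_const hw s s' τ, ← norm_sub_const hw₀ s₀ s₀' τ]
  refine (abs_norm_sub_norm_le _ _).trans ?_
  rw [show Ψ τ - Ψ' τ - (Ψ₀ τ - Ψ₀' τ) = (Ψ τ - Ψ₀ τ) - (Ψ' τ - Ψ₀' τ) by abel]
  exact norm_sub_le _ _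

theorem ScattersTo.unique {Φ Φout Φout' : HalfLineL2}
    (h : ScattersTo (operatorGraph α w) (operatorGraph α w₀) Φ Φout)
    (h₁ : ScattersTo (operatorGraph α w) (operatorGraph α w₀) Φ Φout') : Φout = Φout' := by
  obtain ⟨X, a, b⟩ := h
  obtain ⟨X', a', b'⟩ := h₁
  have e := a.eq hw hw₀ a'
  have e' := b.eq hw hw₀ b'
  rw [sub_self, norm_zero] at e
  rw [e] at e'
  exact sub_eq_zero.1 (norm_eq_zero.1 e'.symm)

end

/-! ### The two boundary conditions -/

theorem memLp_of_norm_le_rpow {f : ℝ → ℂ} {p C : ℝ} (hp : -1 < 2 * p)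
    (hf : ContinuousOn f (Ioi 0)) (h : ∀ r ∈ Ioc (0 : ℝ) 1, ‖f r‖ ≤ C * r ^ p) :
    MemLp f 2 (volume.restrict (Ioc 0 1)) := by
  have hm : AEStronglyMeasurable f (volume.restrict (Ioc 0 1)) :=
    (hf.mono Ioc_subset_Ioi_self).aestronglyMeasurable measurableSet_Ioc
  rw [memLp_two_iff_integrable_sq_norm hm]
  have hi : IntegrableOn (fun r : ℝ => C ^ 2 * r ^ (2 * p)) (Ioc 0 1) :=
    ((intervalIntegrable_iff_integrableOn_Ioc_of_le zero_le_one).1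
      (intervalIntegral.intervalIntegrable_rpow' hp)).const_mul _
  refine Integrable.mono' hi (hm.norm.pow 2) ?_
  rw [ae_restrict_iff' measurableSet_Ioc]
  refine Eventually.of_forall fun r hr => ?_
  have e : C ^ 2 * r ^ (2 * p) = (C * r ^ p) ^ 2 := by
    rw [mul_pow, mul_comm 2 p, Real.rpow_mul hr.1.le]; simp
  rw [norm_pow, norm_norm, e]
  gcongr
  exact h r hr

theorem NearBound.memLp {β E : ℝ} {X Y : ℝ → ℝ → ℝ} (hβ : β < 1 / 2) (h : NearBound β X Y)
    (hc : ContinuousOn (X E) (Ioi 0)) :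
    MemLp (fun r => (X E r : ℂ)) 2 (volume.restrict (Ioc 0 1)) := by
  obtain ⟨C, -, k⟩ := h |E|
  refine memLp_of_norm_le_rpow (p := -β) (C := C) (by linarith)
    (Complex.continuous_ofReal.comp_continuousOn hc) fun r hr => ?_
  rw [Complex.norm_real]
  exact (k E r le_rfl hr.1 hr.2).1

section
variable {α : ℝ} (hα0 : 0 ≤ α) (hα1 : α < 1)
include hα0 hα1

theorem admissible_boundaryFn (s : ℝ) : AdmissibleBoundary α (boundaryFn α s) :=
  ⟨bcSol α s 0, bcSolDeriv α s 0, regSol α 0, regSolDeriv α 0, boundaryFn_eq hα0 hα1 s,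
    isSol_bcSol hα0 hα1 s 0, isSol_regSol hα0 0, fun _ hr => wronskian_bc_reg hα0 hα1 s 0 hr,
    (nearBound_regSol hα0).memLp (by linarith)
      fun r hr => ((isSol_regSol hα0 0).left r hr).continuousAt.continuousWithinAt⟩

theorem admissible_zeroRegular : AdmissibleBoundary α (fun r => (zeroRegular α r : ℂ)) := by
  have hB := isSol_bcSol hα0 hα1 0 0
  -- The sign of the companion makes the Wronskian `+1` after the roles are exchanged.
  refine ⟨regSol α 0, regSolDeriv α 0, fun r => -1 * bcSol α 0 0 r, fun r => -1 * bcSolDeriv α 0 0 r,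
    zeroRegular_eq hα0, isSol_regSol hα0 0, hB.const_mul (-1), fun r hr => ?_, ?_⟩
  · linear_combination wronskian_bc_reg hα0 hα1 0 0 hr
  · exact ((nearBound_bcSol hα0 hα1 0).const_mul (-1)).memLp (E := 0) (by linarith)
      fun r hr => ((hB.const_mul (-1)).left r hr).continuousAt.continuousWithinAt

end

end AnyonDelta

end
noncomputable section

namespace AnyonDelta

/-! ### Oscillatory integrals of the Hankel function -/

theorem pJDeriv_eq_regSolDeriv {α r : ℝ} (hα0 : 0 ≤ α) (hr : 0 < r) :
    pJDeriv α r = freeFactor α 1 * regSolDeriv α 1 r := by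
  refine ((isSol_pJ (by linarith : -1 < α)).left r hr).unique
    ((((isSol_regSol hα0 1).left r hr).const_mul (freeFactor α 1)).congr_of_eventuallyEq ?_)
  filter_upwards [Ioi_mem_nhds hr] with x hx
  have := pJ_scale hα0 one_pos hx
  rwa [one_mul, one_pow] at this

theorem qY_eq_bcSol {α r : ℝ} (hα0 : 0 ≤ α) (hα1 : α < 1) (hr : 0 < r) :
    qY α r = cotPhase α 0 1 * freeFactor α 1 * regSol α 1 r - bcFactor α 1 * bcSol α 0 1 r := by
  have h1 := cotPhase_mul_pJ_sub_qY (s := 0) hα0 hα1 one_pos hr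
  have h2 := pJ_scale hα0 one_pos hr
  rw [one_mul, one_pow] at h1 h2
  rw [← h1, h2]; ring

theorem qYDeriv_eq_bcSolDeriv {α r : ℝ} (hα0 : 0 ≤ α) (hα1 : α < 1) (hr : 0 < r) :
    qYDeriv α r =
      cotPhase α 0 1 * freeFactor α 1 * regSolDeriv α 1 r - bcFactor α 1 * bcSolDeriv α 0 1 r := by
  refine ((isSol_qY hα0 hα1).left r hr).unique
    (((((isSol_regSol hα0 1).left r hr).const_mul (cotPhase α 0 1 * freeFactor α 1)).sub
      (((isSol_bcSol hα0 hα1 0 1).left r hr).const_mul (bcFactor α 1))).congr_of_eventuallyEq ?_)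
  filter_upwards [Ioi_mem_nhds hr] with x hx using qY_eq_bcSol hα0 hα1 hx

/-- Below one, `χ` is expanded in `regSol` and `bcSol` at energy one, where the choice `s = 0` is
arbitrary; above one, its asymptotics apply. In `χ' - iχ` the leading waves cancel, a gain of `1/x`;
this combination is what integration by parts leaves behind. -/
theorem chi_bound {α : ℝ} (hα0 : 0 ≤ α) (hα1 : α < 1) : ∃ K : ℝ, 0 ≤ K ∧ ∀ x : ℝ, 0 < x →
    ‖chi α x‖ ≤ K * (1 + x ^ (-(α / 2))) ∧
    x * ‖chiDeriv α x - Complex.I * chi α x‖ ≤ K * (1 + x ^ (-(α / 2))) := by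
  obtain ⟨C₁, hC₁, k₁⟩ := (nearBound_regSol hα0 (α := α)) 1
  obtain ⟨C₂, hC₂, k₂⟩ := (nearBound_bcSol hα0 hα1 0) 1
  obtain ⟨K, hK⟩ := chi_asymptotics hα0 hα1
  have hK0 : 0 ≤ K := by
    have := (norm_nonneg _).trans (hK 1 le_rfl).1
    simpa using this
  set f := |freeFactor α 1|
  set f₁ := |cotPhase α 0 1 * freeFactor α 1|
  set f₂ := |bcFactor α 1|
  set D := f * C₁ + (f₁ * C₁ + f₂ * C₂) with hD
  have hD0 : 0 ≤ D := by positivity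
  refine ⟨2 * D + 2 * K + 1, by positivity, fun x hx => ?_⟩
  have hxp : 0 < x ^ (-(α / 2)) := Real.rpow_pos_of_pos hx _
  rcases le_total x 1 with h1 | h1
  · obtain ⟨a1, a2, -, -⟩ := k₁ 1 x (by norm_num) hx h1
    obtain ⟨b1, b2, -, -⟩ := k₂ 1 x (by norm_num) hx h1
    have key : ∀ (P Q R B q : ℝ), P = freeFactor α 1 * R →
        Q = cotPhase α 0 1 * freeFactor α 1 * R - bcFactor α 1 * B → |R| ≤ C₁ * q →
        |B| ≤ C₂ * q → ‖(P : ℂ) + Complex.I * Q‖ ≤ D * q := by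
      intro P Q R B q hP hQ hR hB
      have n1 : |P| ≤ f * (C₁ * q) := by rw [hP, abs_mul]; gcongr
      have n2 : |Q| ≤ f₁ * (C₁ * q) + f₂ * (C₂ * q) := by
        rw [hQ]
        refine (abs_sub _ _).trans ?_
        rw [abs_mul (cotPhase α 0 1 * freeFactor α 1), abs_mul (bcFactor α 1)]
        gcongr
      refine (norm_add_le _ _).trans ?_
      rw [norm_mul, Complex.norm_I, one_mul, Complex.norm_real, Complex.norm_real, Real.norm_eq_abs,
        Real.norm_eq_abs, hD]
      linarith
    have hp := pJ_scale hα0 one_pos hx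
    rw [one_mul, one_pow] at hp
    have c1 := key _ _ _ _ _ hp (qY_eq_bcSol hα0 hα1 hx) a1 b1
    have c2 := key _ _ _ _ _ (pJDeriv_eq_regSolDeriv hα0 hx) (qYDeriv_eq_bcSolDeriv hα0 hα1 hx) a2 b2
    change ‖chi α x‖ ≤ _ at c1
    change ‖chiDeriv α x‖ ≤ _ at c2
    have e : x * x ^ (-1 - α / 2) = x ^ (-(α / 2)) := by
      rw [mul_comm, ← Real.rpow_add_one hx.ne']; congr 1; ring
    have c3 : x * ‖chiDeriv α x‖ ≤ D * x ^ (-(α / 2)) := by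
      calc x * ‖chiDeriv α x‖ ≤ x * (D * x ^ (-1 - α / 2)) := by gcongr
        _ = D * x ^ (-(α / 2)) := by rw [← e]; ring
    have c4 : x * ‖chi α x‖ ≤ D * x ^ (-(α / 2)) :=
      (mul_le_of_le_one_left (norm_nonneg _) h1).trans c1
    have c5 : x * ‖chiDeriv α x - Complex.I * chi α x‖ ≤ 2 * (D * x ^ (-(α / 2))) := by
      have := norm_sub_le (chiDeriv α x) (Complex.I * chi α x)
      rw [norm_mul, Complex.norm_I, one_mul] at this
      have := mul_le_mul_of_nonneg_left this hx.le
      linarith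
    have : 0 ≤ D * x ^ (-(α / 2)) := by positivity
    constructor <;> nlinarith
  · obtain ⟨a1, a2⟩ := hK x h1
    have hKx : K / x ≤ K := div_le_self hK0 h1
    have nph : ‖phase α * Complex.exp (Complex.I * x)‖ = 1 := by
      rw [norm_mul, norm_phase, mul_comm Complex.I, Complex.norm_exp_ofReal_mul_I, one_mul]
    have n1 : ‖chi α x‖ ≤ K + 1 := by
      have := norm_sub_norm_le (chi α x) (phase α * Complex.exp (Complex.I * x))
      linarith
    have n2 : ‖chiDeriv α x - Complex.I * chi α x‖ ≤ 2 * (K / x) := by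
      rw [show chiDeriv α x - Complex.I * chi α x =
        (chiDeriv α x - Complex.I * (phase α * Complex.exp (Complex.I * x))) -
        Complex.I * (chi α x - phase α * Complex.exp (Complex.I * x)) by ring]
      refine (norm_sub_le _ _).trans ?_
      rw [norm_mul, Complex.norm_I, one_mul]
      linarith
    have n3 : x * ‖chiDeriv α x - Complex.I * chi α x‖ ≤ 2 * K := by
      calc x * ‖chiDeriv α x - Complex.I * chi α x‖ ≤ x * (2 * (K / x)) := by gcongr
        _ = 2 * K := by field_simp
    have : 0 ≤ (2 * D + 2 * K + 1) * x ^ (-(α / 2)) := by positivity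
    constructor <;> nlinarith

/-- Continuously differentiable amplitudes supported in `(p, q)`, with a bound. -/
structure IsAmp (p q M : ℝ) (a a' : ℝ → ℂ) : Prop where
  pos : 0 < p
  lt : p < q
  hasDerivAt : ∀ k, 0 < k → HasDerivAt a (a' k) k
  cont : ContinuousOn a' (Ioi 0)
  zero : ∀ k, k ∉ Ioo p q → a k = 0
  le : ∀ k, p ≤ k → k ≤ q → ‖a k‖ ≤ M
  le' : ∀ k, p ≤ k → k ≤ q → ‖a' k‖ ≤ M

/-- The wave packet with amplitude `a` and kernel `u`. -/
def packet (u : ℝ → ℝ → ℂ) (a : ℝ → ℂ) (r : ℝ) : ℂ := ∫ k in Ioi (0 : ℝ), a k * u k r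

/-- The weight that controls wave packets. -/
def weight (α r : ℝ) : ℝ := (1 + r ^ (-(α / 2))) * (1 + r) ^ (-(3 / 4) : ℝ)

theorem weight_pos {α r : ℝ} (hr : 0 < r) : 0 < weight α r := by
  have := Real.rpow_pos_of_pos hr (-(α / 2))
  have := Real.rpow_pos_of_pos (by linarith : 0 < 1 + r) (-(3 / 4) : ℝ)
  rw [weight]; positivity

theorem packet_eq_intervalIntegral {p q : ℝ} (hp : 0 < p) (hpq : p < q) (u : ℝ → ℝ → ℂ) {a : ℝ → ℂ}
    (h : ∀ k, k ∉ Ioo p q → a k = 0) (r : ℝ) : packet u a r = ∫ k in p..q, a k * u k r := by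
  rw [packet, intervalIntegral.integral_of_le hpq.le]
  refine setIntegral_eq_of_subset_of_forall_sdiff_eq_zero measurableSet_Ioi
    (fun k hk => hp.trans hk.1) fun k hk => ?_
  rw [h k fun hk' => hk.2 ⟨hk'.1, hk'.2.le⟩, zero_mul]

/-- The power `3/4` of `1 + r` is enough for square integrability at infinity; the remaining `1/4`
gives the decay in time. -/
theorem mul_rpow_le_add {r c : ℝ} (hr : 0 ≤ r) (hc : 0 ≤ c) :
    (1 + r + c)⁻¹ ≤ (1 + r) ^ (-(3 / 4) : ℝ) * (1 + c) ^ (-(1 / 4) : ℝ) := by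
  have h : (1 + r) ^ (3 / 4 : ℝ) * (1 + c) ^ (1 / 4 : ℝ) ≤ 1 + r + c := by
    calc (1 + r) ^ (3 / 4 : ℝ) * (1 + c) ^ (1 / 4 : ℝ)
        ≤ (1 + r + c) ^ (3 / 4 : ℝ) * (1 + r + c) ^ (1 / 4 : ℝ) := by
          refine mul_le_mul (Real.rpow_le_rpow (by linarith) (by linarith) (by norm_num))
            (Real.rpow_le_rpow (by linarith) (by linarith) (by norm_num)) (by positivity)
            (by positivity)
      _ = 1 + r + c := by rw [← Real.rpow_add (by linarith)]; norm_num
  rw [Real.rpow_neg (by linarith), Real.rpow_neg (by linarith), ← mul_inv]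
  exact inv_anti₀ (by positivity) h

/-- Wave packets of the Hankel function spread out in the direction of positive `T`. -/
theorem norm_packet_chi_le {α p : ℝ} (hα0 : 0 ≤ α) (hα1 : α < 1) (hp : 0 < p) (q : ℝ) :
    ∃ C : ℝ, 0 ≤ C ∧ ∀ (M : ℝ) (a a' : ℝ → ℂ), IsAmp p q M a a' → ∀ T r : ℝ, 0 ≤ T → 0 < r →
      ‖packet (fun k r => chi α (k * r)) (fun k => a k * Complex.exp (Complex.I * (k ^ 2 * T))) r‖
        ≤ C * M * (1 + 2 * p * T) ^ (-(1 / 4) : ℝ) * weight α r := by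
  obtain ⟨K, hK0, hK⟩ := chi_bound hα0 hα1
  have hpα : 0 < p ^ (-(α / 2)) := Real.rpow_pos_of_pos hp _
  refine ⟨2 * (|q - p| * (K * (1 + p ^ (-(α / 2))) * (1 + 2 / p))), by positivity,
    fun M a a' h T r hT hr => ?_⟩
  have hM : 0 ≤ M := (norm_nonneg _).trans (h.le p le_rfl h.lt.le)
  have hrα : 0 < r ^ (-(α / 2)) := Real.rpow_pos_of_pos hr _
  rw [packet_eq_intervalIntegral hp h.lt _ (fun k hk => by rw [h.zero k hk, zero_mul])]
  set B : ℝ := K * (1 + p ^ (-(α / 2))) * (1 + r ^ (-(α / 2))) with hB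
  have hB0 : 0 ≤ B := by positivity
  set y : ℝ := r + 2 * p * T with hy
  have hy0 : 0 < y := by positivity
  set e : ℝ → ℂ := fun k => Complex.exp (Complex.I * (k ^ 2 * T)) with he
  have ne : ∀ k, ‖e k‖ = 1 := fun k => by
    rw [he]
    simp only
    rw [show Complex.I * ((k : ℂ) ^ 2 * T) = ((k ^ 2 * T : ℝ) : ℂ) * Complex.I by push_cast; ring,
      Complex.norm_exp_ofReal_mul_I]
  set X : ℝ → ℂ := fun k => chi α (k * r) with hX
  set Y : ℝ → ℂ := fun k => chiDeriv α (k * r) with hY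
  have hkB : ∀ k, p ≤ k → K * (1 + (k * r) ^ (-(α / 2))) ≤ B := by
    intro k hk
    have h1 : (k * r) ^ (-(α / 2)) ≤ p ^ (-(α / 2)) * r ^ (-(α / 2)) := by
      rw [Real.mul_rpow (hp.le.trans hk) hr.le]
      gcongr ?_ * _
      exact Real.rpow_le_rpow_of_nonpos hp hk (by linarith)
    rw [hB, mul_assoc]
    gcongr
    nlinarith
  have nX : ∀ k, p ≤ k → ‖X k‖ ≤ B := fun k hk =>
    (hK (k * r) (mul_pos (hp.trans_le hk) hr)).1.trans (hkB k hk)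
  have nY : ∀ k, p ≤ k → k * (r * ‖Y k - Complex.I * X k‖) ≤ B := fun k hk => by
    rw [← mul_assoc]
    exact (hK (k * r) (mul_pos (hp.trans_le hk) hr)).2.trans (hkB k hk)
  -- The trivial estimate, for small `r` and `T`.
  have bound1 : ‖∫ k in p..q, a k * e k * X k‖ ≤ M * B * |q - p| := by
    refine intervalIntegral.norm_integral_le_of_norm_le_const fun k hk => ?_
    rw [uIoc_of_le h.lt.le] at hk
    rw [norm_mul, norm_mul, ne, mul_one]
    exact mul_le_mul (h.le k hk.1.le hk.2) (nX k hk.1.le) (norm_nonneg _) hM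
  -- The total phase `k r + k² T` has derivative `θ = r + 2kT ≥ r + 2pT > 0` because `T ≥ 0`. There
  -- is no stationary point, and one integration by parts gains `1/θ`.
  have bound2 : ‖∫ k in p..q, a k * e k * X k‖ ≤ M * B * (1 + 2 / p) / y * |q - p| := by
    set θ : ℝ → ℝ := fun k => r + 2 * k * T with hθ
    have hθ0 : ∀ k, p ≤ k → y ≤ θ k := fun k hk => by simp only [hθ, hy]; gcongr
    have hθne : ∀ k, p ≤ k → (θ k : ℂ) ≠ 0 := fun k hk =>
      Complex.ofReal_ne_zero.2 (hy0.trans_le (hθ0 k hk)).ne'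
    have hkpos : ∀ k ∈ uIcc p q, 0 < k := fun k hk => by
      rw [uIcc_of_le h.lt.le] at hk; exact hp.trans_le hk.1
    have hkp : ∀ k ∈ uIcc p q, p ≤ k := fun k hk => by
      rw [uIcc_of_le h.lt.le] at hk; exact hk.1
    have dθ : ∀ k, HasDerivAt (fun k => (θ k : ℂ)) (2 * T) k := fun k => by
      have := (((hasDerivAt_id k).const_mul 2).mul_const T).const_add r
      refine (HasDerivAt.ofReal_comp this).congr_deriv ?_
      simp
    have de : ∀ k, HasDerivAt e (e k * (Complex.I * (2 * k * T))) k := fun k => by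
      have h1 : HasDerivAt (fun k : ℝ => (k : ℂ)) 1 k := Complex.ofRealCLM.hasDerivAt
      have := (((h1.pow 2).mul_const (T : ℂ)).const_mul Complex.I).cexp
      refine this.congr_deriv ?_
      simp [he]
    have dX : ∀ k, 0 < k → HasDerivAt X (r * Y k) k := fun k hk => by
      have h1 : HasDerivAt (fun k => k * r) r k := by simpa using (hasDerivAt_id k).mul_const r
      have := HasDerivAt.scomp k ((isSol_chi hα0 hα1).left (k * r) (mul_pos hk hr)) h1
      exact this.congr_deriv (by rw [Complex.real_smul])
    have cX : ContinuousOn X (uIcc p q) := fun k hk =>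
      (dX k (hkpos k hk)).continuousAt.continuousWithinAt
    have cY : ContinuousOn Y (uIcc p q) := fun k hk => by
      have h1 : ContinuousAt (chiDeriv α) (k * r) :=
        ((isSol_chi hα0 hα1).right (k * r) (mul_pos (hkpos k hk) hr)).continuousAt
      exact (ContinuousAt.comp (f := fun k => k * r) h1 (by fun_prop)).continuousWithinAt
    have ce : ContinuousOn e (uIcc p q) := fun k _ => (de k).continuousAt.continuousWithinAt
    have ca : ContinuousOn a (uIcc p q) := fun k hk =>
      (h.hasDerivAt k (hkpos k hk)).continuousAt.continuousWithinAt
    have ca' : ContinuousOn a' (uIcc p q) := h.cont.mono hkpos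
    have cθ : ContinuousOn (fun k => (θ k : ℂ)) (uIcc p q) := fun k _ =>
      (dθ k).continuousAt.continuousWithinAt
    have hθne' : ∀ k ∈ uIcc p q, (θ k : ℂ) ≠ 0 := fun k hk => hθne k (hkp k hk)
    have hθne2 : ∀ k ∈ uIcc p q, (θ k : ℂ) ^ 2 ≠ 0 := fun k hk => pow_ne_zero 2 (hθne' k hk)
    -- The derivative of `(a/θ) e X`, less the original integrand times `i`: the derivative falls on
    -- `a/θ`, or on `X` with its oscillation `iX` removed.
    set R : ℝ → ℂ := fun k => (a' k * θ k - a k * (2 * T)) / (θ k) ^ 2 * (e k * X k)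
      + a k / θ k * (e k * (r * (Y k - Complex.I * X k))) with hR
    have cR : ContinuousOn R (uIcc p q) :=
      ((((ca'.mul cθ).sub (ca.mul continuousOn_const)).div (cθ.pow 2) hθne2).mul (ce.mul cX)).add
        ((ca.div cθ hθne').mul (ce.mul (continuousOn_const.mul (cY.sub (continuousOn_const.mul cX)))))
    have cS : ContinuousOn (fun k => Complex.I * (a k * e k * X k)) (uIcc p q) :=
      continuousOn_const.mul ((ca.mul ce).mul cX)
    have hd : ∀ k ∈ uIcc p q, HasDerivAt (fun k => a k / θ k * (e k * X k))
        (R k + Complex.I * (a k * e k * X k)) k := fun k hk => by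
      have h0 := hθne' k hk
      refine ((((h.hasDerivAt k (hkpos k hk)).div (dθ k) h0)).mul
        ((de k).mul (dX k (hkpos k hk)))).congr_deriv ?_
      have e1 : Complex.I * (a k * e k * X k) = a k / θ k * (e k * (Complex.I * θ k * X k)) := by
        field_simp
      have e2 : (θ k : ℂ) = r + 2 * k * T := by simp only [hθ]; push_cast; rfl
      rw [e1, hR]
      simp only [Pi.div_apply, Pi.mul_apply]
      linear_combination (-(a k / θ k * e k * Complex.I * X k)) * e2
    have ibp := intervalIntegral.integral_eq_sub_of_hasDerivAt hd
      ((cR.add cS).intervalIntegrable)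
    rw [intervalIntegral.integral_add cR.intervalIntegrable cS.intervalIntegrable,
      intervalIntegral.integral_const_mul, h.zero p (by simp), h.zero q (by simp)] at ibp
    have eq : ‖∫ k in p..q, a k * e k * X k‖ = ‖∫ k in p..q, R k‖ := by
      have : Complex.I * ∫ k in p..q, a k * e k * X k = -∫ k in p..q, R k := by
        linear_combination ibp
      have := congrArg norm this
      rwa [norm_mul, Complex.norm_I, one_mul, norm_neg] at this
    rw [eq]
    refine intervalIntegral.norm_integral_le_of_norm_le_const fun k hk => ?_
    rw [uIoc_of_le h.lt.le] at hk
    have hk1 : p ≤ k := hk.1.le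
    have hk0 : 0 < k := hp.trans_le hk1
    have t0 : 0 < θ k := hy0.trans_le (hθ0 k hk1)
    have na := h.le k hk1 hk.2
    have na' := h.le' k hk1 hk.2
    have b1 : ‖(a' k * θ k - a k * (2 * T)) / (θ k : ℂ) ^ 2‖ ≤ M * (1 + 1 / p) / θ k := by
      rw [norm_div, norm_pow, Complex.norm_real, Real.norm_of_nonneg t0.le, div_le_div_iff₀
        (by positivity) t0]
      have : ‖a' k * θ k - a k * (2 * T)‖ ≤ M * θ k + M * (2 * T) := by
        refine (norm_sub_le _ _).trans ?_
        rw [norm_mul, norm_mul, Complex.norm_real, Real.norm_of_nonneg t0.le,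
          show (2 * T : ℂ) = ((2 * T : ℝ) : ℂ) by push_cast; rfl, Complex.norm_real,
          Real.norm_of_nonneg (by positivity)]
        gcongr
      have h2 : 2 * T ≤ 1 / p * θ k := by
        rw [div_mul_eq_mul_div, le_div_iff₀ hp, one_mul]
        have : p * T ≤ k * T := by gcongr
        simp only [hθ]; linarith
      have h3 : M * (2 * T) ≤ M * (1 / p * θ k) := by gcongr
      calc _ ≤ (M * θ k + M * (2 * T)) * θ k := by gcongr
        _ ≤ (M * θ k + M * (1 / p * θ k)) * θ k := by gcongr
        _ = _ := by ring
    have b2 : ‖(e k * (r * (Y k - Complex.I * X k)) : ℂ)‖ ≤ B / p := by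
      rw [norm_mul, ne, one_mul, norm_mul, Complex.norm_real, Real.norm_of_nonneg hr.le,
        le_div_iff₀ hp, mul_comm]
      refine le_trans ?_ (nY k hk1)
      gcongr
    have b3 : ‖a k / (θ k : ℂ)‖ ≤ M / θ k := by
      rw [norm_div, Complex.norm_real, Real.norm_of_nonneg t0.le]; gcongr
    have b4 : ‖e k * X k‖ ≤ B := by rw [norm_mul, ne, one_mul]; exact nX k hk1
    calc ‖R k‖ ≤ M * (1 + 1 / p) / θ k * B + M / θ k * (B / p) := by
          refine (norm_add_le _ _).trans ?_
          rw [norm_mul, norm_mul (a k / (θ k : ℂ))]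
          gcongr
      _ = M * B * (1 + 2 / p) / θ k := by ring
      _ ≤ M * B * (1 + 2 / p) / y := by
          have := hθ0 k hk1
          gcongr
  set Z : ℝ := M * B * (1 + 2 / p) * |q - p| with hZ
  have hZ0 : 0 ≤ Z := by positivity
  have hp2 : 1 ≤ 1 + 2 / p := by have : 0 < 2 / p := by positivity
                                 linarith
  set I := ‖∫ k in p..q, a k * e k * X k‖ with hI
  have z1 : I ≤ Z := bound1.trans (by
    rw [hZ]
    exact mul_le_mul_of_nonneg_right (le_mul_of_one_le_right (by positivity) hp2) (abs_nonneg _))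
  have z2 : y * I ≤ Z := by
    rw [div_mul_eq_mul_div, le_div_iff₀ hy0, mul_comm] at bound2; exact bound2
  -- Adding the bounds for `I` and `y I` removes the singularity at `y = 0`.
  have z3 : I ≤ 2 * Z * (1 + r + 2 * p * T)⁻¹ := by
    rw [← div_eq_mul_inv, le_div_iff₀ (by positivity)]
    have : I * (1 + r + 2 * p * T) = I + y * I := by rw [hy]; ring
    linarith
  calc I ≤ 2 * Z * (1 + r + 2 * p * T)⁻¹ := z3
    _ ≤ 2 * Z * ((1 + r) ^ (-(3 / 4) : ℝ) * (1 + 2 * p * T) ^ (-(1 / 4) : ℝ)) := by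
        gcongr
        exact mul_rpow_le_add hr.le (by positivity)
    _ = _ := by rw [hZ, hB, weight]; ring

end AnyonDelta

end
noncomputable section

namespace AnyonDelta

/-! ### Wave packets -/

/-- The square of the weight is `O(r^{-α})` at the origin, where `α < 1`, and `O(r^{-3/2})` at
infinity. -/
theorem memLp_weight {α : ℝ} (hα0 : 0 ≤ α) (hα1 : α < 1) : MemLp (weight α) 2 halfLine := by
  have hc : ContinuousOn (weight α) (Ioi 0) := by
    intro r hr
    have h1 : r ≠ 0 := (mem_Ioi.1 hr).ne'
    have h2 : 1 + r ≠ 0 := by have := mem_Ioi.1 hr; positivity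
    refine ContinuousAt.continuousWithinAt ?_
    unfold weight
    exact (continuousAt_const.add (Real.continuousAt_rpow_const r _ (Or.inl h1))).mul
      ((continuousAt_const.add continuousAt_id).rpow_const (Or.inl h2))
  have hm := hc.aestronglyMeasurable measurableSet_Ioi (μ := volume)
  rw [memLp_two_iff_integrable_sq_norm hm]
  change IntegrableOn (fun r => ‖weight α r‖ ^ 2) (Ioi 0) volume
  rw [← Ioc_union_Ioi_eq_Ioi zero_le_one]
  have hm2 : AEStronglyMeasurable (fun r => ‖weight α r‖ ^ 2) halfLine := hm.norm.pow 2
  refine IntegrableOn.union ?_ ?_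
  · refine Integrable.mono' (g := fun r : ℝ => 4 * r ^ (-α)) ?_
      (hm2.mono_measure (Measure.restrict_mono Ioc_subset_Ioi_self le_rfl)) ?_
    · exact ((intervalIntegrable_iff_integrableOn_Ioc_of_le zero_le_one).1
        (intervalIntegral.intervalIntegrable_rpow' (by linarith))).const_mul _
    · rw [ae_restrict_iff' measurableSet_Ioc]
      refine Eventually.of_forall fun r hr => ?_
      have h0 := weight_pos (α := α) hr.1
      have h1 : 1 ≤ r ^ (-(α / 2)) := Real.one_le_rpow_of_pos_of_le_one_of_nonpos hr.1 hr.2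
        (by linarith)
      have h2 : (1 + r) ^ (-(3 / 4) : ℝ) ≤ 1 :=
        Real.rpow_le_one_of_one_le_of_nonpos (by linarith [hr.1]) (by norm_num)
      have h3 : weight α r ≤ 2 * r ^ (-(α / 2)) := by
        rw [weight]
        calc _ ≤ (1 + r ^ (-(α / 2))) * 1 := by gcongr
          _ ≤ _ := by linarith
      have e : r ^ (-α) = (r ^ (-(α / 2))) ^ 2 := by
        rw [← Real.rpow_natCast, ← Real.rpow_mul hr.1.le]; congr 1; push_cast; ring
      rw [Real.norm_eq_abs, Real.norm_eq_abs, sq_abs, abs_of_nonneg (sq_nonneg _), e]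
      calc weight α r ^ 2 ≤ (2 * r ^ (-(α / 2))) ^ 2 := by gcongr
        _ = _ := by ring
  · refine Integrable.mono' (g := fun r : ℝ => 4 * r ^ (-(3 / 2) : ℝ)) ?_
      (hm2.mono_measure (Measure.restrict_mono (Ioi_subset_Ioi zero_le_one) le_rfl)) ?_
    · exact (integrableOn_Ioi_rpow_of_lt (by norm_num) one_pos).const_mul _
    · rw [ae_restrict_iff' measurableSet_Ioi]
      refine Eventually.of_forall fun r hr => ?_
      have hr1 : 1 < r := hr
      have hr0 : 0 < r := by linarith
      have h0 := weight_pos (α := α) hr0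
      have h1 : r ^ (-(α / 2)) ≤ 1 := Real.rpow_le_one_of_one_le_of_nonpos hr1.le (by linarith)
      have h2 : (1 + r) ^ (-(3 / 4) : ℝ) ≤ r ^ (-(3 / 4) : ℝ) :=
        Real.rpow_le_rpow_of_nonpos hr0 (by linarith) (by norm_num)
      have h3 : weight α r ≤ 2 * r ^ (-(3 / 4) : ℝ) := by
        rw [weight]
        calc _ ≤ (1 + 1) * r ^ (-(3 / 4) : ℝ) := by gcongr
          _ = _ := by ring
      have e : r ^ (-(3 / 2) : ℝ) = (r ^ (-(3 / 4) : ℝ)) ^ 2 := by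
        rw [← Real.rpow_natCast, ← Real.rpow_mul hr0.le]; congr 1; push_cast; ring
      rw [Real.norm_eq_abs, Real.norm_eq_abs, sq_abs, abs_of_nonneg (sq_nonneg _), e]
      calc weight α r ^ 2 ≤ (2 * r ^ (-(3 / 4) : ℝ)) ^ 2 := by gcongr
        _ = _ := by ring

/-! ### Calculus of amplitudes -/

section amp
variable {p q M : ℝ} {a a' : ℝ → ℂ}

theorem IsAmp.bound_nonneg (h : IsAmp p q M a a') : 0 ≤ M :=
  (norm_nonneg _).trans (h.le p le_rfl h.lt.le)

theorem IsAmp.continuousOn (h : IsAmp p q M a a') : ContinuousOn a (Ioi 0) := fun k hk =>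
  (h.hasDerivAt k hk).continuousAt.continuousWithinAt

theorem IsAmp.conj (h : IsAmp p q M a a') :
    IsAmp p q M (fun k => (starRingEnd ℂ) (a k)) (fun k => (starRingEnd ℂ) (a' k)) :=
  ⟨h.pos, h.lt, fun k hk => (Complex.conjCLE : ℂ →L[ℝ] ℂ).hasFDerivAt.comp_hasDerivAt k
    (h.hasDerivAt k hk), Complex.continuous_conj.comp_continuousOn h.cont,
    fun k hk => by rw [h.zero k hk, map_zero], fun k h1 h2 => by rw [Complex.norm_conj]; exact h.le k h1 h2,
    fun k h1 h2 => by rw [Complex.norm_conj]; exact h.le' k h1 h2⟩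

theorem IsAmp.mul (h : IsAmp p q M a a') {D : ℝ} {f f' : ℝ → ℂ}
    (hd : ∀ k, 0 < k → HasDerivAt f (f' k) k) (hc : ContinuousOn f' (Ioi 0))
    (hD : ∀ k, p ≤ k → k ≤ q → ‖f k‖ ≤ D) (hD' : ∀ k, p ≤ k → k ≤ q → ‖f' k‖ ≤ D) :
    IsAmp p q (2 * D * M) (fun k => f k * a k) (fun k => f' k * a k + f k * a' k) := by
  have hM := h.bound_nonneg
  have hD0 : 0 ≤ D := (norm_nonneg _).trans (hD p le_rfl h.lt.le)
  have hDM : 0 ≤ D * M := by positivity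
  have hf : ContinuousOn f (Ioi 0) := fun k hk => (hd k hk).continuousAt.continuousWithinAt
  refine ⟨h.pos, h.lt, fun k hk => (hd k hk).mul (h.hasDerivAt k hk),
    (hc.mul h.continuousOn).add (hf.mul h.cont), fun k hk => by rw [h.zero k hk, mul_zero],
    fun k h1 h2 => ?_, fun k h1 h2 => ?_⟩
  · rw [norm_mul]
    have : ‖f k‖ * ‖a k‖ ≤ D * M := by
      gcongr
      exacts [hD k h1 h2, h.le k h1 h2]
    linarith
  · refine (norm_add_le _ _).trans ?_
    rw [norm_mul, norm_mul]
    have : ‖f' k‖ * ‖a k‖ ≤ D * M := by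
      gcongr
      exacts [hD' k h1 h2, h.le k h1 h2]
    have : ‖f k‖ * ‖a' k‖ ≤ D * M := by
      gcongr
      exacts [hD k h1 h2, h.le' k h1 h2]
    linarith

/-- Multiplication of amplitudes by a continuously differentiable function. -/
theorem exists_isAmp_mul {f : ℝ → ℂ} (hf : ContDiffOn ℝ 1 f (Ioi 0)) (hp : 0 < p) (q : ℝ) :
    ∃ D : ℝ, 0 ≤ D ∧ ∀ M a a', IsAmp p q M a a' →
      IsAmp p q (D * M) (fun k => f k * a k) (fun k => deriv f k * a k + f k * a' k) := by
  have hsub : Icc p q ⊆ Ioi 0 := fun k hk => hp.trans_le hk.1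
  have hc := hf.continuousOn_deriv_of_isOpen isOpen_Ioi le_rfl
  obtain ⟨D₁, h₁⟩ := isCompact_Icc.exists_bound_of_continuousOn (hf.continuousOn.mono hsub)
  obtain ⟨D₂, h₂⟩ := isCompact_Icc.exists_bound_of_continuousOn (hc.mono hsub)
  refine ⟨2 * max 0 (max D₁ D₂), by positivity, fun M a a' h => h.mul (fun k hk => ?_) hc
    (fun k h1 h2 => (h₁ k ⟨h1, h2⟩).trans ((le_max_left _ _).trans (le_max_right _ _)))
    fun k h1 h2 => (h₂ k ⟨h1, h2⟩).trans ((le_max_right _ _).trans (le_max_right _ _))⟩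
  exact ((hf.contDiffAt (Ioi_mem_nhds hk)).differentiableAt one_ne_zero).hasDerivAt

end amp

/-- Families of solutions of the eigenvalue equation, indexed by the momentum, that give square
integrable wave packets. -/
structure PacketKernel (α : ℝ) (u v : ℝ → ℝ → ℂ) : Prop where
  sol : ∀ k, 0 < k → IsSol (α ^ 2 - 1 / 4) (k ^ 2) (u k) (v k)
  contu : ContinuousOn (fun x : ℝ × ℝ => u x.1 x.2) (Ioi 0 ×ˢ Ioi 0)
  contv : ContinuousOn (fun x : ℝ × ℝ => v x.1 x.2) (Ioi 0 ×ˢ Ioi 0)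
  bound : ∀ p q, 0 < p → ∃ C : ℝ, 0 ≤ C ∧ ∀ M a a', IsAmp p q M a a' → ∀ r, 0 < r →
    ‖packet u a r‖ ≤ C * M * weight α r

theorem continuousOn_slice {u : ℝ → ℝ → ℂ}
    (hu : ContinuousOn (fun x : ℝ × ℝ => u x.1 x.2) (Ioi 0 ×ˢ Ioi 0)) {r : ℝ} (hr : 0 < r) :
    ContinuousOn (fun k => u k r) (Ioi 0) :=
  hu.comp (by fun_prop : ContinuousOn (fun k : ℝ => (k, r)) (Ioi 0)) fun _ hk => ⟨hk, hr⟩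

/-! ### Linearity and differentiation of wave packets -/

section
variable {p q : ℝ} {a b : ℝ → ℂ} {u u₁ v : ℝ → ℝ → ℂ} {r : ℝ}

theorem intervalIntegrable_packet (hp : 0 < p) (hpq : p < q) (ca : ContinuousOn a (Ioi 0))
    (hu : ContinuousOn (fun x : ℝ × ℝ => u x.1 x.2) (Ioi 0 ×ˢ Ioi 0)) (hr : 0 < r) :
    IntervalIntegrable (fun k => a k * u k r) volume p q :=
  ((ca.mul (continuousOn_slice hu hr)).mono
    (uIcc_subset_Ioi hp (hp.trans hpq))).intervalIntegrable

theorem packet_add (hp : 0 < p) (hpq : p < q) (ca : ContinuousOn a (Ioi 0))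
    (cb : ContinuousOn b (Ioi 0)) (ha : ∀ k, k ∉ Ioo p q → a k = 0)
    (hb : ∀ k, k ∉ Ioo p q → b k = 0)
    (hu : ContinuousOn (fun x : ℝ × ℝ => u x.1 x.2) (Ioi 0 ×ˢ Ioi 0)) (hr : 0 < r) :
    packet u (fun k => a k + b k) r = packet u a r + packet u b r := by
  rw [packet_eq_intervalIntegral hp hpq u ha, packet_eq_intervalIntegral hp hpq u hb,
    packet_eq_intervalIntegral hp hpq u (fun k hk => by rw [ha k hk, hb k hk, add_zero]),
    ← intervalIntegral.integral_add (intervalIntegrable_packet hp hpq ca hu hr)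
      (intervalIntegrable_packet hp hpq cb hu hr)]
  simp only [add_mul]

theorem packet_kernel_add (hp : 0 < p) (hpq : p < q) (ca : ContinuousOn a (Ioi 0))
    (ha : ∀ k, k ∉ Ioo p q → a k = 0)
    (hu : ContinuousOn (fun x : ℝ × ℝ => u x.1 x.2) (Ioi 0 ×ˢ Ioi 0))
    (hu₁ : ContinuousOn (fun x : ℝ × ℝ => u₁ x.1 x.2) (Ioi 0 ×ˢ Ioi 0)) (hr : 0 < r) :
    packet (fun k r => u k r + u₁ k r) a r = packet u a r + packet u₁ a r := by
  rw [packet_eq_intervalIntegral hp hpq _ ha, packet_eq_intervalIntegral hp hpq u ha,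
    packet_eq_intervalIntegral hp hpq u₁ ha,
    ← intervalIntegral.integral_add (intervalIntegrable_packet hp hpq ca hu hr)
      (intervalIntegrable_packet hp hpq ca hu₁ hr)]
  simp only [mul_add]

theorem packet_kernel_mul (f : ℝ → ℂ) :
    packet (fun k r => f k * u k r) a r = packet u (fun k => f k * a k) r := by
  rw [packet, packet]
  refine integral_congr_ae (Eventually.of_forall fun k => ?_)
  simp only
  ring

theorem packet_const_mul (c : ℂ) : packet u (fun k => c * a k) r = c * packet u a r := by
  rw [packet, packet, ← integral_const_mul]
  simp only [mul_assoc]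

theorem packet_conj : packet (fun k r => (starRingEnd ℂ) (u k r)) a r =
    (starRingEnd ℂ) (packet u (fun k => (starRingEnd ℂ) (a k)) r) := by
  rw [packet, packet, ← integral_conj]
  simp only [map_mul, Complex.conj_conj]

theorem packet_congr (h : ∀ k, 0 < k → a k * u k r = b k * u₁ k r) :
    packet u a r = packet u₁ b r :=
  setIntegral_congr_fun measurableSet_Ioi fun k hk => h k hk

theorem hasDerivAt_packet (hp : 0 < p) (hpq : p < q) (ca : ContinuousOn a (Ioi 0))
    (ha : ∀ k, k ∉ Ioo p q → a k = 0)
    (hd : ∀ k, 0 < k → ∀ r, 0 < r → HasDerivAt (u k) (v k r) r)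
    (hu : ContinuousOn (fun x : ℝ × ℝ => u x.1 x.2) (Ioi 0 ×ˢ Ioi 0))
    (hv : ContinuousOn (fun x : ℝ × ℝ => v x.1 x.2) (Ioi 0 ×ˢ Ioi 0)) (hr : 0 < r) :
    HasDerivAt (packet u a) (packet v a r) r := by
  have hsub : Icc p q ×ˢ Icc (r / 2) (2 * r) ⊆ Ioi 0 ×ˢ Ioi 0 := fun x hx =>
    ⟨hp.trans_le hx.1.1, (half_pos hr).trans_le hx.2.1⟩
  obtain ⟨B, hB⟩ := (isCompact_Icc.prod isCompact_Icc).exists_bound_of_continuousOn (hv.mono hsub)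
  obtain ⟨A, hA⟩ := isCompact_Icc.exists_bound_of_continuousOn
    (ca.mono fun k (hk : k ∈ Icc p q) => hp.trans_le hk.1)
  have hm : ∀ {w : ℝ → ℝ → ℂ}, ContinuousOn (fun x : ℝ × ℝ => w x.1 x.2) (Ioi 0 ×ˢ Ioi 0) →
      ∀ {x : ℝ}, 0 < x → AEStronglyMeasurable (fun k => a k * w k x)
        (volume.restrict (uIoc p q)) := fun hw x hx =>
    ((ca.mul (continuousOn_slice hw hx)).mono (uIoc_subset_uIcc.trans
      (uIcc_subset_Ioi hp (hp.trans hpq)))).aestronglyMeasurable measurableSet_uIoc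
  have key := (intervalIntegral.hasDerivAt_integral_of_dominated_loc_of_deriv_le (μ := volume)
    (F := fun x k => a k * u k x) (F' := fun x k => a k * v k x) (x₀ := r) (a := p) (b := q)
    (s := Icc (r / 2) (2 * r)) (bound := fun _ => A * B)
    (Icc_mem_nhds (by linarith) (by linarith)) ?_ (intervalIntegrable_packet hp hpq ca hu hr)
    (hm hv hr) ?_ intervalIntegrable_const ?_).2
  · rw [packet_eq_intervalIntegral hp hpq v ha]
    refine key.congr_of_eventuallyEq (Eventually.of_forall fun x => ?_)
    exact packet_eq_intervalIntegral hp hpq u ha x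
  · filter_upwards [Ioi_mem_nhds hr] with x hx using hm hu hx
  · refine Eventually.of_forall fun k hk x hx => ?_
    rw [uIoc_of_le hpq.le] at hk
    rw [norm_mul]
    have h1 := hA k ⟨hk.1.le, hk.2⟩
    exact mul_le_mul h1 (hB (k, x) ⟨⟨hk.1.le, hk.2⟩, hx⟩) (norm_nonneg _)
      ((norm_nonneg _).trans h1)
  · refine Eventually.of_forall fun k hk x hx => ?_
    rw [uIoc_of_le hpq.le] at hk
    exact (hd k (hp.trans hk.1) x ((half_pos hr).trans_le hx.1)).const_mul (a k)

end

namespace PacketKernel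
variable {α : ℝ} {u v u₁ v₁ : ℝ → ℝ → ℂ}

theorem conj (K : PacketKernel α u v) : PacketKernel α (fun k r => (starRingEnd ℂ) (u k r))
    (fun k r => (starRingEnd ℂ) (v k r)) := by
  refine ⟨fun k hk => (K.sol k hk).conj, Complex.continuous_conj.comp_continuousOn K.contu,
    Complex.continuous_conj.comp_continuousOn K.contv, fun p q hp => ?_⟩
  obtain ⟨C, hC, k⟩ := K.bound p q hp
  refine ⟨C, hC, fun M a a' h r hr => ?_⟩
  rw [packet_conj, Complex.norm_conj]
  exact k M _ _ h.conj r hr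

theorem add (K : PacketKernel α u v) (K₁ : PacketKernel α u₁ v₁) :
    PacketKernel α (fun k r => u k r + u₁ k r) (fun k r => v k r + v₁ k r) := by
  refine ⟨fun k hk => (K.sol k hk).add (K₁.sol k hk), K.contu.add K₁.contu,
    K.contv.add K₁.contv, fun p q hp => ?_⟩
  obtain ⟨C, hC, k⟩ := K.bound p q hp
  obtain ⟨C₁, hC₁, k₁⟩ := K₁.bound p q hp
  refine ⟨C + C₁, by positivity, fun M a a' h r hr => ?_⟩
  rw [packet_kernel_add hp h.lt h.continuousOn h.zero K.contu K₁.contu hr]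
  refine (norm_add_le _ _).trans ?_
  have := k M a a' h r hr
  have := k₁ M a a' h r hr
  linarith

theorem mul (K : PacketKernel α u v) {f : ℝ → ℂ} (hf : ContDiffOn ℝ 1 f (Ioi 0)) :
    PacketKernel α (fun k r => f k * u k r) (fun k r => f k * v k r) := by
  have hf1 : ContinuousOn (fun x : ℝ × ℝ => f x.1) (Ioi 0 ×ˢ Ioi 0) :=
    hf.continuousOn.comp continuousOn_fst fun x hx => hx.1
  refine ⟨fun k hk => (K.sol k hk).const_mul (f k), hf1.mul K.contu, hf1.mul K.contv,
    fun p q hp => ?_⟩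
  obtain ⟨C, hC, k⟩ := K.bound p q hp
  obtain ⟨D, hD, hm⟩ := exists_isAmp_mul hf hp q
  refine ⟨C * D, by positivity, fun M a a' h r hr => ?_⟩
  rw [packet_kernel_mul]
  have := k _ _ _ (hm M a a' h) r hr
  rwa [mul_assoc C D M]

variable {p q M : ℝ} {a a' : ℝ → ℂ}

theorem hasDerivAt (K : PacketKernel α u v) (h : IsAmp p q M a a') {r : ℝ} (hr : 0 < r) :
    HasDerivAt (packet u a) (packet v a r) r :=
  hasDerivAt_packet h.pos h.lt h.continuousOn h.zero (fun k hk => (K.sol k hk).left) K.contu K.contv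
    hr

theorem hasDerivAt_deriv (K : PacketKernel α u v) (h : IsAmp p q M a a') {r : ℝ} (hr : 0 < r) :
    HasDerivAt (packet v a) (((α ^ 2 - 1 / 4) / r ^ 2 : ℝ) * packet u a r
      - packet u (fun k => (k : ℂ) ^ 2 * a k) r) r := by
  have ck : ContinuousOn (fun k : ℝ => -((k : ℂ) ^ 2) * a k) (Ioi 0) :=
    (by fun_prop : ContinuousOn (fun k : ℝ => -((k : ℂ) ^ 2)) (Ioi 0)).mul h.continuousOn
  have hw : ContinuousOn (fun x : ℝ × ℝ =>
      ((α ^ 2 - 1 / 4) / x.2 ^ 2 - x.1 ^ 2) • u x.1 x.2) (Ioi 0 ×ˢ Ioi 0) := by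
    have : ContinuousOn (fun x : ℝ × ℝ => (α ^ 2 - 1 / 4) / x.2 ^ 2 - x.1 ^ 2)
        (Ioi 0 ×ˢ Ioi 0) := by
      refine ContinuousOn.sub (continuousOn_const.div (by fun_prop) fun x hx => ?_) (by fun_prop)
      exact pow_ne_zero 2 (mem_Ioi.1 hx.2).ne'
    exact this.smul K.contu
  refine (hasDerivAt_packet h.pos h.lt h.continuousOn h.zero
    (v := fun k r => ((α ^ 2 - 1 / 4) / r ^ 2 - k ^ 2) • u k r)
    (fun k hk => (K.sol k hk).right) K.contv hw hr).congr_deriv ?_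
  rw [← packet_const_mul, sub_eq_add_neg (packet _ _ _), ← neg_one_mul (packet u _ r),
    ← packet_const_mul]
  have := packet_add (a := fun k => (((α ^ 2 - 1 / 4) / r ^ 2 : ℝ) : ℂ) * a k)
    (b := fun k => -1 * ((k : ℂ) ^ 2 * a k)) h.pos h.lt (continuousOn_const.mul h.continuousOn)
    (ck.congr fun k _ => by ring) (fun k hk => by rw [h.zero k hk, mul_zero])
    (fun k hk => by rw [h.zero k hk]; ring) K.contu hr
  rw [← this]
  refine packet_congr fun k hk => ?_
  rw [Complex.real_smul]
  push_cast; ring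

theorem continuousOn_packet (K : PacketKernel α u v) (h : IsAmp p q M a a') :
    ContinuousOn (packet u a) (Ioi 0) := fun _ hr =>
  (K.hasDerivAt h hr).continuousAt.continuousWithinAt

theorem norm_packet_le (K : PacketKernel α u v) (hp : 0 < p) (q : ℝ) : ∃ C : ℝ, 0 ≤ C ∧
    ∀ M a a', IsAmp p q M a a' → ∀ᵐ r ∂halfLine, ‖packet u a r‖ ≤ C * M * ‖weight α r‖ := by
  obtain ⟨C, hC, k⟩ := K.bound p q hp
  refine ⟨C, hC, fun M a a' h => ?_⟩
  rw [ae_restrict_iff' measurableSet_Ioi]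
  refine Eventually.of_forall fun r hr => ?_
  rw [Real.norm_of_nonneg (weight_pos hr).le]
  exact k M a a' h r hr

theorem memLp_packet (hα0 : 0 ≤ α) (hα1 : α < 1) (K : PacketKernel α u v)
    (h : IsAmp p q M a a') : MemLp (packet u a) 2 halfLine := by
  obtain ⟨C, -, k⟩ := K.norm_packet_le h.pos q
  exact (memLp_weight hα0 hα1).of_le_mul
    ((K.continuousOn_packet h).aestronglyMeasurable measurableSet_Ioi) (k M a a' h)

theorem exists_isAmp_sq_mul (h : IsAmp p q M a a') :
    ∃ M₂ a₂', IsAmp p q M₂ (fun k => (k : ℂ) ^ 2 * a k) a₂' := by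
  have hf : ContDiffOn ℝ 1 (fun k : ℝ => (k : ℂ) ^ 2) (Ioi 0) :=
    (Complex.ofRealCLM.contDiff.pow 2).contDiffOn
  obtain ⟨D, -, hm⟩ := exists_isAmp_mul hf h.pos q
  exact ⟨_, _, hm M a a' h⟩

theorem radialExpr_packet (K : PacketKernel α u v) (h : IsAmp p q M a a') {r : ℝ} (hr : 0 < r) :
    radialExpr α (packet u a) r = packet u (fun k => (k : ℂ) ^ 2 * a k) r := by
  have hd : HasDerivAt (deriv (packet u a)) _ r :=
    (K.hasDerivAt_deriv h hr).congr_of_eventuallyEq (by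
      filter_upwards [Ioi_mem_nhds hr] with x hx using (K.hasDerivAt h hx).deriv)
  rw [radialExpr, hd.deriv]
  push_cast; ring

theorem inMaximalDomain (hα0 : 0 ≤ α) (hα1 : α < 1) (K : PacketKernel α u v)
    (h : IsAmp p q M a a') : InMaximalDomain α (packet u a) := by
  obtain ⟨M₂, a₂', h₂⟩ := exists_isAmp_sq_mul h
  refine ⟨fun r hr => (K.hasDerivAt h hr).differentiableAt, fun x y hx hxy => ?_,
    K.memLp_packet hα0 hα1 h, ?_⟩
  · have hsub := uIcc_subset_Ioi hx (hx.trans hxy)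
    refine absolutelyContinuous_congr (absolutelyContinuous_of_hasDerivAt
      (fun r hr => K.hasDerivAt_deriv h (hsub hr)) ?_)
      fun r hr => (K.hasDerivAt h (hsub hr)).deriv
    have hV : ContinuousOn (fun r : ℝ => (((α ^ 2 - 1 / 4) / r ^ 2 : ℝ) : ℂ)) (Ioi 0) := by
      refine Complex.continuous_ofReal.comp_continuousOn ?_
      exact continuousOn_const.div (by fun_prop) fun r hr => pow_ne_zero 2 (mem_Ioi.1 hr).ne'
    exact ((hV.mul (K.continuousOn_packet h)).sub (K.continuousOn_packet h₂)).mono hsub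
  · refine (K.memLp_packet hα0 hα1 h₂).ae_eq ?_
    rw [EventuallyEq, ae_restrict_iff' measurableSet_Ioi]
    exact Eventually.of_forall fun r hr => (K.radialExpr_packet h hr).symm

/-- Wave packets of solutions that have the boundary values of a controlled family satisfy the
boundary condition of this family. -/
theorem boundaryCondition (K : PacketKernel α u v) {β : ℝ} (hβ : β < 1 / 2) {X Y : ℝ → ℝ → ℝ}
    (hX : ∀ E r, 0 < r → HasDerivAt (X E) (Y E r) r) (hXY : NearBound β X Y) {F : ℝ → ℂ}
    (hF : ContinuousOn F (Ioi 0)) (he : ∀ k r, 0 < k → 0 < r → u k r = F k * X (k ^ 2) r)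
    (h : IsAmp p q M a a') : BoundaryCondition (fun r => (X 0 r : ℂ)) (packet u a) := by
  have he' : ∀ k r, 0 < k → 0 < r → v k r = F k * Y (k ^ 2) r := fun k r hk hr => by
    refine ((K.sol k hk).left r hr).unique
      (((hX (k ^ 2) r hr).ofReal_comp.const_mul (F k)).congr_of_eventuallyEq ?_)
    filter_upwards [Ioi_mem_nhds hr] with x hx using he k x hk hx
  rw [boundaryCondition_iff (hX 0)]
  -- At zero energy the Wronskian of the family with itself vanishes, so at energies up to `q²` it
  -- is `O(r^{1-2β})`, uniformly over the momenta in the packet.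
  obtain ⟨C, hC, k⟩ := hXY.wronskian_sub_le hXY (q ^ 2)
  obtain ⟨A, hA⟩ := isCompact_Icc.exists_bound_of_continuousOn
    (hF.mono fun k (hk : k ∈ Icc p q) => h.pos.trans_le hk.1)
  have t : Tendsto (fun r : ℝ => M * A * (C * r ^ (1 - 2 * β)) * |q - p|) (𝓝[>] 0) (𝓝 0) := by
    have := (((tendsto_rpow_nhdsGT (by linarith : 0 < 1 - 2 * β)).const_mul C).const_mul
      (M * A)).mul_const |q - p|
    simpa using this
  refine squeeze_zero_norm' ?_ t
  filter_upwards [Ioc_mem_nhdsGT (zero_lt_one' ℝ)] with r hr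
  rw [(K.hasDerivAt h hr.1).deriv, packet_eq_intervalIntegral h.pos h.lt u h.zero,
    packet_eq_intervalIntegral h.pos h.lt v h.zero, ← intervalIntegral.integral_const_mul,
    ← intervalIntegral.integral_mul_const, ← intervalIntegral.integral_sub
      ((intervalIntegrable_packet h.pos h.lt h.continuousOn K.contv hr.1).const_mul _)
      ((intervalIntegrable_packet h.pos h.lt h.continuousOn K.contu hr.1).mul_const _)]
  refine intervalIntegral.norm_integral_le_of_norm_le_const fun κ hκ => ?_
  rw [uIoc_of_le h.lt.le] at hκ
  have hκ0 : 0 < κ := h.pos.trans hκ.1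
  rw [he κ r hκ0 hr.1, he' κ r hκ0 hr.1, show (X 0 r : ℂ) * (a κ * (F κ * Y (κ ^ 2) r))
    - a κ * (F κ * X (κ ^ 2) r) * Y 0 r
    = a κ * F κ * ((X 0 r * Y (κ ^ 2) r - X (κ ^ 2) r * Y 0 r : ℝ) : ℂ) by push_cast; ring,
    norm_mul, norm_mul, Complex.norm_real, Real.norm_eq_abs]
  have e1 := h.le κ hκ.1.le hκ.2
  have e2 := hA κ ⟨hκ.1.le, hκ.2⟩
  have e3 := k 0 (κ ^ 2) r (by rw [abs_zero]; positivity)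
    (by rw [abs_of_nonneg (sq_nonneg κ)]; have := hκ.2; gcongr) hr.1 hr.2
  rw [sub_self, sub_zero] at e3
  have e4 : ‖a κ‖ * ‖F κ‖ ≤ M * A :=
    mul_le_mul e1 e2 (norm_nonneg _) h.bound_nonneg
  exact mul_le_mul e4 e3 (abs_nonneg _) ((mul_nonneg (norm_nonneg _) (norm_nonneg _)).trans e4)

end PacketKernel

end AnyonDelta

end
noncomputable section

namespace AnyonDelta

/-! ### Evolution of wave packets -/

open Classical in
/-- The wave packet as an element of the Hilbert space. -/
def packetState (u : ℝ → ℝ → ℂ) (a : ℝ → ℂ) : HalfLineL2 :=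
  if h : MemLp (packet u a) 2 halfLine then h.toLp else 0

theorem coeFn_packetState {u : ℝ → ℝ → ℂ} {a : ℝ → ℂ} (h : MemLp (packet u a) 2 halfLine) :
    (packetState u a : ℝ → ℂ) =ᵐ[halfLine] packet u a := by
  rw [packetState, dif_pos h]; exact h.coeFn_toLp

/-- The weight as an element of `L²`. -/
def weightState {α : ℝ} (hα0 : 0 ≤ α) (hα1 : α < 1) : Lp ℝ 2 halfLine :=
  (memLp_weight hα0 hα1).toLp

theorem norm_le_weightState {α C : ℝ} (hα0 : 0 ≤ α) (hα1 : α < 1) {Φ : HalfLineL2} {f : ℝ → ℂ}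
    (hΦ : (Φ : ℝ → ℂ) =ᵐ[halfLine] f) (hf : ∀ᵐ r ∂halfLine, ‖f r‖ ≤ C * ‖weight α r‖) :
    ‖Φ‖ ≤ C * ‖weightState hα0 hα1‖ := by
  refine Lp.norm_le_mul_norm_of_ae_le_mul ?_
  filter_upwards [hΦ, hf, (memLp_weight hα0 hα1).coeFn_toLp] with r h1 h2 h3
  rw [h1, weightState, h3]; exact h2

/-- The time dependent phase factor. -/
def timePhase (t k : ℝ) : ℂ := Complex.exp (-(Complex.I * (k ^ 2 * t)))

theorem hasDerivAt_timePhase (t k : ℝ) :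
    HasDerivAt (timePhase t) (timePhase t k * (-(Complex.I * (2 * k * t)))) k := by
  have h1 : HasDerivAt (fun k : ℝ => (k : ℂ)) 1 k := Complex.ofRealCLM.hasDerivAt
  have := (((h1.pow 2).mul_const (t : ℂ)).const_mul Complex.I).neg.cexp
  refine this.congr_deriv ?_
  simp [timePhase]

theorem timePhase_add (t h k : ℝ) : timePhase (t + h) k = timePhase t k * timePhase h k := by
  rw [timePhase, timePhase, timePhase, ← Complex.exp_add]; congr 1; push_cast; ring

theorem contDiff_timePhase (t : ℝ) : ContDiff ℝ 1 (timePhase t) := by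
  have h1 : ContDiff ℝ 1 (fun k : ℝ => (k : ℂ)) := Complex.ofRealCLM.contDiff
  exact ((contDiff_const.mul ((h1.pow 2).mul contDiff_const)).neg).cexp

theorem norm_timePhase_sub_le {k h : ℝ} :
    ‖timePhase h k - 1‖ ≤ k ^ 2 * |h| ∧
    (k ^ 2 * |h| ≤ 1 → ‖timePhase h k - 1 + Complex.I * (k ^ 2 * h)‖ ≤ (k ^ 2 * |h|) ^ 2) := by
  have e : timePhase h k = Complex.exp (Complex.I * ((-(k ^ 2 * h) : ℝ) : ℂ)) := by
    rw [timePhase]; congr 1; push_cast; ring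
  have n : ‖-(k ^ 2 * h)‖ = k ^ 2 * |h| := by
    rw [norm_neg, norm_mul, Real.norm_eq_abs, Real.norm_eq_abs, abs_of_nonneg (sq_nonneg k)]
  have n' : ‖Complex.I * ((-(k ^ 2 * h) : ℝ) : ℂ)‖ = k ^ 2 * |h| := by
    rw [norm_mul, Complex.norm_I, one_mul, Complex.norm_real, n]
  refine ⟨?_, fun h1 => ?_⟩
  · rw [e, ← n]; exact Real.norm_exp_I_mul_ofReal_sub_one_le
  · have := Complex.norm_exp_sub_one_sub_id_le (x := Complex.I * ((-(k ^ 2 * h) : ℝ) : ℂ))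
      (by rwa [n'])
    rw [n', ← e] at this
    refine le_trans (le_of_eq ?_) this
    congr 1; push_cast; ring

namespace PacketKernel
variable {α : ℝ} {u v : ℝ → ℝ → ℂ} {p q M : ℝ} {a a' : ℝ → ℂ}

theorem exists_isAmp_timePhase (h : IsAmp p q M a a') (t : ℝ) :
    ∃ M₁ a₁', IsAmp p q M₁ (fun k => timePhase t k * a k) a₁' := by
  obtain ⟨D, -, hm⟩ := exists_isAmp_mul (contDiff_timePhase t).contDiffOn h.pos q
  exact ⟨_, _, hm M a a' h⟩

theorem exists_isAmp_const_mul (h : IsAmp p q M a a') (c : ℂ) :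
    ∃ M₁ a₁', IsAmp p q M₁ (fun k => c * a k) a₁' := by
  obtain ⟨D, -, hm⟩ := exists_isAmp_mul (f := fun _ => c) contDiffOn_const h.pos q
  exact ⟨_, _, hm M a a' h⟩

variable (hα0 : 0 ≤ α) (hα1 : α < 1) (K : PacketKernel α u v)
include hα0 hα1 K

theorem coeFn_state (h : IsAmp p q M a a') :
    (packetState u a : ℝ → ℂ) =ᵐ[halfLine] packet u a :=
  coeFn_packetState (K.memLp_packet hα0 hα1 h)

/-- The remainder of the first order expansion in time. -/
theorem exists_remainder_bound (h : IsAmp p q M a a') (t : ℝ) : ∃ C : ℝ, ∀ᶠ τ in 𝓝 (0 : ℝ),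
    ‖packetState u (fun k => timePhase (t + τ) k * a k) - packetState u (fun k => timePhase t k * a k)
      - τ • packetState u (fun k => -Complex.I * ((k : ℂ) ^ 2 * (timePhase t k * a k)))‖
      ≤ C * ‖τ ^ 2‖ := by
  obtain ⟨M₁, a₁', h₁⟩ := exists_isAmp_timePhase h t
  obtain ⟨M₂, a₂', h₂⟩ := exists_isAmp_sq_mul h₁
  obtain ⟨M₃, a₃', h₃⟩ := exists_isAmp_const_mul h₂ (-Complex.I)
  obtain ⟨C, hC, hK⟩ := K.norm_packet_le h.pos q
  have hq : 0 < q := h.pos.trans h.lt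
  refine ⟨C * (2 * (q ^ 4 + 2 * q ^ 3) * M₁) * ‖weightState hα0 hα1‖, ?_⟩
  have hev : ∀ᶠ τ in 𝓝 (0 : ℝ), q ^ 2 * |τ| < 1 := by
    have : Continuous fun τ : ℝ => q ^ 2 * |τ| := by fun_prop
    exact this.continuousAt.eventually_lt continuousAt_const (by simp)
  filter_upwards [hev] with τ hτ
  obtain ⟨M₄, a₄', h₄⟩ := exists_isAmp_timePhase h (t + τ)
  have hk2 : ∀ k, p ≤ k → k ≤ q → k ^ 2 ≤ q ^ 2 := fun k h1 h2 => by
    have := h.pos; gcongr; linarith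
  -- The remainder is again a packet. Its factor is `O(τ²)` as a Taylor remainder, and the
  -- `k`-derivative of the factor is a product of two terms `O(τ)`; so the amplitude is of size `τ²`
  -- in the sense that controls packets.
  have amp : IsAmp p q (2 * ((q ^ 4 + 2 * q ^ 3) * τ ^ 2) * M₁)
      (fun k => (timePhase τ k - 1 + Complex.I * (k ^ 2 * τ)) * (timePhase t k * a k))
      (fun k => (timePhase τ k * (-(Complex.I * (2 * k * τ))) + Complex.I * (2 * k * τ)) *
        (timePhase t k * a k) + (timePhase τ k - 1 + Complex.I * (k ^ 2 * τ)) * a₁' k) := by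
    refine h₁.mul (fun k hk => ?_) ?_ (fun k h1 h2 => ?_) fun k h1 h2 => ?_
    · have h1 : HasDerivAt (fun k : ℝ => (k : ℂ)) 1 k := Complex.ofRealCLM.hasDerivAt
      have := ((hasDerivAt_timePhase τ k).sub_const 1).add
        (((h1.pow 2).mul_const (τ : ℂ)).const_mul Complex.I)
      refine this.congr_deriv ?_
      simp
    · have := (contDiff_timePhase τ).continuous
      fun_prop
    · have hk := hk2 k h1 h2
      have hle : k ^ 2 * |τ| ≤ q ^ 2 * |τ| := by gcongr
      refine (norm_timePhase_sub_le.2 (hle.trans hτ.le)).trans ?_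
      calc (k ^ 2 * |τ|) ^ 2 ≤ (q ^ 2 * |τ|) ^ 2 := by gcongr
        _ = q ^ 4 * τ ^ 2 := by rw [mul_pow, sq_abs]; ring
        _ ≤ (q ^ 4 + 2 * q ^ 3) * τ ^ 2 := by gcongr; linarith [pow_pos hq 3]
    · have hk0 : 0 < k := h.pos.trans_le h1
      rw [show timePhase τ k * (-(Complex.I * (2 * k * τ))) + Complex.I * (2 * k * τ)
        = -(Complex.I * ((2 * k * τ : ℝ) : ℂ)) * (timePhase τ k - 1) by push_cast; ring, norm_mul,
        norm_neg, norm_mul, Complex.norm_I, one_mul, Complex.norm_real, Real.norm_eq_abs, abs_mul,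
        abs_of_pos (by positivity : 0 < 2 * k)]
      calc 2 * k * |τ| * ‖timePhase τ k - 1‖ ≤ 2 * q * |τ| * (q ^ 2 * |τ|) := by
            gcongr
            refine norm_timePhase_sub_le.1.trans ?_
            have := hk2 k h1 h2
            gcongr
        _ = 2 * q ^ 3 * τ ^ 2 := by rw [← sq_abs τ]; ring
        _ ≤ (q ^ 4 + 2 * q ^ 3) * τ ^ 2 := by gcongr; linarith [pow_pos hq 4]
  have e : (packetState u (fun k => timePhase (t + τ) k * a k)
      - packetState u (fun k => timePhase t k * a k)
      - τ • packetState u (fun k => -Complex.I * ((k : ℂ) ^ 2 * (timePhase t k * a k))) :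
        HalfLineL2) =ᵐ[halfLine] packet u (fun k =>
        (timePhase τ k - 1 + Complex.I * (k ^ 2 * τ)) * (timePhase t k * a k)) := by
    refine (Lp.coeFn_sub _ _).trans (((Lp.coeFn_sub _ _).sub (Lp.coeFn_smul _ _)).trans ?_)
    filter_upwards [K.coeFn_state hα0 hα1 h₄, K.coeFn_state hα0 hα1 h₁, K.coeFn_state hα0 hα1 h₃,
      self_mem_ae_restrict measurableSet_Ioi] with r e1 e2 e3 hr
    simp only [Pi.sub_apply, Pi.smul_apply, e1, e2, e3, Complex.real_smul]
    rw [sub_eq_iff_eq_add, sub_eq_iff_eq_add, ← packet_const_mul,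
      ← packet_add (b := fun k => (τ : ℂ) * (-Complex.I * ((k : ℂ) ^ 2 * (timePhase t k * a k))))
        h.pos h.lt amp.continuousOn (continuousOn_const.mul h₃.continuousOn) amp.zero
        (fun k hk => by rw [h₃.zero k hk, mul_zero]) K.contu hr,
      ← packet_add (a := fun k =>
          (timePhase τ k - 1 + Complex.I * (k ^ 2 * τ)) * (timePhase t k * a k) +
            (τ : ℂ) * (-Complex.I * ((k : ℂ) ^ 2 * (timePhase t k * a k))))
        h.pos h.lt (amp.continuousOn.add (continuousOn_const.mul h₃.continuousOn))
        h₁.continuousOn (fun k hk => by rw [amp.zero k hk, h₃.zero k hk]; ring) h₁.zero K.contu hr]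
    refine packet_congr fun k hk => ?_
    rw [timePhase_add]; ring
  refine (norm_le_weightState hα0 hα1 e (hK _ _ _ amp)).trans (le_of_eq ?_)
  rw [Real.norm_of_nonneg (sq_nonneg τ)]; ring

theorem hasDerivAt_state (h : IsAmp p q M a a') (t : ℝ) :
    HasDerivAt (fun t => packetState u (fun k => timePhase t k * a k))
      (packetState u (fun k => -Complex.I * ((k : ℂ) ^ 2 * (timePhase t k * a k)))) t := by
  rw [hasDerivAt_iff_isLittleO_nhds_zero]
  obtain ⟨C, hC⟩ := K.exists_remainder_bound hα0 hα1 h t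
  exact (Asymptotics.IsBigO.of_bound C hC).trans_isLittleO
    (Asymptotics.isLittleO_pow_id one_lt_two)

/-- Wave packets evolve by the phase factors `exp(-i k² t)`. -/
theorem isSchrodingerSolution {w : ℝ → ℂ} (hbc : ∀ M (a a' : ℝ → ℂ), IsAmp p q M a a' →
    BoundaryCondition w (packet u a)) (h : IsAmp p q M a a') :
    IsSchrodingerSolution (operatorGraph α w)
      (fun t => packetState u (fun k => timePhase t k * a k)) := by
  intro t
  obtain ⟨M₁, a₁', h₁⟩ := exists_isAmp_timePhase h t
  obtain ⟨M₂, a₂', h₂⟩ := exists_isAmp_sq_mul h₁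
  obtain ⟨M₃, a₃', h₃⟩ := exists_isAmp_const_mul h₂ (-Complex.I)
  refine ⟨_, K.hasDerivAt_state hα0 hα1 h t, packet u (fun k => timePhase t k * a k),
    K.inMaximalDomain hα0 hα1 h₁, hbc _ _ _ h₁, K.coeFn_state hα0 hα1 h₁, ?_⟩
  refine (Lp.coeFn_smul _ _).trans ?_
  filter_upwards [K.coeFn_state hα0 hα1 h₃, self_mem_ae_restrict measurableSet_Ioi] with r e hr
  rw [Pi.smul_apply, e, K.radialExpr_packet h₁ hr, packet_const_mul, smul_eq_mul, ← mul_assoc,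
    mul_neg, Complex.I_mul_I, neg_neg, one_mul]

end PacketKernel

/-! ### The kernels of the free and of the outgoing states -/

theorem packetKernel_chi {α : ℝ} (hα0 : 0 ≤ α) (hα1 : α < 1) :
    PacketKernel α (fun k r => chi α (k * r)) (fun k r => k • chiDeriv α (k * r)) := by
  have hc := (isSol_chi hα0 hα1).continuousOn
  have hm : MapsTo (fun x : ℝ × ℝ => x.1 * x.2) (Ioi 0 ×ˢ Ioi 0) (Ioi 0) := fun x hx =>
    mem_Ioi.2 (mul_pos (mem_Ioi.1 hx.1) (mem_Ioi.1 hx.2))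
  have hcm : ContinuousOn (fun x : ℝ × ℝ => x.1 * x.2) (Ioi 0 ×ˢ Ioi 0) := by fun_prop
  refine ⟨fun k hk => (isSol_chi hα0 hα1).scale hk, hc.1.comp hcm hm,
    continuousOn_fst.smul (hc.2.comp hcm hm), fun p q hp => ?_⟩
  obtain ⟨C, hC, h⟩ := norm_packet_chi_le hα0 hα1 hp q
  refine ⟨C, hC, fun M a a' ha r hr => ?_⟩
  -- The static bound is the decay estimate at `T = 0`.
  have := h M a a' ha 0 r le_rfl hr
  simpa using this

theorem contDiffOn_cotPhase (α s : ℝ) : ContDiffOn ℝ 1 (cotPhase α s) (Ioi 0) := by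
  have h2 : ContDiffOn ℝ 1 (fun k : ℝ => k / 2) (Ioi 0) := (contDiff_id.div_const 2).contDiffOn
  have hne : ∀ k ∈ Ioi (0 : ℝ), k / 2 ≠ 0 := fun k hk => (half_pos hk).ne'
  unfold cotPhase
  split_ifs with h
  · exact contDiffOn_const.mul (((h2.log hne).add contDiffOn_const).add contDiffOn_const)
  · exact ((((h2.rpow_const_of_ne hne).mul contDiffOn_const).mul contDiffOn_const).mul
      contDiffOn_const).add contDiffOn_const

/-- The coefficient of the scattered wave. -/
def scatteringCoeff (α s k : ℝ) : ℂ := 2 * Complex.I / π * resolventCoeff k α s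

theorem contDiffOn_scatteringCoeff (α s : ℝ) : ContDiffOn ℝ 1 (scatteringCoeff α s) (Ioi 0) := by
  have h1 : ContDiffOn ℝ 1 (fun k => (cotPhase α s k : ℂ)) (Ioi 0) :=
    Complex.ofRealCLM.contDiff.comp_contDiffOn (contDiffOn_cotPhase α s)
  have h2 := (contDiffOn_const (c := 2 * Complex.I / π)).mul ((contDiffOn_const (c := (π / 2 : ℂ))).mul
    ((h1.sub (contDiffOn_const (c := Complex.I))).inv fun k _ => ofReal_sub_I_ne_zero _))
  refine h2.congr fun k hk => ?_
  rw [scatteringCoeff, resolventCoeff_eq hk]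
  rfl

/-- The kernel of the free states. -/
def freeKernel (α k r : ℝ) : ℂ :=
  1 / 2 * (starRingEnd ℂ) (chi α (k * r)) + 1 / 2 * chi α (k * r)

/-- The kernel of the outgoing states. -/
def outKernel (α s k r : ℝ) : ℂ :=
  freeKernel α k r + scatteringCoeff α s k * chi α (k * r)

theorem freeKernel_eq {α k r : ℝ} (hk : 0 < k) (hr : 0 < r) : freeKernel α k r = phiFree α k r := by
  rw [phiFree_eq hk hr, pJ_eq_chi, freeKernel]; ring

theorem outKernel_eq {α s k r : ℝ} (hα0 : 0 ≤ α) (hα1 : α < 1) (hk : 0 < k) (hr : 0 < r) :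
    outKernel α s k r = outgoingFn α s k r := by
  rw [outKernel, freeKernel_eq hk hr, outgoingFn, chiFree_eq hα0 hα1 hk hr, scatteringCoeff]

section
variable {α : ℝ} (hα0 : 0 ≤ α) (hα1 : α < 1) (s : ℝ)
include hα0 hα1

theorem packetKernel_free : ∃ v, PacketKernel α (freeKernel α) v :=
  ⟨_, ((packetKernel_chi hα0 hα1).conj.mul (f := fun _ => 1 / 2) contDiffOn_const).add
    ((packetKernel_chi hα0 hα1).mul (f := fun _ => 1 / 2) contDiffOn_const)⟩

theorem packetKernel_out : ∃ v, PacketKernel α (outKernel α s) v := by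
  obtain ⟨v, hv⟩ := packetKernel_free hα0 hα1
  exact ⟨_, hv.add ((packetKernel_chi hα0 hα1).mul (contDiffOn_scatteringCoeff α s))⟩

variable {p q M : ℝ} {a a' : ℝ → ℂ} (h : IsAmp p q M a a')
include h

theorem boundaryCondition_free :
    BoundaryCondition (fun r => (zeroRegular α r : ℂ)) (packet (freeKernel α) a) := by
  obtain ⟨v, hv⟩ := packetKernel_free hα0 hα1
  rw [zeroRegular_eq hα0]
  refine hv.boundaryCondition (by linarith) (fun E => (isSol_regSol hα0 E).left)
    (nearBound_regSol hα0) (F := fun k => (freeFactor α k : ℂ)) ?_ (fun k r hk hr => ?_) h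
  · refine Complex.continuous_ofReal.comp_continuousOn ?_
    unfold freeFactor
    exact (continuousOn_const.mul (continuousOn_id.rpow_const fun k hk =>
      Or.inl (mem_Ioi.1 hk).ne')).div_const _
  · rw [freeKernel_eq hk hr, phiFree_eq_regSol hα0 hk hr]

theorem boundaryCondition_out : BoundaryCondition (boundaryFn α s) (packet (outKernel α s) a) := by
  obtain ⟨v, hv⟩ := packetKernel_out hα0 hα1 s
  rw [boundaryFn_eq hα0 hα1]
  refine hv.boundaryCondition (by linarith) (fun E => (isSol_bcSol hα0 hα1 s E).left)
    (nearBound_bcSol hα0 hα1 s) (F := outgoingFactor α s) ?_ (fun k r hk hr => ?_) h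
  · have hb : ContinuousOn (bcFactor α) (Ioi 0) := by
      unfold bcFactor
      have hr : ∀ p : ℝ, ContinuousOn (fun k : ℝ => k ^ p) (Ioi 0) := fun p =>
        continuousOn_id.rpow_const fun k hk => Or.inl (mem_Ioi.1 hk).ne'
      split_ifs with h
      · exact (continuousOn_const.mul (hr _)).mul continuousOn_const
      · exact ((continuousOn_const.mul (hr _)).mul continuousOn_const).div_const _
    exact (Complex.continuous_ofReal.comp_continuousOn hb).div
      ((Complex.continuous_ofReal.comp_continuousOn
        (contDiffOn_cotPhase α s).continuousOn).sub continuousOn_const)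
      fun k _ => ofReal_sub_I_ne_zero _
  · rw [outKernel_eq hα0 hα1 hk hr, outgoingFn_eq hα0 hα1 hk hr]

end

/-! ### The wave operators -/

/-- The scattering matrix `1 + (4i/π) A`. -/
def scatteringMatrix (α s k : ℝ) : ℂ := 1 + 4 * Complex.I / π * resolventCoeff k α s

theorem scatteringMatrix_eq (α s k : ℝ) : scatteringMatrix α s k = 1 + 2 * scatteringCoeff α s k := by
  rw [scatteringMatrix, scatteringCoeff]; ring

theorem contDiffOn_scatteringMatrix (α s : ℝ) :
    ContDiffOn ℝ 1 (scatteringMatrix α s) (Ioi 0) :=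
  (contDiffOn_const.add (contDiffOn_const.mul (contDiffOn_scatteringCoeff α s))).congr
    fun k _ => scatteringMatrix_eq α s k

theorem exists_isAmp_scatteringMatrix (α s : ℝ) {p q M : ℝ} {a a' : ℝ → ℂ}
    (h : IsAmp p q M a a') :
    ∃ M₁ a₁', IsAmp p q M₁ (fun k => scatteringMatrix α s k * a k) a₁' := by
  obtain ⟨D, -, hD⟩ := exists_isAmp_mul (contDiffOn_scatteringMatrix α s) h.pos q
  exact ⟨_, _, hD M a a' h⟩

theorem conj_timePhase (t k : ℝ) :
    (starRingEnd ℂ) (timePhase t k) = Complex.exp (Complex.I * (k ^ 2 * t)) := by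
  rw [timePhase, ← Complex.exp_conj]
  simp

theorem packetState_sub {α : ℝ} (hα0 : 0 ≤ α) (hα1 : α < 1) {u₁ u₂ v₁ v₂ : ℝ → ℝ → ℂ}
    (K₁ : PacketKernel α u₁ v₁) (K₂ : PacketKernel α u₂ v₂) {p q M₁ M₂ : ℝ} {a₁ a₁' a₂ a₂' : ℝ → ℂ}
    (h₁ : IsAmp p q M₁ a₁ a₁') (h₂ : IsAmp p q M₂ a₂ a₂') {f : ℝ → ℂ}
    (h : ∀ r, 0 < r → packet u₁ a₁ r = packet u₂ a₂ r + f r) :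
    (packetState u₁ a₁ - packetState u₂ a₂ : HalfLineL2) =ᵐ[halfLine] f := by
  refine (Lp.coeFn_sub _ _).trans ?_
  filter_upwards [K₁.coeFn_state hα0 hα1 h₁, K₂.coeFn_state hα0 hα1 h₂,
    self_mem_ae_restrict measurableSet_Ioi] with r e1 e2 hr
  rw [Pi.sub_apply, e1, e2, h r hr, add_sub_cancel_left]

theorem tendsto_decay {p : ℝ} (hp : 0 < p) (C W : ℝ) :
    Tendsto (fun T : ℝ => C * (1 + 2 * p * T) ^ (-(1 / 4) : ℝ) * W) atTop (𝓝 0) := by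
  have h1 : Tendsto (fun T : ℝ => 1 + 2 * p * T) atTop atTop :=
    tendsto_atTop_add_const_left _ _ (tendsto_id.const_mul_atTop (by positivity))
  have := (((tendsto_rpow_neg_atTop (by norm_num : (0 : ℝ) < 1 / 4)).comp h1).const_mul C).mul_const W
  simpa using this

section
variable {α : ℝ} (hα0 : 0 ≤ α) (hα1 : α < 1) (s : ℝ) {p q M : ℝ} {a a' : ℝ → ℂ}
  (h : IsAmp p q M a a')
include hα0 hα1 h

theorem isSchrodingerSolution_free : IsSchrodingerSolution (freeHamiltonian α)
    (fun t => packetState (freeKernel α) (fun k => timePhase t k * a k)) := by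
  obtain ⟨v, hv⟩ := packetKernel_free hα0 hα1
  exact hv.isSchrodingerSolution hα0 hα1
    (fun M a a' h => boundaryCondition_free hα0 hα1 h) h

theorem isSchrodingerSolution_out : IsSchrodingerSolution (deltaHamiltonian α s)
    (fun t => packetState (outKernel α s) (fun k => timePhase t k * a k)) := by
  obtain ⟨v, hv⟩ := packetKernel_out hα0 hα1 s
  exact hv.isSchrodingerSolution hα0 hα1
    (fun M a a' h => boundaryCondition_out hα0 hα1 s h) h

/-- At time `t` the difference of the two motions is the packet of `χ` whose amplitude carries
`e^{ik²(-t)}`. For `t ≤ 0` this is the non-stationary case with `T = -t`, so its norm tends to zero.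
-/
theorem isWaveOperatorImage_atBot : IsWaveOperatorImage (deltaHamiltonian α s) (freeHamiltonian α)
    atBot (packetState (freeKernel α) a) (packetState (outKernel α s) a) := by
  refine ⟨_, _, isSchrodingerSolution_out hα0 hα1 s h, isSchrodingerSolution_free hα0 hα1 h,
    by simp [timePhase], by simp [timePhase], ?_⟩
  obtain ⟨v, hv⟩ := packetKernel_free hα0 hα1
  obtain ⟨v', hv'⟩ := packetKernel_out hα0 hα1 s
  have hχ := packetKernel_chi hα0 hα1
  obtain ⟨D, -, hD⟩ := exists_isAmp_mul (contDiffOn_scatteringCoeff α s) h.pos q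
  have h₁ := hD M a a' h
  obtain ⟨C, hC, hb⟩ := norm_packet_chi_le hα0 hα1 h.pos q
  refine squeeze_zero' (Eventually.of_forall fun t => norm_nonneg _) ?_
    ((tendsto_decay h.pos (C * (D * M)) ‖weightState hα0 hα1‖).comp tendsto_neg_atBot_atTop)
  filter_upwards [eventually_le_atBot 0] with t ht
  obtain ⟨M₂, a₂', h₂⟩ := PacketKernel.exists_isAmp_timePhase h t
  have e := packetState_sub hα0 hα1 hv' hv h₂ h₂ (f := packet (fun k r => chi α (k * r))
    (fun k => scatteringCoeff α s k * a k * Complex.exp (Complex.I * (k ^ 2 * (-t : ℝ)))))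
    fun r hr => by
      rw [show outKernel α s = fun k r => freeKernel α k r +
        scatteringCoeff α s k * chi α (k * r) from rfl, packet_kernel_add h.pos h.lt
          h₂.continuousOn h₂.zero hv.contu (hχ.mul (contDiffOn_scatteringCoeff α s)).contu hr]
      congr 1
      rw [packet_kernel_mul]
      refine packet_congr fun k hk => ?_
      rw [timePhase, show Complex.I * ((k : ℂ) ^ 2 * ((-t : ℝ) : ℂ)) = -(Complex.I * (k ^ 2 * t)) by
        push_cast; ring]
      ring
  refine norm_le_weightState hα0 hα1 e ?_
  rw [ae_restrict_iff' measurableSet_Ioi]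
  refine Eventually.of_forall fun r hr => ?_
  rw [Real.norm_of_nonneg (weight_pos hr).le]
  exact hb _ _ _ h₁ (-t) r (by linarith) hr

/-- With the scattering matrix `1 + 2c` and `φ_0 = (χ + χ̄)/2`, the outgoing state minus `(1 + 2c)
φ_0` is `-c χ̄`, a purely incoming wave. Complex conjugation turns its packet at `t ≥ 0` into the
non-stationary case for `χ` with `T = t`. -/
theorem isWaveOperatorImage_atTop : IsWaveOperatorImage (deltaHamiltonian α s) (freeHamiltonian α)
    atTop (packetState (freeKernel α) (fun k => scatteringMatrix α s k * a k))
    (packetState (outKernel α s) a) := by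
  obtain ⟨M₀, a₀', h₀⟩ := exists_isAmp_scatteringMatrix α s h
  refine ⟨_, _, isSchrodingerSolution_out hα0 hα1 s h, isSchrodingerSolution_free hα0 hα1 h₀,
    by simp [timePhase], by simp [timePhase], ?_⟩
  obtain ⟨v, hv⟩ := packetKernel_free hα0 hα1
  obtain ⟨v', hv'⟩ := packetKernel_out hα0 hα1 s
  have hχ := packetKernel_chi hα0 hα1
  obtain ⟨D, -, hD⟩ := exists_isAmp_mul
    (f := fun k => -scatteringCoeff α s k) (contDiffOn_scatteringCoeff α s).neg h.pos q
  have h₁ := (hD M a a' h).conj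
  obtain ⟨C, hC, hb⟩ := norm_packet_chi_le hα0 hα1 h.pos q
  refine squeeze_zero' (Eventually.of_forall fun t => norm_nonneg _) ?_
    (tendsto_decay h.pos (C * (D * M)) ‖weightState hα0 hα1‖)
  filter_upwards [eventually_ge_atTop 0] with t ht
  obtain ⟨M₂, a₂', h₂⟩ := PacketKernel.exists_isAmp_timePhase h t
  obtain ⟨M₃, a₃', h₃⟩ := PacketKernel.exists_isAmp_timePhase h₀ t
  have hneg := (contDiffOn_scatteringCoeff α s).neg
  have e := packetState_sub hα0 hα1 hv' hv h₂ h₃ (f := fun r => (starRingEnd ℂ)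
    (packet (fun k r => chi α (k * r)) (fun k => (starRingEnd ℂ) (-scatteringCoeff α s k * a k) *
      Complex.exp (Complex.I * (k ^ 2 * t))) r))
    fun r hr => by
      have e₁ : (starRingEnd ℂ) (packet (fun k r => chi α (k * r)) (fun k => (starRingEnd ℂ)
          (-scatteringCoeff α s k * a k) * Complex.exp (Complex.I * (k ^ 2 * t))) r) =
          packet (fun k r => -scatteringCoeff α s k * (starRingEnd ℂ) (chi α (k * r)))
            (fun k => timePhase t k * a k) r := by
        rw [packet_kernel_mul, packet_conj]
        congr 1
        refine packet_congr fun k hk => ?_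
        simp only [map_mul, map_neg, conj_timePhase]
        ring
      have e₂ : packet (freeKernel α) (fun k => timePhase t k * (scatteringMatrix α s k * a k)) r =
          packet (fun k r => scatteringMatrix α s k * freeKernel α k r)
            (fun k => timePhase t k * a k) r := by
        rw [packet_kernel_mul]
        refine packet_congr fun k hk => ?_
        ring
      rw [e₁, e₂, ← packet_kernel_add h.pos h.lt h₂.continuousOn h₂.zero
        (hv.mul (contDiffOn_scatteringMatrix α s)).contu (hχ.conj.mul hneg).contu hr]
      refine packet_congr fun k hk => ?_
      rw [outKernel, scatteringMatrix_eq, freeKernel]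
      ring
  refine norm_le_weightState hα0 hα1 e ?_
  rw [ae_restrict_iff' measurableSet_Ioi]
  refine Eventually.of_forall fun r hr => ?_
  rw [Real.norm_of_nonneg (weight_pos hr).le, Complex.norm_conj]
  exact hb _ _ _ h₁ t r ht hr

end

end AnyonDelta

end
noncomputable section

namespace AnyonDelta

/-! ### Completeness of the free states -/

theorem intervalIntegral_mul_eval_eq_zero {w : ℝ → ℝ} {p q : ℝ} (hw : Continuous w)
    (h : ∀ m : ℕ, ∫ k in p..q, w k * (k ^ 2) ^ m = 0) (P : Polynomial ℝ) :
    ∫ k in p..q, w k * P.eval (k ^ 2) = 0 := by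
  induction P using Polynomial.induction_on' with
  | add P Q hP hQ =>
    simp only [Polynomial.eval_add, mul_add]
    rw [intervalIntegral.integral_add, hP, hQ, add_zero]
    · exact Continuous.intervalIntegrable (by fun_prop) _ _
    · exact Continuous.intervalIntegrable (by fun_prop) _ _
  | monomial n c =>
    simp only [Polynomial.eval_monomial]
    rw [show (fun k => w k * (c * (k ^ 2) ^ n)) = fun k => c * (w k * (k ^ 2) ^ n) by
      ext k; ring, intervalIntegral.integral_const_mul, h, mul_zero]

/-- The even moments determine a continuous function on an interval of the positive axis. -/
theorem eq_zero_of_moments {w : ℝ → ℝ} {p q : ℝ} (hp : 0 < p) (hpq : p < q) (hw : Continuous w)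
    (h : ∀ m : ℕ, ∫ k in p..q, w k * (k ^ 2) ^ m = 0) : ∀ k ∈ Ioo p q, w k = 0 := by
  -- On a positive interval `w` is a continuous function of `k²`, hence approximable by polynomials
  -- in `k²`. These are orthogonal to `w`, so `∫ w²` is arbitrarily small.
  have hc : ContinuousOn (fun y => w (√y)) (Icc (p ^ 2) (q ^ 2)) := by fun_prop
  set B : ℝ := ∫ k in p..q, |w k| with hB
  have hB0 : 0 ≤ B := intervalIntegral.integral_nonneg hpq.le fun k _ => abs_nonneg _
  have key : ∀ ε : ℝ, 0 < ε → ∫ k in p..q, w k ^ 2 ≤ ε * B := by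
    intro ε hε
    obtain ⟨P, hP⟩ := exists_polynomial_near_of_continuousOn _ _ _ hc ε hε
    have e : ∫ k in p..q, w k ^ 2 = ∫ k in p..q, w k * (w k - P.eval (k ^ 2)) := by
      simp only [mul_sub]
      rw [intervalIntegral.integral_sub (Continuous.intervalIntegrable (by fun_prop) _ _)
        (Continuous.intervalIntegrable (by fun_prop) _ _),
        intervalIntegral_mul_eval_eq_zero hw h, sub_zero]
      simp only [sq]
    rw [e, hB, ← intervalIntegral.integral_const_mul]
    refine intervalIntegral.integral_mono_on hpq.le (Continuous.intervalIntegrable (by fun_prop) _ _)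
      (Continuous.intervalIntegrable (by fun_prop) _ _) fun k hk => ?_
    have hk0 : 0 < k := hp.trans_le hk.1
    have := hP (k ^ 2) ⟨by nlinarith [hk.1], by nlinarith [hk.2]⟩
    rw [Real.sqrt_sq hk0.le, abs_sub_comm] at this
    calc w k * (w k - P.eval (k ^ 2)) ≤ |w k * (w k - P.eval (k ^ 2))| := le_abs_self _
      _ = |w k - P.eval (k ^ 2)| * |w k| := by rw [abs_mul, mul_comm]
      _ ≤ ε * |w k| := by gcongr
  have h0 : ∫ k in p..q, w k ^ 2 ≤ 0 := by
    refine le_of_forall_pos_le_add fun ε hε => ?_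
    refine (key (ε / (B + 1)) (by positivity)).trans ?_
    rw [zero_add, div_mul_eq_mul_div, div_le_iff₀ (by positivity)]
    nlinarith
  intro k hk
  by_contra hne
  have := intervalIntegral.integral_pos hpq (f := fun k => w k ^ 2) (by fun_prop)
    (fun x _ => sq_nonneg _) ⟨k, ⟨hk.1.le, hk.2.le⟩, by positivity⟩
  linarith

theorem continuous_of_zero_off {w : ℝ → ℂ} {p q : ℝ} (hp : 0 < p) (hc : ContinuousOn w (Ioi 0))
    (h0 : ∀ k, k ∉ Ioo p q → w k = 0) : Continuous w := by
  rw [continuous_iff_continuousAt]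
  intro k
  rcases lt_or_ge k p with hk | hk
  · refine ContinuousAt.congr (f := fun _ => 0) continuousAt_const ?_
    filter_upwards [Iio_mem_nhds hk] with x hx
    exact (h0 x fun h => (h.1.trans hx).false).symm
  · exact hc.continuousAt (Ioi_mem_nhds (hp.trans_le hk))

/-- Each derivative in `x` brings down `-k²` and raises the order by one. -/
theorem packet_bj_eq_zero {ν p q : ℝ} {w : ℝ → ℂ} (hp : 0 < p) (hpq : p < q)
    (hc : ContinuousOn w (Ioi 0)) (h0 : ∀ k, k ∉ Ioo p q → w k = 0) (hν : -1 < ν)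
    (h : ∀ x, 0 < x → packet (fun k x => (bj ν (k ^ 2 * x) : ℂ)) w x = 0) (m : ℕ) :
    ∀ x, 0 < x → packet (fun k x => (((k ^ 2) ^ m * bj (ν + m) (k ^ 2 * x) : ℝ) : ℂ)) w x = 0 := by
  have cb : ∀ m : ℕ, Continuous (bj (ν + m)) := fun m =>
    continuous_bj (by have : (0 : ℝ) ≤ m := m.cast_nonneg
                      linarith)
  induction m with
  | zero => simpa using h
  | succ m ih =>
    intro x hx
    have hd := hasDerivAt_packet (u := fun k x => (((k ^ 2) ^ m * bj (ν + m) (k ^ 2 * x) : ℝ) : ℂ))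
      (v := fun k x => ((-((k ^ 2) ^ (m + 1) * bj (ν + (m + 1 : ℕ)) (k ^ 2 * x)) : ℝ) : ℂ))
      hp hpq hc h0 (fun k hk r hr => ?_) ?_ ?_ hx
    · have h1 := (hd.congr_of_eventuallyEq (f₁ := fun _ => 0) (by
        filter_upwards [Ioi_mem_nhds hx] with y hy using (ih y hy).symm)).unique
          (hasDerivAt_const x (0 : ℂ))
      rw [← neg_eq_zero, ← neg_one_mul, ← packet_const_mul, ← h1]
      refine packet_congr fun k hk => ?_
      push_cast; ring
    · have hνm : -1 < ν + m := by have : (0 : ℝ) ≤ m := m.cast_nonneg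
                                  linarith
      have h1 : HasDerivAt (fun r : ℝ => k ^ 2 * r) (k ^ 2) r := by
        simpa using (hasDerivAt_id r).const_mul (k ^ 2)
      have := (((hasDerivAt_bj hνm (k ^ 2 * r)).comp r h1).const_mul ((k ^ 2) ^ m)).ofReal_comp
      refine this.congr_deriv ?_
      rw [show ν + ((m + 1 : ℕ) : ℝ) = ν + m + 1 by push_cast; ring]
      push_cast; ring
    · have := cb m
      exact Continuous.continuousOn (by fun_prop)
    · have := cb (m + 1)
      exact Continuous.continuousOn (by fun_prop)

/-- Letting `x ↓ 0` in the `m`-th derivative leaves the `m`-th moment of `w` in `k²`, multiplied by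
the nonzero value of `bj` at the origin. All these moments vanish, hence so does `w`. -/
theorem eq_zero_of_packet_bj {ν p q : ℝ} {w : ℝ → ℂ} (hp : 0 < p) (hpq : p < q)
    (hc : ContinuousOn w (Ioi 0)) (h0 : ∀ k, k ∉ Ioo p q → w k = 0) (hν : -1 < ν)
    (h : ∀ x, 0 < x → packet (fun k x => (bj ν (k ^ 2 * x) : ℂ)) w x = 0) : ∀ k, w k = 0 := by
  have hw := continuous_of_zero_off hp hc h0
  have mom : ∀ m : ℕ, ∫ k in p..q, w k * (((k ^ 2) ^ m : ℝ) : ℂ) = 0 := by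
    intro m
    have hνm : -1 < ν + m := by have : (0 : ℝ) ≤ m := m.cast_nonneg
                                linarith
    have cb := continuous_bj hνm
    have hF : Continuous fun x : ℝ => ∫ k in p..q,
        w k * (((k ^ 2) ^ m * bj (ν + m) (k ^ 2 * x) : ℝ) : ℂ) :=
      intervalIntegral.continuous_parametric_intervalIntegral_of_continuous'
        (f := fun x k => w k * (((k ^ 2) ^ m * bj (ν + m) (k ^ 2 * x) : ℝ) : ℂ)) (by fun_prop) p q
    have hz := packet_bj_eq_zero hp hpq hc h0 hν h m
    have hl := tendsto_nhds_unique (l := 𝓝[>] (0 : ℝ)) ((hF.tendsto 0).mono_left nhdsWithin_le_nhds)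
      (tendsto_const_nhds.congr' (f₁ := fun _ => (0 : ℂ)) (by
        filter_upwards [self_mem_nhdsWithin] with x hx
        rw [← hz x hx, packet_eq_intervalIntegral hp hpq _ h0]))
    simp only [mul_zero, bj_zero] at hl
    have hΓ : ((1 / Real.Gamma (ν + m + 1) : ℝ) : ℂ) ≠ 0 := by
      rw [Complex.ofReal_ne_zero]
      exact one_div_ne_zero (Real.Gamma_pos_of_pos (by linarith)).ne'
    refine (mul_eq_zero.1 (?_ : _ * ((1 / Real.Gamma (ν + m + 1) : ℝ) : ℂ) = 0)).resolve_right hΓ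
    rw [← intervalIntegral.integral_mul_const, ← hl]
    congr 1; ext k
    push_cast; ring
  have hi : ∀ m : ℕ, IntervalIntegrable (fun k => w k * (((k ^ 2) ^ m : ℝ) : ℂ)) volume p q :=
    fun m => Continuous.intervalIntegrable (by fun_prop) _ _
  have hre := eq_zero_of_moments hp hpq (w := fun k => (w k).re) (by fun_prop) fun m => by
    have := Complex.reCLM.intervalIntegral_comp_comm (hi m)
    rw [mom m, map_zero] at this
    rw [← this]
    congr 1; ext k
    rw [Complex.reCLM_apply, Complex.re_mul_ofReal]
  have him := eq_zero_of_moments hp hpq (w := fun k => (w k).im) (by fun_prop) fun m => by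
    have := Complex.imCLM.intervalIntegral_comp_comm (hi m)
    rw [mom m, map_zero] at this
    rw [← this]
    congr 1; ext k
    rw [Complex.imCLM_apply, Complex.im_mul_ofReal]
  intro k
  by_cases hk : k ∈ Ioo p q
  · exact Complex.ext (hre k hk) (him k hk)
  · exact h0 k hk

theorem eq_zero_of_packet_phiFree {α p q : ℝ} {f : ℝ → ℂ} (hα0 : 0 ≤ α) (hp : 0 < p) (hpq : p < q)
    (hc : ContinuousOn f (Ioi 0)) (h0 : ∀ k, k ∉ Ioo p q → f k = 0)
    (h : ∀ r, 0 < r → packet (phiFree α) f r = 0) : ∀ k, f k = 0 := by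
  have hz := eq_zero_of_packet_bj (w := fun k => ((k ^ (1 / 2 + α) : ℝ) : ℂ) * f k)
    (ν := α) hp hpq (by
      refine ContinuousOn.mul ?_ hc
      exact Complex.continuous_ofReal.comp_continuousOn
        (continuousOn_id.rpow_const fun k hk => Or.inl (mem_Ioi.1 hk).ne'))
    (fun k hk => by rw [h0 k hk, mul_zero]) (by linarith) fun x hx => ?_
  · intro k
    rcases lt_or_ge 0 k with hk | hk
    · refine (mul_eq_zero.1 (hz k)).resolve_left ?_
      exact Complex.ofReal_ne_zero.2 (Real.rpow_pos_of_pos hk _).ne'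
    · exact h0 k fun h => (hp.trans h.1).not_ge hk
  -- For `r = 2√x` the argument `(kr)²/4` is `k² x`, and the power of `k r` splits into one factor
  -- for the amplitude and one constant.
  · set r : ℝ := 2 * √x with hr
    have hr0 : 0 < r := by positivity
    set C : ℝ := √(π / 2) * 2 ^ (-α) * r ^ (1 / 2 + α) with hC
    have hC0 : (C : ℂ) ≠ 0 := by
      rw [Complex.ofReal_ne_zero]; positivity
    refine (mul_eq_zero.1 (?_ : (C : ℂ) * _ = 0)).resolve_left hC0
    rw [← h r hr0, ← packet_const_mul]
    refine setIntegral_congr_fun measurableSet_Ioi fun k hk => ?_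
    have e : 1 * (k * r) ^ 2 / 4 = k ^ 2 * x := by
      rw [hr, mul_pow, mul_pow, Real.sq_sqrt hx.le]; ring
    simp only
    rw [phiFree_eq hk hr0, pJ, powSol, e, Real.mul_rpow (mem_Ioi.1 hk).le hr0.le, hC]
    push_cast; ring

/-! ### Wave packets of test functions and the phase shift -/

theorem IsMomentumTest.exists_isAmp {g : ℝ → ℂ} (hg : IsMomentumTest g) :
    ∃ p q M, IsAmp p q M g (deriv g) := by
  obtain ⟨hs, hc, ht⟩ := hg
  obtain ⟨p, q, hp, hpq, hz⟩ : ∃ p q : ℝ, 0 < p ∧ p < q ∧ tsupport g ⊆ Ioo p q := by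
    rcases (tsupport g).eq_empty_or_nonempty with h | h
    · exact ⟨1, 2, one_pos, one_lt_two, by rw [h]; exact empty_subset _⟩
    · obtain ⟨m, hm, hm'⟩ := IsCompact.exists_isLeast hc h
      obtain ⟨n, hn, hn'⟩ := IsCompact.exists_isGreatest hc h
      have h1 : 0 < m := ht hm
      have h2 : m ≤ n := hm' hn
      refine ⟨m / 2, n + 1, by positivity, by linarith, fun x hx => ⟨?_, ?_⟩⟩
      · linarith [hm' hx]
      · linarith [hn' hx]
  have hd : ContDiff ℝ 1 g := hs.of_le (by exact_mod_cast le_top)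
  have hcd : Continuous (deriv g) := hd.continuous_deriv le_rfl
  obtain ⟨D₁, h₁⟩ := isCompact_Icc.exists_bound_of_continuousOn (s := Icc p q) hd.continuous.continuousOn
  obtain ⟨D₂, h₂⟩ := isCompact_Icc.exists_bound_of_continuousOn (s := Icc p q) hcd.continuousOn
  exact ⟨p, q, max D₁ D₂, hp, hpq, fun k _ => (hd.differentiable one_ne_zero k).hasDerivAt,
    hcd.continuousOn, fun k hk => image_eq_zero_of_notMem_tsupport fun h => hk (hz h),
    fun k h1 h2 => (h₁ k ⟨h1, h2⟩).trans (le_max_left _ _),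
    fun k h1 h2 => (h₂ k ⟨h1, h2⟩).trans (le_max_right _ _)⟩

theorem exists_isMomentumTest {k₀ : ℝ} (hk : 0 < k₀) : ∃ g : ℝ → ℂ, IsMomentumTest g ∧ g k₀ ≠ 0 := by
  let f : ContDiffBump k₀ := ⟨k₀ / 4, k₀ / 2, by positivity, by linarith⟩
  have hsub : tsupport (fun k => (f k : ℂ)) ⊆ tsupport f :=
    tsupport_comp_subset (g := (Complex.ofReal : ℝ → ℂ)) Complex.ofReal_zero f
  refine ⟨fun k => (f k : ℂ), ⟨Complex.ofRealCLM.contDiff.comp f.contDiff,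
    f.hasCompactSupport.comp_left Complex.ofReal_zero, fun k hk' => ?_⟩, ?_⟩
  · have := hsub hk'
    rw [f.tsupport_eq, Metric.mem_closedBall, Real.dist_eq] at this
    have h2 : f.rOut = k₀ / 2 := rfl
    rw [h2, abs_le] at this
    exact mem_Ioi.2 (by linarith [this.1])
  · rw [Complex.ofReal_ne_zero, f.one_of_mem_closedBall (Metric.mem_closedBall_self f.rIn_pos.le)]
    exact one_ne_zero

/-! ### Identification of the scattering operator -/

section
variable {α : ℝ} (hα0 : 0 ≤ α) (hα1 : α < 1) {p q M : ℝ} {a a' : ℝ → ℂ}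
include hα0 hα1

theorem isWavePacket_free (h : IsAmp p q M a a') {b : ℝ → ℂ} (hb : ∀ k, 0 < k → b k = a k) :
    IsWavePacket (phiFree α) b (packetState (freeKernel α) a) := by
  obtain ⟨v, hv⟩ := packetKernel_free hα0 hα1
  refine (hv.coeFn_state hα0 hα1 h).trans ?_
  filter_upwards [self_mem_ae_restrict measurableSet_Ioi] with r hr
  exact packet_congr fun k hk => by rw [freeKernel_eq hk hr, hb k hk]

theorem isWavePacket_out (s : ℝ) (h : IsAmp p q M a a') :
    IsWavePacket (outgoingFn α s) a (packetState (outKernel α s) a) := by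
  obtain ⟨v, hv⟩ := packetKernel_out hα0 hα1 s
  refine (hv.coeFn_state hα0 hα1 h).trans ?_
  filter_upwards [self_mem_ae_restrict measurableSet_Ioi] with r hr
  exact packet_congr fun k hk => by rw [outKernel_eq hα0 hα1 hk hr]

theorem exists_isWaveOperatorImage (s : ℝ) {g : ℝ → ℂ} (hg : IsMomentumTest g) :
    ∃ Φ X : HalfLineL2, IsWavePacket (phiFree α) g Φ ∧ IsWavePacket (outgoingFn α s) g X ∧
      IsWaveOperatorImage (deltaHamiltonian α s) (freeHamiltonian α) atBot Φ X := by
  obtain ⟨p, q, M, h⟩ := hg.exists_isAmp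
  exact ⟨_, _, isWavePacket_free hα0 hα1 h fun _ _ => rfl, isWavePacket_out hα0 hα1 s h,
    isWaveOperatorImage_atBot hα0 hα1 s h⟩

/-- Packets are continuous in `r`, so equality almost everywhere is equality everywhere, and the
injectivity of the transform applies to the difference. -/
theorem eq_of_isWavePacket {f₁ f₂ : ℝ → ℂ} (hp : 0 < p) (hpq : p < q)
    (c₁ : ContinuousOn f₁ (Ioi 0)) (c₂ : ContinuousOn f₂ (Ioi 0))
    (z₁ : ∀ k, k ∉ Ioo p q → f₁ k = 0) (z₂ : ∀ k, k ∉ Ioo p q → f₂ k = 0) {Φ : HalfLineL2}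
    (h₁ : IsWavePacket (phiFree α) f₁ Φ) (h₂ : IsWavePacket (phiFree α) f₂ Φ) (k : ℝ) :
    f₁ k = f₂ k := by
  obtain ⟨v, hv⟩ := packetKernel_free hα0 hα1
  have c : ∀ {f : ℝ → ℂ}, ContinuousOn f (Ioi 0) → (∀ k, k ∉ Ioo p q → f k = 0) →
      ContinuousOn (packet (freeKernel α) f) (Ioi 0) := fun cf zf r hr =>
    (hasDerivAt_packet hp hpq cf zf (fun k hk => (hv.sol k hk).left) hv.contu hv.contv
      hr).continuousAt.continuousWithinAt
  have hae : packet (freeKernel α) f₁ =ᵐ[halfLine] packet (freeKernel α) f₂ := by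
    filter_upwards [h₁, h₂, self_mem_ae_restrict measurableSet_Ioi] with r e1 e2 hr
    have : ∀ f, packet (freeKernel α) f r = packet (phiFree α) f r := fun f =>
      packet_congr fun k hk => by rw [freeKernel_eq hk hr]
    rw [this, this]
    exact e1.symm.trans e2
  have heq := Measure.eqOn_open_of_ae_eq hae isOpen_Ioi (c c₁ z₁) (c c₂ z₂)
  have c₃ : ContinuousOn (fun k => -1 * f₂ k) (Ioi 0) := continuousOn_const.mul c₂
  have hz := eq_zero_of_packet_phiFree (f := fun k => f₁ k + -1 * f₂ k) hα0 hp hpq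
    (c₁.add c₃) (fun k hk => by rw [z₁ k hk, z₂ k hk]; ring) (fun r hr => ?_) k
  · linear_combination hz
  · have e : packet (phiFree α) (fun k => f₁ k + -1 * f₂ k) r
        = packet (freeKernel α) (fun k => f₁ k + -1 * f₂ k) r :=
      packet_congr fun k hk => by rw [freeKernel_eq hk hr]
    rw [e, packet_add hp hpq c₁ c₃ z₁ (fun k hk => by rw [z₂ k hk, mul_zero]) hv.contu hr,
      packet_const_mul, heq hr]
    ring

/-- The explicit images at both ends of time show that scattering multiplies amplitudes by the
scattering matrix. Conversely, the outgoing asymptote and its amplitude are unique, and a test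
function that does not vanish at `k₀` isolates the value there. -/
theorem isPhaseShift_iff (s : ℝ) (δ : ℝ → ℝ) : IsPhaseShift α s δ ↔ ContinuousOn δ (Ioi 0) ∧
    ∀ k : ℝ, 0 < k → Complex.exp (2 * Complex.I * δ k) = scatteringMatrix α s k := by
  refine and_congr_right fun hδ => ⟨fun h k₀ hk₀ => ?_, fun h g hg => ?_⟩
  · obtain ⟨g, hg, hne⟩ := exists_isMomentumTest hk₀
    obtain ⟨p, q, M, ha⟩ := hg.exists_isAmp
    obtain ⟨Φin, Φout, w1, w2, hsc⟩ := h g hg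
    obtain ⟨M₀, a₀', h₀⟩ := exists_isAmp_scatteringMatrix α s ha
    have e1 : Φin = packetState (freeKernel α) g :=
      Lp.ext (w1.trans (isWavePacket_free hα0 hα1 ha fun _ _ => rfl).symm)
    subst e1
    have e2 := hsc.unique (admissible_boundaryFn hα0 hα1 s) (admissible_zeroRegular hα0 hα1)
      ⟨_, isWaveOperatorImage_atBot hα0 hα1 s ha, isWaveOperatorImage_atTop hα0 hα1 s ha⟩
    have cδ : ContinuousOn (fun k => Complex.exp (2 * Complex.I * δ k) * g k) (Ioi 0) :=
      (Complex.continuous_exp.comp_continuousOn (continuousOn_const.mul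
        (Complex.continuous_ofReal.comp_continuousOn hδ))).mul ha.continuousOn
    have := eq_of_isWavePacket hα0 hα1 ha.pos ha.lt cδ h₀.continuousOn
      (fun k hk => by rw [ha.zero k hk, mul_zero]) h₀.zero (e2 ▸ w2)
      (isWavePacket_free hα0 hα1 h₀ fun _ _ => rfl) k₀
    exact mul_right_cancel₀ hne this
  · obtain ⟨p, q, M, ha⟩ := hg.exists_isAmp
    obtain ⟨M₀, a₀', h₀⟩ := exists_isAmp_scatteringMatrix α s ha
    exact ⟨_, _, isWavePacket_free hα0 hα1 ha fun _ _ => rfl,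
      isWavePacket_free hα0 hα1 h₀ fun k hk => by rw [h k hk],
      _, isWaveOperatorImage_atBot hα0 hα1 s ha, isWaveOperatorImage_atTop hα0 hα1 s ha⟩

end

end AnyonDelta

end
noncomputable section

namespace AnyonDelta

/-! ### Solutions at negative energies -/

/-- At negative arguments the signs cancel and all terms are nonnegative; the first two are kept. -/
theorem bj_neg_ge {ν z : ℝ} (hν : -1 < ν) (hz : 0 ≤ z) :
    (Real.Gamma (ν + 1))⁻¹ + z * (Real.Gamma (ν + 2))⁻¹ ≤ bj ν (-z) := by
  have hs := (rapid_bjCoeff hν).hasSum (-z)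
  have := sum_le_hasSum (Finset.range 2) (fun m _ => ?_) hs
  · refine le_trans (le_of_eq ?_) this
    simp only [Finset.sum_range_succ, Finset.sum_range_zero, bjCoeff]
    norm_num
    rw [show 1 + ν + 1 = ν + 2 by ring]
    ring
  · have g3 : 0 < Real.Gamma (m + ν + 1) := Real.Gamma_pos_of_pos (by
      have : (0 : ℝ) ≤ m := by positivity
      linarith)
    rw [bjCoeff, div_mul_eq_mul_div, ← mul_pow, neg_one_mul, neg_neg]
    positivity

theorem bj_neg_pos {ν z : ℝ} (hν : -1 < ν) (hz : 0 ≤ z) : 0 < bj ν (-z) := by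
  have g1 : 0 < Real.Gamma (ν + 1) := Real.Gamma_pos_of_pos (by linarith)
  have g2 : 0 < Real.Gamma (ν + 2) := Real.Gamma_pos_of_pos (by linarith)
  exact lt_of_lt_of_le (by positivity) (bj_neg_ge hν hz)

theorem powSol_neg_pos {ν κ r : ℝ} (hν : -1 < ν) (hr : 0 < r) : 0 < powSol ν (-κ ^ 2) r := by
  rw [powSol, show -κ ^ 2 * r ^ 2 / 4 = -(κ ^ 2 * r ^ 2 / 4) by ring]
  exact mul_pos (Real.rpow_pos_of_pos hr _) (bj_neg_pos hν (by positivity))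

theorem exists_le_powSol_neg {ν κ : ℝ} (hν : -1 < ν) (hκ : 0 < κ) :
    ∃ c : ℝ, 0 < c ∧ ∀ r, 0 < r → c * r ^ (5 / 2 + ν) ≤ powSol ν (-κ ^ 2) r := by
  have g1 : 0 < Real.Gamma (ν + 1) := Real.Gamma_pos_of_pos (by linarith)
  have g2 : 0 < Real.Gamma (ν + 2) := Real.Gamma_pos_of_pos (by linarith)
  refine ⟨κ ^ 2 / 4 * (Real.Gamma (ν + 2))⁻¹, by positivity, fun r hr => ?_⟩
  have h := bj_neg_ge hν (by positivity : 0 ≤ κ ^ 2 * r ^ 2 / 4)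
  rw [powSol, show -κ ^ 2 * r ^ 2 / 4 = -(κ ^ 2 * r ^ 2 / 4) by ring,
    show 5 / 2 + ν = 1 / 2 + ν + (2 : ℕ) by push_cast; ring, Real.rpow_add_natCast hr.ne']
  have hp := Real.rpow_pos_of_pos hr (1 / 2 + ν)
  calc κ ^ 2 / 4 * (Real.Gamma (ν + 2))⁻¹ * (r ^ (1 / 2 + ν) * r ^ 2)
      = r ^ (1 / 2 + ν) * (κ ^ 2 * r ^ 2 / 4 * (Real.Gamma (ν + 2))⁻¹) := by ring
    _ ≤ _ := by
      gcongr
      have : 0 < (Real.Gamma (ν + 1))⁻¹ := by positivity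
      linarith

theorem exists_le_powSol_neg_of_one_le {ν κ p : ℝ} (hν : -1 < ν) (hκ : 0 < κ) (hp : p ≤ 5 / 2 + ν) :
    ∃ c : ℝ, 0 < c ∧ ∀ r, 1 ≤ r → c * r ^ p ≤ powSol ν (-κ ^ 2) r := by
  obtain ⟨c, hc, h⟩ := exists_le_powSol_neg hν hκ
  refine ⟨c, hc, fun r hr => le_trans ?_ (h r (by linarith))⟩
  have := Real.rpow_le_rpow_of_exponent_le hr hp
  gcongr

theorem powSolDeriv_neg_nonneg {ν κ r : ℝ} (hν : 0 ≤ ν) (hr : 0 < r) :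
    0 ≤ powSolDeriv ν (-κ ^ 2) r := by
  rw [powSolDeriv, show -κ ^ 2 * r ^ 2 / 4 = -(κ ^ 2 * r ^ 2 / 4) by ring]
  have h1 := bj_neg_pos (ν := ν) (by linarith) (by positivity : 0 ≤ κ ^ 2 * r ^ 2 / 4)
  have h2 := bj_neg_pos (ν := ν + 1) (by linarith) (by positivity : 0 ≤ κ ^ 2 * r ^ 2 / 4)
  have h3 := Real.rpow_pos_of_pos hr (ν - 1 / 2)
  rw [mul_neg, neg_mul, sub_neg_eq_add]
  positivity

theorem powSol_neg_scale {ν κ r : ℝ} (hκ : 0 < κ) (hr : 0 < r) :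
    powSol ν (-1 ^ 2) (κ * r) = κ ^ (1 / 2 + ν) * powSol ν (-κ ^ 2) r := by
  rw [powSol, powSol, Real.mul_rpow hκ.le hr.le, mul_assoc]
  congr 3
  ring

/-- Functions with an integrable derivative converge at infinity. -/
theorem exists_tendsto_atTop_of_deriv_le {f f' : ℝ → ℝ} {C : ℝ}
    (hd : ∀ r, 0 < r → HasDerivAt f (f' r) r) (hc : ContinuousOn f' (Ioi 0))
    (hb : ∀ r, 1 ≤ r → |f' r| ≤ C * r ^ (-2 : ℝ)) : ∃ L, Tendsto f atTop (𝓝 L) := by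
  refine ⟨_, tendsto_limUnder_of_hasDerivAt_of_integrableOn_Ioi (a := 1)
    (fun x hx => hd x (one_pos.trans hx)) ?_⟩
  refine Integrable.mono' ((integrableOn_Ioi_rpow_of_lt (by norm_num : (-2 : ℝ) < -1)
    one_pos).const_mul C) ((hc.mono (Ioi_subset_Ioi zero_le_one)).aestronglyMeasurable
      measurableSet_Ioi) ?_
  rw [ae_restrict_iff' measurableSet_Ioi]
  exact Eventually.of_forall fun r hr => hb r (le_of_lt hr)

/-- The quotient of a solution by a growing one converges at infinity. -/
theorem IsSol.exists_tendsto_div {c E C : ℝ} {P P' Q Q' : ℝ → ℝ} (hP : IsSol c E P P')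
    (hQ : IsSol c E Q Q') (hpos : ∀ r, 0 < r → 0 < P r) (hC : 0 < C) (hge : ∀ r, 1 ≤ r → C * r ≤ P r) :
    ∃ L, Tendsto (fun r => Q r / P r) atTop (𝓝 L) := by
  -- The derivative of the quotient is a constant Wronskian over `P²`, integrable because `P` grows
  -- at least linearly.
  refine exists_tendsto_atTop_of_deriv_le (f' := fun r => -(Q 1 * P' 1 - P 1 * Q' 1) / P r ^ 2)
    (C := |Q 1 * P' 1 - P 1 * Q' 1| / C ^ 2) (fun r hr => ?_) ?_ fun r hr => ?_
  · refine ((hQ.left r hr).div (hP.left r hr) (hpos r hr).ne').congr_deriv ?_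
    rw [hQ.wronskian_const hP one_pos hr]
    ring
  · exact continuousOn_const.div ((HasDerivAt.continuousOn fun r hr => hP.left r hr).pow 2)
      fun r hr => (pow_pos (hpos r hr) 2).ne'
  · have hr0 : 0 < r := by linarith
    have := hge r hr
    rw [abs_div, abs_neg, abs_of_pos (pow_pos (hpos r hr0) 2), Real.rpow_neg hr0.le,
      Real.rpow_ofNat, div_mul_eq_mul_div, ← div_eq_mul_inv, div_div, ← mul_pow, mul_comm r C]
    gcongr

/-- The quotient of the solutions with exponents `-α` and `α` at energy `-1` converges, and so does
its inverse, hence the limit is positive. Scaling to energy `-κ²` contributes the factor `κ^{2α}`.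
-/
theorem tendsto_irrSol_div_regSol {α : ℝ} (hα0 : 0 < α) (hα1 : α < 1) : ∃ M : ℝ, 0 < M ∧
    ∀ κ, 0 < κ → Tendsto (fun r => irrSol α (-κ ^ 2) r / regSol α (-κ ^ 2) r) atTop
      (𝓝 ((κ ^ (2 * α) * M - 1) / (2 * α))) := by
  have hm : -1 < -α := by linarith
  have hp : -1 < α := by linarith
  have g1 : 0 < Real.Gamma (1 + α) := Real.Gamma_pos_of_pos (by linarith)
  have g2 : 0 < Real.Gamma (1 - α) := Real.Gamma_pos_of_pos (by linarith)
  have s1 := isSol_powSol hm (-1 ^ 2)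
  rw [neg_sq] at s1
  have s2 := isSol_powSol hp (-1 ^ 2)
  obtain ⟨c₁, hc₁, k₁⟩ := exists_le_powSol_neg_of_one_le (p := 1) hm one_pos (by linarith)
  obtain ⟨c₂, hc₂, k₂⟩ := exists_le_powSol_neg_of_one_le (p := 1) hp one_pos (by linarith)
  simp only [Real.rpow_one] at k₁ k₂
  obtain ⟨L, hL⟩ := s2.exists_tendsto_div s1 (fun r hr => powSol_neg_pos hp hr) hc₂ k₂
  obtain ⟨L', hL'⟩ := s1.exists_tendsto_div s2 (fun r hr => powSol_neg_pos hm hr) hc₁ k₁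
  have hLL : L * L' = 1 := by
    refine tendsto_nhds_unique (hL.mul hL') (tendsto_const_nhds.congr' ?_)
    filter_upwards [eventually_gt_atTop 0] with r hr
    have h1 := powSol_neg_pos (κ := 1) hp hr
    have h2 := powSol_neg_pos (κ := 1) hm hr
    rw [div_mul_div_cancel₀ h1.ne', div_self h2.ne']
  have hL0 : 0 ≤ L := ge_of_tendsto hL (by
    filter_upwards [eventually_gt_atTop 0] with r hr
    exact (div_pos (powSol_neg_pos hm hr) (powSol_neg_pos hp hr)).le)
  have hLp : 0 < L := lt_of_le_of_ne hL0 fun h => by rw [← h] at hLL; simp at hLL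
  refine ⟨Real.Gamma (1 - α) / Real.Gamma (1 + α) * L, by positivity, fun κ hκ => ?_⟩
  have hs : Tendsto (fun r : ℝ => κ * r) atTop atTop := tendsto_id.const_mul_atTop hκ
  have t := ((((hL.comp hs).const_mul (Real.Gamma (1 - α) / Real.Gamma (1 + α))).const_mul
    (κ ^ (2 * α))).sub_const 1).div_const (2 * α)
  refine t.congr' ?_
  filter_upwards [eventually_gt_atTop 0] with r hr
  have h1 := powSol_neg_pos (κ := κ) hp hr
  have e1 : κ ^ (1 / 2 + α) = κ ^ (1 / 2 + -α) * κ ^ (2 * α) := by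
    rw [← Real.rpow_add hκ]; congr 1; ring
  have e2 := Real.rpow_pos_of_pos hκ (1 / 2 + -α)
  have e3 := Real.rpow_pos_of_pos hκ (2 * α)
  rw [Function.comp_apply, powSol_neg_scale hκ hr, powSol_neg_scale hκ hr, irrSol, if_neg hα0.ne',
    regSol, e1]
  field_simp

/-- For order zero scaling acts on the logarithm, so `κ` enters by the summand `log κ` instead of a
factor. -/
theorem tendsto_irrSol_div_regSol_zero : ∃ M : ℝ,
    ∀ κ, 0 < κ → Tendsto (fun r => irrSol 0 (-κ ^ 2) r / regSol 0 (-κ ^ 2) r) atTop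
      (𝓝 (M + Real.log κ)) := by
  have hp : (-1 : ℝ) < 0 := by norm_num
  have s1 := isSol_logSol (-1 ^ 2)
  have s2 := isSol_powSol hp (-1 ^ 2)
  obtain ⟨c₂, hc₂, k₂⟩ := exists_le_powSol_neg_of_one_le (p := 1) hp one_pos (by norm_num)
  simp only [Real.rpow_one] at k₂
  obtain ⟨L, hL⟩ := s2.exists_tendsto_div s1 (fun r hr => powSol_neg_pos hp hr) hc₂ k₂
  refine ⟨-L, fun κ hκ => ?_⟩
  have hs : Tendsto (fun r : ℝ => κ * r) atTop atTop := tendsto_id.const_mul_atTop hκ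
  refine ((hL.comp hs).neg.add_const (Real.log κ)).congr' ?_
  filter_upwards [eventually_gt_atTop 0] with r hr
  have h1 := powSol_neg_pos (κ := κ) hp hr
  have hb := bj_neg_pos hp (by positivity : 0 ≤ κ ^ 2 * r ^ 2 / 4)
  have hr' := Real.rpow_pos_of_pos hr (1 / 2)
  have hκ' := Real.rpow_pos_of_pos hκ (1 / 2)
  rw [Function.comp_apply, irrSol, if_pos rfl, regSol, logSol, logSol, powSol, powSol, add_zero,
    add_zero, Real.Gamma_one, one_mul, Real.mul_rpow hκ.le hr.le, Real.log_mul hκ.ne' hr.ne',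
    show -1 ^ 2 * (κ * r) ^ 2 / 4 = -(κ ^ 2 * r ^ 2 / 4) by ring,
    show -κ ^ 2 * r ^ 2 / 4 = -(κ ^ 2 * r ^ 2 / 4) by ring]
  field_simp
  ring

/-- The limit of the quotient of the solution with the boundary condition by the regular one. -/
theorem exists_tendsto_bcSol_div_regSol {α s : ℝ} (hα0 : 0 ≤ α) (hα1 : α < 1) : ∃ ℓ : ℝ → ℝ,
    (∀ κ, 0 < κ → Tendsto (fun r => bcSol α s (-κ ^ 2) r / regSol α (-κ ^ 2) r) atTop (𝓝 (ℓ κ))) ∧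
    (2 * α * s < 1 → ∃ κ₀, 0 < κ₀ ∧ ∀ κ, 0 < κ → (ℓ κ = 0 ↔ κ = κ₀)) ∧
    (1 < 2 * α * s → ∀ κ, 0 < κ → ℓ κ ≠ 0) := by
  have g1 : 0 < Real.Gamma (1 + α) := Real.Gamma_pos_of_pos (by linarith)
  have step : ∀ {κ L : ℝ}, 0 < κ →
      Tendsto (fun r => irrSol α (-κ ^ 2) r / regSol α (-κ ^ 2) r) atTop (𝓝 L) →
      Tendsto (fun r => bcSol α s (-κ ^ 2) r / regSol α (-κ ^ 2) r) atTop (𝓝 (L + s)) := by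
    intro κ L hκ h
    refine (h.add_const s).congr' ?_
    filter_upwards [eventually_gt_atTop 0] with r hr
    have h1 : 0 < regSol α (-κ ^ 2) r := mul_pos g1 (powSol_neg_pos (by linarith) hr)
    rw [bcSol]
    field_simp
  rcases hα0.eq_or_lt with h | h
  · subst h
    obtain ⟨M, hM⟩ := tendsto_irrSol_div_regSol_zero
    refine ⟨fun κ => M + Real.log κ + s, fun κ hκ => step hκ (hM κ hκ),
      fun _ => ⟨rexp (-(M + s)), Real.exp_pos _, fun κ hκ => ⟨fun e => ?_, fun e => ?_⟩⟩,
      fun h1 => by simp at h1; linarith⟩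
    · rw [← Real.exp_log hκ]; congr 1; linarith
    · simp only [e, Real.log_exp]; ring
  · obtain ⟨M, hM0, hM⟩ := tendsto_irrSol_div_regSol h hα1
    -- The condition for a bound state: the left side runs once through all positive numbers, so it
    -- is solvable exactly when `1 - 2αs` is positive.
    have hiff : ∀ κ : ℝ, (κ ^ (2 * α) * M - 1) / (2 * α) + s = 0 ↔
        κ ^ (2 * α) = (1 - 2 * α * s) / M := fun κ => by
      rw [eq_div_iff hM0.ne', div_add' _ _ _ (by positivity), div_eq_zero_iff]
      constructor
      · rintro (e | e)
        · linarith
        · linarith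
      · intro e; left; linarith
    refine ⟨fun κ => (κ ^ (2 * α) * M - 1) / (2 * α) + s, fun κ hκ => step hκ (hM κ hκ),
      fun h1 => ?_, fun h1 κ hκ e => ?_⟩
    · have hq : 0 < (1 - 2 * α * s) / M := div_pos (by linarith) hM0
      refine ⟨((1 - 2 * α * s) / M) ^ (2 * α)⁻¹, Real.rpow_pos_of_pos hq _, fun κ hκ => ?_⟩
      rw [hiff]
      constructor
      · intro e
        rw [← e, Real.rpow_rpow_inv hκ.le (by positivity)]
      · intro e
        rw [e, Real.rpow_inv_rpow hq.le (by positivity)]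
    · have := (hiff κ).1 e
      have h2 : (1 - 2 * α * s) / M < 0 := div_neg_of_neg_of_pos (by linarith) hM0
      linarith [Real.rpow_pos_of_pos hκ (2 * α)]

section
variable {α : ℝ} (hα0 : 0 ≤ α) (hα1 : α < 1) (s : ℝ) {κ : ℝ} (hκ : 0 < κ)
include hα0 hκ

theorem exists_le_regSol_neg {p : ℝ} (hp : p ≤ 5 / 2 + α) :
    ∃ c : ℝ, 0 < c ∧ ∀ r, 1 ≤ r → c * r ^ p ≤ regSol α (-κ ^ 2) r := by
  have g1 : 0 < Real.Gamma (1 + α) := Real.Gamma_pos_of_pos (by linarith)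
  obtain ⟨c, hc, h⟩ := exists_le_powSol_neg_of_one_le (p := p) (by linarith : -1 < α) hκ hp
  refine ⟨Real.Gamma (1 + α) * c, by positivity, fun r hr => ?_⟩
  rw [regSol, mul_assoc]
  have := h r hr
  gcongr

theorem tendsto_abs_bcSol {L : ℝ} (hL : L ≠ 0)
    (h : Tendsto (fun r => bcSol α s (-κ ^ 2) r / regSol α (-κ ^ 2) r) atTop (𝓝 L)) :
    Tendsto (fun r => |bcSol α s (-κ ^ 2) r|) atTop atTop := by
  obtain ⟨c, hc, hge⟩ := exists_le_regSol_neg (p := 1) hα0 hκ (by linarith)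
  have hF : Tendsto (regSol α (-κ ^ 2)) atTop atTop := by
    refine tendsto_atTop_mono' _ ?_ (tendsto_id.const_mul_atTop hc)
    filter_upwards [eventually_ge_atTop 1] with r hr
    simpa using hge r hr
  refine ((h.abs.pos_mul_atTop (abs_pos.2 hL) hF)).congr' ?_
  filter_upwards [hF.eventually_gt_atTop 0] with r hr
  rw [abs_div, abs_of_pos hr]
  field_simp

include hα1

/-- The decay of the solution whose quotient by the regular one tends to zero. -/
theorem exists_abs_bcSol_le
    (h : Tendsto (fun r => bcSol α s (-κ ^ 2) r / regSol α (-κ ^ 2) r) atTop (𝓝 0)) :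
    ∃ C : ℝ, ∀ r, 1 ≤ r → |bcSol α s (-κ ^ 2) r| ≤ C * r ^ (-1 : ℝ) := by
  have g1 : 0 < Real.Gamma (1 + α) := Real.Gamma_pos_of_pos (by linarith)
  obtain ⟨c, hc, hge⟩ := exists_le_regSol_neg (p := 2) hα0 hκ (by linarith)
  set F := regSol α (-κ ^ 2) with hF
  have hpos : ∀ r, 0 < r → 0 < F r := fun r hr => mul_pos g1 (powSol_neg_pos (by linarith) hr)
  have sF := isSol_regSol hα0 (-κ ^ 2)
  have sB := isSol_bcSol hα0 hα1 s (-κ ^ 2)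
  have hmono : MonotoneOn F (Ioi 0) := by
    refine monotoneOn_of_deriv_nonneg (convex_Ioi 0)
      (HasDerivAt.continuousOn fun r hr => sF.left r hr)
      (fun r hr => (sF.left r (interior_subset hr)).differentiableAt.differentiableWithinAt)
      fun r hr => ?_
    rw [(sF.left r (interior_subset hr)).deriv]
    exact mul_nonneg g1.le (powSolDeriv_neg_nonneg hα0 (interior_subset hr))
  have hD : ∀ r, 0 < r → HasDerivAt (fun r => bcSol α s (-κ ^ 2) r / F r) (-(1 / F r ^ 2)) r := by
    intro r hr
    refine ((sB.left r hr).div (sF.left r hr) (hpos r hr).ne').congr_deriv ?_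
    rw [← neg_div]
    congr 1
    linarith [wronskian_bc_reg hα0 hα1 s (-κ ^ 2) hr]
  refine ⟨1 / c, fun r hr => ?_⟩
  have hr0 : 0 < r := by linarith
  have hFr := hpos r hr0
  have hsub : ∀ {x}, x ∈ Ici r → 0 < x := fun hx => hr0.trans_le hx
  have hanti : AntitoneOn (fun r => bcSol α s (-κ ^ 2) r / F r) (Ici r) := by
    refine antitoneOn_of_deriv_nonpos (convex_Ici r)
      (HasDerivAt.continuousOn fun x hx => hD x (hsub hx))
      (fun x hx => (hD x (hsub (interior_subset hx))).differentiableAt.differentiableWithinAt)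
      fun x hx => ?_
    rw [(hD x (hsub (interior_subset hx))).deriv]
    exact neg_nonpos.2 (by positivity)
  have h0 : 0 ≤ bcSol α s (-κ ^ 2) r / F r := le_of_tendsto h (by
    filter_upwards [eventually_ge_atTop r] with x hx using hanti self_mem_Ici hx hx)
  -- Since `(bcSol / F)' = -1/F²`, with `F` increasing and `F(x) ≥ c x²`, the quotient at `r` is at
  -- most the integral over `x ≥ r` of `1/(F(r) c x²)`, which is `1/(F(r) c r)`. This is expressed
  -- as monotonicity of the difference, whose limit is zero.
  have hE : ∀ x, 0 < x → HasDerivAt (fun x => bcSol α s (-κ ^ 2) x / F x - 1 / (F r * c) * x⁻¹)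
      (-(1 / F x ^ 2) - 1 / (F r * c) * -(x ^ 2)⁻¹) x := fun x hx =>
    (hD x hx).sub ((hasDerivAt_inv hx.ne').const_mul _)
  have hmon : MonotoneOn (fun x => bcSol α s (-κ ^ 2) x / F x - 1 / (F r * c) * x⁻¹) (Ici r) := by
    refine monotoneOn_of_deriv_nonneg (convex_Ici r)
      (HasDerivAt.continuousOn fun x hx => hE x (hsub hx))
      (fun x hx => (hE x (hsub (interior_subset hx))).differentiableAt.differentiableWithinAt)
      fun x hx => ?_
    have hx := interior_subset hx
    have hx0 := hsub hx
    rw [(hE x hx0).deriv]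
    have h1 : F r ≤ F x := hmono hr0 hx0 hx
    have h2 : c * x ^ 2 ≤ F x := by
      have := hge x (hr.trans hx)
      rwa [Real.rpow_ofNat] at this
    have h3 : 1 / F x ^ 2 ≤ 1 / (F r * (c * x ^ 2)) := by
      apply one_div_le_one_div_of_le (by positivity)
      rw [sq (F x)]
      exact mul_le_mul h1 h2 (by positivity) (hpos x hx0).le
    have h4 : 1 / (F r * (c * x ^ 2)) = 1 / (F r * c) * (x ^ 2)⁻¹ := by field_simp
    linarith
  have hlim : Tendsto (fun x => bcSol α s (-κ ^ 2) x / F x - 1 / (F r * c) * x⁻¹) atTop (𝓝 0) := by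
    simpa using h.sub (tendsto_inv_atTop_zero.const_mul (1 / (F r * c)))
  have h5 : bcSol α s (-κ ^ 2) r / F r - 1 / (F r * c) * r⁻¹ ≤ 0 := ge_of_tendsto hlim (by
    filter_upwards [eventually_ge_atTop r] with x hx using hmon self_mem_Ici hx hx)
  have hb : 0 ≤ bcSol α s (-κ ^ 2) r := by
    have := mul_nonneg h0 hFr.le
    rwa [div_mul_cancel₀ _ hFr.ne'] at this
  rw [abs_of_nonneg hb, Real.rpow_neg_one]
  have h6 : bcSol α s (-κ ^ 2) r / F r ≤ 1 / (F r * c) * r⁻¹ := by linarith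
  rw [div_le_iff₀ hFr] at h6
  refine h6.trans (le_of_eq ?_)
  field_simp

end

end AnyonDelta

end
noncomputable section

namespace AnyonDelta

/-! ### Bound states -/

theorem continuousOn_potential (c E : ℝ) : ContinuousOn (fun x : ℝ => c / x ^ 2 - E) (Ioi 0) :=
  (continuousOn_const.div (continuousOn_id.pow 2) fun _ hx =>
    pow_ne_zero 2 (mem_Ioi.1 hx).ne').sub continuousOn_const

/-- By absolute continuity the first derivative is the integral of a function that is continuous, so
the equation, given almost everywhere, holds at every point. -/
theorem InMaximalDomain.isSol {α E : ℝ} {ψ : ℝ → ℂ} (h : InMaximalDomain α ψ)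
    (he : radialExpr α ψ =ᵐ[halfLine] fun r => E * ψ r) : IsSol (α ^ 2 - 1 / 4) E ψ (deriv ψ) := by
  refine ⟨fun r hr => (h.differentiable r hr).hasDerivAt, fun r hr => ?_⟩
  set f : ℝ → ℂ := fun x => ((α ^ 2 - 1 / 4) / x ^ 2 - E) • ψ x with hf
  have hc : ContinuousOn f (Ioi 0) := (continuousOn_potential _ E).smul h.continuousOn
  rw [Filter.EventuallyEq, ae_restrict_iff' measurableSet_Ioi] at he
  have hd : ∀ᵐ x, x ∈ Ioi (0 : ℝ) → HasDerivAt (deriv ψ) (f x) x := by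
    filter_upwards [he, h.ae_hasDerivAt] with x h1 h2 hx
    refine (h2 hx).congr_deriv ?_
    simp only [h1 hx, hf, Complex.real_smul]
    push_cast; ring
  have hr2 : 0 < r / 2 := half_pos hr
  have hI : ∀ y, 0 < y → deriv ψ y = (∫ x in (r / 2)..y, f x) + deriv ψ (r / 2) := fun y hy => by
    rw [(integral_eq_sub_of_absolutelyContinuous (h.ac_deriv hr2 hy) (hd.mono fun x hx hm =>
      hx (uIcc_subset_Ioi hr2 hy hm))).2]
    ring
  have hFTC := intervalIntegral.integral_hasDerivAt_right
    ((hc.mono (uIcc_subset_Ioi hr2 hr)).intervalIntegrable)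
    (hc.stronglyMeasurableAtFilter isOpen_Ioi r hr) (hc.continuousAt (Ioi_mem_nhds hr))
  refine (hFTC.add_const (deriv ψ (r / 2))).congr_of_eventuallyEq ?_
  filter_upwards [Ioi_mem_nhds hr] with y hy using hI y hy

theorem IsSol.scale_energy {V : Type*} [NormedAddCommGroup V] [NormedSpace ℝ V] {c E : ℝ}
    {u v : ℝ → V} (h : IsSol c E u v) {k : ℝ} (hk : 0 < k) :
    IsSol c (E * k ^ 2) (fun r => u (k * r)) (fun r => k • v (k * r)) := by
  have hm : ∀ r, HasDerivAt (fun r => k * r) k r := fun r => by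
    simpa using (hasDerivAt_id r).const_mul k
  refine ⟨fun r hr => ?_, fun r hr => ?_⟩
  · exact HasDerivAt.scomp r (h.left (k * r) (by positivity)) (hm r)
  · have h1 := (HasDerivAt.scomp r (h.right (k * r) (by positivity)) (hm r)).const_smul k
    refine h1.congr_deriv ?_
    rw [smul_smul, smul_smul]
    congr 1
    field_simp

/-- There are no square integrable solutions at positive energies. -/
theorem InMaximalDomain.eq_zero_of_isSol {α k : ℝ} {ψ : ℝ → ℂ} (hk : 0 < k)
    (h : InMaximalDomain α ψ) (hs : IsSol (α ^ 2 - 1 / 4) (k ^ 2) ψ (deriv ψ)) :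
    ψ k⁻¹ = 0 ∧ deriv ψ k⁻¹ = 0 := by
  have hs1 := hs.scale_energy (inv_pos.2 hk)
  rw [inv_pow, mul_inv_cancel₀ (pow_ne_zero 2 hk.ne')] at hs1
  -- After rescaling to energy one, `m` bounds the energy from below for all large radii. If it were
  -- positive, `‖ψ‖² + k⁻² ‖ψ'‖²` would not be integrable at infinity, although both terms are.
  set m : ℝ := (‖ψ (k⁻¹ * 1)‖ ^ 2 + ‖k⁻¹ • deriv ψ (k⁻¹ * 1)‖ ^ 2) * rexp (-|α ^ 2 - 1 / 4|) with hm
  have hm0 : m ≤ 0 := by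
    by_contra! hpos
    have hi : IntegrableOn (fun r => ‖ψ r‖ ^ 2 + k⁻¹ ^ 2 * ‖deriv ψ r‖ ^ 2) (Ioi 1) :=
      (h.integrable_normSq.mono_set (Ioi_subset_Ioi zero_le_one)).add
        (h.integrableOn_normSq_deriv.const_mul _)
    refine not_integrableOn_of_one_le (a := 1) (b := k⁻¹)
      (f := fun r => m⁻¹ * (‖ψ r‖ ^ 2 + k⁻¹ ^ 2 * ‖deriv ψ r‖ ^ 2)) (fun r hr => ?_)
      (hi.const_mul m⁻¹)
    have := hs1.le_energy (x := k * r) (by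
      rw [← mul_inv_cancel₀ hk.ne']; gcongr)
    rw [inv_mul_cancel_left₀ hk.ne', ← hm, norm_smul, Real.norm_of_nonneg (inv_pos.2 hk).le,
      mul_pow] at this
    rw [inv_mul_eq_div, one_le_div hpos]
    exact this
  have he := Real.exp_pos (-|α ^ 2 - 1 / 4|)
  have h0 : ‖ψ (k⁻¹ * 1)‖ ^ 2 + ‖k⁻¹ • deriv ψ (k⁻¹ * 1)‖ ^ 2 ≤ 0 := by
    by_contra! hc
    exact absurd (mul_pos hc he) (not_lt.2 hm0)
  rw [mul_one] at h0
  constructor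
  · have : ‖ψ k⁻¹‖ ^ 2 = 0 := le_antisymm (by nlinarith [sq_nonneg ‖k⁻¹ • deriv ψ k⁻¹‖]) (sq_nonneg _)
    simpa using this
  · have : ‖k⁻¹ • deriv ψ k⁻¹‖ ^ 2 = 0 := le_antisymm (by nlinarith [sq_nonneg ‖ψ k⁻¹‖]) (sq_nonneg _)
    simpa [hk.ne'] using this

theorem eq_zero_of_memLp_of_tendsto {b : ℂ} {u : ℝ → ℝ} {ψ : ℝ → ℂ} (hψ : MemLp ψ 2 halfLine)
    (h : ∀ r, 0 < r → ψ r = b * u r) (hu : Tendsto (fun r => |u r|) atTop atTop) : b = 0 := by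
  by_contra hb
  have hb' : 0 < ‖b‖ := norm_pos_iff.2 hb
  obtain ⟨x₀, hx₀⟩ := eventually_atTop.1 ((hu.const_mul_atTop hb').eventually_ge_atTop 1)
  have hi : IntegrableOn (fun r => ‖ψ r‖ ^ 2) (Ioi 0) := by
    have := hψ.integrable_norm_pow two_ne_zero
    exact_mod_cast this
  refine not_integrableOn_of_one_le (b := max 1 x₀) (fun r hr => ?_) hi
  have h1 : 0 < r := by linarith [le_max_left 1 x₀]
  have h2 := hx₀ r ((le_max_right 1 x₀).trans hr)
  rw [h r h1, norm_mul, Complex.norm_real, Real.norm_eq_abs]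
  nlinarith

theorem eq_zero_of_ae_eq_zero {α s : ℝ} {Ψ : HalfLineL2} {ψ : ℝ → ℂ} {E : ℝ}
    (h : (Ψ : ℝ → ℂ) =ᵐ[halfLine] ψ) (hψ : ∀ r, 0 < r → ψ r = (0 : ℂ) * bcSol α s E r) : Ψ = 0 := by
  refine Lp.ext (h.trans ?_)
  filter_upwards [self_mem_ae_restrict measurableSet_Ioi, Lp.coeFn_zero ℂ 2 halfLine] with r hr h0
  rw [h0, hψ r hr, zero_mul, Pi.zero_apply]

section
variable {α : ℝ} (hα0 : 0 ≤ α) (hα1 : α < 1) {s : ℝ}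
include hα0 hα1

/-- For `α > 0` the coefficient of the growing power `r^{1/2+α}` is `s - 1/(2α)`, which vanishes
precisely in the excluded case; for `α = 0` the logarithm dominates. -/
theorem tendsto_abs_bcSol_zero (hs : 2 * α * s ≠ 1) :
    Tendsto (fun r => |bcSol α s 0 r|) atTop atTop := by
  have hp : Tendsto (fun r : ℝ => r ^ (1 / 2 + α)) atTop atTop :=
    tendsto_rpow_atTop (by linarith)
  by_cases h : α = 0
  · subst h
    have h1 : Tendsto (fun r => |-Real.log r + s|) atTop atTop :=
      tendsto_abs_atBot_atTop.comp (tendsto_atBot_add_const_right _ s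
        (tendsto_neg_atTop_atBot.comp Real.tendsto_log_atTop))
    refine (h1.atTop_mul_atTop₀ hp).congr' ?_
    filter_upwards [eventually_gt_atTop 0] with r hr
    have hr' := Real.rpow_pos_of_pos hr (1 / 2)
    rw [bcSol, irrSol_zero hα0 hα1, regSol_zero hα0, zeroIrregular, if_pos rfl, Real.sqrt_eq_rpow,
      add_zero, ← abs_of_pos hr', ← abs_mul, abs_of_pos hr']
    congr 1; ring
  · have hα : 0 < α := lt_of_le_of_ne hα0 (Ne.symm h)
    have h1 : Tendsto (fun r : ℝ => |1 / (2 * α) * r ^ (-(2 * α)) + (s - 1 / (2 * α))|) atTop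
        (𝓝 |1 / (2 * α) * 0 + (s - 1 / (2 * α))|) :=
      (((tendsto_rpow_neg_atTop (by positivity : 0 < 2 * α)).const_mul _).add_const _).abs
    refine (h1.pos_mul_atTop (abs_pos.2 ?_) hp).congr' ?_
    · rw [mul_zero, zero_add, sub_ne_zero]
      intro e
      apply hs
      rw [e]; field_simp
    · filter_upwards [eventually_gt_atTop 0] with r hr
      have hr' := Real.rpow_pos_of_pos hr (1 / 2 + α)
      have e : r ^ (1 / 2 - α) = r ^ (1 / 2 + α) * r ^ (-(2 * α)) := by
        rw [← Real.rpow_add hr]; congr 1; ring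
      rw [bcSol, irrSol_zero hα0 hα1, regSol_zero hα0, zeroIrregular, if_neg h, e,
        ← abs_of_pos hr', ← abs_mul, abs_of_pos hr']
      congr 1; ring

theorem exists_eq_mul_bcSol_of_mem {E : ℝ} {Ψ : HalfLineL2}
    (h : (Ψ, (E : ℂ) • Ψ) ∈ deltaHamiltonian α s) : ∃ (ψ : ℝ → ℂ) (b : ℂ), InMaximalDomain α ψ ∧
      (Ψ : ℝ → ℂ) =ᵐ[halfLine] ψ ∧ IsSol (α ^ 2 - 1 / 4) E ψ (deriv ψ) ∧
      ∀ r, 0 < r → ψ r = b * bcSol α s E r := by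
  obtain ⟨ψ, hψ, hb, e1, e2⟩ := h
  have hs := hψ.isSol (E := E) (e2.symm.trans ((Lp.coeFn_smul _ _).trans (by
    filter_upwards [e1] with r hr
    rw [Pi.smul_apply, hr, smul_eq_mul])))
  obtain ⟨b, hb'⟩ := hs.eq_mul_bcSol hα0 hα1 s E hb
  exact ⟨ψ, b, hψ, e1, hs, hb'⟩

theorem eq_zero_of_mem_of_nonneg (hs : 2 * α * s ≠ 1) {E : ℝ} (hE : 0 ≤ E) {Ψ : HalfLineL2}
    (h : (Ψ, (E : ℂ) • Ψ) ∈ deltaHamiltonian α s) : Ψ = 0 := by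
  obtain ⟨ψ, b, hψ, e1, hsol, hb⟩ := exists_eq_mul_bcSol_of_mem hα0 hα1 h
  suffices hb0 : b = 0 by
    subst hb0; exact eq_zero_of_ae_eq_zero e1 hb
  rcases hE.eq_or_lt with h0 | h0
  · subst h0
    exact eq_zero_of_memLp_of_tendsto hψ.memLp hb (tendsto_abs_bcSol_zero hα0 hα1 hs)
  · obtain ⟨k, hk, rfl⟩ : ∃ k : ℝ, 0 < k ∧ E = k ^ 2 := ⟨√E, Real.sqrt_pos.2 h0, (Real.sq_sqrt hE).symm⟩
    have hki := inv_pos.2 hk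
    obtain ⟨z1, z2⟩ := hψ.eq_zero_of_isSol hk hsol
    have hd := ((isSol_bcSol hα0 hα1 s (k ^ 2)).left _ hki).ofReal_comp.const_mul b
    rw [deriv_congr_Ioi hb hki, hd.deriv] at z2
    rw [hb _ hki] at z1
    have w := congrArg (fun x : ℝ => (x : ℂ)) (wronskian_bc_reg hα0 hα1 s (k ^ 2) hki)
    push_cast at w
    -- The function and its derivative vanish at `1/k`, and `bcSol` has Wronskian one with `regSol`
    -- there, so the factor `b` is zero.
    linear_combination (regSolDeriv α (k ^ 2) k⁻¹ : ℂ) * z1 - (regSol α (k ^ 2) k⁻¹ : ℂ) * z2 - b * w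

theorem eq_zero_of_mem_of_tendsto {κ L : ℝ} (hκ : 0 < κ) (hL : L ≠ 0)
    (ht : Tendsto (fun r => bcSol α s (-κ ^ 2) r / regSol α (-κ ^ 2) r) atTop (𝓝 L))
    {Ψ : HalfLineL2} (h : (Ψ, ((-κ ^ 2 : ℝ) : ℂ) • Ψ) ∈ deltaHamiltonian α s) : Ψ = 0 := by
  obtain ⟨ψ, b, hψ, e1, hsol, hb⟩ := exists_eq_mul_bcSol_of_mem hα0 hα1 h
  have hb0 := eq_zero_of_memLp_of_tendsto hψ.memLp hb (tendsto_abs_bcSol hα0 s hκ hL ht)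
  subst hb0
  exact eq_zero_of_ae_eq_zero e1 hb

theorem memLp_bcSol {κ : ℝ} (hκ : 0 < κ)
    (ht : Tendsto (fun r => bcSol α s (-κ ^ 2) r / regSol α (-κ ^ 2) r) atTop (𝓝 0)) :
    MemLp (fun r => (bcSol α s (-κ ^ 2) r : ℂ)) 2 halfLine := by
  have hc : ContinuousOn (bcSol α s (-κ ^ 2)) (Ioi 0) :=
    HasDerivAt.continuousOn fun r hr => (isSol_bcSol hα0 hα1 s (-κ ^ 2)).left r hr
  have hm : ∀ {S : Set ℝ}, MeasurableSet S → S ⊆ Ioi 0 →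
      AEStronglyMeasurable (fun r => (bcSol α s (-κ ^ 2) r : ℂ)) (volume.restrict S) :=
    fun hS hsub => ((Complex.continuous_ofReal.comp_continuousOn hc).mono hsub).aestronglyMeasurable hS
  have h1 := (nearBound_bcSol hα0 hα1 s).memLp (E := -κ ^ 2) (by linarith) hc
  obtain ⟨C, hC⟩ := exists_abs_bcSol_le hα0 hα1 s hκ ht
  rw [memLp_two_iff_integrable_sq_norm (hm measurableSet_Ioc Ioc_subset_Ioi_self)] at h1
  rw [memLp_two_iff_integrable_sq_norm (hm measurableSet_Ioi subset_rfl)]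
  have h2 : IntegrableOn (fun r => ‖(bcSol α s (-κ ^ 2) r : ℂ)‖ ^ 2) (Ioi 1) := by
    refine Integrable.mono' ((integrableOn_Ioi_rpow_of_lt (by norm_num : (-2 : ℝ) < -1)
      one_pos).const_mul (C ^ 2)) ((hm measurableSet_Ioi (Ioi_subset_Ioi zero_le_one)).norm.pow 2) ?_
    rw [ae_restrict_iff' measurableSet_Ioi]
    refine Eventually.of_forall fun r hr => ?_
    have hr0 : 0 < r := one_pos.trans hr
    have := hC r (le_of_lt hr)
    rw [Real.norm_of_nonneg (by positivity), Complex.norm_real, Real.norm_eq_abs]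
    calc |bcSol α s (-κ ^ 2) r| ^ 2 ≤ (C * r ^ (-1 : ℝ)) ^ 2 := by gcongr
      _ = C ^ 2 * r ^ (-2 : ℝ) := by
        rw [mul_pow, ← Real.rpow_natCast (r ^ (-1 : ℝ)), ← Real.rpow_mul hr0.le]; norm_num
  have := IntegrableOn.union h1 h2
  rwa [Ioc_union_Ioi_eq_Ioi zero_le_one] at this

theorem inMaximalDomain_bcSol {κ : ℝ} (hκ : 0 < κ)
    (ht : Tendsto (fun r => bcSol α s (-κ ^ 2) r / regSol α (-κ ^ 2) r) atTop (𝓝 0)) :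
    InMaximalDomain α (fun r => (bcSol α s (-κ ^ 2) r : ℂ)) := by
  have hs := (isSol_bcSol hα0 hα1 s (-κ ^ 2)).ofReal
  have hL := memLp_bcSol hα0 hα1 hκ ht
  refine ⟨fun r hr => (hs.left r hr).differentiableAt, fun a b ha hab => ?_, hL, ?_⟩
  · have hsub := uIcc_subset_Ioi ha (ha.trans hab)
    refine absolutelyContinuous_of_hasDerivAt (fun x hx => hs.deriv_deriv_eq (hsub hx)) ?_
    exact ((continuousOn_potential _ _).smul
      (HasDerivAt.continuousOn fun r hr => hs.left r hr)).mono hsub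
  · refine MemLp.ae_eq ?_ (hL.const_mul ((-κ ^ 2 : ℝ) : ℂ))
    filter_upwards [self_mem_ae_restrict measurableSet_Ioi] with r hr
    exact (hs.radialExpr_eq hr).symm

/-- The number of bound states. -/
theorem boundStateCount_deltaHamiltonian (hs : 2 * α * s ≠ 1) :
    (2 * α * s < 1 → boundStateCount (deltaHamiltonian α s) = 1) ∧
    (1 < 2 * α * s → boundStateCount (deltaHamiltonian α s) = 0) := by
  obtain ⟨ℓ, hℓ, h1, h2⟩ := exists_tendsto_bcSol_div_regSol (s := s) hα0 hα1
  have hneg : ∀ {E : ℝ}, E < 0 → ∃ κ, 0 < κ ∧ E = -κ ^ 2 := fun {E} hE =>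
    ⟨√(-E), Real.sqrt_pos.2 (by linarith), by rw [Real.sq_sqrt (by linarith)]; ring⟩
  refine ⟨fun hlt => ?_, fun hgt => ?_⟩
  · obtain ⟨κ₀, hκ₀, hiff⟩ := h1 hlt
    have ht : Tendsto (fun r => bcSol α s (-κ₀ ^ 2) r / regSol α (-κ₀ ^ 2) r) atTop (𝓝 0) := by
      rw [← (hiff κ₀ hκ₀).2 rfl]; exact hℓ κ₀ hκ₀
    have hsol := (isSol_bcSol hα0 hα1 s (-κ₀ ^ 2)).ofReal
    have hD := inMaximalDomain_bcSol hα0 hα1 hκ₀ ht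
    set Ψ₀ : HalfLineL2 := hD.memLp.toLp with hΨ₀
    have e₀ : (Ψ₀ : ℝ → ℂ) =ᵐ[halfLine] fun r => (bcSol α s (-κ₀ ^ 2) r : ℂ) := hD.memLp.coeFn_toLp
    have hmem : (Ψ₀, ((-κ₀ ^ 2 : ℝ) : ℂ) • Ψ₀) ∈ deltaHamiltonian α s := by
      refine ⟨_, hD, boundaryCondition_bcSol hα0 hα1 s (-κ₀ ^ 2) (a := 1) fun r hr => (one_mul _).symm,
        e₀, (Lp.coeFn_smul _ _).trans ?_⟩
      filter_upwards [e₀, self_mem_ae_restrict measurableSet_Ioi] with r e hr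
      rw [Pi.smul_apply, e, hsol.radialExpr_eq hr, smul_eq_mul]
    have hne : Ψ₀ ≠ 0 := by
      intro h0
      have hae : (fun r => (bcSol α s (-κ₀ ^ 2) r : ℂ)) =ᵐ[halfLine] fun _ => 0 := by
        refine e₀.symm.trans ?_
        rw [h0]; exact Lp.coeFn_zero ℂ 2 halfLine
      have hz := Measure.eqOn_open_of_ae_eq hae isOpen_Ioi
        (HasDerivAt.continuousOn fun r hr => hsol.left r hr) continuousOn_const
      have hd : deriv (fun r => (bcSol α s (-κ₀ ^ 2) r : ℂ)) 1 = 0 := by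
        rw [deriv_congr_Ioi (v := fun _ => (0 : ℂ)) (fun r hr => hz hr) one_pos]; simp
      rw [hsol.deriv_eq one_pos] at hd
      have w := wronskian_bc_reg hα0 hα1 s (-κ₀ ^ 2) one_pos
      have z1 : bcSol α s (-κ₀ ^ 2) 1 = 0 := Complex.ofReal_eq_zero.1 (hz (mem_Ioi.2 one_pos))
      have z2 : bcSolDeriv α s (-κ₀ ^ 2) 1 = 0 := by exact_mod_cast hd
      rw [z1, z2] at w
      simp at w
    have hspan : Submodule.span ℂ {Ψ : HalfLineL2 | ∃ E : ℝ, (Ψ, (E : ℂ) • Ψ) ∈ deltaHamiltonian α s}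
        = Submodule.span ℂ {Ψ₀} := by
      refine le_antisymm (Submodule.span_le.2 ?_) (Submodule.span_mono ?_)
      · rintro Ψ ⟨E, hE⟩
        rw [SetLike.mem_coe]
        rcases le_or_gt 0 E with h0 | h0
        · rw [eq_zero_of_mem_of_nonneg hα0 hα1 hs h0 hE]; exact Submodule.zero_mem _
        · obtain ⟨κ, hκ, rfl⟩ := hneg h0
          by_cases hκκ : κ = κ₀
          · subst hκκ
            obtain ⟨ψ, b, -, e1, -, hb⟩ := exists_eq_mul_bcSol_of_mem hα0 hα1 hE
            refine Submodule.mem_span_singleton.2 ⟨b, Lp.ext ((Lp.coeFn_smul _ _).trans ?_)⟩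
            filter_upwards [e₀, e1, self_mem_ae_restrict measurableSet_Ioi] with r h3 h4 hr
            rw [Pi.smul_apply, h3, h4, hb r hr, smul_eq_mul]
          · rw [eq_zero_of_mem_of_tendsto hα0 hα1 hκ (fun h => hκκ ((hiff κ hκ).1 h)) (hℓ κ hκ) hE]
            exact Submodule.zero_mem _
      · rw [singleton_subset_iff]; exact ⟨_, hmem⟩
    rw [boundStateCount, hspan, ← CommSemiring.rank_self ℂ]
    exact (LinearEquiv.toSpanNonzeroSingleton ℂ HalfLineL2 Ψ₀ hne).rank_eq.symm
  · have hspan : Submodule.span ℂ {Ψ : HalfLineL2 | ∃ E : ℝ, (Ψ, (E : ℂ) • Ψ) ∈ deltaHamiltonian α s}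
        = ⊥ := by
      rw [Submodule.span_eq_bot]
      rintro Ψ ⟨E, hE⟩
      rcases le_or_gt 0 E with h0 | h0
      · exact eq_zero_of_mem_of_nonneg hα0 hα1 hs h0 hE
      · obtain ⟨κ, hκ, rfl⟩ := hneg h0
        exact eq_zero_of_mem_of_tendsto hα0 hα1 hκ (h2 hgt κ hκ) (hℓ κ hκ) hE
    rw [boundStateCount, hspan, rank_bot]

end

end AnyonDelta

end
noncomputable section

namespace AnyonDelta

/-! ### The phase shift -/

/-- Up to a positive factor, `e^{-i arctan T}` is `1 - iT`; its square is `(1 - iT)/(1 + iT)`, and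
`e^{iπ}` turns this into the stated quotient. -/
theorem exp_two_mul_pi_div_two_sub_arctan (T : ℝ) :
    Complex.exp (2 * Complex.I * (π / 2 - Real.arctan T : ℝ)) = (T + Complex.I) / (T - Complex.I) := by
  have hc : (1 / √(1 + T ^ 2)) ^ 2 * (1 + T ^ 2) = 1 := by
    rw [div_pow, Real.sq_sqrt (by positivity)]
    have : 1 + T ^ 2 ≠ 0 := by positivity
    field_simp
  have hc' := congrArg (fun x : ℝ => (x : ℂ)) hc
  set c : ℝ := 1 / √(1 + T ^ 2) with hcd
  have e1 : Complex.exp (-(Real.arctan T : ℂ) * Complex.I) = c * (1 - T * Complex.I) := by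
    rw [← Complex.ofReal_neg, Complex.exp_mul_I, ← Complex.ofReal_cos, ← Complex.ofReal_sin,
      Real.cos_neg, Real.sin_neg, Real.cos_arctan, Real.sin_arctan, hcd]
    push_cast; ring
  have e2 : Complex.exp (2 * Complex.I * (π / 2 - Real.arctan T : ℝ)) =
      Complex.exp (π * Complex.I) * Complex.exp (-(Real.arctan T : ℂ) * Complex.I) ^ 2 := by
    rw [← Complex.exp_nat_mul, ← Complex.exp_add]
    congr 1; push_cast; ring
  rw [e2, e1, Complex.exp_pi_mul_I, eq_div_iff (ofReal_sub_I_ne_zero T)]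
  push_cast at hc'
  linear_combination (T + Complex.I) * hc' + (-(c : ℂ) ^ 2 * T ^ 3 +
    (c : ℂ) ^ 2 * T ^ 2 * Complex.I - 2 * (c : ℂ) ^ 2 * T) * Complex.I_sq

/-- The phase shift with values in `(0, π)`. -/
def principalPhase (α s k : ℝ) : ℝ := π / 2 - Real.arctan (cotPhase α s k)

theorem principalPhase_mem (α s k : ℝ) : principalPhase α s k ∈ Ioo 0 π := by
  have h1 := Real.neg_pi_div_two_lt_arctan (cotPhase α s k)
  have h2 := Real.arctan_lt_pi_div_two (cotPhase α s k)
  constructor <;> rw [principalPhase] <;> linarith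

theorem isPhaseShift_principalPhase {α : ℝ} (hα0 : 0 ≤ α) (hα1 : α < 1) (s : ℝ) :
    IsPhaseShift α s (principalPhase α s) := by
  rw [isPhaseShift_iff hα0 hα1]
  refine ⟨continuousOn_const.sub (Real.continuous_arctan.comp_continuousOn
    (contDiffOn_cotPhase α s).continuousOn), fun k hk => ?_⟩
  rw [principalPhase, exp_two_mul_pi_div_two_sub_arctan, scatteringMatrix, one_add_resolventCoeff hk]

/-- Phase shifts differ by a constant multiple of `π`. -/
theorem IsPhaseShift.exists_eq_add {α s : ℝ} (hα0 : 0 ≤ α) (hα1 : α < 1) {δ : ℝ → ℝ}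
    (h : IsPhaseShift α s δ) :
    ∃ n : ℤ, ∀ k, 0 < k → δ k = principalPhase α s k + n * π := by
  obtain ⟨c1, e1⟩ := (isPhaseShift_iff hα0 hα1 s δ).1 h
  obtain ⟨c2, e2⟩ := (isPhaseShift_iff hα0 hα1 s _).1 (isPhaseShift_principalPhase hα0 hα1 s)
  have hint : ∀ k, 0 < k → ∃ n : ℤ, (n : ℝ) = (δ k - principalPhase α s k) / π := by
    intro k hk
    obtain ⟨n, hn⟩ := Complex.exp_eq_exp_iff_exists_int.1 ((e1 k hk).trans (e2 k hk).symm)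
    refine ⟨n, ?_⟩
    have hI : (2 * Complex.I) ≠ 0 := mul_ne_zero two_ne_zero Complex.I_ne_zero
    have : ((δ k : ℝ) : ℂ) = ((principalPhase α s k + n * π : ℝ) : ℂ) := by
      refine mul_left_cancel₀ hI ?_
      rw [hn]; push_cast; ring
    rw [Complex.ofReal_inj.1 this, add_sub_cancel_left, mul_div_cancel_right₀ _ pi_ne_zero]
  obtain ⟨n, hn⟩ := hint 1 one_pos
  refine ⟨n, fun k hk => ?_⟩
  -- The difference divided by `π` is continuous and takes integer values on a connected set.
  have hconst := isPreconnected_Ioi.constant_of_mapsTo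
    (T := range ((↑) : ℤ → ℝ)) Int.isClosedEmbedding_coe_real.isEmbedding.isDiscrete_range
    ((c1.sub c2).div_const π) (fun k hk => hint k hk) (mem_Ioi.2 hk) (mem_Ioi.2 one_pos)
  simp only [Pi.sub_apply] at hconst
  rw [← hn, div_eq_iff pi_ne_zero] at hconst
  linarith

section
variable {α : ℝ} {s : ℝ}

theorem tendsto_principalPhase_of_atTop {l : Filter ℝ} (h : Tendsto (cotPhase α s) l atTop) :
    Tendsto (principalPhase α s) l (𝓝 0) := by
  have := ((tendsto_nhds_of_tendsto_nhdsWithin Real.tendsto_arctan_atTop).comp h).const_sub (π / 2)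
  rwa [sub_self] at this

theorem tendsto_principalPhase_of_atBot {l : Filter ℝ} (h : Tendsto (cotPhase α s) l atBot) :
    Tendsto (principalPhase α s) l (𝓝 π) := by
  have := ((tendsto_nhds_of_tendsto_nhdsWithin Real.tendsto_arctan_atBot).comp h).const_sub (π / 2)
  rwa [sub_neg_eq_add, add_halves] at this

theorem tendsto_half_nhdsGT : Tendsto (fun k : ℝ => k / 2) (𝓝[>] 0) (𝓝[>] 0) := by
  refine tendsto_nhdsWithin_of_tendsto_nhds_of_eventually_within _ ?_ ?_
  · have : Tendsto (fun k : ℝ => k / 2) (𝓝 0) (𝓝 (0 / 2)) := tendsto_id.div_const 2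
    rw [zero_div] at this
    exact this.mono_left nhdsWithin_le_nhds
  · filter_upwards [self_mem_nhdsWithin] with k hk using half_pos (mem_Ioi.1 hk)

theorem tendsto_rpow_half_nhdsGT (hα : 0 < α) :
    Tendsto (fun k : ℝ => (k / 2) ^ (-(2 * α))) (𝓝[>] 0) atTop :=
  (tendsto_rpow_neg_nhdsGT_zero (by linarith : -(2 * α) < 0)).comp tendsto_half_nhdsGT

variable (hα0 : 0 ≤ α) (hα1 : α < 1)
include hα0 hα1

theorem gammaFactor_pos (hα : α ≠ 0) :
    0 < 1 / Real.sin (π * α) * (Real.Gamma (1 + α) / Real.Gamma (1 - α)) := by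
  have h1 := sin_pi_mul_pos (lt_of_le_of_ne hα0 (Ne.symm hα)) hα1
  have h2 : 0 < Real.Gamma (1 + α) := Real.Gamma_pos_of_pos (by linarith)
  have h3 : 0 < Real.Gamma (1 - α) := Real.Gamma_pos_of_pos (by linarith)
  positivity

/-- For `α > 0` the factor `k^{-2α}` blows up and the sign of `2αs - 1` decides the direction, all
other factors being positive. For `α = 0` the logarithm tends to `-∞` for every `s`. -/
theorem tendsto_cotPhase_zero_atBot (hs : 2 * α * s < 1) :
    Tendsto (cotPhase α s) (𝓝[>] 0) atBot := by
  by_cases h : α = 0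
  · refine (((tendsto_atBot_add_const_right _ s (tendsto_atBot_add_const_right _
      Real.eulerMascheroniConstant (Real.tendsto_log_nhdsGT_zero.comp tendsto_half_nhdsGT))
      ).const_mul_atBot (by positivity : 0 < 2 / π))).congr fun k => ?_
    rw [cotPhase, if_pos h]; rfl
  · have hneg : (2 * s * α - 1) * (1 / Real.sin (π * α) *
        (Real.Gamma (1 + α) / Real.Gamma (1 - α))) < 0 :=
      mul_neg_of_neg_of_pos (by linarith) (gammaFactor_pos hα0 hα1 h)
    refine (tendsto_atBot_add_const_right _ (Real.cot (π * α))
      ((tendsto_rpow_half_nhdsGT (lt_of_le_of_ne hα0 (Ne.symm h))).atTop_mul_const_of_neg hneg)).congr fun k => ?_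
    rw [cotPhase, if_neg h]; ring

theorem tendsto_cotPhase_zero_atTop (hs : 1 < 2 * α * s) :
    Tendsto (cotPhase α s) (𝓝[>] 0) atTop := by
  have h : α ≠ 0 := by
    rintro rfl
    norm_num at hs
  have hp : 0 < (2 * s * α - 1) * (1 / Real.sin (π * α) *
      (Real.Gamma (1 + α) / Real.Gamma (1 - α))) :=
    mul_pos (by linarith) (gammaFactor_pos hα0 hα1 h)
  refine (tendsto_atTop_add_const_right _ (Real.cot (π * α))
    ((tendsto_rpow_half_nhdsGT (lt_of_le_of_ne hα0 (Ne.symm h))).atTop_mul_const hp)).congr fun k => ?_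
  rw [cotPhase, if_neg h]; ring

/-- For `α > 0` the power of `k` dies out and `cot πα` remains, whose angle in `(0, π)` is `πα`
itself. For `α = 0` the cotangent tends to `+∞` and the phase to zero. -/
theorem tendsto_principalPhase_atTop (s : ℝ) :
    Tendsto (principalPhase α s) atTop (𝓝 (π * α)) := by
  have hk : Tendsto (fun k : ℝ => k / 2) atTop atTop := tendsto_id.atTop_div_const two_pos
  by_cases h : α = 0
  · rw [show π * α = 0 by rw [h, mul_zero]]
    refine tendsto_principalPhase_of_atTop ((((tendsto_atTop_add_const_right _ s
      (tendsto_atTop_add_const_right _ Real.eulerMascheroniConstant (Real.tendsto_log_atTop.comp hk))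
      ).const_mul_atTop (by positivity : 0 < 2 / π))).congr fun k => ?_)
    rw [cotPhase, if_pos h]; rfl
  · have hpos : 0 < α := lt_of_le_of_ne hα0 (Ne.symm h)
    have hT : Tendsto (cotPhase α s) atTop (𝓝 (Real.cot (π * α))) := by
      have := ((((tendsto_rpow_neg_atTop (by positivity : 0 < 2 * α)).comp hk).mul_const
        ((2 * s * α - 1) * (1 / Real.sin (π * α) *
          (Real.Gamma (1 + α) / Real.Gamma (1 - α))))).add_const (Real.cot (π * α)))
      rw [zero_mul, zero_add] at this
      refine this.congr fun k => ?_
      rw [cotPhase, if_neg h, Function.comp_apply]; ring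
    have := ((Real.continuous_arctan.tendsto _).comp hT).const_sub (π / 2)
    refine this.trans_eq ?_
    have e : Real.cot (π * α) = Real.tan (π / 2 - π * α) := by
      rw [Real.tan_pi_div_two_sub, Real.cot_eq_cos_div_sin, Real.tan_eq_sin_div_cos, inv_div]
    have hπα : 0 < π * α := by positivity
    have hπα' : π * α < π := by nlinarith [pi_pos]
    rw [e, Real.arctan_tan (by linarith) (by linarith), sub_sub_cancel]

end

/-! ### The partial wave amplitude -/

theorem sqrtPiIK_eq {k : ℝ} (hk : 0 < k) :
    sqrtPiIK k = √(π * k) * Complex.exp (Complex.I * (π / 4 : ℝ)) := by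
  have hpk : 0 < π * k := by positivity
  rw [sqrtPiIK, show (π * Complex.I * k : ℂ) = ((π * k : ℝ) : ℂ) * Complex.I by push_cast; ring,
    Complex.cpow_def_of_ne_zero (mul_ne_zero (Complex.ofReal_ne_zero.2 hpk.ne') Complex.I_ne_zero),
    Complex.log_ofReal_mul hpk Complex.I_ne_zero, Complex.log_I, Real.sqrt_eq_rpow,
    Real.rpow_def_of_pos hpk, Complex.ofReal_exp, ← Complex.exp_add]
  congr 1
  push_cast; ring

/-- The principal root contributes `e^{-iπ/4}`; with `-πα/2` this is the phase of the Hankel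
function at infinity. -/
theorem sqrt_mul_div_sqrtPiIK {k : ℝ} (α : ℝ) (hk : 0 < k) (r : ℝ) :
    (√(π * k) : ℂ) / sqrtPiIK k * Complex.exp (Complex.I * (k * r - π / 2 * α))
      = phase α * Complex.exp (Complex.I * (k * r)) := by
  have h1 : (√(π * k) : ℂ) ≠ 0 := Complex.ofReal_ne_zero.2 (Real.sqrt_pos.2 (by positivity)).ne'
  rw [sqrtPiIK_eq hk, ← div_div, div_self h1, one_div, ← Complex.exp_neg, phase, ← Complex.exp_add,
    ← Complex.exp_add]
  congr 1
  push_cast; ring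

theorem partialWaveAmplitude_eq {α s k : ℝ} {δ : ℝ → ℝ}
    (h : Complex.exp (2 * Complex.I * δ k) = scatteringMatrix α s k) :
    partialWaveAmplitude δ k = 4 * Complex.I / π * (resolventCoeff k α s / sqrtPiIK k) := by
  rw [partialWaveAmplitude, h, scatteringMatrix, add_sub_cancel_left, mul_div_assoc]

theorem tendsto_outgoing_sub_partialWave {α s k : ℝ} (hα0 : 0 ≤ α) (hα1 : α < 1) (hk : 0 < k)
    {δ : ℝ → ℝ} (h : Complex.exp (2 * Complex.I * δ k) = scatteringMatrix α s k) {φ : ℝ → ℂ}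
    (hφ : IsOutgoingState α s k φ) :
    Tendsto (fun r : ℝ => φ r - phiFree α k r - 1 / 2 * (√(π * k) : ℂ) * partialWaveAmplitude δ k *
      Complex.exp (Complex.I * (k * r - π / 2 * α))) atTop (𝓝 0) := by
  refine (tendsto_outgoingFn_sub s hα0 hα1 hk).congr' ?_
  filter_upwards [eventually_gt_atTop 0] with r hr
  rw [(isOutgoingState_iff s hα0 hα1 hk φ).1 hφ r hr, partialWaveAmplitude_eq h]
  linear_combination (-(2 * Complex.I / π * resolventCoeff k α s)) *
    (sqrt_mul_div_sqrtPiIK α hk r).symm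

/-! ### Levinson's relation -/

/-- The limit of the principal phase at zero momentum is the only input that depends on bound
states. Another phase shift adds a constant multiple of `π`, which cancels in the difference of the
limits and is zero if the values lie in `(0, π)`. -/
theorem levinson {α s : ℝ} (hα0 : 0 ≤ α) (hα1 : α < 1) {m : ℝ}
    (hm : Tendsto (principalPhase α s) (𝓝[>] 0) (𝓝 (π * m))) :
    (∀ δ : ℝ → ℝ, IsPhaseShift α s δ → (∀ k : ℝ, 0 < k → δ k ∈ Ioo 0 π) →
      Tendsto δ (𝓝[>] 0) (𝓝 (π * m)) ∧ Tendsto δ atTop (𝓝 (π * α))) ∧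
    ∀ δ : ℝ → ℝ, IsPhaseShift α s δ → ∃ δ₀ δinf : ℝ, Tendsto δ (𝓝[>] 0) (𝓝 δ₀) ∧
      Tendsto δ atTop (𝓝 δinf) ∧ δ₀ - δinf = π * (m - α) := by
  have key : ∀ {δ : ℝ → ℝ} {n : ℤ}, (∀ k, 0 < k → δ k = principalPhase α s k + n * π) →
      Tendsto δ (𝓝[>] 0) (𝓝 (π * m + n * π)) ∧ Tendsto δ atTop (𝓝 (π * α + n * π)) := by
    intro δ n h
    refine ⟨(hm.add_const (n * π)).congr' ?_,
      ((tendsto_principalPhase_atTop hα0 hα1 s).add_const (n * π)).congr' ?_⟩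
    · filter_upwards [self_mem_nhdsWithin] with k hk using (h k hk).symm
    · filter_upwards [eventually_gt_atTop 0] with k hk using (h k hk).symm
  refine ⟨fun δ hδ hmem => ?_, fun δ hδ => ?_⟩
  · obtain ⟨n, hn⟩ := hδ.exists_eq_add hα0 hα1
    have h1 := hmem 1 one_pos
    have h2 := principalPhase_mem α s 1
    rw [hn 1 one_pos] at h1
    have h3 : n = 0 := by
      have a1 : (n : ℝ) * π < 1 * π := by linarith [h1.2, h2.1]
      have a2 : (-1 : ℝ) * π < n * π := by linarith [h1.1, h2.2]
      have b1 : n < 1 := by exact_mod_cast lt_of_mul_lt_mul_right a1 pi_pos.le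
      have b2 : -1 < n := by exact_mod_cast lt_of_mul_lt_mul_right a2 pi_pos.le
      omega
    subst h3
    simpa using key hn
  · obtain ⟨n, hn⟩ := hδ.exists_eq_add hα0 hα1
    exact ⟨_, _, (key hn).1, (key hn).2, by ring⟩

end AnyonDelta

end

/-! ### The theorem -/

open AnyonDelta

theorem mainTheorem7 (α s : ℝ) (hα0 : 0 ≤ α) (hα1 : α < 1) :
    -- the outgoing state at each energy `k² > 0`
    (∀ k : ℝ, 0 < k → ∀ φ : ℝ → ℂ,
      IsOutgoingState α s k φ ↔
        ∀ r : ℝ, 0 < r →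
          φ r = phiFree α k r
            + 2 * Complex.I / (Real.pi : ℂ) * resolventCoeff k α s * chiFree α k r) ∧
    -- the outgoing states are the images of the free states under the wave operator `t → -∞`
    (∀ g : ℝ → ℂ, IsMomentumTest g → ∃ Φ X : HalfLineL2,
      IsWavePacket (phiFree α) g Φ ∧ IsWavePacket (outgoingFn α s) g X ∧
      IsWaveOperatorImage (deltaHamiltonian α s) (freeHamiltonian α) Filter.atBot Φ X) ∧
    -- the phase shift
    (∀ δ : ℝ → ℝ, IsPhaseShift α s δ ↔
      ContinuousOn δ (Set.Ioi 0) ∧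
        ∀ k : ℝ, 0 < k →
          Complex.exp (2 * Complex.I * δ k)
            = 1 + 4 * Complex.I / (Real.pi : ℂ) * resolventCoeff k α s) ∧
    -- the partial wave amplitude, and its meaning for the asymptotics of the outgoing state
    (∀ δ : ℝ → ℝ, IsPhaseShift α s δ → ∀ k : ℝ, 0 < k →
      partialWaveAmplitude δ k
        = 4 * Complex.I / (Real.pi : ℂ) * (resolventCoeff k α s / sqrtPiIK k) ∧
      ∀ φ : ℝ → ℂ, IsOutgoingState α s k φ →
        Filter.Tendsto
          (fun r : ℝ => φ r - phiFree α k r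
            - 1 / 2 * (Real.sqrt (Real.pi * k) : ℂ) * partialWaveAmplitude δ k
              * Complex.exp (Complex.I * (k * r - Real.pi / 2 * α)))
          Filter.atTop (nhds 0)) ∧
    -- the phase shift exists, with values in `(0, π)`
    (∃ δ : ℝ → ℝ, IsPhaseShift α s δ ∧ ∀ k : ℝ, 0 < k → δ k ∈ Set.Ioo 0 Real.pi) ∧
    -- the modified Levinson relation
    (2 * α * s ≠ 1 → ∃ n : ℕ,
      boundStateCount (deltaHamiltonian α s) = (n : Cardinal) ∧
      (n : ℝ) = (1 - Real.sign (2 * α * s - 1)) / 2 ∧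
      (∀ δ : ℝ → ℝ, IsPhaseShift α s δ →
        (∀ k : ℝ, 0 < k → δ k ∈ Set.Ioo 0 Real.pi) →
          Filter.Tendsto δ (nhdsWithin 0 (Set.Ioi 0)) (nhds (Real.pi * n)) ∧
          Filter.Tendsto δ Filter.atTop (nhds (Real.pi * α))) ∧
      ∀ δ : ℝ → ℝ, IsPhaseShift α s δ →
        ∃ δ₀ δinf : ℝ,
          Filter.Tendsto δ (nhdsWithin 0 (Set.Ioi 0)) (nhds δ₀) ∧
          Filter.Tendsto δ Filter.atTop (nhds δinf) ∧
          δ₀ - δinf = Real.pi * (n - α)) := by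
  refine ⟨fun k hk φ => isOutgoingState_iff s hα0 hα1 hk φ,
    fun g hg => exists_isWaveOperatorImage hα0 hα1 s hg, isPhaseShift_iff hα0 hα1 s,
    fun δ hδ k hk => ?_, ⟨_, isPhaseShift_principalPhase hα0 hα1 s,
      fun k _ => principalPhase_mem α s k⟩, fun hs => ?_⟩
  · have h := ((isPhaseShift_iff hα0 hα1 s δ).1 hδ).2 k hk
    exact ⟨partialWaveAmplitude_eq h, fun φ hφ => tendsto_outgoing_sub_partialWave hα0 hα1 hk h hφ⟩
  · have hcount := boundStateCount_deltaHamiltonian hα0 hα1 hs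
    -- The sign of `2αs - 1` decides together the number of bound states and whether the cotangent
    -- of the phase tends to `-∞` or `+∞` at zero momentum.
    rcases lt_or_gt_of_ne hs with h | h
    · refine ⟨1, by rw [hcount.1 h, Nat.cast_one],
        by rw [Real.sign_of_neg (by linarith)]; norm_num, levinson hα0 hα1 ?_⟩
      rw [Nat.cast_one, mul_one]
      exact tendsto_principalPhase_of_atBot (tendsto_cotPhase_zero_atBot hα0 hα1 h)
    · refine ⟨0, by rw [hcount.2 h, Nat.cast_zero],
        by rw [Real.sign_of_pos (by linarith)]; norm_num, levinson hα0 hα1 ?_⟩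
      rw [Nat.cast_zero, mul_zero]
      exact tendsto_principalPhase_of_atTop (tendsto_cotPhase_zero_atTop hα0 hα1 h)
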